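/- **Setting.** Let $M$ be a connected smooth manifold (finite-dimensional, Hausdorff, second countable). Let $\tau:\mathcal T^{S*}M\to M$ be its second-order cotangent bundle. A chart $(x^i)$ of $M$ induces canonical coordinates $(x^i,p_i,o_{jk})$, $o_{jk}=o_{kj}$, on $\mathcal T^{S*}M$, which under a change of chart transform like $(q,\partial_i f(q),\partial_j\partial_k f(q))$, the coordinates of the second-order differential $d^2f_q$ of a function $f$ at $q$. For $S\in C^\infty(\mathbb R\times M)$ write $d^2S(t,q)$ for the second-order differential of $S(t,\cdot)$ at $q$. A *second-order tangent vector* to a manifold $N$ at $q$ is a functional $A:f\mapsto A^i\partial_if(q)+A^{jk}\partial_j\partial_kf(q)$, $A^{jk}=A^{kj}$, on $C^\infty(N)$; it is *elliptic* if $(A^{jk})$ is positive semi-definite. For a smooth map $F:N\to N'$, put $(d^2F_qA)f=A(f\circ F)$. *Diffusions and mean derivatives.* Processes live on filtered probability spaces satisfying the usual conditions and are adapted and continuous on a stochastic interval $[t_0,\tau_\infty)$, where $\tau_\infty>t_0$ is a stopping time (a possibly finite lifetime). Such an $N$-valued process $X$ has mean derivatives $(DX(t),QX(t))=\mathcal A(t)$,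 where $\mathcal A$ is an adapted process of elliptic second-order tangent vectors at $X(t)$, continuous in $t$, if for all smooth $f$ on $\mathbb R\times N$ the process $$f(t,X(t))-f(t_0,X(t_0))-\int_{t_0}^t\Bigl(\frac{\partial f}{\partial s}+\mathcal A(s)f(s,\cdot)\Bigr)(s,X(s))\,ds$$ is a local martingale on $[t_0,\tau_\infty)$. In coordinates, $\mathcal A=(DX)^i\partial_i+\frac12(QX)^{jk}\partial_j\partial_k$. The process $X$ is a *diffusion* if $\mathcal A(t)=A_{(t,X(t))}$ for a smooth time-dependent elliptic second-order operator $A$ on $N$ (its generator). *Second-order Hamiltonian vectors.* Let $h\in C^\infty(\mathcal T^{S*}M)$. A second-order tangent vector to $\mathcal T^{S*}M$ at $z$ is a second-order Hamiltonian vector of $h$ if, in all canonical coordinates around $z$, it has the form $$\frac{\partial h}{\partial p_i}\frac{\partial}{\partial x^i}-\frac{\partial h}{\partial x^i}\frac{\partial}{\partial p_i}+\frac{\partial h}{\partial o_{jk}}\frac{\partial^2}{\partial x^j\partial x^k}-\Bigl(\frac{\partial^2h}{\partial x^j\partial x^k}+C_{jk}\Bigr)\frac{\partial}{\partial o_{jk}}+A_{jk}\frac{\partial^2}{\partial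 p_j\partial p_k}+A_{ijkl}\frac{\partial^2}{\partial o_{ij}\partial o_{kl}}+A^j_k\frac{\partial^2}{\partial x^j\partial p_k}+A^j_{kl}\frac{\partial^2}{\partial x^j\partial o_{kl}}+A_{jkl}\frac{\partial^2}{\partial p_j\partial o_{kl}}$$ where $$C_{jk}\frac{\partial h}{\partial o_{jk}}=A_{jk}\frac{\partial^2h}{\partial p_j\partial p_k}+A_{ijkl}\frac{\partial^2h}{\partial o_{ij}\partial o_{kl}}+A^j_k\frac{\partial^2h}{\partial x^j\partial p_k}+A^j_{kl}\frac{\partial^2h}{\partial x^j\partial o_{kl}}+A_{jkl}\frac{\partial^2h}{\partial p_j\partial o_{kl}},$$ the last condition being equivalent, given the others, to $A h=0$. The coefficients $C,A$ are not determined by $h$. Let $H\in C^\infty(\mathbb R\times\mathcal T^{S*}M)$ be a time-dependent second-order Hamiltonian. A smooth time-dependent second-order vector field $A_H$ on $\mathcal T^{S*}M$ is a *second-order Hamiltonian vector field* of $H$ if $A_H(t,z)$ is a second-order Hamiltonian vector of $H(\cdot,t)$ at $z$ for all $t,z$. A *horizontal integral process* of $A_H$ is a $\mathcal T^{S*}M$-valued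 diffusion $\mathbf X$ that is horizontal, i.e. of the form $\mathbf X(t)=\varphi(t,X(t))$ with $X$ a diffusion on $M$ and $\varphi$ a smooth time-dependent section of $\mathcal T^{S*}M$, and that solves the stochastic Hamilton's equations $$D x=\frac{\partial H}{\partial p},\qquad Q x=2\frac{\partial H}{\partial o},\qquad D p=-\frac{\partial H}{\partial x},\qquad D o=-\Bigl(\frac{\partial^2H}{\partial x\partial x}+C\Bigr)$$ along $\mathbf X$ in all canonical coordinates, with $C$ subject to the equation above written for the mean derivatives of $\mathbf X$; that is, for all $t$ in its lifetime, $(D\mathbf X(t),Q\mathbf X(t))$ is a second-order Hamiltonian vector of $H(\cdot,t)$ at $\mathbf X(t)$. **Theorem.** Let $A_H$ be a second-order Hamiltonian vector field of $H$ and let $S\in C^\infty(\mathbb R\times M)$ be such that the second-order tangent vector $d^2\tau_{d^2S(t,q)}A_H(t,d^2S(t,q))$ to $M$ is elliptic for all $(t,q)\in\mathbb R\times M$. Then the following statements are equivalent. (i) For every $M$-valued diffusion $X$ (on any filtered probability space, with any starting time and lifetime) satisfying $$(DX(t),QX(t))=d^2\tau_{d^2S(t,X(t))}A_H,$$ the $\mathcal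 T^{S*}M$-valued process $d^2S\circ X=\{d^2S(t,X(t))\}_t$ is a horizontal integral process of $A_H$. (ii) There is a function $f:\mathbb R\to\mathbb R$ such that $S$ satisfies the Hamilton–Jacobi–Bellman equation $$\frac{\partial S}{\partial t}(t,q)+H(d^2S(t,q),t)=f(t)\qquad\text{for all }(t,q)\in\mathbb R\times M.$$ -/

import Mathlib

set_option maxSynthPendingDepth 3

open scoped Manifold ContDiff Topology
open MeasureTheory Set Filter

namespace StochHam

/-! ## Second-order tangent vectors, second-order vector fields -/

section SecondOrder

variable {E H : Type*} [NormedAddCommGroup E] [NormedSpace ℝ E] [TopologicalSpace H]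
  {N : Type*} [TopologicalSpace N] [ChartedSpace H N]

/-- A second-order tangent vector at `q` (an element of `𝒯^O_q N`), as a second-order derivation:
a linear functional `A` on `C^∞(N)` such that, for some symmetric `(2,0)`-tensor `Γ` at `q`,
`A (f g) = f(q) A g + g(q) A f + (df ⊗ dg)(Γ)` for all `f, g`. In local coordinates these are the
functionals `f ↦ A^i ∂_i f(q) + A^{jk} ∂_j ∂_k f(q)`, and `(df ⊗ dg)(Γ) = 2 A^{jk} ∂_j f ∂_k g`. -/
structure SecondOrderVector (I : ModelWithCorners ℝ E H) (q : N) where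
  toLin : C^∞⟮I, N; ℝ⟯ →ₗ[ℝ] ℝ
  exists_tensor : ∃ Γ : (TangentSpace I q →L[ℝ] ℝ) →ₗ[ℝ] (TangentSpace I q →L[ℝ] ℝ) →ₗ[ℝ] ℝ,
    (∀ α β, Γ α β = Γ β α) ∧
    ∀ f g : C^∞⟮I, N; ℝ⟯, toLin (f * g) = f q * toLin g + g q * toLin f +
      Γ (mfderiv I 𝓘(ℝ, ℝ) f q) (mfderiv I 𝓘(ℝ, ℝ) g q)

namespace SecondOrderVector

variable {I : ModelWithCorners ℝ E H} {q : N}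

/-- The squared field operator (carré du champ) `A (f g) - f(q) A g - g(q) A f`, which has the
local expression `2 A^{jk} ∂_j f ∂_k g`. If `A = 𝔟^i ∂_i + ½ a^{jk} ∂_j ∂_k`, it is
`a^{jk} ∂_j f ∂_k g`. -/
noncomputable def squaredField (A : SecondOrderVector I q) (f g : C^∞⟮I, N; ℝ⟯) : ℝ :=
  A.toLin (f * g) - f q * A.toLin g - g q * A.toLin f

/-- The symmetric tensor of the second-order tangent vector is positive semi-definite. -/
def IsElliptic (A : SecondOrderVector I q) : Prop :=
  ∀ f : C^∞⟮I, N; ℝ⟯, 0 ≤ A.squaredField f f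

variable {E' H' : Type*} [NormedAddCommGroup E'] [NormedSpace ℝ E'] [TopologicalSpace H']
  {I' : ModelWithCorners ℝ E' H'} {N' : Type*} [TopologicalSpace N'] [ChartedSpace H' N']

/-- The second-order tangent map `d²F_q`: `(d²F_q A) f = A (f ∘ F)`. -/
noncomputable def map (F : C^∞⟮I, N; I', N'⟯) (A : SecondOrderVector I q) : SecondOrderVector I' (F q) where
  toLin :=
    { toFun := fun f => A.toLin (f.comp F)
      map_add' := fun f g => A.toLin.map_add (f.comp F) (g.comp F)
      map_smul' := fun c f => A.toLin.map_smul c (f.comp F) }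
  exists_tensor := by
    obtain ⟨Γ, hsymm, hΓ⟩ := A.exists_tensor
    let P : (TangentSpace I' (F q) →L[ℝ] ℝ) →ₗ[ℝ] (TangentSpace I q →L[ℝ] ℝ) :=
      { toFun := fun α => α.comp (mfderiv I I' F q)
        map_add' := fun _ _ => rfl
        map_smul' := fun _ _ => rfl }
    refine ⟨Γ.compl₁₂ P P, fun α β => hsymm _ _, fun f g => ?_⟩
    have hd : ∀ f : C^∞⟮I', N'; ℝ⟯, P (mfderiv I' 𝓘(ℝ, ℝ) f (F q)) =
        mfderiv I 𝓘(ℝ, ℝ) (f.comp F) q := by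
      intro f
      have h := mfderiv_comp q (f.contMDiff.mdifferentiable (by simp) (F q))
        (F.contMDiff.mdifferentiable (by simp) q)
      exact h.symm
    have h := hΓ (f.comp F) (g.comp F)
    rw [← hd f, ← hd g] at h
    exact h

end SecondOrderVector

/-- A smooth time-dependent second-order vector field on `N`, i.e. a smooth time-dependent
second-order operator. -/
structure SecondOrderField (I : ModelWithCorners ℝ E H) (N : Type*) [TopologicalSpace N]
    [ChartedSpace H N] where
  val : ℝ → ∀ q : N, SecondOrderVector I q
  smooth : ∀ f : C^∞⟮I, N; ℝ⟯, ContMDiff (𝓘(ℝ, ℝ).prod I) 𝓘(ℝ, ℝ) ∞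
    (fun z : ℝ × N => (val z.1 z.2).toLin f)

/-- The function `f(t, ·)`. -/
noncomputable def slice {I : ModelWithCorners ℝ E H} (f : C^∞⟮𝓘(ℝ, ℝ).prod I, ℝ × N; ℝ⟯) (t : ℝ) :
    C^∞⟮I, N; ℝ⟯ :=
  ⟨fun q => f (t, q), f.contMDiff.comp (contMDiff_const.prodMk contMDiff_id)⟩

end SecondOrder

/-! ## Diffusions and mean derivatives -/

section Processes

variable {Ω : Type*} [mΩ : MeasurableSpace Ω]

/-- The filtration is right-continuous and complete. -/
def UsualConditions (ℱ : Filtration ℝ mΩ) (P : Measure Ω) : Prop :=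
  ℱ.rightCont ≤ ℱ ∧ ∀ t, ∀ s : Set Ω, P s = 0 → MeasurableSet[ℱ t] s

/-- The real-valued process `Y`, defined on the stochastic interval `[t₀, τ)`, is a local
martingale there: it becomes a martingale when it is stopped along some sequence of stopping times
that increases to `τ` from below. -/
def IsLocalMartingaleUpTo (ℱ : Filtration ℝ mΩ) (P : Measure Ω) (t₀ : ℝ) (τ : Ω → WithTop ℝ)
    (Y : ℝ → Ω → ℝ) : Prop :=
  ∃ σ : ℕ → Ω → ℝ, (∀ n, IsStoppingTime ℱ (fun w => (σ n w : WithTop ℝ))) ∧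
    (∀ᵐ w ∂P, Monotone (fun n => σ n w) ∧ (∀ n, t₀ ≤ σ n w ∧ (σ n w : WithTop ℝ) < τ w) ∧
      ∀ t : ℝ, (t : WithTop ℝ) < τ w → ∃ n, t < σ n w) ∧
    ∀ n, Martingale (fun t w => Y (min (max t t₀) (σ n w)) w) ℱ P

variable {E H : Type*} [NormedAddCommGroup E] [NormedSpace ℝ E] [TopologicalSpace H]
  {I : ModelWithCorners ℝ E H} {N : Type*} [TopologicalSpace N] [ChartedSpace H N]

/-- The random set of times `[t₀, τ(w))`. -/
def lifeInterval (t₀ : ℝ) (τ : Ω → WithTop ℝ) (w : Ω) : Set ℝ :=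
  {t | t₀ ≤ t ∧ (t : WithTop ℝ) < τ w}

/-- `f(t, X(t)) - f(t₀, X(t₀)) - ∫_{t₀}^t (∂_s + 𝒜_s) f (s, X(s)) ds`. -/
noncomputable def compensated (t₀ : ℝ) (X : ℝ → Ω → N)
    (𝒜 : ∀ t w, SecondOrderVector I (X t w)) (f : C^∞⟮𝓘(ℝ, ℝ).prod I, ℝ × N; ℝ⟯)
    (t : ℝ) (w : Ω) : ℝ :=
  f (t, X t w) - f (t₀, X t₀ w) -
    ∫ s in t₀..t, (deriv (fun r => f (r, X s w)) s + (𝒜 s w).toLin (slice f s))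

/-- `X = {X(t)}_{t ∈ [t₀, τ)}` is an `N`-valued Itô process on the filtered probability space
`(Ω, ℱ, P)`, and `𝒜` is its random generator, an adapted continuous process of elliptic
second-order tangent vectors with `𝒜(t)` at `X(t)`. By definition the mean derivatives of `X` are
the components of its random generator, so that this says `(DX(t), QX(t)) = 𝒜(t)` for
`t ∈ [t₀, τ)`. Only the values `X(t)(w)`, `𝒜(t)(w)` with `t₀ ≤ t < τ(w)` matter. -/
structure HasMeanDerivatives (ℱ : Filtration ℝ mΩ) (P : Measure Ω) (t₀ : ℝ) (τ : Ω → WithTop ℝ)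
    (X : ℝ → Ω → N) (𝒜 : ∀ t w, SecondOrderVector I (X t w)) : Prop where
  lifetime : IsStoppingTime ℱ τ
  start_lt : ∀ᵐ w ∂P, (t₀ : WithTop ℝ) < τ w
  continuous : ∀ᵐ w ∂P, ContinuousOn (fun t => X t w) (lifeInterval t₀ τ w)
  adapted : ∀ t, t₀ ≤ t → ∀ U : Set N, IsOpen U →
    MeasurableSet[ℱ t] {w | (t : WithTop ℝ) < τ w ∧ X t w ∈ U}
  gen_elliptic : ∀ᵐ w ∂P, ∀ t ∈ lifeInterval t₀ τ w, (𝒜 t w).IsElliptic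
  gen_continuous : ∀ᵐ w ∂P, ∀ f : C^∞⟮I, N; ℝ⟯,
    ContinuousOn (fun t => (𝒜 t w).toLin f) (lifeInterval t₀ τ w)
  gen_adapted : ∀ f : C^∞⟮I, N; ℝ⟯, ∀ t, t₀ ≤ t → ∀ B : Set ℝ, MeasurableSet B →
    MeasurableSet[ℱ t] {w | (t : WithTop ℝ) < τ w ∧ (𝒜 t w).toLin f ∈ B}
  martingale : ∀ f : C^∞⟮𝓘(ℝ, ℝ).prod I, ℝ × N; ℝ⟯,
    IsLocalMartingaleUpTo ℱ P t₀ τ (compensated t₀ X 𝒜 f)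

/-- `X = {X(t)}_{t ∈ [t₀, τ)}` is an `N`-valued diffusion: it solves the martingale problem of some
time-dependent second-order elliptic operator `A`, its generator. -/
def IsDiffusion (I : ModelWithCorners ℝ E H) (ℱ : Filtration ℝ mΩ) (P : Measure Ω) (t₀ : ℝ)
    (τ : Ω → WithTop ℝ) (X : ℝ → Ω → N) : Prop :=
  ∃ A : SecondOrderField I N, (∀ t q, (A.val t q).IsElliptic) ∧
    HasMeanDerivatives ℱ P t₀ τ X (fun t w => A.val t (X t w))

end Processes

/-! ## The second-order cotangent bundle -/

section Cotangent

variable (E : Type*) [NormedAddCommGroup E] [NormedSpace ℝ E]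

/-- Bilinear forms on `E`. -/
abbrev Bilin : Type _ := E →L[ℝ] E →L[ℝ] ℝ

/-- Symmetric bilinear forms on `E`. -/
def symBilin : Submodule ℝ (Bilin E) where
  carrier := {o | ∀ u v, o u v = o v u}
  add_mem' := fun ha hb u v => by simp [ha u v, hb u v]
  zero_mem' := fun _ _ => rfl
  smul_mem' := fun c a ha u v => by simp [ha u v]

/-- The transpose of a bilinear form. -/
noncomputable def transpose : Bilin E →L[ℝ] Bilin E :=
  (ContinuousLinearMap.flipₗᵢ ℝ (E) (E) ℝ).toContinuousLinearEquiv.toContinuousLinearMap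

/-- Symmetrization `o ↦ ½ (o(u,v) + o(v,u))`. -/
noncomputable def symm : Bilin E →L[ℝ] symBilin E :=
  ((1 / 2 : ℝ) • (ContinuousLinearMap.id ℝ (Bilin E) + transpose E)).codRestrict (symBilin E)
    (fun o u v => by simp [transpose, add_comm])

/-- The typical fibre of the second-order cotangent bundle: pairs `(p, o)` of a covector and a
symmetric bilinear form. -/
abbrev CotFiber : Type _ := (E →L[ℝ] ℝ) × symBilin E

variable {E}

/-- Precomposition `p ↦ p ∘ g`. -/
noncomputable def precomp (g : E →L[ℝ] E) :
    (E →L[ℝ] ℝ) →L[ℝ] (E →L[ℝ] ℝ) :=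
  (ContinuousLinearMap.compL ℝ (E) (E) ℝ).flip g

/-- `o ↦ o(g ·, g ·)`. -/
noncomputable def quadPart (g : E →L[ℝ] E) : Bilin E →L[ℝ] Bilin E :=
  (ContinuousLinearMap.compL ℝ (E) (E →L[ℝ] ℝ) (E →L[ℝ] ℝ) (precomp g)).comp
    ((ContinuousLinearMap.compL ℝ (E) (E) (E →L[ℝ] ℝ)).flip g)

/-- `p ↦ p(κ(·, ·))`. -/
noncomputable def linPart (κ : E →L[ℝ] E →L[ℝ] E) :
    (E →L[ℝ] ℝ) →L[ℝ] Bilin E :=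
  ((ContinuousLinearMap.compL ℝ (E) (E →L[ℝ] E) (E →L[ℝ] ℝ)).flip κ).comp
    (ContinuousLinearMap.compL ℝ (E) (E) ℝ)

/-- The right action `(p, o) · (g, κ) = (g^* p, κ^* p + (g^* ⊗ g^*) o)` of the Itô group on the
typical fibre (`κ` acts through its symmetric part). -/
noncomputable def itoAct (g : E →L[ℝ] E)
    (κ : E →L[ℝ] E →L[ℝ] E) : CotFiber E →L[ℝ] CotFiber E :=
  (ContinuousLinearMap.inl ℝ (E →L[ℝ] ℝ) (symBilin E)).comp
      ((precomp g).comp (ContinuousLinearMap.fst ℝ _ _)) +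
    (ContinuousLinearMap.inr ℝ (E →L[ℝ] ℝ) (symBilin E)).comp
      ((symm E).comp ((linPart κ).comp (ContinuousLinearMap.fst ℝ _ _) +
        ((quadPart g).comp (symBilin E).subtypeL).comp (ContinuousLinearMap.snd ℝ _ _)))

theorem symm_apply (o : Bilin E) (u v : E) :
    (symm E o : Bilin E) u v = (1 / 2 : ℝ) * (o u v + o v u) := by
  simp [symm, transpose]
  ring

theorem itoAct_fst (g : E →L[ℝ] E)
    (κ : E →L[ℝ] E →L[ℝ] E) (a : CotFiber E) (u : E) :
    (itoAct g κ a).1 u = a.1 (g u) := by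
  simp [itoAct, precomp]

theorem itoAct_snd (g : E →L[ℝ] E)
    (κ : E →L[ℝ] E →L[ℝ] E) (a : CotFiber E) (u v : E) :
    ((itoAct g κ a).2 : Bilin E) u v =
      (1 / 2 : ℝ) * (a.1 (κ u v) + a.1 (κ v u)) + (a.2 : Bilin E) (g u) (g v) := by
  have h : (a.2 : Bilin E) (g v) (g u) = (a.2 : Bilin E) (g u) (g v) := a.2.2 _ _
  have h0 : (itoAct g κ a).2 = symm E (linPart κ a.1 + quadPart g (a.2 : Bilin E)) := by
    simp [itoAct]
  rw [h0, symm_apply]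
  simp [linPart, quadPart, precomp, h]
  ring

theorem contDiff_itoAct :
    ContDiff ℝ ∞ (fun z : (E →L[ℝ] E) × (E →L[ℝ] E →L[ℝ] E) =>
      itoAct z.1 z.2) := by
  have h1 : ContDiff ℝ ∞ (fun z : (E →L[ℝ] E) ×
      (E →L[ℝ] E →L[ℝ] E) => precomp z.1) :=
    (ContinuousLinearMap.contDiff _).comp contDiff_fst
  have h2 : ContDiff ℝ ∞ (fun z : (E →L[ℝ] E) ×
      (E →L[ℝ] E →L[ℝ] E) => quadPart z.1) :=
    ((ContinuousLinearMap.contDiff _).comp h1).clm_comp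
      ((ContinuousLinearMap.contDiff _).comp contDiff_fst)
  have h3 : ContDiff ℝ ∞ (fun z : (E →L[ℝ] E) ×
      (E →L[ℝ] E →L[ℝ] E) => linPart z.2) :=
    ((ContinuousLinearMap.contDiff _).comp contDiff_snd).clm_comp contDiff_const
  have h4 : ContDiff ℝ ∞ (fun z : (E →L[ℝ] E) × (E →L[ℝ] E →L[ℝ] E) =>
      (precomp z.1).comp (ContinuousLinearMap.fst ℝ (E →L[ℝ] ℝ) (symBilin E))) :=
    h1.clm_comp contDiff_const
  have h5 : ContDiff ℝ ∞ (fun z : (E →L[ℝ] E) ×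
      (E →L[ℝ] E →L[ℝ] E) =>
      (symm E).comp ((linPart z.2).comp (ContinuousLinearMap.fst ℝ _ _) +
      ((quadPart z.1).comp (symBilin E).subtypeL).comp (ContinuousLinearMap.snd ℝ _ _))) :=
    contDiff_const.clm_comp ((h3.clm_comp contDiff_const).add
      ((h2.clm_comp contDiff_const).clm_comp contDiff_const))
  exact (contDiff_const.clm_comp h4).add (contDiff_const.clm_comp h5)

variable {M : Type*} [TopologicalSpace M] [ChartedSpace (E) M]

/-- The local coordinate systems (charts) of the smooth manifold `M`. -/
abbrev Chart (E : Type*) [NormedAddCommGroup E] [NormedSpace ℝ E] (M : Type*) [TopologicalSpace M] [ChartedSpace (E) M] : Type _ :=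
  {c : OpenPartialHomeomorph M (E) // c ∈ IsManifold.maximalAtlas 𝓘(ℝ, E) ∞ M}

/-- The change of coordinates from the chart `j` to the chart `i`. -/
def transition (i j : Chart E M) : E → E := fun y => i.1 (j.1.symm y)

theorem contDiffAt_transition (i j : Chart E M) {x : M} (hi : x ∈ i.1.source)
    (hj : x ∈ j.1.source) : ContDiffAt ℝ ∞ (transition i j) (j.1 x) := by
  have h1 := contMDiffAt_of_mem_maximalAtlas i.2 hi
  have h2 := contMDiffAt_symm_of_mem_maximalAtlas j.2 (j.1.map_source hj)
  rw [← j.1.left_inv hj] at h1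
  exact (h1.comp (j.1 x) h2).contDiffAt


/-- The change of coordinates `(p, o)` from the chart `i` to the chart `j` at the point `x`. -/
noncomputable def cotChange (i j : Chart E M) (x : M) : CotFiber E →L[ℝ] CotFiber E :=
  itoAct (fderiv ℝ (transition i j) (j.1 x)) (fderiv ℝ (fderiv ℝ (transition i j)) (j.1 x))

theorem cotChange_self (i : Chart E M) (x : M) (hx : x ∈ i.1.source) (a : CotFiber E) :
    cotChange i i x a = a := by
  have h : transition i i =ᶠ[𝓝 (i.1 x)] id := by
    filter_upwards [i.1.open_target.mem_nhds (i.1.map_source hx)] with y hy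
    exact i.1.right_inv hy
  have h1 : fderiv ℝ (transition i i) (i.1 x) = ContinuousLinearMap.id ℝ E := by
    rw [h.fderiv_eq, fderiv_id]
  have h2 : fderiv ℝ (fderiv ℝ (transition i i)) (i.1 x) = 0 := by
    rw [h.fderiv.fderiv_eq]
    have : fderiv ℝ (id : E → E) = fun _ => ContinuousLinearMap.id ℝ E := by
      funext y
      exact fderiv_id
    rw [this]
    simp
  refine Prod.ext ?_ (Subtype.ext ?_)
  · ext u
    rw [cotChange, itoAct_fst, h1]
    rfl
  · ext u v
    rw [cotChange, itoAct_snd, h1, h2]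
    simp

theorem cotChange_comp (i j k : Chart E M) (x : M) (hi : x ∈ i.1.source) (hj : x ∈ j.1.source)
    (hk : x ∈ k.1.source) (a : CotFiber E) :
    cotChange j k x (cotChange i j x a) = cotChange i k x a := by
  set f := transition i j
  set g := transition j k
  set y := k.1 x
  have hgy : g y = j.1 x := by
    simp [g, y, transition, k.1.left_inv hk]
  have hf : ContDiffAt ℝ ∞ f (g y) := hgy ▸ contDiffAt_transition i j hi hj
  have hg : ContDiffAt ℝ ∞ g y := contDiffAt_transition j k hj hk
  have h : transition i k =ᶠ[𝓝 y] f ∘ g := by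
    have hc : ContinuousAt k.1.symm y := k.1.continuousAt_symm (k.1.map_source hk)
    have hm : j.1.source ∈ 𝓝 (k.1.symm y) := by
      rw [k.1.left_inv hk]
      exact j.1.open_source.mem_nhds hj
    filter_upwards [hc hm] with z hz
    simp only [f, g, transition, Function.comp_apply]
    rw [j.1.left_inv hz]
  have hD : fderiv ℝ (transition i k) =ᶠ[𝓝 y] fun z => (fderiv ℝ f (g z)).comp (fderiv ℝ g z) := by
    have hf' : ∀ᶠ w in 𝓝 (g y), ContDiffAt ℝ 1 f w :=
      (hf.of_le (by simp) : ContDiffAt ℝ 1 f (g y)).eventually (by simp)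
    have hg' : ∀ᶠ z in 𝓝 y, ContDiffAt ℝ 1 g z :=
      (hg.of_le (by simp) : ContDiffAt ℝ 1 g y).eventually (by simp)
    filter_upwards [h.fderiv (𝕜 := ℝ), hg', hg.continuousAt hf'] with z h1 h2 h3
    have h3 : ContDiffAt ℝ 1 f (g z) := h3
    rw [h1, fderiv_comp z (h3.differentiableAt (by simp)) (h2.differentiableAt (by simp))]
  have hf1 : DifferentiableAt ℝ (fderiv ℝ f) (g y) :=
    (hf.fderiv_right (m := 1) (by norm_cast)).differentiableAt (by simp)
  have hg1 : DifferentiableAt ℝ (fderiv ℝ g) y :=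
    (hg.fderiv_right (m := 1) (by norm_cast)).differentiableAt (by simp)
  have hg0 : DifferentiableAt ℝ g y := hg.differentiableAt (by simp)
  have hD1 : fderiv ℝ (transition i k) y = (fderiv ℝ f (g y)).comp (fderiv ℝ g y) := hD.eq_of_nhds
  have hD2 : ∀ u v, fderiv ℝ (fderiv ℝ (transition i k)) y u v =
      fderiv ℝ f (g y) (fderiv ℝ (fderiv ℝ g) y u v) +
        fderiv ℝ (fderiv ℝ f) (g y) (fderiv ℝ g y u) (fderiv ℝ g y v) := by
    intro u v
    have h1 : HasFDerivAt (fun z => fderiv ℝ f (g z))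
        ((fderiv ℝ (fderiv ℝ f) (g y)).comp (fderiv ℝ g y)) y :=
      hf1.hasFDerivAt.comp y hg0.hasFDerivAt
    have h2 := h1.clm_comp hg1.hasFDerivAt
    rw [hD.fderiv_eq, h2.fderiv]
    simp
  refine Prod.ext ?_ (Subtype.ext ?_)
  · ext u
    simp only [cotChange, itoAct_fst]
    rw [hD1, ← hgy]
    rfl
  · ext u v
    simp only [cotChange, itoAct_snd, itoAct_fst]
    change (1 / 2 : ℝ) * (a.1 (fderiv ℝ f (j.1 x) (fderiv ℝ (fderiv ℝ g) y u v)) +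
      a.1 (fderiv ℝ f (j.1 x) (fderiv ℝ (fderiv ℝ g) y v u))) +
      ((1 / 2 : ℝ) * (a.1 (fderiv ℝ (fderiv ℝ f) (j.1 x) (fderiv ℝ g y u) (fderiv ℝ g y v)) +
        a.1 (fderiv ℝ (fderiv ℝ f) (j.1 x) (fderiv ℝ g y v) (fderiv ℝ g y u))) +
      (a.2 : Bilin E) (fderiv ℝ f (j.1 x) (fderiv ℝ g y u))
        (fderiv ℝ f (j.1 x) (fderiv ℝ g y v))) = _
    change _ = (1 / 2 : ℝ) * (a.1 (fderiv ℝ (fderiv ℝ (transition i k)) y u v) +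
      a.1 (fderiv ℝ (fderiv ℝ (transition i k)) y v u)) +
      (a.2 : Bilin E) (fderiv ℝ (transition i k) y u) (fderiv ℝ (transition i k) y v)
    rw [hD2 u v, hD2 v u, hD1, hgy]
    simp only [map_add, ContinuousLinearMap.comp_apply]
    ring

theorem contDiffAt_itoAct_transition (i j : Chart E M) {x : M} (hi : x ∈ i.1.source)
    (hj : x ∈ j.1.source) :
    ContDiffAt ℝ ∞ (fun y => itoAct (fderiv ℝ (transition i j) y)
      (fderiv ℝ (fderiv ℝ (transition i j)) y)) (j.1 x) := by
  have h1 : ContDiffAt ℝ ∞ (fderiv ℝ (transition i j)) (j.1 x) :=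
    (contDiffAt_transition i j hi hj).fderiv_right (by norm_cast)
  have h2 : ContDiffAt ℝ ∞ (fderiv ℝ (fderiv ℝ (transition i j))) (j.1 x) :=
    h1.fderiv_right (by norm_cast)
  have h3 : ContDiffAt ℝ ∞ (fun y => (fderiv ℝ (transition i j) y,
      fderiv ℝ (fderiv ℝ (transition i j)) y)) (j.1 x) := h1.prodMk h2
  have h4 := ContDiff.comp_contDiffAt (j.1 x) (contDiff_itoAct (E := E)) h3
  exact h4

theorem contMDiffOn_cotChange (i j : Chart E M) :
    ContMDiffOn 𝓘(ℝ, E) 𝓘(ℝ, CotFiber E →L[ℝ] CotFiber E) ∞ (cotChange i j)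
      (i.1.source ∩ j.1.source) := by
  intro x hx
  have h1 := (contDiffAt_itoAct_transition i j hx.1 hx.2).contMDiffAt
  have h2 := contMDiffAt_of_mem_maximalAtlas j.2 hx.2
  have h3 := h1.comp x h2
  exact h3.contMDiffWithinAt

variable (E M) in
/-- The second-order cotangent bundle `𝒯^{S*}M` as a vector bundle: its typical fibre is the space
of pairs `(p, o)`, and over the local charts of `M` its changes of coordinates are the actions of
the elements of the Itô group that consist of the first and second derivatives of the changes of
coordinates of `M`. -/
noncomputable def cotCore [IsManifold 𝓘(ℝ, E) ∞ M] :
    VectorBundleCore ℝ M (CotFiber E) (Chart E M) where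
  baseSet i := i.1.source
  isOpen_baseSet i := i.1.open_source
  indexAt q := ⟨chartAt E q, IsManifold.chart_mem_maximalAtlas q⟩
  mem_baseSet_at q := mem_chart_source E q
  coordChange := cotChange
  coordChange_self i x hx a := cotChange_self i x hx a
  continuousOn_coordChange i j := (contMDiffOn_cotChange i j).continuousOn
  coordChange_comp i j k x hx a := cotChange_comp i j k x hx.1.1 hx.1.2 hx.2 a

variable [IsManifold 𝓘(ℝ, E) ∞ M]

instance : (cotCore E M).IsContMDiff 𝓘(ℝ, E) ∞ where
  contMDiffOn_coordChange i j := contMDiffOn_cotChange i j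

variable (E M) in
/-- The manifold `𝒯^{S*}M`. A point over `q` is represented by its coordinates `(p, o)` in the
preferred chart at `q`. -/
abbrev SOCotangent : Type _ := Bundle.TotalSpace (CotFiber E) (cotCore E M).Fiber

variable (E) in
/-- The model of the manifold `𝒯^{S*}M`. -/
noncomputable abbrev cotModel : ModelWithCorners ℝ (E × CotFiber E) (ModelProd E (CotFiber E)) :=
  𝓘(ℝ, E).prod 𝓘(ℝ, CotFiber E)

variable (E M) in
/-- The projection `τ : 𝒯^{S*}M → M`. -/
noncomputable def cotProj : C^∞⟮cotModel E, SOCotangent E M; 𝓘(ℝ, E), M⟯ :=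
  ⟨Bundle.TotalSpace.proj, Bundle.contMDiff_proj (cotCore E M).Fiber⟩

/-- The canonical coordinates `(x, p, o)` on `𝒯^{S*}M` induced by the chart `c` of `M`. -/
noncomputable def canonicalCoord (c : Chart E M) (z : SOCotangent E M) : E × CotFiber E :=
  (c.1 z.proj, cotChange ((cotCore E M).indexAt z.proj) c z.proj z.2)

/-- The point of `𝒯^{S*}M` with the canonical coordinates `(x, p, o)`. -/
noncomputable def ofCanonicalCoord (c : Chart E M) (y : E × CotFiber E) : SOCotangent E M :=
  ⟨c.1.symm y.1, cotChange c ((cotCore E M).indexAt (c.1.symm y.1)) (c.1.symm y.1) y.2⟩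

/-- The second-order differential `d²f_q = (∂_i f, ∂_j ∂_k f)` at `q` of the function `f` on `M`. -/
noncomputable def secondDifferential (f : M → ℝ) (q : M) : SOCotangent E M :=
  ⟨q, (fderiv ℝ (f ∘ (chartAt E q).symm) (chartAt E q q),
    symm E (fderiv ℝ (fderiv ℝ (f ∘ (chartAt E q).symm)) (chartAt E q q)))⟩

/-! ## Second-order Hamiltonian vector fields and their horizontal integral processes -/

/-- The derivative at `z`, in the canonical coordinates `(x, p, o)` induced by the chart `c`, of the
function `H` on `𝒯^{S*}M` in the direction `y`. -/
noncomputable def coordDeriv (H : SOCotangent E M → ℝ) (c : Chart E M) (z : SOCotangent E M)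
    (y : E × CotFiber E) : ℝ :=
  fderiv ℝ (H ∘ ofCanonicalCoord c) (canonicalCoord c z) y

/-- `A` is a second-order Hamiltonian vector of `H` at `z`: in all canonical coordinates
`(x, p, o)` around `z` that are induced by charts of `M`, it is of the form
`A = ∂H/∂p_i ∂_{x^i} - ∂H/∂x^i ∂_{p_i} + ∂H/∂o_{jk} ∂_{x^j} ∂_{x^k}`
`- (∂²H/∂x^j∂x^k + C_{jk}) ∂_{o_{jk}} + A_{jk} ∂_{p_j} ∂_{p_k} + A_{ijkl} ∂_{o_{ij}} ∂_{o_{kl}}`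
`+ A^j_k ∂_{x^j} ∂_{p_k} + A^j_{kl} ∂_{x^j} ∂_{o_{kl}} + A_{jkl} ∂_{p_j} ∂_{o_{kl}}`,
where `C_{jk} ∂H/∂o_{jk}` equals the sum of
`A_{jk} ∂²H/∂p_j∂p_k`, `A_{ijkl} ∂²H/∂o_{ij}∂o_{kl}`, `A^j_k ∂²H/∂x^j∂p_k`,
`A^j_{kl} ∂²H/∂x^j∂o_{kl}` and `A_{jkl} ∂²H/∂p_j∂o_{kl}`; given the other conditions,
this is the equation `A H = 0`. The coordinates are taken with respect to arbitrary linear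
coordinates on `E`: `ℓ ∘ x` for `ℓ` in the dual of `E`, and `p(e)` for `e` in `E`. A coordinate
function is local, and `A` acts on it through any smooth function with the same germ at `z`. -/
structure IsHamiltonianVector (H : C^∞⟮cotModel E, SOCotangent E M; ℝ⟯) (z : SOCotangent E M)
    (A : SecondOrderVector (cotModel E) z) : Prop where
  /-- `A x^i = ∂H/∂p_i` -/
  apply_x : ∀ c : Chart E M, z.proj ∈ c.1.source → ∀ (ℓ : E →L[ℝ] ℝ)
    (u : C^∞⟮cotModel E, SOCotangent E M; ℝ⟯),
    (u =ᶠ[𝓝 z] fun w => ℓ (canonicalCoord c w).1) →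
    A.toLin u = coordDeriv H c z (0, ℓ, 0)
  /-- `Γ_A(x^j, x^k) = 2 ∂H/∂o_{jk}`, with the symmetric gradient `∂H/∂o` -/
  squaredField_x : ∀ c : Chart E M, z.proj ∈ c.1.source → ∀ (ℓ m : E →L[ℝ] ℝ)
    (u v : C^∞⟮cotModel E, SOCotangent E M; ℝ⟯),
    (u =ᶠ[𝓝 z] fun w => ℓ (canonicalCoord c w).1) →
    (v =ᶠ[𝓝 z] fun w => m (canonicalCoord c w).1) →
    A.squaredField u v = 2 * coordDeriv H c z (0, 0, symm E (ℓ.smulRight m))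
  /-- `A p_i = - ∂H/∂x^i` -/
  apply_p : ∀ c : Chart E M, z.proj ∈ c.1.source → ∀ (e : E)
    (u : C^∞⟮cotModel E, SOCotangent E M; ℝ⟯),
    (u =ᶠ[𝓝 z] fun w => (canonicalCoord c w).2.1 e) →
    A.toLin u = - coordDeriv H c z (e, 0)
  /-- `A H = 0` -/
  apply_H : A.toLin H = 0

/-- `A` is a second-order Hamiltonian vector field of the (time-dependent) second-order
Hamiltonian `H`. -/
def IsHamiltonianField (H : C^∞⟮𝓘(ℝ, ℝ).prod (cotModel E), ℝ × SOCotangent E M; ℝ⟯)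
    (A : SecondOrderField (cotModel E) (SOCotangent E M)) : Prop :=
  ∀ t z, IsHamiltonianVector (slice H t) z (A.val t z)

/-- `d²S(t, q)`, the second-order differential of `S(t, ·)` at `q`. -/
noncomputable def d2 (S : C^∞⟮𝓘(ℝ, ℝ).prod 𝓘(ℝ, E), ℝ × M; ℝ⟯) (t : ℝ) (q : M) :
    SOCotangent E M :=
  secondDifferential (fun r => S (t, r)) q

/-- The projection `d²τ_{d²S(t, q)} A` of the second-order vector field `A` on `𝒯^{S*}M` at the
point `d²S(t, q)`; it is a second-order tangent vector to `M` at `q`. -/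
noncomputable def projection (A : SecondOrderField (cotModel E) (SOCotangent E M))
    (S : C^∞⟮𝓘(ℝ, ℝ).prod 𝓘(ℝ, E), ℝ × M; ℝ⟯) (t : ℝ) (q : M) :
    SecondOrderVector 𝓘(ℝ, E) q :=
  (A.val t (d2 S t q)).map (cotProj E M)

section

variable {Ω : Type*} [mΩ : MeasurableSpace Ω]

/-- `Z` is a horizontal diffusion on `𝒯^{S*}M`: it is a diffusion, and `Z(t) = φ(t, X(t))` for a
diffusion `X` on `M` and a smooth time-dependent section `φ`. -/
def IsHorizontalDiffusion (ℱ : Filtration ℝ mΩ) (P : Measure Ω) (t₀ : ℝ) (τ : Ω → WithTop ℝ)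
    (Z : ℝ → Ω → SOCotangent E M) : Prop :=
  IsDiffusion (cotModel E) ℱ P t₀ τ Z ∧
  ∃ (X : ℝ → Ω → M) (φ : ℝ × M → SOCotangent E M),
    IsDiffusion 𝓘(ℝ, E) ℱ P t₀ τ X ∧
    ContMDiff (𝓘(ℝ, ℝ).prod 𝓘(ℝ, E)) (cotModel E) ∞ φ ∧ (∀ t q, (φ (t, q)).proj = q) ∧
    ∀ᵐ w ∂P, ∀ t ∈ lifeInterval t₀ τ w, Z t w = φ (t, X t w)

/-- `Z` is a horizontal integral process of the second-order Hamiltonian vector field of `H`,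
i.e. it is a horizontal diffusion that solves the stochastic Hamilton's equations
`D x = ∂H/∂p`, `Q x = 2 ∂H/∂o`, `D p = - ∂H/∂x`, `D o = - (∂²H/∂x∂x + C)`, with the equation
for `C`: for all `t` in the lifetime of `Z`, its mean derivatives `(DZ(t), QZ(t))` are a
second-order Hamiltonian vector of `H(·, t)` at `Z(t)`. The coefficients that the equation
`A_H ⌟ ω = d²H` leaves free are not prescribed. -/
def IsHorizontalIntegralProcess (H : C^∞⟮𝓘(ℝ, ℝ).prod (cotModel E), ℝ × SOCotangent E M; ℝ⟯)
    (ℱ : Filtration ℝ mΩ) (P : Measure Ω) (t₀ : ℝ) (τ : Ω → WithTop ℝ)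
    (Z : ℝ → Ω → SOCotangent E M) : Prop :=
  IsHorizontalDiffusion ℱ P t₀ τ Z ∧
  ∃ 𝒜 : ∀ t w, SecondOrderVector (cotModel E) (Z t w),
    HasMeanDerivatives ℱ P t₀ τ Z 𝒜 ∧
    ∀ᵐ w ∂P, ∀ t ∈ lifeInterval t₀ τ w, IsHamiltonianVector (slice H t) (Z t w) (𝒜 t w)

end

end Cotangent

end StochHam

/-!
Along a diffusion `X` on `M` that is generated by the projection of `A_H`, the process `d²S(t, X(t))`
moves on the graph of `d²S`, and everything is decided by the expression `Φ = ∂_t S + H(t, d²S)`.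

In a chart, let `K(t, x)` be the derivative of `H(t, ·)` in canonical coordinates at `d²S(t, x)`.
The space-time generator of `X` is `∂_t + K(0, D_x, D_x²)` (`deriv_add_projection`): it depends on
`H` and `S` only. Since derivatives commute, the space derivative of `Φ` in the direction `e` is
`(∂_t + K(0, D_x, D_x²)) (∂_e S) + K(e, 0)` (`fderiv_hjb`). The first term is the mean derivative
of the coordinate `p(e) = ∂_e S(t, X(t))` by Itô's formula, and Hamilton's equation for `p` says
that it is `-K(e, 0)`. So Hamilton's equation for `p` along all the processes amounts to the
vanishing of the space derivatives of `Φ`, i.e. to the Hamilton–Jacobi–Bellman equation.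

If the equation holds, `d²S(t, X(t))` has to be shown to be a diffusion on `𝒯^{S*}M`. Its generator
is only determined on the graph of `d²S`; it is extended to a smooth elliptic second-order vector
field by translating the graph along the fibres in each chart and gluing with a partition of unity
(`exists_liftField`). The equations for `x` hold by construction, the one for `p` by the formula
above, and `A H = 0` follows from the derivatives of `Φ` in space, because derivatives in time and
in space commute (`isHamiltonianVector_of_hjb`).

Conversely, suppose that some space derivative of `Φ` is positive at a point. Then it is positive
near that point, and the local martingale of `p(e)` obtained from Itô's formula and the one
obtained from Hamilton's equations differ by a strictly increasing process, which is impossible for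
a diffusion started there (`LocalDiffusion.false_of_pos`). This argument needs such a diffusion,
although the generator may be degenerate. With coefficients that are cut off in a chart, a solution
of the martingale problem in a vector space is constructed as a weak limit of Euler schemes driven
by coin tosses: fourth moments of the increments give continuous paths, a uniform Taylor estimate
gives the martingale property in the limit, and the diffusion matrix at each point is only
factorized pointwise, without any regularity of the factors (`exists_martingaleSolution`). The
solution is stopped when it leaves a small space-time ball, where the cutoff has no effect
(`exists_localDiffusion`). Finally, a function on the connected manifold `M` with vanishing
derivative is constant, so that `Φ` depends on `t` only.
-/


namespace StochHam

/-! ### Averages over finitely many draws -/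

section Draws

variable {A E : Type*}

/-- The Markov chain that starts at `x₀` and moves at time `k` from `x` to `step k x a`, where `a`
is the `k`-th draw. -/
def walk (step : ℕ → E → A → E) (x₀ : E) : ℕ → (ℕ → A) → E
  | 0, _ => x₀
  | k + 1, w => step k (walk step x₀ k w) (w k)

open scoped Classical in
theorem walk_update (step : ℕ → E → A → E) (x₀ : E) {k j : ℕ} (h : k ≤ j) (w : ℕ → A) (a : A) :
    walk step x₀ k (Function.update w j a) = walk step x₀ k w := by
  induction k with
  | zero => rfl
  | succ k ih =>
    simp only [walk]
    rw [ih (by omega), Function.update_of_ne (by omega)]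

variable [Fintype A]

/-- The mean of a function on a finite type. -/
noncomputable def mean (φ : A → ℝ) : ℝ := (Fintype.card A : ℝ)⁻¹ * ∑ a, φ a

theorem mean_add (φ ψ : A → ℝ) : mean (fun a => φ a + ψ a) = mean φ + mean ψ := by
  simp [mean, Finset.sum_add_distrib, mul_add]

theorem mean_const_mul (c : ℝ) (φ : A → ℝ) : mean (fun a => c * φ a) = c * mean φ := by
  simp only [mean, ← Finset.mul_sum]; ring

theorem mean_const [Nonempty A] (c : ℝ) : mean (fun _ : A => c) = c := by
  have : (Fintype.card A : ℝ) ≠ 0 := by exact_mod_cast Fintype.card_ne_zero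
  simp [mean, this]

theorem mean_mono {φ ψ : A → ℝ} (h : ∀ a, φ a ≤ ψ a) : mean φ ≤ mean ψ :=
  mul_le_mul_of_nonneg_left (Finset.sum_le_sum fun a _ => h a) (by positivity)

variable (a₀ : A)

open scoped Classical in
/-- The expectation of `F` when the first `N` draws are independent and uniform and all others
are `a₀`. -/
noncomputable def drawMean : ℕ → ((ℕ → A) → ℝ) → ℝ
  | 0, F => F fun _ => a₀
  | N + 1, F => mean fun a => drawMean N fun w => F (Function.update w N a)

theorem drawMean_add (N : ℕ) (F G : (ℕ → A) → ℝ) :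
    drawMean a₀ N (fun w => F w + G w) = drawMean a₀ N F + drawMean a₀ N G := by
  induction N generalizing F G with
  | zero => rfl
  | succ N ih => simp only [drawMean, ih, mean_add]

theorem drawMean_const_mul (N : ℕ) (c : ℝ) (F : (ℕ → A) → ℝ) :
    drawMean a₀ N (fun w => c * F w) = c * drawMean a₀ N F := by
  induction N generalizing F with
  | zero => rfl
  | succ N ih => simp only [drawMean, ih, mean_const_mul]

theorem drawMean_sub (N : ℕ) (F G : (ℕ → A) → ℝ) :
    drawMean a₀ N (fun w => F w - G w) = drawMean a₀ N F - drawMean a₀ N G := by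
  have := drawMean_add a₀ N F (fun w => (-1) * G w)
  rw [drawMean_const_mul] at this
  simp only [neg_one_mul, ← sub_eq_add_neg] at this
  exact this

theorem drawMean_mono (N : ℕ) {F G : (ℕ → A) → ℝ} (h : ∀ w, F w ≤ G w) :
    drawMean a₀ N F ≤ drawMean a₀ N G := by
  induction N generalizing F G with
  | zero => exact h _
  | succ N ih => exact mean_mono fun a => ih fun w => h _

theorem drawMean_const [Nonempty A] (N : ℕ) (c : ℝ) : drawMean a₀ N (fun _ => c) = c := by
  induction N with
  | zero => rfl
  | succ N ih => simp only [drawMean, ih, mean_const]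

theorem abs_drawMean_le (N : ℕ) (F : (ℕ → A) → ℝ) :
    |drawMean a₀ N F| ≤ drawMean a₀ N (fun w => |F w|) := by
  rw [abs_le]
  constructor
  · have := drawMean_mono a₀ N (F := fun w => (-1) * |F w|) (G := F)
      (fun w => by linarith [neg_abs_le (F w)])
    rw [drawMean_const_mul] at this
    linarith
  · exact drawMean_mono a₀ N fun w => le_abs_self _

theorem drawMean_sum (N : ℕ) {ι : Type*} (s : Finset ι) (F : ι → (ℕ → A) → ℝ) :
    drawMean a₀ N (fun w => ∑ i ∈ s, F i w) = ∑ i ∈ s, drawMean a₀ N (F i) := by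
  classical
  induction s using Finset.induction_on with
  | empty =>
    have := drawMean_const_mul a₀ N 0 (fun _ => 0)
    simpa using this
  | insert i s hi ih => simp only [Finset.sum_insert hi, drawMean_add, ih]

open scoped Classical in
/-- The tower property: a draw that has not been used yet may be averaged out. -/
theorem drawMean_mean_update [Nonempty A] (N : ℕ) {j : ℕ} (hj : j < N) (F : (ℕ → A) → ℝ) :
    drawMean a₀ N (fun w => mean fun a => F (Function.update w j a)) = drawMean a₀ N F := by
  induction N generalizing F with
  | zero => omega
  | succ N ih =>
    rcases Nat.lt_succ_iff_lt_or_eq.1 hj with h | rfl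
    · simp only [drawMean]
      congr 1
      funext b
      rw [← ih h (fun w => F (Function.update w N b))]
      congr 1
      funext w
      congr 1
      funext a
      rw [Function.update_comm h.ne]
    · simp only [drawMean, Function.update_idem]
      rw [mean_const]
      clear ih hj
      -- exchange of the two averages
      simp only [mean]
      rw [drawMean_const_mul, drawMean_sum]

/-- The expectation is a finite convex combination of evaluations. -/
theorem drawMean_eq_sum [Nonempty A] (N : ℕ) : ∃ (ι : Type) (_ : Fintype ι) (p : ι → ℝ)
    (ν : ι → ℕ → A), (∀ i, 0 ≤ p i) ∧ ∑ i, p i = 1 ∧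
    ∀ F, drawMean a₀ N F = ∑ i, p i * F (ν i) := by
  classical
  induction N with
  | zero => exact ⟨Unit, inferInstance, fun _ => 1, fun _ _ => a₀, by simp, by simp,
      fun F => by simp [drawMean]⟩
  | succ N ih =>
    obtain ⟨ι, _, p, ν, hp, h1, h⟩ := ih
    let e := Fintype.equivFin A
    have hc : (Fintype.card A : ℝ) ≠ 0 := by exact_mod_cast Fintype.card_ne_zero
    refine ⟨Fin (Fintype.card A) × ι, inferInstance,
      fun q => (Fintype.card A : ℝ)⁻¹ * p q.2,
      fun q => Function.update (ν q.2) N (e.symm q.1),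
      fun q => mul_nonneg (by positivity) (hp _), ?_, fun F => ?_⟩
    · rw [Fintype.sum_prod_type]
      simp only [← Finset.mul_sum, h1]
      simp [hc]
    · rw [Fintype.sum_prod_type]
      simp only [drawMean, mean, h]
      rw [← Equiv.sum_comp e.symm, Finset.mul_sum]
      refine Finset.sum_congr rfl fun a _ => ?_
      rw [Finset.mul_sum]
      exact Finset.sum_congr rfl fun i _ => by ring

open scoped Classical in
/-- The Markov property of the chain. -/
theorem drawMean_walk_succ [Nonempty A] (step : ℕ → E → A → E) (x₀ : E) {N j : ℕ} (hj : j < N)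
    (Φ : (ℕ → A) → E → ℝ) (hΦ : ∀ w a, Φ (Function.update w j a) = Φ w) :
    drawMean a₀ N (fun w => Φ w (walk step x₀ (j + 1) w)) =
      drawMean a₀ N (fun w => mean fun a => Φ w (step j (walk step x₀ j w) a)) := by
  rw [← drawMean_mean_update a₀ N hj]
  congr 1
  funext w
  congr 1
  funext a
  rw [hΦ]
  simp only [walk]
  rw [walk_update _ _ le_rfl, Function.update_self]

end Draws

/-! ### A uniform second-order Taylor formula -/

section Taylor

variable {W : Type*} [NormedAddCommGroup W] [NormedSpace ℝ W]

theorem exists_taylor_two_bound [FiniteDimensional ℝ W] {f : W → ℝ} (hf : ContDiff ℝ ∞ f)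
    (ρ : ℝ) : ∃ C, 0 ≤ C ∧ ∀ z v : W, ‖z‖ ≤ ρ → ‖v‖ ≤ ρ →
    |f (z + v) - f z - fderiv ℝ f z v - (1 / 2) * fderiv ℝ (fderiv ℝ f) z v v| ≤
      C * ‖v‖ ^ 3 := by
  have h1 : ContDiff ℝ ∞ (fderiv ℝ f) := hf.fderiv_right (by norm_cast)
  have h2 : ContDiff ℝ ∞ (fderiv ℝ (fderiv ℝ f)) := h1.fderiv_right (by norm_cast)
  have hK : IsCompact (Metric.closedBall (0 : W) (2 * ρ)) := isCompact_closedBall _ _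
  obtain ⟨C, hC⟩ := ContDiffOn.exists_lipschitzOnWith (n := ∞)
    (h2.contDiffOn (s := Metric.closedBall (0 : W) (2 * ρ))) (by simp)
    (convex_closedBall _ _) hK
  refine ⟨C, C.2, fun z v hz hv => ?_⟩
  have hd : ∀ v' : W, ‖v'‖ ≤ ‖v‖ →
      ‖fderiv ℝ (fderiv ℝ f) (z + v') - fderiv ℝ (fderiv ℝ f) z‖ ≤ C * ‖v‖ := by
    intro v' hv'
    have := hC.norm_sub_le (x := z + v') (y := z) ?_ ?_
    · simp only [add_sub_cancel_left] at this
      exact this.trans (mul_le_mul_of_nonneg_left hv' C.2)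
    · rw [mem_closedBall_zero_iff]
      linarith [norm_add_le z v']
    · rw [mem_closedBall_zero_iff]
      linarith [norm_nonneg v]
  have hb0 : (0 : W) ∈ Metric.closedBall (0 : W) ‖v‖ := by simp
  have hd1 : ∀ v' : W, ‖v'‖ ≤ ‖v‖ →
      ‖fderiv ℝ f (z + v') - fderiv ℝ f z - fderiv ℝ (fderiv ℝ f) z v'‖ ≤ C * ‖v‖ * ‖v‖ := by
    intro v' hv'
    have hD : ∀ x ∈ Metric.closedBall (0 : W) ‖v‖, HasFDerivWithinAt
        (fun x => fderiv ℝ f (z + x) - fderiv ℝ (fderiv ℝ f) z x)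
        (fderiv ℝ (fderiv ℝ f) (z + x) - fderiv ℝ (fderiv ℝ f) z)
        (Metric.closedBall (0 : W) ‖v‖) x := by
      intro x _
      have e1 : HasFDerivAt (fderiv ℝ f) (fderiv ℝ (fderiv ℝ f) (z + x)) (z + x) :=
        (h1.differentiable (by simp) _).hasFDerivAt
      have e2 : HasFDerivAt (fun x => fderiv ℝ f (z + x)) (fderiv ℝ (fderiv ℝ f) (z + x)) x := by
        exact (hasFDerivAt_comp_add_left z).2 e1
      exact (e2.sub (fderiv ℝ (fderiv ℝ f) z).hasFDerivAt).hasFDerivWithinAt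
    have := (convex_closedBall (0 : W) ‖v‖).norm_image_sub_le_of_norm_hasFDerivWithin_le hD
      (fun x hx => hd x (by simpa using hx)) hb0 (y := v') (by simpa using hv')
    simp only [add_zero, map_zero, sub_zero] at this
    have e : fderiv ℝ f (z + v') - fderiv ℝ f z - fderiv ℝ (fderiv ℝ f) z v' =
        fderiv ℝ f (z + v') - fderiv ℝ (fderiv ℝ f) z v' - fderiv ℝ f z := by abel
    rw [e]
    exact this.trans (mul_le_mul_of_nonneg_left hv' (by positivity))
  have hsym : ∀ x y, fderiv ℝ (fderiv ℝ f) z x y = fderiv ℝ (fderiv ℝ f) z y x := by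
    intro x y
    exact (hf.contDiffAt.isSymmSndFDerivAt (by simp; norm_cast)).eq x y
  have hD : ∀ x ∈ Metric.closedBall (0 : W) ‖v‖, HasFDerivWithinAt
      (fun x => f (z + x) - fderiv ℝ f z x - (1 / 2 : ℝ) * fderiv ℝ (fderiv ℝ f) z x x)
      (fderiv ℝ f (z + x) - fderiv ℝ f z - fderiv ℝ (fderiv ℝ f) z x)
      (Metric.closedBall (0 : W) ‖v‖) x := by
    intro x _
    have e1 : HasFDerivAt f (fderiv ℝ f (z + x)) (z + x) :=
      (hf.differentiable (by simp) _).hasFDerivAt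
    have e2 : HasFDerivAt (fun x => f (z + x)) (fderiv ℝ f (z + x)) x := by
      exact (hasFDerivAt_comp_add_left z).2 e1
    have e3 : HasFDerivAt (fun x => fderiv ℝ (fderiv ℝ f) z x x)
        ((fderiv ℝ (fderiv ℝ f) z x).comp (ContinuousLinearMap.id ℝ W) +
          (fderiv ℝ (fderiv ℝ f) z).flip x) x := by
      exact (fderiv ℝ (fderiv ℝ f) z).hasFDerivAt.clm_apply (hasFDerivAt_id x)
    have e4 := (e2.sub (fderiv ℝ f z).hasFDerivAt).sub (e3.const_mul (1 / 2 : ℝ))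
    refine (e4.congr_fderiv ?_).hasFDerivWithinAt
    ext y
    simp [hsym y x]
    ring
  have := (convex_closedBall (0 : W) ‖v‖).norm_image_sub_le_of_norm_hasFDerivWithin_le hD
      (fun x hx => hd1 x (by simpa using hx)) hb0 (y := v) (by simp)
  simp only [add_zero, map_zero, sub_zero, mul_zero, Real.norm_eq_abs] at this
  have e : f (z + v) - f z - fderiv ℝ f z v - (1 / 2) * fderiv ℝ (fderiv ℝ f) z v v =
      f (z + v) - fderiv ℝ f z v - (1 / 2) * fderiv ℝ (fderiv ℝ f) z v v - f z := by ring
  rw [e]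
  refine this.trans (le_of_eq ?_)
  ring

/-- Averaging over the sign of the noise `ς` removes the terms of odd order. -/
theorem exists_symm_step_bound [FiniteDimensional ℝ W] {f : W → ℝ} (hf : ContDiff ℝ ∞ f)
    (ρ : ℝ) : ∃ C, 0 ≤ C ∧ ∀ z β ς : W, ‖z‖ ≤ ρ → ‖β‖ ≤ ρ → ‖ς‖ ≤ ρ → ∀ r : ℝ, 0 ≤ r → r ≤ 1 →
    |(f (z + (r ^ 2 • β + r • ς)) + f (z + (r ^ 2 • β - r • ς))) / 2 - f z -
      r ^ 2 * (fderiv ℝ f z β + (1 / 2) * fderiv ℝ (fderiv ℝ f) z ς ς)| ≤ C * r ^ 3 := by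
  rcases lt_or_ge ρ 0 with hρ | hρ
  · exact ⟨0, le_rfl, fun z β ς hz => absurd (norm_nonneg z) (by linarith)⟩
  obtain ⟨C, hC0, hC⟩ := exists_taylor_two_bound hf (2 * ρ)
  have h1 : ContDiff ℝ ∞ (fderiv ℝ f) := hf.fderiv_right (by norm_cast)
  have h2 : ContDiff ℝ ∞ (fderiv ℝ (fderiv ℝ f)) := h1.fderiv_right (by norm_cast)
  obtain ⟨D, hD⟩ := (isCompact_closedBall (0 : W) ρ).exists_bound_of_continuousOn
    h2.continuous.continuousOn
  have hD0 : 0 ≤ D := (norm_nonneg _).trans (hD 0 (by simpa using hρ))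
  refine ⟨C * (2 * ρ) ^ 3 + D * ρ * ρ, by positivity, fun z β ς hz hβ hς r hr0 hr1 => ?_⟩
  have hn : ∀ v : W, ‖v‖ ≤ r * (2 * ρ) → |f (z + v) - f z - fderiv ℝ f z v -
      (1 / 2) * fderiv ℝ (fderiv ℝ f) z v v| ≤ C * (2 * ρ) ^ 3 * r ^ 3 := by
    intro v hv
    refine (hC z v (by linarith) (hv.trans (by nlinarith))).trans ?_
    calc C * ‖v‖ ^ 3 ≤ C * (r * (2 * ρ)) ^ 3 := by gcongr
      _ = _ := by ring
  have hb : ‖r ^ 2 • β‖ ≤ r * ρ := by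
    rw [norm_smul, Real.norm_eq_abs, abs_of_nonneg (by positivity)]
    have : r ^ 2 ≤ r := by nlinarith
    exact mul_le_mul this hβ (norm_nonneg _) hr0
  have hs : ‖r • ς‖ ≤ r * ρ := by
    rw [norm_smul, Real.norm_eq_abs, abs_of_nonneg hr0]
    gcongr
  have e1 := hn (r ^ 2 • β + r • ς) ((norm_add_le _ _).trans (by linarith))
  have e2 := hn (r ^ 2 • β - r • ς) ((norm_sub_le _ _).trans (by linarith))
  have e3 : |fderiv ℝ (fderiv ℝ f) z β β| ≤ D * ρ * ρ := by
    have q1 := (fderiv ℝ (fderiv ℝ f) z β).le_opNorm β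
    have q2 := (fderiv ℝ (fderiv ℝ f) z).le_opNorm β
    have q3 := hD z (by simpa using hz)
    rw [Real.norm_eq_abs] at q1
    refine q1.trans (mul_le_mul (q2.trans ?_) hβ (norm_nonneg _) (by positivity))
    exact mul_le_mul q3 hβ (norm_nonneg _) hD0
  simp only [map_add, map_sub, map_smul, add_apply, sub_apply, smul_apply, smul_eq_mul] at e1 e2
  have e4 : r ^ 4 * |fderiv ℝ (fderiv ℝ f) z β β| ≤ r ^ 3 * (D * ρ * ρ) := by
    have : r ^ 4 ≤ r ^ 3 := by
      have : r ^ 4 = r ^ 3 * r := by ring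
      nlinarith [pow_nonneg hr0 3]
    exact mul_le_mul this e3 (abs_nonneg _) (by positivity)
  have e5 : r ^ 4 * fderiv ℝ (fderiv ℝ f) z β β ≤ r ^ 3 * (D * ρ * ρ) :=
    le_trans (mul_le_mul_of_nonneg_left (le_abs_self _) (by positivity)) e4
  have e6 : -(r ^ 3 * (D * ρ * ρ)) ≤ r ^ 4 * fderiv ℝ (fderiv ℝ f) z β β := by
    have := mul_le_mul_of_nonneg_left (neg_abs_le (fderiv ℝ (fderiv ℝ f) z β β))
      (by positivity : 0 ≤ r ^ 4)
    linarith
  have e0 : 0 ≤ r ^ 3 * (D * ρ * ρ) := by positivity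
  rw [abs_le] at e1 e2 ⊢
  constructor
  · linarith [e1.1, e2.1]
  · linarith [e1.2, e2.2]

end Taylor

end StochHam

namespace StochHam

/-! ### The Euler scheme with coin-toss noise -/

section Euler

variable {E : Type*} [NormedAddCommGroup E] [NormedSpace ℝ E] {κ : Type*} [Fintype κ]

theorem mean_prod_bool (φ : κ × Bool → ℝ) :
    mean φ = mean fun i => (φ (i, true) + φ (i, false)) / 2 := by
  simp only [mean, Fintype.card_prod, Fintype.card_bool, Fintype.sum_prod_type, Fintype.sum_bool,
    ← Finset.sum_div]
  push_cast
  rw [mul_inv]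
  ring

/-- One step of the Euler scheme with drift `b` and noise directions `σ i`: with time step `r²`,
a uniformly chosen direction `i` and a fair sign. The factor `√(card κ)` makes the covariance of
the step equal to `r² ∑ σ i ⊗ σ i`. -/
noncomputable def eulerStep (b : ℝ × E → E) (σ : κ → ℝ × E → E) (t₀ r : ℝ) (k : ℕ) (x : E)
    (a : κ × Bool) : E :=
  x + (r ^ 2 • b (t₀ + k * r ^ 2, x) +
    (bif a.2 then 1 else -1 : ℝ) • r • √(Fintype.card κ) • σ a.1 (t₀ + k * r ^ 2, x))

/-- The generator `∂_t f + D_b f + ½ ∑ D²_{σ i} f`. -/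
noncomputable def eulerGen (b : ℝ × E → E) (σ : κ → ℝ × E → E) (f : ℝ × E → ℝ) (z : ℝ × E) : ℝ :=
  fderiv ℝ f z (1, b z) + (1 / 2) * ∑ i, fderiv ℝ (fderiv ℝ f) z (0, σ i z) (0, σ i z)

/-- The coefficients are bounded by `C` and vanish outside the ball of radius `R`. -/
structure BoundedCoeff (b : ℝ × E → E) (σ : κ → ℝ × E → E) (R C : ℝ) : Prop where
  radius_nonneg : 0 ≤ R
  bound_nonneg : 0 ≤ C
  drift_le : ∀ z, ‖b z‖ ≤ C
  noise_le : ∀ i z, ‖σ i z‖ ≤ C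
  drift_zero : ∀ t x, R < ‖x‖ → b (t, x) = 0
  noise_zero : ∀ i t x, R < ‖x‖ → σ i (t, x) = 0

variable {b : ℝ × E → E} {σ : κ → ℝ × E → E} {R C : ℝ}

theorem norm_sign_smul (s : Bool) (v : E) : ‖(bif s then 1 else -1 : ℝ) • v‖ = ‖v‖ := by
  cases s <;> simp

/-- A radius that the scheme never leaves. -/
noncomputable def safeRadius (κ : Type*) [Fintype κ] (R C : ℝ) : ℝ :=
  R + (C + √(Fintype.card κ) * C)

theorem BoundedCoeff.norm_step_le (h : BoundedCoeff b σ R C) (t₀ : ℝ) {r : ℝ} (hr0 : 0 ≤ r)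
    (hr1 : r ≤ 1) (k : ℕ) {x : E} (hx : ‖x‖ ≤ safeRadius κ R C) (a : κ × Bool) :
    ‖eulerStep b σ t₀ r k x a‖ ≤ safeRadius κ R C := by
  have hC := h.bound_nonneg
  rcases le_or_gt ‖x‖ R with hR | hR
  · unfold eulerStep safeRadius
    refine (norm_add_le _ _).trans (add_le_add hR ((norm_add_le _ _).trans (add_le_add ?_ ?_)))
    · rw [norm_smul, Real.norm_eq_abs, abs_of_nonneg (by positivity)]
      have : r ^ 2 ≤ 1 := by nlinarith
      calc r ^ 2 * _ ≤ 1 * C := mul_le_mul this (h.drift_le _) (norm_nonneg _) zero_le_one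
        _ = C := one_mul C
    · rw [norm_sign_smul, norm_smul, norm_smul, Real.norm_eq_abs, Real.norm_eq_abs,
        abs_of_nonneg hr0, abs_of_nonneg (Real.sqrt_nonneg _)]
      have := mul_le_mul_of_nonneg_left (h.noise_le a.1 (t₀ + k * r ^ 2, x))
        (Real.sqrt_nonneg (Fintype.card κ))
      calc r * _ ≤ 1 * (√(Fintype.card κ) * C) :=
            mul_le_mul hr1 this (by positivity) zero_le_one
        _ = _ := one_mul _
  · unfold eulerStep
    rw [h.drift_zero _ _ hR, h.noise_zero _ _ _ hR]
    simpa using hx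

theorem BoundedCoeff.norm_walk_le (h : BoundedCoeff b σ R C) (t₀ : ℝ) {r : ℝ} (hr0 : 0 ≤ r)
    (hr1 : r ≤ 1) {x₀ : E} (hx : ‖x₀‖ ≤ R) (k : ℕ) (w : ℕ → κ × Bool) :
    ‖walk (eulerStep b σ t₀ r) x₀ k w‖ ≤ safeRadius κ R C := by
  induction k with
  | zero =>
    have := h.bound_nonneg
    have : 0 ≤ √(Fintype.card κ) * C := by positivity
    simp only [walk, safeRadius]
    linarith
  | succ k ih => exact h.norm_step_le t₀ hr0 hr1 k ih _

theorem sum_eq_card_mul_mean [Nonempty κ] (φ : κ → ℝ) :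
    ∑ i, φ i = Fintype.card κ * mean φ := by
  have : (Fintype.card κ : ℝ) ≠ 0 := by exact_mod_cast Fintype.card_ne_zero
  simp [mean, this]

theorem mean_sub (φ ψ : κ → ℝ) : mean (fun a => φ a - ψ a) = mean φ - mean ψ := by
  simp [mean, Finset.sum_sub_distrib, mul_sub]

theorem abs_mean_le [Nonempty κ] {φ : κ → ℝ} {c : ℝ} (h : ∀ a, |φ a| ≤ c) : |mean φ| ≤ c := by
  rw [abs_le]
  constructor
  · rw [← mean_const (A := κ) (-c)]
    exact mean_mono fun a => (abs_le.1 (h a)).1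
  · rw [← mean_const (A := κ) c]
    exact mean_mono fun a => (abs_le.1 (h a)).2

/-- The scheme is consistent with its generator. -/
theorem BoundedCoeff.exists_consistency [Nonempty κ] [FiniteDimensional ℝ E]
    (h : BoundedCoeff b σ R C) (t₀ : ℝ) {f : ℝ × E → ℝ} (hf : ContDiff ℝ ∞ f) :
    ∃ K, 0 ≤ K ∧ ∀ r : ℝ, 0 ≤ r → r ≤ 1 → ∀ k : ℕ, k * r ^ 2 ≤ 1 → ∀ x : E,
      ‖x‖ ≤ safeRadius κ R C →
      |mean (fun a => f (t₀ + (k + 1 : ℕ) * r ^ 2, eulerStep b σ t₀ r k x a)) -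
        f (t₀ + k * r ^ 2, x) - r ^ 2 * eulerGen b σ f (t₀ + k * r ^ 2, x)| ≤ K * r ^ 3 := by
  set m : ℝ := √(Fintype.card κ) with hm
  have hC := h.bound_nonneg
  have hR := h.radius_nonneg
  have hm0 : 0 ≤ m := Real.sqrt_nonneg _
  have hmm : m * m = Fintype.card κ := Real.mul_self_sqrt (by positivity)
  obtain ⟨K, hK0, hK⟩ := exists_symm_step_bound hf
    (safeRadius κ R C + (|t₀| + 1) + 1 + C + m * C)
  refine ⟨K, hK0, fun r hr0 hr1 k hk x hx => ?_⟩
  have hsr : 0 ≤ safeRadius κ R C := (norm_nonneg _).trans hx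
  set z : ℝ × E := (t₀ + k * r ^ 2, x) with hz
  have hmC : 0 ≤ m * C := by positivity
  have hzn : ‖z‖ ≤ safeRadius κ R C + (|t₀| + 1) + 1 + C + m * C := by
    rw [Prod.norm_def]
    refine max_le ?_ (by simp only [hz]; linarith [abs_nonneg t₀])
    simp only [hz, Real.norm_eq_abs]
    have := abs_add_le t₀ (k * r ^ 2)
    rw [abs_of_nonneg (by positivity : 0 ≤ k * r ^ 2)] at this
    linarith
  have hbn : ‖((1 : ℝ), b z)‖ ≤ safeRadius κ R C + (|t₀| + 1) + 1 + C + m * C := by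
    rw [Prod.norm_def]
    refine max_le (by simp; linarith [abs_nonneg t₀]) ?_
    have := h.drift_le z
    simp only
    linarith [abs_nonneg t₀]
  have hs : ∀ i, ‖((0 : ℝ), m • σ i z)‖ ≤ safeRadius κ R C + (|t₀| + 1) + 1 + C + m * C := by
    intro i
    rw [Prod.norm_def]
    refine max_le (by simp; linarith [abs_nonneg t₀]) ?_
    rw [norm_smul, Real.norm_eq_abs, abs_of_nonneg hm0]
    have := mul_le_mul_of_nonneg_left (h.noise_le i z) hm0
    linarith [abs_nonneg t₀]
  have key := fun i => hK z (1, b z) (0, m • σ i z) hzn hbn (hs i) r hr0 hr1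
  rw [mean_prod_bool]
  have e : ∀ i : κ, (f (t₀ + (k + 1 : ℕ) * r ^ 2, eulerStep b σ t₀ r k x (i, true)) +
      f (t₀ + (k + 1 : ℕ) * r ^ 2, eulerStep b σ t₀ r k x (i, false))) / 2 =
      (f (z + (r ^ 2 • (1, b z) + r • (0, m • σ i z))) +
        f (z + (r ^ 2 • (1, b z) - r • (0, m • σ i z)))) / 2 := by
    intro i
    congr 3
    · ext
      · simp [hz]; ring
      · simp [hz, eulerStep, hm]
    · ext
      · simp [hz]; ring
      · simp [hz, eulerStep, hm, sub_eq_add_neg]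
  simp only [e]
  have e2 : eulerGen b σ f z = mean fun i => fderiv ℝ f z (1, b z) +
      (1 / 2) * fderiv ℝ (fderiv ℝ f) z (0, m • σ i z) (0, m • σ i z) := by
    rw [mean_add, mean_const, mean_const_mul]
    have : ∀ i, fderiv ℝ (fderiv ℝ f) z (0, m • σ i z) (0, m • σ i z) =
        Fintype.card κ * fderiv ℝ (fderiv ℝ f) z (0, σ i z) (0, σ i z) := by
      intro i
      have e3 : ((0 : ℝ), m • σ i z) = m • ((0 : ℝ), σ i z) := by simp
      rw [e3, map_smul, map_smul, smul_apply, smul_eq_mul, smul_eq_mul, ← mul_assoc, hmm]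
    simp only [this]
    rw [mean_const_mul, eulerGen, sum_eq_card_mul_mean]
  rw [e2, ← mean_const (A := κ) (f z), ← mean_const_mul, ← mean_sub, ← mean_sub]
  exact abs_mean_le key

/-- Moments of a scalar step `B r² ± r s`. -/
theorem scalar_step_moments {U D r : ℝ} (hU : 0 ≤ U) (hD : 0 ≤ D) (hr0 : 0 ≤ r) (hr1 : r ≤ 1)
    {u B s : ℝ} (hu : |u| ≤ U) (hB : |B| ≤ D) (hs : |s| ≤ D) :
    ((u + (r ^ 2 * B + r * s)) ^ 2 + (u + (r ^ 2 * B - r * s)) ^ 2) / 2 ≤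
      u ^ 2 + r ^ 2 * (2 * U * D + 2 * D ^ 2) ∧
    ((u + (r ^ 2 * B + r * s)) ^ 4 + (u + (r ^ 2 * B - r * s)) ^ 4) / 2 ≤
      u ^ 4 + r ^ 2 * (4 * U * D + 12 * D ^ 2 + 16 * U * D ^ 3 + 8 * D ^ 4) * (u ^ 2 + r ^ 2) := by
  have hr2 : r ^ 2 ≤ 1 := by nlinarith
  set h := r ^ 2 with hh
  have h0 : 0 ≤ h := by positivity
  have hB2 : B ^ 2 ≤ D ^ 2 := sq_le_sq' (abs_le.1 hB).1 (abs_le.1 hB).2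
  have hs2 : s ^ 2 ≤ D ^ 2 := sq_le_sq' (abs_le.1 hs).1 (abs_le.1 hs).2
  have huB : u * B ≤ U * D := (le_abs_self _).trans (by
    rw [abs_mul]; exact mul_le_mul hu hB (abs_nonneg _) hU)
  have hB4 : B ^ 4 ≤ D ^ 4 := by nlinarith [sq_nonneg B, sq_nonneg D]
  have hs4 : s ^ 4 ≤ D ^ 4 := by nlinarith [sq_nonneg s, sq_nonneg D]
  have hs2B2 : s ^ 2 * B ^ 2 ≤ D ^ 4 := by
    calc s ^ 2 * B ^ 2 ≤ D ^ 2 * D ^ 2 := mul_le_mul hs2 hB2 (sq_nonneg _) (sq_nonneg _)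
      _ = D ^ 4 := by ring
  have huB3 : u * B * B ^ 2 ≤ U * D ^ 3 := by
    calc u * B * B ^ 2 ≤ U * D * B ^ 2 := mul_le_mul_of_nonneg_right huB (sq_nonneg _)
      _ ≤ U * D * D ^ 2 := mul_le_mul_of_nonneg_left hB2 (by positivity)
      _ = _ := by ring
  have hus : u * B * s ^ 2 ≤ U * D ^ 3 := by
    calc u * B * s ^ 2 ≤ U * D * s ^ 2 := mul_le_mul_of_nonneg_right huB (sq_nonneg _)
      _ ≤ U * D * D ^ 2 := mul_le_mul_of_nonneg_left hs2 (by positivity)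
      _ = _ := by ring
  have hh1 : h ^ 2 ≤ h := by nlinarith
  constructor
  · have e : ((u + (h * B + r * s)) ^ 2 + (u + (h * B - r * s)) ^ 2) / 2 =
        u ^ 2 + h * (2 * (u * B) + s ^ 2) + h ^ 2 * B ^ 2 := by rw [hh]; ring
    rw [e]
    have : h ^ 2 * B ^ 2 ≤ h * D ^ 2 := mul_le_mul hh1 hB2 (sq_nonneg _) h0
    nlinarith [mul_le_mul_of_nonneg_left huB h0, mul_le_mul_of_nonneg_left hs2 h0]
  · have e : ((u + (h * B + r * s)) ^ 4 + (u + (h * B - r * s)) ^ 4) / 2 =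
        u ^ 4 + h * (4 * (u * B) + 6 * (h * B ^ 2) + 6 * s ^ 2) * u ^ 2 +
        h ^ 2 * (4 * h * (u * B * B ^ 2) + h ^ 2 * B ^ 4 + 12 * (u * B * s ^ 2) +
          6 * h * (s ^ 2 * B ^ 2) + s ^ 4) := by rw [hh]; ring
    rw [e]
    have c1 : 4 * (u * B) + 6 * (h * B ^ 2) + 6 * s ^ 2 ≤ 4 * (U * D) + 12 * D ^ 2 := by
      have : h * B ^ 2 ≤ 1 * D ^ 2 := mul_le_mul hr2 hB2 (sq_nonneg _) zero_le_one
      linarith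
    have hUD : 0 ≤ U * D ^ 3 := by positivity
    have c2 : 4 * h * (u * B * B ^ 2) + h ^ 2 * B ^ 4 + 12 * (u * B * s ^ 2) +
        6 * h * (s ^ 2 * B ^ 2) + s ^ 4 ≤ 16 * (U * D ^ 3) + 8 * D ^ 4 := by
      have q1 : h * (u * B * B ^ 2) ≤ 1 * (U * D ^ 3) :=
        (mul_le_mul_of_nonneg_left huB3 h0).trans (mul_le_mul_of_nonneg_right hr2 hUD)
      have q2 : h ^ 2 * B ^ 4 ≤ 1 * D ^ 4 :=
        mul_le_mul (by nlinarith) hB4 (by positivity) zero_le_one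
      have q3 : h * (s ^ 2 * B ^ 2) ≤ 1 * D ^ 4 :=
        mul_le_mul hr2 hs2B2 (by positivity) zero_le_one
      linarith
    have k1 := mul_le_mul_of_nonneg_left (mul_le_mul_of_nonneg_right c1 (sq_nonneg u)) h0
    have k2 := mul_le_mul_of_nonneg_left c2 (sq_nonneg h)
    have p1 : 0 ≤ h * u ^ 2 * (16 * (U * D ^ 3) + 8 * D ^ 4) := by positivity
    have p2 : 0 ≤ h ^ 2 * (4 * (U * D) + 12 * D ^ 2) := by positivity
    linarith

variable {x₀ : E}

set_option maxHeartbeats 400000 in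
theorem BoundedCoeff.exists_moments_functional [Nonempty κ] (h : BoundedCoeff b σ R C)
    (hx : ‖x₀‖ ≤ R) (t₀ : ℝ) (a₀ : κ × Bool) (ℓ : E →L[ℝ] ℝ) :
    ∃ K, 0 ≤ K ∧ ∀ r : ℝ, 0 ≤ r → r ≤ 1 → ∀ N k n : ℕ, k + n ≤ N →
      drawMean a₀ N (fun w => (ℓ (walk (eulerStep b σ t₀ r) x₀ (k + n) w) -
        ℓ (walk (eulerStep b σ t₀ r) x₀ k w)) ^ 2) ≤ K * (n * r ^ 2) ∧
      drawMean a₀ N (fun w => (ℓ (walk (eulerStep b σ t₀ r) x₀ (k + n) w) -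
        ℓ (walk (eulerStep b σ t₀ r) x₀ k w)) ^ 4) ≤ K * (n * r ^ 2) ^ 2 := by
  classical
  set m : ℝ := √(Fintype.card κ) with hm
  have hm0 : 0 ≤ m := Real.sqrt_nonneg _
  have hC := h.bound_nonneg
  have hsr : 0 ≤ safeRadius κ R C := by
    have := h.radius_nonneg
    unfold safeRadius; positivity
  set U : ℝ := 2 * (‖ℓ‖ * safeRadius κ R C) with hU
  set D : ℝ := ‖ℓ‖ * (C + m * C) with hD
  have hU0 : 0 ≤ U := by positivity
  have hD0 : 0 ≤ D := by positivity
  set K2 : ℝ := 2 * U * D + 2 * D ^ 2 with hK2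
  set K4 : ℝ := 4 * U * D + 12 * D ^ 2 + 16 * U * D ^ 3 + 8 * D ^ 4 with hK4
  have hK20 : 0 ≤ K2 := by positivity
  have hK40 : 0 ≤ K4 := by positivity
  refine ⟨K2 + K4 * (K2 + 1), by positivity, fun r hr0 hr1 N k n hkn => ?_⟩
  set X := walk (eulerStep b σ t₀ r) x₀ with hX
  -- one step of the moment recursion
  have step : ∀ j, k ≤ j → j < N →
      drawMean a₀ N (fun w => (ℓ (X (j + 1) w) - ℓ (X k w)) ^ 2) ≤
        drawMean a₀ N (fun w => (ℓ (X j w) - ℓ (X k w)) ^ 2) + r ^ 2 * K2 ∧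
      drawMean a₀ N (fun w => (ℓ (X (j + 1) w) - ℓ (X k w)) ^ 4) ≤
        drawMean a₀ N (fun w => (ℓ (X j w) - ℓ (X k w)) ^ 4) + r ^ 2 * K4 *
          (drawMean a₀ N (fun w => (ℓ (X j w) - ℓ (X k w)) ^ 2) + r ^ 2) := by
    intro j hkj hj
    have hu : ∀ w, |ℓ (X j w) - ℓ (X k w)| ≤ U := by
      intro w
      have q1 := ℓ.le_opNorm (X j w)
      have q2 := ℓ.le_opNorm (X k w)
      rw [Real.norm_eq_abs] at q1 q2
      have p1 := mul_le_mul_of_nonneg_left (h.norm_walk_le t₀ hr0 hr1 hx j w) (norm_nonneg ℓ)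
      have p2 := mul_le_mul_of_nonneg_left (h.norm_walk_le t₀ hr0 hr1 hx k w) (norm_nonneg ℓ)
      have := abs_sub (ℓ (X j w)) (ℓ (X k w))
      linarith
    have hB : ∀ z, |ℓ (b z)| ≤ D := by
      intro z
      refine (ℓ.le_opNorm _).trans (mul_le_mul_of_nonneg_left ?_ (norm_nonneg _))
      have := h.drift_le z
      have : 0 ≤ m * C := by positivity
      linarith
    have hs : ∀ i z, |m * ℓ (σ i z)| ≤ D := by
      intro i z
      rw [abs_mul, abs_of_nonneg hm0]
      have q := (ℓ.le_opNorm (σ i z)).trans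
        (mul_le_mul_of_nonneg_left (h.noise_le i z) (norm_nonneg _))
      rw [Real.norm_eq_abs] at q
      have := mul_le_mul_of_nonneg_left q hm0
      have : 0 ≤ ‖ℓ‖ * C := by positivity
      rw [hD, mul_add]
      nlinarith
    have hex : ∀ w (s : Bool) (i : κ), ℓ (eulerStep b σ t₀ r j (X j w) (i, s)) - ℓ (X k w) =
        (ℓ (X j w) - ℓ (X k w)) + (r ^ 2 * ℓ (b (t₀ + j * r ^ 2, X j w)) +
          (bif s then 1 else -1 : ℝ) * (r * (m * ℓ (σ i (t₀ + j * r ^ 2, X j w))))) := by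
      intro w s i
      simp only [eulerStep, map_add, map_smul, smul_eq_mul]
      ring
    have hmom := fun w i => scalar_step_moments hU0 hD0 hr0 hr1 (hu w)
      (hB (t₀ + j * r ^ 2, X j w)) (hs i (t₀ + j * r ^ 2, X j w))
    have hpast : ∀ p : ℕ, ∀ (w : ℕ → κ × Bool) (a : κ × Bool),
        (fun x => (ℓ x - ℓ (X k (Function.update w j a))) ^ p) =
        fun x => (ℓ x - ℓ (X k w)) ^ p := by
      intro p w a
      rw [hX, walk_update _ _ hkj]
    constructor
    · rw [drawMean_walk_succ a₀ (eulerStep b σ t₀ r) x₀ hj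
        (fun w x => (ℓ x - ℓ (X k w)) ^ 2) (hpast 2)]
      rw [← drawMean_const a₀ N (r ^ 2 * K2), ← drawMean_add]
      refine drawMean_mono a₀ N fun w => ?_
      rw [mean_prod_bool]
      rw [← mean_const (A := κ) ((ℓ (X j w) - ℓ (X k w)) ^ 2 + r ^ 2 * K2)]
      refine mean_mono fun i => ?_
      rw [← hX, hex, hex]
      simpa [sub_eq_add_neg] using (hmom w i).1
    · rw [drawMean_walk_succ a₀ (eulerStep b σ t₀ r) x₀ hj
        (fun w x => (ℓ x - ℓ (X k w)) ^ 4) (hpast 4)]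
      have e : r ^ 2 * K4 * (drawMean a₀ N (fun w => (ℓ (X j w) - ℓ (X k w)) ^ 2) + r ^ 2) =
          drawMean a₀ N (fun w => r ^ 2 * K4 * ((ℓ (X j w) - ℓ (X k w)) ^ 2 + r ^ 2)) := by
        rw [drawMean_const_mul, drawMean_add, drawMean_const]
      rw [e, ← drawMean_add]
      refine drawMean_mono a₀ N fun w => ?_
      rw [mean_prod_bool]
      rw [← mean_const (A := κ) ((ℓ (X j w) - ℓ (X k w)) ^ 4 +
        r ^ 2 * K4 * ((ℓ (X j w) - ℓ (X k w)) ^ 2 + r ^ 2))]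
      refine mean_mono fun i => ?_
      rw [← hX, hex, hex]
      simpa [sub_eq_add_neg] using (hmom w i).2
  have main : ∀ n, k + n ≤ N →
      drawMean a₀ N (fun w => (ℓ (X (k + n) w) - ℓ (X k w)) ^ 2) ≤ K2 * (n * r ^ 2) ∧
      drawMean a₀ N (fun w => (ℓ (X (k + n) w) - ℓ (X k w)) ^ 4) ≤
        K4 * (K2 + 1) * (n * r ^ 2) ^ 2 := by
    intro n
    induction n with
    | zero =>
      intro _
      simp [drawMean_const]
    | succ n ih =>
      intro hn
      obtain ⟨i2, i4⟩ := ih (by omega)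
      obtain ⟨s2, s4⟩ := step (k + n) (by omega) (by omega)
      rw [← add_assoc]
      push_cast
      refine ⟨s2.trans (by linarith), s4.trans ?_⟩
      have hr4 : 0 ≤ r ^ 2 * K4 := by positivity
      generalize drawMean a₀ N (fun w => (ℓ (X (k + n) w) - ℓ (X k w)) ^ 2) = E2 at i2 ⊢
      generalize drawMean a₀ N (fun w => (ℓ (X (k + n) w) - ℓ (X k w)) ^ 4) = E4 at i4 ⊢
      have i2' : E2 + r ^ 2 ≤ K2 * (n * r ^ 2) + r ^ 2 := by linarith
      have := mul_le_mul_of_nonneg_left i2' hr4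
      have hn0 : (0 : ℝ) ≤ n := by positivity
      have e : 0 ≤ K4 * r ^ 4 * (K2 * n + K2 + 2 * n) := by positivity
      clear_value K2 K4
      linarith
  obtain ⟨m2, m4⟩ := main n hkn
  have p1 : 0 ≤ K4 * (K2 + 1) * (n * r ^ 2) := by positivity
  have p2 : 0 ≤ K2 * (n * r ^ 2) ^ 2 := by positivity
  exact ⟨m2.trans (by linarith), m4.trans (by linarith)⟩

/-- The norm of a vector is controlled by finitely many linear functionals. -/
theorem exists_functionals [FiniteDimensional ℝ E] : ∃ (d : ℕ) (ℓ : Fin d → E →L[ℝ] ℝ)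
    (e : Fin d → E), (∀ x, x = ∑ i, ℓ i x • e i) ∧
    ∃ K, 0 ≤ K ∧ ∀ x, ‖x‖ ^ 2 ≤ K * ∑ i, (ℓ i x) ^ 2 ∧ ‖x‖ ^ 4 ≤ K * ∑ i, (ℓ i x) ^ 4 := by
  let B := Module.finBasis ℝ E
  set d := Module.finrank ℝ E
  let ℓ : Fin d → E →L[ℝ] ℝ := fun i => LinearMap.toContinuousLinearMap (B.coord i)
  have hx : ∀ x, x = ∑ i, ℓ i x • B i := fun x => (B.sum_repr x).symm
  refine ⟨d, ℓ, B, hx, ?_⟩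
  set K : ℝ := ∑ i, ‖B i‖ ^ 2
  have h2 : ∀ x, ‖x‖ ^ 2 ≤ K * ∑ i, (ℓ i x) ^ 2 := by
    intro x
    have h1 : ‖x‖ ≤ ∑ i, ‖B i‖ * |ℓ i x| := by
      conv_lhs => rw [hx x]
      refine (norm_sum_le _ _).trans (Finset.sum_le_sum fun i _ => ?_)
      rw [norm_smul, mul_comm, Real.norm_eq_abs]
    calc ‖x‖ ^ 2 ≤ (∑ i, ‖B i‖ * |ℓ i x|) ^ 2 := by gcongr
      _ ≤ (∑ i, ‖B i‖ ^ 2) * ∑ i, |ℓ i x| ^ 2 := Finset.sum_mul_sq_le_sq_mul_sq _ _ _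
      _ = _ := by simp [K]
  have hK : 0 ≤ K := by positivity
  refine ⟨K + K ^ 2 * d, by positivity, fun x => ⟨(h2 x).trans ?_, ?_⟩⟩
  · gcongr
    have : 0 ≤ K ^ 2 * d := by positivity
    linarith
  · have h4 : (∑ i, (ℓ i x) ^ 2) ^ 2 ≤ d * ∑ i, (ℓ i x) ^ 4 := by
      have := sq_sum_le_card_mul_sum_sq (s := Finset.univ) (f := fun i => (ℓ i x) ^ 2)
      simpa [← pow_mul] using this
    have h0 : 0 ≤ ∑ i, (ℓ i x) ^ 4 := Finset.sum_nonneg fun i _ => by positivity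
    calc ‖x‖ ^ 4 = (‖x‖ ^ 2) ^ 2 := by ring
      _ ≤ (K * ∑ i, (ℓ i x) ^ 2) ^ 2 := by gcongr; exact h2 x
      _ = K ^ 2 * (∑ i, (ℓ i x) ^ 2) ^ 2 := by ring
      _ ≤ K ^ 2 * (d * ∑ i, (ℓ i x) ^ 4) := by gcongr
      _ ≤ _ := by nlinarith

theorem BoundedCoeff.exists_moments [Nonempty κ] [FiniteDimensional ℝ E]
    (h : BoundedCoeff b σ R C) (hx : ‖x₀‖ ≤ R) (t₀ : ℝ) (a₀ : κ × Bool) :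
    ∃ K, 0 ≤ K ∧ ∀ r : ℝ, 0 ≤ r → r ≤ 1 → ∀ N k n : ℕ, k + n ≤ N →
      drawMean a₀ N (fun w => ‖walk (eulerStep b σ t₀ r) x₀ (k + n) w -
        walk (eulerStep b σ t₀ r) x₀ k w‖ ^ 2) ≤ K * (n * r ^ 2) ∧
      drawMean a₀ N (fun w => ‖walk (eulerStep b σ t₀ r) x₀ (k + n) w -
        walk (eulerStep b σ t₀ r) x₀ k w‖ ^ 4) ≤ K * (n * r ^ 2) ^ 2 := by
  obtain ⟨d, ℓ, e, -, K, hK0, hK⟩ := exists_functionals (E := E)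
  choose K' hK'0 hK' using fun i => h.exists_moments_functional hx t₀ a₀ (ℓ i)
  refine ⟨K * ∑ i, K' i, mul_nonneg hK0 (Finset.sum_nonneg fun i _ => hK'0 i),
    fun r hr0 hr1 N k n hkn => ⟨?_, ?_⟩⟩
  · refine (drawMean_mono a₀ N fun w => (hK _).1).trans ?_
    rw [drawMean_const_mul, drawMean_sum, mul_assoc, Finset.sum_mul]
    refine mul_le_mul_of_nonneg_left (Finset.sum_le_sum fun i _ => ?_) hK0
    simpa only [map_sub] using (hK' i r hr0 hr1 N k n hkn).1
  · refine (drawMean_mono a₀ N fun w => (hK _).2).trans ?_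
    rw [drawMean_const_mul, drawMean_sum, mul_assoc, Finset.sum_mul]
    refine mul_le_mul_of_nonneg_left (Finset.sum_le_sum fun i _ => ?_) hK0
    simpa only [map_sub] using (hK' i r hr0 hr1 N k n hkn).2

open scoped Classical in
/-- The local martingale problem of the scheme: over a time `T = n r²`, conditionally on the past,
the function `f` grows by `T` times its generator, up to `O(√T³ + r T)`. -/
theorem BoundedCoeff.exists_increment_bound [Nonempty κ] [FiniteDimensional ℝ E]
    (h : BoundedCoeff b σ R C) (hx : ‖x₀‖ ≤ R) (t₀ : ℝ) (a₀ : κ × Bool) {f : ℝ × E → ℝ}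
    (hf : ContDiff ℝ ∞ f) {Lg : ℝ} (hLg : 0 ≤ Lg)
    (hg : ∀ t ∈ Icc t₀ (t₀ + 1), ∀ t' ∈ Icc t₀ (t₀ + 1), ∀ x x' : E, ‖x‖ ≤ safeRadius κ R C →
      ‖x'‖ ≤ safeRadius κ R C →
      |eulerGen b σ f (t, x) - eulerGen b σ f (t', x')| ≤ Lg * (|t - t'| + ‖x - x'‖)) :
    ∃ K, 0 ≤ K ∧ ∀ r : ℝ, 0 ≤ r → r ≤ 1 → ∀ N : ℕ, N * r ^ 2 ≤ 1 → ∀ k n : ℕ, k + n ≤ N →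
      ∀ G : (ℕ → κ × Bool) → ℝ, (∀ w, |G w| ≤ 1) →
      (∀ w j a, k ≤ j → G (Function.update w j a) = G w) →
      |drawMean a₀ N (fun w => G w *
        (f (t₀ + (k + n : ℕ) * r ^ 2, walk (eulerStep b σ t₀ r) x₀ (k + n) w) -
          f (t₀ + k * r ^ 2, walk (eulerStep b σ t₀ r) x₀ k w) -
          n * r ^ 2 * eulerGen b σ f (t₀ + k * r ^ 2, walk (eulerStep b σ t₀ r) x₀ k w)))| ≤
        K * (n * r ^ 2) * (r + √(n * r ^ 2)) := by
  obtain ⟨K₁, hK₁0, hK₁⟩ := h.exists_consistency t₀ hf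
  obtain ⟨K₂, hK₂0, hK₂⟩ := h.exists_moments hx t₀ a₀
  refine ⟨K₁ + Lg * (2 + K₂), by positivity, fun r hr0 hr1 N hN k n hkn G hG hGp => ?_⟩
  set X := walk (eulerStep b σ t₀ r) x₀ with hX
  set F : ℕ → (ℕ → κ × Bool) → ℝ := fun j w => f (t₀ + j * r ^ 2, X j w) with hF
  set g : ℕ → (ℕ → κ × Bool) → ℝ := fun j w => eulerGen b σ f (t₀ + j * r ^ 2, X j w) with hgd
  have hr2 : 0 ≤ r ^ 2 := by positivity
  have htime : ∀ j : ℕ, j ≤ N → (j : ℝ) * r ^ 2 ≤ 1 := by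
    intro j hj
    have : (j : ℝ) ≤ N := by exact_mod_cast hj
    nlinarith
  have hXn : ∀ j w, ‖X j w‖ ≤ safeRadius κ R C := fun j w => h.norm_walk_le t₀ hr0 hr1 hx j w
  have step : ∀ i, i < n → |drawMean a₀ N (fun w => G w *
      (F (k + i + 1) w - F (k + i) w - r ^ 2 * g k w))| ≤
        K₁ * r ^ 3 + r ^ 2 * (Lg * (2 + K₂) * √(n * r ^ 2)) := by
    intro i hi
    have hjN : k + i < N := by omega
    set T : ℝ := n * r ^ 2 with hT
    have e1 : drawMean a₀ N (fun w => G w * F (k + i + 1) w) = drawMean a₀ N (fun w =>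
        G w * mean fun a => f (t₀ + (k + i + 1 : ℕ) * r ^ 2,
          eulerStep b σ t₀ r (k + i) (X (k + i) w) a)) := by
      rw [drawMean_walk_succ a₀ (eulerStep b σ t₀ r) x₀ hjN
        (fun w x => G w * f (t₀ + (k + i + 1 : ℕ) * r ^ 2, x))
        (fun w a => by rw [hGp w _ a (by omega)])]
      simp only [mean_const_mul]
      rfl
    have e2 : drawMean a₀ N (fun w => G w * (F (k + i + 1) w - F (k + i) w - r ^ 2 * g k w)) =
        drawMean a₀ N (fun w => G w * ((mean fun a => f (t₀ + (k + i + 1 : ℕ) * r ^ 2,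
          eulerStep b σ t₀ r (k + i) (X (k + i) w) a)) - F (k + i) w - r ^ 2 * g (k + i) w) +
          r ^ 2 * (G w * (g (k + i) w - g k w))) := by
      have : ∀ w, G w * (F (k + i + 1) w - F (k + i) w - r ^ 2 * g k w) =
          G w * F (k + i + 1) w - G w * (F (k + i) w + r ^ 2 * g k w) := fun w => by ring
      simp only [this]
      rw [drawMean_sub, e1, ← drawMean_sub]
      congr 1
      funext w
      ring
    rw [e2, drawMean_add, drawMean_const_mul]
    refine (abs_add_le _ _).trans (add_le_add ?_ ?_)
    · refine (abs_drawMean_le _ _ _).trans ?_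
      rw [← drawMean_const a₀ N (K₁ * r ^ 3)]
      refine drawMean_mono a₀ N fun w => ?_
      rw [abs_mul]
      have := hK₁ r hr0 hr1 (k + i) (htime _ hjN.le) (X (k + i) w) (hXn _ _)
      calc |G w| * _ ≤ 1 * (K₁ * r ^ 3) :=
            mul_le_mul (hG w) this (abs_nonneg _) zero_le_one
        _ = _ := one_mul _
    · rw [abs_mul, abs_of_nonneg hr2]
      refine mul_le_mul_of_nonneg_left ?_ hr2
      refine (abs_drawMean_le _ _ _).trans ?_
      have hT1 : T ≤ 1 := htime n (by omega)
      have hT0 : 0 ≤ T := by positivity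
      have hiT : i * r ^ 2 ≤ T := by
        have : (i : ℝ) ≤ n := by exact_mod_cast hi.le
        exact mul_le_mul_of_nonneg_right this hr2
      -- `‖v‖ ≤ √T + ‖v‖² / √T`, so that the second moment controls the first
      rcases hT0.eq_or_lt with hT0 | hT0
      · have hr : r ^ 2 = 0 := by
          rcases mul_eq_zero.1 (hT0.symm : (n : ℝ) * r ^ 2 = 0) with h | h
          · have : n = 0 := by exact_mod_cast h
            omega
          · exact h
        have hr : r = 0 := by simpa using hr
        have hsame : ∀ w, X (k + i) w = X k w := by
          intro w
          clear e1 e2 hjN hiT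
          induction i with
          | zero => rfl
          | succ i ih =>
            rw [← ih (by omega), ← add_assoc, hX]
            simp [walk, eulerStep, hr]
        have : ∀ w, |G w * (g (k + i) w - g k w)| = 0 := by
          intro w
          simp [hgd, hsame, hr]
        simp only [this, drawMean_const]
        positivity
      · set q := √T with hq
        have hq0 : 0 < q := Real.sqrt_pos.2 hT0
        have hqq : q * q = T := Real.mul_self_sqrt hT0.le
        have hTq : T ≤ q := by nlinarith [Real.sqrt_le_one.2 hT1]
        have hpt : ∀ w, |G w * (g (k + i) w - g k w)| ≤
            Lg * (2 * q) + Lg / q * ‖X (k + i) w - X k w‖ ^ 2 := by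
          intro w
          rw [abs_mul]
          have m1 : t₀ + (k + i : ℕ) * r ^ 2 ∈ Icc t₀ (t₀ + 1) :=
            ⟨by have : 0 ≤ ((k + i : ℕ) : ℝ) * r ^ 2 := by positivity
                linarith, by linarith [htime (k + i) hjN.le]⟩
          have m2 : t₀ + k * r ^ 2 ∈ Icc t₀ (t₀ + 1) :=
            ⟨by have : 0 ≤ (k : ℝ) * r ^ 2 := by positivity
                linarith, by linarith [htime k (by omega)]⟩
          have b1 := hg _ m1 _ m2 _ _ (hXn (k + i) w) (hXn k w)
          have b2 : |t₀ + (k + i : ℕ) * r ^ 2 - (t₀ + k * r ^ 2)| ≤ q := by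
            have : t₀ + (k + i : ℕ) * r ^ 2 - (t₀ + k * r ^ 2) = i * r ^ 2 := by push_cast; ring
            rw [this, abs_of_nonneg (by positivity)]
            linarith
          set v := ‖X (k + i) w - X k w‖
          have b3 : v ≤ q + v ^ 2 / q := by
            have : v * q ≤ q * q + v ^ 2 := by nlinarith [sq_nonneg (v - q)]
            rw [← mul_le_mul_iff_left₀ hq0, add_mul, div_mul_cancel₀ _ hq0.ne']
            linarith
          calc |G w| * |g (k + i) w - g k w| ≤ 1 * (Lg * (q + (q + v ^ 2 / q))) := by
                refine mul_le_mul (hG w) (b1.trans ?_) (abs_nonneg _) zero_le_one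
                exact mul_le_mul_of_nonneg_left (add_le_add b2 b3) hLg
            _ = _ := by ring
        refine (drawMean_mono a₀ N hpt).trans ?_
        rw [drawMean_add, drawMean_const, drawMean_const_mul]
        have b4 := (hK₂ r hr0 hr1 N k i (by omega)).1
        have b5 : Lg / q * drawMean a₀ N (fun w => ‖X (k + i) w - X k w‖ ^ 2) ≤
            Lg / q * (K₂ * T) :=
          mul_le_mul_of_nonneg_left (b4.trans (mul_le_mul_of_nonneg_left hiT hK₂0))
            (by positivity)
        have b6 : Lg / q * (K₂ * T) = Lg * K₂ * q := by
          rw [← hqq]; field_simp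
        rw [b6] at b5
        linarith
  have htel : ∀ w, G w * (F (k + n) w - F k w - n * r ^ 2 * g k w) =
      ∑ i ∈ Finset.range n, G w * (F (k + i + 1) w - F (k + i) w - r ^ 2 * g k w) := by
    intro w
    rw [← Finset.mul_sum, Finset.sum_sub_distrib,
      show ∑ i ∈ Finset.range n, (F (k + i + 1) w - F (k + i) w) = F (k + n) w - F k w from
        Finset.sum_range_sub (fun i => F (k + i) w) n, Finset.sum_const, Finset.card_range,
      nsmul_eq_mul, mul_assoc]
  have : |drawMean a₀ N (fun w => G w * (F (k + n) w - F k w - n * r ^ 2 * g k w))| ≤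
      n * (K₁ * r ^ 3 + r ^ 2 * (Lg * (2 + K₂) * √(n * r ^ 2))) := by
    simp only [htel]
    rw [drawMean_sum]
    refine (Finset.abs_sum_le_sum_abs _ _).trans ?_
    refine (Finset.sum_le_sum fun i hi => step i (Finset.mem_range.1 hi)).trans ?_
    rw [Finset.sum_const, Finset.card_range, nsmul_eq_mul]
  refine this.trans ?_
  have p1 : 0 ≤ K₁ * (n * r ^ 2) * √(n * r ^ 2) := by positivity
  have p2 : 0 ≤ Lg * (2 + K₂) * (n * r ^ 2) * r := by positivity
  linarith

end Euler

end StochHam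

namespace StochHam

/-! ### The weak limit of the Euler schemes along rational times -/

section WeakLimit

universe u

variable {E : Type*} [NormedAddCommGroup E] [NormedSpace ℝ E] [FiniteDimensional ℝ E]
  [MeasurableSpace E] [BorelSpace E]

/-- Compactness: uniformly bounded random paths on `ℚ` have a limit in law. The coordinates of the
paths live in a compact product of intervals, on which probability measures form a compact space. -/
theorem exists_weak_limit {A : Type*} [Fintype A] [Nonempty A] (a₀ : A) {ρ : ℝ}
    (path : ℕ → (ℕ → A) → ℚ → E) (hρ : ∀ N w q, ‖path N w q‖ ≤ ρ) :
    ∃ (Ω : Type u) (_ : MeasurableSpace Ω) (P : Measure Ω) (_ : IsProbabilityMeasure P)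
      (Y : ℚ → Ω → E) (𝒰 : Ultrafilter ℕ) (ρ' : ℝ), (𝒰 : Filter ℕ) ≤ atTop ∧
      (∀ q, Measurable (Y q)) ∧ (∀ q w, ‖Y q w‖ ≤ ρ') ∧
      ∀ F : (ℚ → E) → ℝ, Continuous F →
        Integrable (fun w => F fun q => Y q w) P ∧
        Tendsto (fun N => drawMean a₀ N fun w => F (path N w)) 𝒰
          (𝓝 (∫ w, F (fun q => Y q w) ∂P)) := by
  obtain ⟨d, ℓ, e, hx, -⟩ := exists_functionals (E := E)
  have hρ0 : 0 ≤ ρ := (norm_nonneg _).trans (hρ 0 (fun _ => a₀) 0)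
  set B : ℝ := ∑ i, ‖ℓ i‖ * ρ with hB
  have hB0 : 0 ≤ B := Finset.sum_nonneg fun i _ => by positivity
  let 𝒦 : Type := ℚ × Fin d → Icc (-B) B
  have hmem : ∀ N w q i, ℓ i (path N w q) ∈ Icc (-B) B := by
    intro N w q i
    refine abs_le.1 ?_
    refine ((ℓ i).le_opNorm _).trans ?_
    refine (mul_le_mul_of_nonneg_left (hρ N w q) (norm_nonneg _)).trans ?_
    exact Finset.single_le_sum (f := fun i => ‖ℓ i‖ * ρ) (fun i _ => by positivity)
      (Finset.mem_univ i)
  let enc : ℕ → (ℕ → A) → 𝒦 := fun N w qi => ⟨ℓ qi.2 (path N w qi.1), hmem _ _ _ _⟩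
  let dec : 𝒦 → ℚ → E := fun y q => ∑ i, (y (q, i) : ℝ) • e i
  have hdec : Continuous dec := by
    refine continuous_pi fun q => continuous_finsetSum _ fun i _ => ?_
    exact (continuous_subtype_val.comp (continuous_apply (q, i))).smul continuous_const
  have hde : ∀ N w, dec (enc N w) = path N w := by
    intro N w
    funext q
    exact (hx (path N w q)).symm
  choose ι hι p ν hp0 hp1 hp using fun N => drawMean_eq_sum a₀ N
  let μ : ℕ → Measure 𝒦 := fun N =>
    ∑ i, ENNReal.ofReal (p N i) • Measure.dirac (enc N (ν N i))
  have hμ : ∀ N, IsProbabilityMeasure (μ N) := by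
    intro N
    constructor
    simp only [μ, Measure.coe_finsetSum, Measure.coe_smul, Finset.sum_apply, Pi.smul_apply,
      measure_univ, smul_eq_mul, mul_one]
    rw [← ENNReal.ofReal_sum_of_nonneg fun i _ => hp0 N i, hp1, ENNReal.ofReal_one]
  have hint : ∀ N (F : 𝒦 → ℝ), Continuous F →
      ∫ y, F y ∂(μ N) = drawMean a₀ N fun w => F (enc N w) := by
    intro N F hF
    simp only [μ]
    rw [integral_finsetSum_measure, hp]
    · refine Finset.sum_congr rfl fun i _ => ?_
      rw [integral_smul_measure, integral_dirac, ENNReal.toReal_ofReal (hp0 N i), smul_eq_mul]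
    · intro i _
      refine (integrable_dirac ?_).smul_measure ENNReal.ofReal_ne_top
      simp
  let μ' : ℕ → ProbabilityMeasure 𝒦 := fun N => ⟨μ N, hμ N⟩
  let 𝒰 : Ultrafilter ℕ := Filter.hyperfilter ℕ
  have h𝒰 : (𝒰 : Filter ℕ) ≤ atTop := Nat.hyperfilter_le_atTop
  obtain ⟨Q, -, hQ⟩ := isCompact_univ.ultrafilter_le_nhds (𝒰.map μ') (by simp)
  have hQ' : Tendsto μ' 𝒰 (𝓝 Q) := hQ
  have hup : Measurable (ULift.up.{u} : 𝒦 → ULift.{u} 𝒦) := measurable_up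
  refine ⟨ULift.{u} 𝒦, inferInstance, (Q : Measure 𝒦).map ULift.up,
    Measure.isProbabilityMeasure_map hup.aemeasurable, fun q y => dec y.down q, 𝒰,
    ∑ i, B * ‖e i‖, h𝒰, fun q => ?_, fun q w => ?_, fun F hF => ?_⟩
  · exact ((continuous_apply q).comp hdec).measurable.comp measurable_down
  · refine (norm_sum_le _ _).trans (Finset.sum_le_sum fun i _ => ?_)
    rw [norm_smul, Real.norm_eq_abs]
    exact mul_le_mul_of_nonneg_right (abs_le.2 (w.down (q, i)).2) (norm_nonneg _)
  · have hFd : Continuous (fun y : 𝒦 => F (dec y)) := hF.comp hdec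
    let Fb : BoundedContinuousFunction 𝒦 ℝ := BoundedContinuousFunction.mkOfCompact ⟨_, hFd⟩
    have hm : Measurable fun y : ULift.{u} 𝒦 => F (dec y.down) :=
      hFd.measurable.comp measurable_down
    have h := (ProbabilityMeasure.tendsto_iff_forall_integral_tendsto.1 hQ') Fb
    constructor
    · rw [integrable_map_measure hm.aestronglyMeasurable hup.aemeasurable]
      exact Fb.integrable (Q : Measure 𝒦)
    · rw [integral_map hup.aemeasurable hm.aestronglyMeasurable]
      refine h.congr fun N => ?_
      have e1 : ∫ y, Fb y ∂(μ' N : Measure 𝒦) = drawMean a₀ N fun w => F (dec (enc N w)) :=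
        hint N _ hFd
      rw [e1]
      simp only [hde]

/-- A function of the path that depends on the values up to time `s` only. -/
def DependsUpTo (s : ℚ) (G : (ℚ → E) → ℝ) : Prop :=
  ∀ y y' : ℚ → E, (∀ q ≤ s, y q = y' q) → G y = G y'

variable {κ : Type*} [Fintype κ] [Nonempty κ] {b : ℝ × E → E} {σ : κ → ℝ × E → E} {R C : ℝ}
  {x₀ : E}

/-- The number of steps of length `1 / N` made up to time `q`; the scheme rests after time `1`. -/
def stepCount (N : ℕ) (q : ℚ) : ℕ := min ⌊q * N⌋₊ N


theorem stepCount_mono (N : ℕ) {q q' : ℚ} (h : q ≤ q') : stepCount N q ≤ stepCount N q' :=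
  min_le_min_right _ (Nat.floor_mono (mul_le_mul_of_nonneg_right h (by positivity)))

theorem stepCount_of_nonpos (N : ℕ) {q : ℚ} (h : q ≤ 0) : stepCount N q = 0 := by
  have : q * N ≤ 0 := mul_nonpos_of_nonpos_of_nonneg h (by positivity)
  simp [stepCount, Nat.floor_of_nonpos this]

theorem abs_stepCount_div_sub_le {N : ℕ} (hN : 0 < N) {q : ℚ} (h0 : 0 ≤ q) (h1 : q ≤ 1) :
    |(stepCount N q : ℝ) * (1 / N) - q| ≤ 1 / N := by
  have hN' : (0 : ℚ) < N := by exact_mod_cast hN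
  have hle : q * N ≤ N := by nlinarith
  have hf : stepCount N q = ⌊q * N⌋₊ := by
    refine min_eq_left ?_
    have := Nat.floor_mono hle
    simpa using this
  have f1 : ((⌊q * N⌋₊ : ℕ) : ℚ) ≤ q * N := Nat.floor_le (by positivity)
  have f2 : q * N < ⌊q * N⌋₊ + 1 := Nat.lt_floor_add_one _
  rw [hf]
  have key : |(⌊q * N⌋₊ : ℚ) * (1 / N) - q| ≤ 1 / N := by
    rw [abs_le]
    constructor
    · rw [← sub_nonneg]
      have : (⌊q * N⌋₊ : ℚ) * (1 / N) - q - -(1 / N) = (⌊q * N⌋₊ + 1 - q * N) / N := by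
        field_simp; ring
      rw [this]
      exact div_nonneg (by linarith) hN'.le
    · rw [← sub_nonneg]
      have : (1 : ℚ) / N - ((⌊q * N⌋₊ : ℚ) * (1 / N) - q) = (1 + q * N - ⌊q * N⌋₊) / N := by
        field_simp; ring
      rw [this]
      exact div_nonneg (by linarith) hN'.le
  have key' := (Rat.cast_le (K := ℝ)).2 key
  push_cast at key'
  exact key'

/-- The limit process on rational times: it starts at `x₀`, has Hölder moments, and solves the
martingale problem locally, up to `O((t - s)^{3/2})`. -/
structure RationalSolution {Ω : Type*} [MeasurableSpace Ω] (P : Measure Ω) (b : ℝ × E → E)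
    (σ : κ → ℝ × E → E) (t₀ : ℝ) (x₀ : E) (Y : ℚ → Ω → E) : Prop where
  measurable : ∀ q, Measurable (Y q)
  bounded : ∃ ρ, ∀ q w, ‖Y q w‖ ≤ ρ
  start : ∀ q ≤ 0, ∀ᵐ w ∂P, Y q w = x₀
  moment : ∃ K, 0 ≤ K ∧ ∀ s t : ℚ, 0 ≤ s → s ≤ t → t ≤ 1 →
    ∫ w, ‖Y t w - Y s w‖ ^ 4 ∂P ≤ K * (t - s) ^ 2
  martingale : ∀ f : ℝ × E → ℝ, ContDiff ℝ ∞ f → ∃ K, 0 ≤ K ∧ ∀ s t : ℚ, 0 ≤ s → s ≤ t → t ≤ 1 →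
    ∀ G : (ℚ → E) → ℝ, Continuous G → (∀ y, |G y| ≤ 1) → DependsUpTo s G →
    |∫ w, G (fun q => Y q w) * (f (t₀ + t, Y t w) - f (t₀ + s, Y s w) -
      (t - s) * eulerGen b σ f (t₀ + s, Y s w)) ∂P| ≤ K * ((t - s) * √(t - s))

theorem BoundedCoeff.exists_rationalSolution (h : BoundedCoeff b σ R C) (hx : ‖x₀‖ ≤ R) (t₀ : ℝ)
    (hgen : ∀ f : ℝ × E → ℝ, ContDiff ℝ ∞ f → ContDiff ℝ 1 (eulerGen b σ f)) :
    ∃ (Ω : Type u) (_ : MeasurableSpace Ω) (P : Measure Ω) (_ : IsProbabilityMeasure P)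
      (Y : ℚ → Ω → E), RationalSolution P b σ t₀ x₀ Y := by
  classical
  obtain ⟨i₀⟩ := ‹Nonempty κ›
  set a₀ : κ × Bool := (i₀, true) with ha₀
  have : Nonempty κ := ⟨i₀⟩
  let r : ℕ → ℝ := fun N => √(1 / N)
  have hr0 : ∀ N, 0 ≤ r N := fun N => Real.sqrt_nonneg _
  have hr2 : ∀ N, r N ^ 2 = 1 / N := fun N => Real.sq_sqrt (by positivity)
  have hr1 : ∀ N, r N ≤ 1 := by
    intro N
    refine Real.sqrt_le_one.2 ?_
    rcases Nat.eq_zero_or_pos N with rfl | hN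
    · simp
    · rw [div_le_one (by exact_mod_cast hN)]
      exact_mod_cast hN
  have hNr : ∀ N : ℕ, N * r N ^ 2 ≤ 1 := by
    intro N
    rw [hr2]
    rcases Nat.eq_zero_or_pos N with rfl | hN
    · simp
    · rw [mul_one_div_cancel (by positivity)]
  let X : (N : ℕ) → ℕ → (ℕ → κ × Bool) → E := fun N => walk (eulerStep b σ t₀ (r N)) x₀
  have hXn : ∀ N k w, ‖X N k w‖ ≤ safeRadius κ R C :=
    fun N k w => h.norm_walk_le t₀ (hr0 N) (hr1 N) hx k w
  let path : ℕ → (ℕ → κ × Bool) → ℚ → E := fun N w q => X N (stepCount N q) w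
  obtain ⟨Ω, mΩ, P, hP, Y, 𝒰, ρ', h𝒰, hYm, hYb, hlim⟩ :=
    exists_weak_limit.{u} a₀ path (fun N w q => hXn _ _ _)
  have hlim0 : Tendsto (fun N : ℕ => (1 : ℝ) / N) 𝒰 (𝓝 0) :=
    tendsto_one_div_atTop_nhds_zero_nat.mono_left h𝒰
  have hpos : ∀ᶠ N : ℕ in 𝒰, 0 < N := h𝒰 (eventually_gt_atTop 0)
  -- the number of steps between two times, and its limit
  have hT : ∀ s t : ℚ, 0 ≤ s → s ≤ t → t ≤ 1 → Tendsto (fun N : ℕ =>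
      ((stepCount N t - stepCount N s : ℕ) : ℝ) * r N ^ 2) 𝒰 (𝓝 ((t : ℝ) - s)) := by
    intro s t hs hst ht
    rw [tendsto_iff_dist_tendsto_zero]
    refine squeeze_zero' (Eventually.of_forall fun N => dist_nonneg) ?_
      (by simpa only [mul_zero] using hlim0.const_mul 2)
    filter_upwards [hpos] with N hN
    have q1 := abs_stepCount_div_sub_le hN (hs.trans hst) ht
    have q2 := abs_stepCount_div_sub_le hN hs (hst.trans ht)
    rw [Real.dist_eq, hr2, Nat.cast_sub (stepCount_mono N hst)]
    rw [abs_le] at q1 q2 ⊢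
    constructor <;> linarith [q1.1, q1.2, q2.1, q2.2]
  refine ⟨Ω, mΩ, P, hP, Y, hYm, ⟨ρ', hYb⟩, ?_, ?_, ?_⟩
  · intro q hq
    obtain ⟨hi, hl⟩ := hlim (fun y => ‖y q - x₀‖) (by fun_prop)
    have hz : ∀ N, drawMean a₀ N (fun w => ‖path N w q - x₀‖) = 0 := by
      intro N
      have : ∀ w, ‖path N w q - x₀‖ = 0 := by
        intro w
        simp [path, stepCount_of_nonpos N hq, X, walk]
      simp only [this, drawMean_const]
    simp only [hz] at hl
    have h0 := tendsto_nhds_unique hl tendsto_const_nhds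
    have := (integral_eq_zero_iff_of_nonneg (fun w => norm_nonneg _) hi).1 h0
    filter_upwards [this] with w hw
    simpa [sub_eq_zero] using hw
  · obtain ⟨K, hK0, hK⟩ := h.exists_moments hx t₀ a₀
    refine ⟨K, hK0, fun s t hs hst ht => ?_⟩
    obtain ⟨-, hl⟩ := hlim (fun y => ‖y t - y s‖ ^ 4) (by fun_prop)
    refine le_of_tendsto_of_tendsto hl (((hT s t hs hst ht).pow 2).const_mul K)
      (Eventually.of_forall fun N => ?_)
    have hle : stepCount N s + (stepCount N t - stepCount N s) = stepCount N t :=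
      Nat.add_sub_cancel' (stepCount_mono N hst)
    have := (hK (r N) (hr0 N) (hr1 N) N (stepCount N s) (stepCount N t - stepCount N s)
      (by rw [hle]; exact min_le_right _ _)).2
    rw [hle] at this
    exact this
  · intro f hf
    have hSK : IsCompact (Icc t₀ (t₀ + 1) ×ˢ Metric.closedBall (0 : E) (safeRadius κ R C)) :=
      isCompact_Icc.prod (isCompact_closedBall _ _)
    have hSc : Convex ℝ (Icc t₀ (t₀ + 1) ×ˢ Metric.closedBall (0 : E) (safeRadius κ R C)) :=
      (convex_Icc _ _).prod (convex_closedBall _ _)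
    have hmS : ∀ t ∈ Icc t₀ (t₀ + 1), ∀ x : E, ‖x‖ ≤ safeRadius κ R C →
        (t, x) ∈ Icc t₀ (t₀ + 1) ×ˢ Metric.closedBall (0 : E) (safeRadius κ R C) :=
      fun t ht x hx => ⟨ht, by simpa using hx⟩
    obtain ⟨Lg, hLg⟩ := ContDiffOn.exists_lipschitzOnWith (hgen f hf).contDiffOn (by simp) hSc hSK
    obtain ⟨Lf, hLf⟩ := ContDiffOn.exists_lipschitzOnWith (hf.contDiffOn (n := ∞)) (by simp)
      hSc hSK
    obtain ⟨Bg, hBg⟩ := hSK.exists_bound_of_continuousOn (hgen f hf).continuous.continuousOn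
    obtain ⟨K, hK0, hK⟩ := h.exists_increment_bound hx t₀ a₀ hf Lg.2
      (fun t ht t' ht' x x' hx hx' => by
        refine (hLg.norm_sub_le (hmS t ht x hx) (hmS t' ht' x' hx')).trans ?_
        refine mul_le_mul_of_nonneg_left ?_ Lg.2
        rw [Prod.norm_def]
        exact max_le (le_add_of_nonneg_right (norm_nonneg _))
          (le_add_of_nonneg_left (abs_nonneg _)))
    refine ⟨K, hK0, fun s t hs hst ht G hG hG1 hGs => ?_⟩
    have hgc := (hgen f hf).continuous
    have hfc := hf.continuous
    obtain ⟨-, hl⟩ := hlim (fun y => G y * (f (t₀ + t, y t) - f (t₀ + s, y s) -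
      (t - s) * eulerGen b σ f (t₀ + s, y s))) (by fun_prop)
    have hrl : Tendsto r 𝒰 (𝓝 0) := by
      have := (Real.continuous_sqrt.tendsto 0).comp hlim0
      rwa [Real.sqrt_zero] at this
    set D : ℝ := 2 * Lf + 2 * Bg + Lg with hD
    have hT' := hT s t hs hst ht
    have hrhs : Tendsto (fun N : ℕ => K * (((stepCount N t - stepCount N s : ℕ) : ℝ) * r N ^ 2) *
        (r N + √(((stepCount N t - stepCount N s : ℕ) : ℝ) * r N ^ 2)) + D * (1 / N)) 𝒰
        (𝓝 (K * ((t - s) * √(t - s)))) := by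
      have := ((hT'.const_mul K).mul (hrl.add ((Real.continuous_sqrt.tendsto _).comp hT'))).add
        (hlim0.const_mul D)
      refine this.trans (le_of_eq ?_)
      congr 1
      ring
    refine le_of_tendsto_of_tendsto hl.abs hrhs ?_
    filter_upwards [hpos] with N hN
    have hle : stepCount N s + (stepCount N t - stepCount N s) = stepCount N t :=
      Nat.add_sub_cancel' (stepCount_mono N hst)
    set T : ℝ := ((stepCount N t - stepCount N s : ℕ) : ℝ) * r N ^ 2 with hTd
    have hT0 : 0 ≤ T := by positivity
    have hT1 : T ≤ 1 := by
      refine le_trans (mul_le_mul_of_nonneg_right ?_ (by positivity)) (hNr N)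
      exact_mod_cast (Nat.sub_le _ _).trans (min_le_right _ _)
    have key := hK (r N) (hr0 N) (hr1 N) N (hNr N) (stepCount N s)
      (stepCount N t - stepCount N s) (by rw [hle]; exact min_le_right _ _)
      (fun w => G (path N w)) (fun w => hG1 _) (fun w j a hj => by
        refine hGs _ _ fun q hq => ?_
        exact walk_update _ _ ((stepCount_mono N hq).trans hj) _ _)
    rw [hle] at key
    have hts : ∀ q : ℚ, 0 ≤ q → q ≤ 1 → |t₀ + stepCount N q * r N ^ 2 - (t₀ + q)| ≤ 1 / N ∧
        t₀ + stepCount N q * r N ^ 2 ∈ Icc t₀ (t₀ + 1) ∧ t₀ + (q : ℝ) ∈ Icc t₀ (t₀ + 1) := by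
      intro q h0 h1
      refine ⟨?_, ⟨?_, ?_⟩, ?_, ?_⟩
      · have := abs_stepCount_div_sub_le hN h0 h1
        rw [hr2, add_sub_add_left_eq_sub]
        exact this
      · have : 0 ≤ (stepCount N q : ℝ) * r N ^ 2 := by positivity
        linarith
      · have : (stepCount N q : ℝ) * r N ^ 2 ≤ N * r N ^ 2 := by
          refine mul_le_mul_of_nonneg_right ?_ (by positivity)
          exact_mod_cast min_le_right _ _
        linarith [hNr N]
      · have : (0 : ℝ) ≤ q := by exact_mod_cast h0
        linarith
      · have : (q : ℝ) ≤ 1 := by exact_mod_cast h1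
        linarith
    obtain ⟨hs1, hs2, hs3⟩ := hts s hs (hst.trans ht)
    obtain ⟨ht1, ht2, ht3⟩ := hts t (hs.trans hst) ht
    have hlipt : ∀ (g : ℝ × E → ℝ) (Lh : NNReal), LipschitzOnWith Lh g
        (Icc t₀ (t₀ + 1) ×ˢ Metric.closedBall (0 : E) (safeRadius κ R C)) →
        ∀ u ∈ Icc t₀ (t₀ + 1), ∀ v ∈ Icc t₀ (t₀ + 1), |u - v| ≤ 1 / N → ∀ x : E,
          ‖x‖ ≤ safeRadius κ R C → |g (u, x) - g (v, x)| ≤ Lh * (1 / N) := by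
      intro g Lh hg u hu v hv huv x hx
      refine (hg.norm_sub_le (hmS u hu x hx) (hmS v hv x hx)).trans ?_
      refine mul_le_mul_of_nonneg_left ?_ Lh.2
      simpa [Prod.norm_def] using huv
    have hdiff : ∀ w, |G (path N w) * (f (t₀ + t, path N w t) - f (t₀ + s, path N w s) -
        (t - s) * eulerGen b σ f (t₀ + s, path N w s)) - G (path N w) *
        (f (t₀ + stepCount N t * r N ^ 2, X N (stepCount N t) w) -
          f (t₀ + stepCount N s * r N ^ 2, X N (stepCount N s) w) -
          T * eulerGen b σ f (t₀ + stepCount N s * r N ^ 2, X N (stepCount N s) w))| ≤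
        D * (1 / N) := by
      intro w
      rw [← mul_sub, abs_mul]
      have d1 := hlipt f Lf hLf _ ht2 _ ht3 ht1 (X N (stepCount N t) w) (hXn _ _ _)
      have d2 := hlipt f Lf hLf _ hs2 _ hs3 hs1 (X N (stepCount N s) w) (hXn _ _ _)
      have d3 := hlipt _ Lg hLg _ hs2 _ hs3 hs1 (X N (stepCount N s) w) (hXn _ _ _)
      have d4 : |eulerGen b σ f (t₀ + s, X N (stepCount N s) w)| ≤ Bg :=
        hBg _ (hmS _ hs3 _ (hXn _ _ _))
      have d5 : |(t - s : ℝ) - T| ≤ 2 * (1 / N) := by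
        have : (t - s : ℝ) - T = (t₀ + stepCount N s * r N ^ 2 - (t₀ + s)) -
            (t₀ + stepCount N t * r N ^ 2 - (t₀ + t)) := by
          rw [hTd, Nat.cast_sub (stepCount_mono N hst)]
          ring
        rw [this]
        exact (abs_sub _ _).trans (by linarith)
      set gs := eulerGen b σ f (t₀ + s, X N (stepCount N s) w)
      set gk := eulerGen b σ f (t₀ + stepCount N s * r N ^ 2, X N (stepCount N s) w)
      have d6 : |T * (gk - gs)| ≤ Lg * (1 / N) := by
        rw [abs_mul, abs_of_nonneg hT0]
        calc T * |gk - gs| ≤ 1 * (Lg * (1 / N)) :=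
              mul_le_mul hT1 d3 (abs_nonneg _) zero_le_one
          _ = _ := one_mul _
      have d7 : |((t - s : ℝ) - T) * gs| ≤ 2 * (1 / N) * Bg := by
        rw [abs_mul]
        exact mul_le_mul d5 d4 (abs_nonneg _) (by positivity)
      have hb : |(f (t₀ + t, X N (stepCount N t) w) - f (t₀ + s, X N (stepCount N s) w) -
          (t - s) * gs) - (f (t₀ + stepCount N t * r N ^ 2, X N (stepCount N t) w) -
          f (t₀ + stepCount N s * r N ^ 2, X N (stepCount N s) w) - T * gk)| ≤ D * (1 / N) := by
        rw [abs_le] at d1 d2 d6 d7 ⊢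
        constructor <;> nlinarith [d1.1, d1.2, d2.1, d2.2, d6.1, d6.2, d7.1, d7.2]
      calc _ ≤ 1 * (D * (1 / N)) := mul_le_mul (hG1 _) hb (abs_nonneg _) zero_le_one
        _ = _ := one_mul _
    have hd := abs_drawMean_le a₀ N (fun w => G (path N w) * (f (t₀ + t, path N w t) -
        f (t₀ + s, path N w s) - (t - s) * eulerGen b σ f (t₀ + s, path N w s)) - G (path N w) *
        (f (t₀ + stepCount N t * r N ^ 2, X N (stepCount N t) w) -
          f (t₀ + stepCount N s * r N ^ 2, X N (stepCount N s) w) -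
          T * eulerGen b σ f (t₀ + stepCount N s * r N ^ 2, X N (stepCount N s) w)))
    rw [drawMean_sub] at hd
    have hd2 := hd.trans (drawMean_mono a₀ N hdiff)
    rw [drawMean_const] at hd2
    have := abs_sub_abs_le_abs_sub (drawMean a₀ N (fun w => G (path N w) *
      (f (t₀ + t, path N w t) - f (t₀ + s, path N w s) -
        (t - s) * eulerGen b σ f (t₀ + s, path N w s)))) (drawMean a₀ N (fun w => G (path N w) *
        (f (t₀ + stepCount N t * r N ^ 2, X N (stepCount N t) w) -
          f (t₀ + stepCount N s * r N ^ 2, X N (stepCount N s) w) -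
          T * eulerGen b σ f (t₀ + stepCount N s * r N ^ 2, X N (stepCount N s) w))))
    linarith

end WeakLimit

end StochHam

namespace StochHam

/-! ### Continuous paths from dyadic increments -/

section Chaining

variable {E : Type*} [NormedAddCommGroup E]

/-- The dyadic approximation of level `m` to `u` from below. -/
noncomputable def dyadicFloor (m : ℕ) (u : ℝ) : ℚ := (⌊u * 2 ^ m⌋₊ : ℚ) / 2 ^ m

theorem dyadicFloor_nonneg (m : ℕ) (u : ℝ) : 0 ≤ dyadicFloor m u := by
  unfold dyadicFloor; positivity

theorem dyadicFloor_le (m : ℕ) {u : ℝ} (hu : 0 ≤ u) : (dyadicFloor m u : ℝ) ≤ u := by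
  unfold dyadicFloor
  push_cast
  rw [div_le_iff₀ (by positivity)]
  exact Nat.floor_le (by positivity)

theorem lt_dyadicFloor_add (m : ℕ) (u : ℝ) : u < dyadicFloor m u + 1 / 2 ^ m := by
  unfold dyadicFloor
  push_cast
  rw [← add_div, lt_div_iff₀ (by positivity)]
  exact Nat.lt_floor_add_one _

/-- The increments of the path along neighbouring dyadic numbers of level `m` are at most
`(9/10)^m`. -/
def SmallIncrements (y : ℚ → E) (m : ℕ) : Prop :=
  ∀ k : ℕ, k < 2 ^ m → ‖y ((k + 1 : ℕ) / 2 ^ m) - y (k / 2 ^ m)‖ ≤ (9 / 10 : ℝ) ^ m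

/-- The path starts at `x₀` and has small dyadic increments at all sufficiently fine levels. -/
def IsTame (x₀ : E) (y : ℚ → E) : Prop :=
  y 0 = x₀ ∧ ∃ m₀, ∀ m ≥ m₀, SmallIncrements y m

theorem SmallIncrements.norm_succ_sub_le {y : ℚ → E} {m : ℕ} (h : SmallIncrements y (m + 1))
    {u : ℝ} (hu0 : 0 ≤ u) (hu1 : u ≤ 1) :
    ‖y (dyadicFloor (m + 1) u) - y (dyadicFloor m u)‖ ≤ (9 / 10 : ℝ) ^ (m + 1) := by
  set k := ⌊u * 2 ^ m⌋₊ with hk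
  have h1 : (k : ℝ) ≤ u * 2 ^ m := Nat.floor_le (by positivity)
  have h2 : u * 2 ^ m < k + 1 := Nat.lt_floor_add_one _
  have hcases : ⌊u * 2 ^ (m + 1)⌋₊ = 2 * k ∨ ⌊u * 2 ^ (m + 1)⌋₊ = 2 * k + 1 := by
    have e : u * 2 ^ (m + 1) = 2 * (u * 2 ^ m) := by ring
    have l1 : 2 * k ≤ ⌊u * 2 ^ (m + 1)⌋₊ := by
      rw [Nat.le_floor_iff (by positivity), e]
      push_cast
      linarith
    have l2 : ⌊u * 2 ^ (m + 1)⌋₊ < 2 * k + 2 := by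
      rw [Nat.floor_lt (by positivity), e]
      push_cast
      linarith
    omega
  have hsame : dyadicFloor m u = ((2 * k : ℕ) : ℚ) / 2 ^ (m + 1) := by
    unfold dyadicFloor
    rw [← hk, pow_succ]
    push_cast
    field_simp
  rcases hcases with hc | hc
  · have : dyadicFloor (m + 1) u = dyadicFloor m u := by
      rw [hsame, dyadicFloor, hc]
    rw [this, sub_self, norm_zero]
    positivity
  · have hlt : 2 * k < 2 ^ (m + 1) := by
      have : ((⌊u * 2 ^ (m + 1)⌋₊ : ℕ) : ℝ) ≤ u * 2 ^ (m + 1) := Nat.floor_le (by positivity)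
      have h3 : u * 2 ^ (m + 1) ≤ 2 ^ (m + 1) := by
        have : (0 : ℝ) < 2 ^ (m + 1) := by positivity
        nlinarith
      have h4 : ⌊u * 2 ^ (m + 1)⌋₊ ≤ 2 ^ (m + 1) := by exact_mod_cast this.trans h3
      omega
    have := h (2 * k) hlt
    rw [hsame, dyadicFloor, hc]
    exact this

theorem norm_sub_dyadicFloor_le {y : ℚ → E} {m₀ : ℕ} (h : ∀ m ≥ m₀, SmallIncrements y m)
    {u : ℝ} (hu0 : 0 ≤ u) (hu1 : u ≤ 1) {l : E}
    (hl : Tendsto (fun m => y (dyadicFloor m u)) atTop (𝓝 l)) {m : ℕ} (hm : m₀ ≤ m) :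
    ‖y (dyadicFloor m u) - l‖ ≤ 10 * (9 / 10 : ℝ) ^ m := by
  have hd : ∀ n, dist (y (dyadicFloor (m + n) u)) (y (dyadicFloor (m + (n + 1)) u)) ≤
      (9 / 10 : ℝ) ^ m * (9 / 10 : ℝ) ^ n := by
    intro n
    rw [dist_comm, dist_eq_norm, ← pow_add]
    refine ((h (m + n + 1) (by omega)).norm_succ_sub_le hu0 hu1).trans ?_
    exact pow_le_pow_of_le_one (by norm_num) (by norm_num) (by omega)
  have ht : Tendsto (fun n => y (dyadicFloor (m + n) u)) atTop (𝓝 l) := by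
    have := (tendsto_add_atTop_iff_nat m).2 hl
    simpa only [add_comm] using this
  have := dist_le_of_le_geometric_of_tendsto₀ (9 / 10 : ℝ) _ (by norm_num) hd ht
  rw [dist_eq_norm, add_zero] at this
  refine this.trans (le_of_eq ?_)
  ring

theorem exists_tendsto_dyadicFloor [CompleteSpace E] {y : ℚ → E} {m₀ : ℕ}
    (h : ∀ m ≥ m₀, SmallIncrements y m) {u : ℝ} (hu0 : 0 ≤ u) (hu1 : u ≤ 1) :
    ∃ l, Tendsto (fun m => y (dyadicFloor m u)) atTop (𝓝 l) := by
  have hd : ∀ n, dist (y (dyadicFloor (n + m₀) u)) (y (dyadicFloor (n + 1 + m₀) u)) ≤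
      1 * (9 / 10 : ℝ) ^ n := by
    intro n
    rw [dist_comm, dist_eq_norm, one_mul, show n + 1 + m₀ = n + m₀ + 1 by omega]
    refine ((h (n + m₀ + 1) (by omega)).norm_succ_sub_le hu0 hu1).trans ?_
    exact pow_le_pow_of_le_one (by norm_num) (by norm_num) (by omega)
  obtain ⟨l, hl⟩ := cauchySeq_tendsto_of_complete
    (cauchySeq_of_le_geometric (9 / 10 : ℝ) 1 (by norm_num) hd)
  exact ⟨l, (tendsto_add_atTop_iff_nat m₀).1 hl⟩

open scoped Classical in
/-- The continuous path that extends a tame path from the dyadic numbers in `[0, 1]` and is constant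
before `0` and after `1`. -/
noncomputable def pathLim (x₀ : E) (y : ℚ → E) (u : ℝ) : E :=
  if IsTame x₀ y then limUnder atTop fun m => y (dyadicFloor m (max 0 (min u 1))) else x₀

theorem clamp_mem (u : ℝ) : 0 ≤ max 0 (min u 1) ∧ max 0 (min u 1) ≤ 1 :=
  ⟨le_max_left _ _, max_le zero_le_one (min_le_right _ _)⟩

theorem abs_clamp_sub_le (u v : ℝ) : |max 0 (min u 1) - max 0 (min v 1)| ≤ |u - v| := by
  have := abs_projIcc_sub_projIcc (zero_le_one' ℝ) (c := u) (d := v)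
  simpa only [coe_projIcc, min_comm (1 : ℝ)] using this

theorem IsTame.tendsto_pathLim [CompleteSpace E] {x₀ : E} {y : ℚ → E} (h : IsTame x₀ y) (u : ℝ) :
    Tendsto (fun m => y (dyadicFloor m (max 0 (min u 1)))) atTop (𝓝 (pathLim x₀ y u)) := by
  obtain ⟨m₀, hm⟩ := h.2
  rw [pathLim, if_pos h]
  exact tendsto_nhds_limUnder (exists_tendsto_dyadicFloor hm (clamp_mem u).1 (clamp_mem u).2)

theorem pathLim_of_nonpos [CompleteSpace E] (x₀ : E) (y : ℚ → E) {u : ℝ} (hu : u ≤ 0) :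
    pathLim x₀ y u = x₀ := by
  by_cases h : IsTame x₀ y
  · have h0 : max 0 (min u 1) = 0 := max_eq_left ((min_le_left _ _).trans hu)
    have ht := h.tendsto_pathLim u
    rw [h0] at ht
    simp only [dyadicFloor, zero_mul, Nat.floor_zero, Nat.cast_zero, zero_div, h.1] at ht
    exact tendsto_nhds_unique ht tendsto_const_nhds
  · rw [pathLim, if_neg h]

theorem norm_pathLim_le [CompleteSpace E] {x₀ : E} {y : ℚ → E} {ρ : ℝ} (hx : ‖x₀‖ ≤ ρ)
    (hy : ∀ q, ‖y q‖ ≤ ρ) (u : ℝ) : ‖pathLim x₀ y u‖ ≤ ρ := by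
  by_cases h : IsTame x₀ y
  · exact le_of_tendsto (h.tendsto_pathLim u).norm (Eventually.of_forall fun m => hy _)
  · rwa [pathLim, if_neg h]

theorem continuous_pathLim [CompleteSpace E] (x₀ : E) (y : ℚ → E) :
    Continuous (pathLim x₀ y) := by
  by_cases h : IsTame x₀ y
  swap
  · have : pathLim x₀ y = fun _ => x₀ := by
      funext u
      rw [pathLim, if_neg h]
    rw [this]
    exact continuous_const
  obtain ⟨m₀, hm⟩ := h.2
  rw [Metric.continuous_iff]
  intro v ε hε
  have hp : Tendsto (fun m : ℕ => 21 * (9 / 10 : ℝ) ^ m) atTop (𝓝 0) := by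
    simpa using (tendsto_pow_atTop_nhds_zero_of_lt_one (r := (9 / 10 : ℝ)) (by norm_num)
      (by norm_num)).const_mul 21
  obtain ⟨m, hme, hmm⟩ := ((hp.eventually (gt_mem_nhds hε)).and (eventually_ge_atTop m₀)).exists
  refine ⟨1 / 2 ^ m, by positivity, fun u huv => ?_⟩
  set u' := max 0 (min u 1) with hu'
  set v' := max 0 (min v 1) with hv'
  have huv' : |u' - v'| < 1 / 2 ^ m := by
    refine lt_of_le_of_lt ?_ huv
    rw [Real.dist_eq]
    exact abs_clamp_sub_le u v
  have b1 := norm_sub_dyadicFloor_le hm (clamp_mem u).1 (clamp_mem u).2 (h.tendsto_pathLim u) hmm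
  have b2 := norm_sub_dyadicFloor_le hm (clamp_mem v).1 (clamp_mem v).2 (h.tendsto_pathLim v) hmm
  -- the floors of two close times agree or are neighbours
  have hnear : ∀ s t : ℝ, 0 ≤ s → s ≤ t → t ≤ 1 → t - s < 1 / 2 ^ m →
      ‖y (dyadicFloor m t) - y (dyadicFloor m s)‖ ≤ (9 / 10 : ℝ) ^ m := by
    intro s t hs hst ht hd
    have hpow : (0 : ℝ) < 2 ^ m := by positivity
    have hd' : t * 2 ^ m < s * 2 ^ m + 1 := by
      rw [lt_div_iff₀ hpow] at hd
      linarith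
    have l1 : ⌊s * 2 ^ m⌋₊ ≤ ⌊t * 2 ^ m⌋₊ := Nat.floor_mono (by gcongr)
    have l2 : ⌊t * 2 ^ m⌋₊ < ⌊s * 2 ^ m⌋₊ + 2 := by
      rw [Nat.floor_lt (by nlinarith)]
      push_cast
      have := Nat.lt_floor_add_one (s * 2 ^ m)
      linarith
    rcases (by omega : ⌊t * 2 ^ m⌋₊ = ⌊s * 2 ^ m⌋₊ ∨ ⌊t * 2 ^ m⌋₊ = ⌊s * 2 ^ m⌋₊ + 1) with hc | hc
    · rw [dyadicFloor, dyadicFloor, hc, sub_self, norm_zero]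
      positivity
    · have hlt : ⌊s * 2 ^ m⌋₊ < 2 ^ m := by
        have : ((⌊t * 2 ^ m⌋₊ : ℕ) : ℝ) ≤ t * 2 ^ m := Nat.floor_le (by nlinarith)
        have h3 : t * 2 ^ m ≤ 2 ^ m := by nlinarith
        have h4 : ⌊t * 2 ^ m⌋₊ ≤ 2 ^ m := by exact_mod_cast this.trans h3
        omega
      have := hm m hmm _ hlt
      rw [dyadicFloor, dyadicFloor, hc]
      exact this
  have b3 : ‖y (dyadicFloor m u') - y (dyadicFloor m v')‖ ≤ (9 / 10 : ℝ) ^ m := by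
    rcases le_total u' v' with hc | hc
    · rw [norm_sub_rev]
      refine hnear _ _ (clamp_mem u).1 hc (clamp_mem v).2 ?_
      rw [abs_lt] at huv'
      linarith [huv'.1]
    · refine hnear _ _ (clamp_mem v).1 hc (clamp_mem u).2 ?_
      rw [abs_lt] at huv'
      linarith [huv'.2]
  rw [dist_eq_norm]
  have e : pathLim x₀ y u - pathLim x₀ y v = -(y (dyadicFloor m u') - pathLim x₀ y u) +
      (y (dyadicFloor m u') - y (dyadicFloor m v')) + (y (dyadicFloor m v') - pathLim x₀ y v) := by
    abel
  rw [e]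
  refine lt_of_le_of_lt (norm_add₃_le) ?_
  rw [norm_neg]
  linarith

end Chaining

section BorelCantelli

variable {E : Type*} [NormedAddCommGroup E] [MeasurableSpace E] [BorelSpace E]
  [SecondCountableTopology E] {Ω : Type*} [MeasurableSpace Ω] {P : Measure Ω}
  [IsProbabilityMeasure P]

/-- The Kolmogorov criterion: fourth moments of the order of the square of the time difference make
almost all paths tame. -/
theorem ae_isTame {Y : ℚ → Ω → E} {x₀ : E} (hm : ∀ q, Measurable (Y q)) {ρ : ℝ}
    (hb : ∀ q w, ‖Y q w‖ ≤ ρ) (h0 : ∀ᵐ w ∂P, Y 0 w = x₀) {K : ℝ} (hK0 : 0 ≤ K)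
    (hK : ∀ s t : ℚ, 0 ≤ s → s ≤ t → t ≤ 1 → ∫ w, ‖Y t w - Y s w‖ ^ 4 ∂P ≤ K * (t - s) ^ 2) :
    ∀ᵐ w ∂P, IsTame x₀ fun q => Y q w := by
  have hθ : (0 : ℝ) < 9 / 10 := by norm_num
  let B : ℕ → Set Ω := fun m => ⋃ k ∈ Finset.range (2 ^ m),
    {w | ((9 / 10 : ℝ) ^ m) ^ 4 ≤ ‖Y ((k + 1 : ℕ) / 2 ^ m) w - Y (k / 2 ^ m) w‖ ^ 4}
  have hB : ∀ m, P (B m) ≤ ENNReal.ofReal (K * (4 / 5 : ℝ) ^ m) := by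
    intro m
    have hk : ∀ k ∈ Finset.range (2 ^ m),
        P {w | ((9 / 10 : ℝ) ^ m) ^ 4 ≤ ‖Y ((k + 1 : ℕ) / 2 ^ m) w - Y (k / 2 ^ m) w‖ ^ 4} ≤
          ENNReal.ofReal (K * (2 / 5 : ℝ) ^ m) := by
      intro k hk
      have hk' : k + 1 ≤ 2 ^ m := Finset.mem_range.1 hk
      set F : Ω → ℝ := fun w => ‖Y ((k + 1 : ℕ) / 2 ^ m) w - Y (k / 2 ^ m) w‖ ^ 4 with hF
      have hFm : Measurable F := (((hm _).sub (hm _)).norm).pow_const 4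
      have hFi : Integrable F P := by
        refine Integrable.of_bound hFm.aestronglyMeasurable ((2 * ρ) ^ 4)
          (Eventually.of_forall fun w => ?_)
        rw [Real.norm_eq_abs, abs_of_nonneg (by positivity)]
        have := (norm_sub_le (Y ((k + 1 : ℕ) / 2 ^ m) w) (Y (k / 2 ^ m) w)).trans
          (add_le_add (hb _ w) (hb _ w))
        rw [hF]
        simp only
        gcongr
        linarith
      have hs : ((k + 1 : ℕ) : ℚ) / 2 ^ m ≤ 1 := by
        rw [div_le_one (by positivity)]
        exact_mod_cast hk'
      have e1 := hK (k / 2 ^ m) ((k + 1 : ℕ) / 2 ^ m) (by positivity)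
        (by push_cast; gcongr; linarith) hs
      have e2 := mul_meas_ge_le_integral_of_nonneg (μ := P)
        (Eventually.of_forall fun w => (by positivity : 0 ≤ F w)) hFi (((9 / 10 : ℝ) ^ m) ^ 4)
      have e3 : ((((k + 1 : ℕ) / 2 ^ m : ℚ) : ℝ) - ((k / 2 ^ m : ℚ) : ℝ)) ^ 2 = (1 / 4) ^ m := by
        push_cast
        rw [← sub_div, add_sub_cancel_left, div_pow, ← pow_mul, mul_comm m, pow_mul,
          one_pow, ← one_div_pow]
        norm_num
      rw [e3] at e1
      have e4 : P.real {w | ((9 / 10 : ℝ) ^ m) ^ 4 ≤ F w} ≤ K * (2 / 5 : ℝ) ^ m := by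
        have e5 : K * (1 / 4 : ℝ) ^ m ≤ ((9 / 10 : ℝ) ^ m) ^ 4 * (K * (2 / 5) ^ m) := by
          have : ((9 / 10 : ℝ) ^ m) ^ 4 * (2 / 5) ^ m = (((9 / 10) ^ 4 * (2 / 5)) : ℝ) ^ m := by
            rw [mul_pow, ← pow_mul, ← pow_mul, mul_comm m 4]
          rw [mul_left_comm, this]
          gcongr
          norm_num
        exact le_of_mul_le_mul_left ((e2.trans e1).trans e5) (by positivity)
      rw [← ENNReal.ofReal_toReal (measure_ne_top P _)]
      exact ENNReal.ofReal_le_ofReal e4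
    refine (measure_biUnion_finset_le _ _).trans ((Finset.sum_le_sum hk).trans ?_)
    rw [Finset.sum_const, Finset.card_range, nsmul_eq_mul]
    have : ((2 ^ m : ℕ) : ENNReal) = ENNReal.ofReal (2 ^ m) := by
      rw [ENNReal.ofReal_pow (by norm_num)]
      simp
    rw [this, ← ENNReal.ofReal_mul (by positivity)]
    refine ENNReal.ofReal_le_ofReal (le_of_eq ?_)
    rw [mul_left_comm, ← mul_pow]
    norm_num
  have hsum : ∑' m, P (B m) ≠ ⊤ := by
    refine ne_top_of_le_ne_top ?_ (ENNReal.tsum_le_tsum hB)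
    rw [← ENNReal.ofReal_tsum_of_nonneg (fun m => by positivity)]
    · exact ENNReal.ofReal_ne_top
    · exact (summable_geometric_of_lt_one (by norm_num) (by norm_num)).mul_left K
  filter_upwards [h0, ae_eventually_notMem hsum] with w hw0 hw
  obtain ⟨m₀, hm₀⟩ := eventually_atTop.1 hw
  refine ⟨hw0, m₀, fun m hmm k hk => ?_⟩
  have := hm₀ m hmm
  simp only [B, mem_iUnion, not_exists, Finset.mem_range, mem_ofPred_eq, not_le] at this
  exact (lt_of_pow_lt_pow_left₀ 4 (by positivity) (this k hk)).le

end BorelCantelli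

section Riemann

theorem tendsto_riemann_sum {φ : ℝ → ℝ} (hφ : Continuous φ) {s t : ℝ} (hst : s ≤ t) :
    Tendsto (fun n : ℕ => ∑ j ∈ Finset.range n, (t - s) / n * φ (s + j * ((t - s) / n))) atTop
      (𝓝 (∫ r in s..t, φ r)) := by
  rw [Metric.tendsto_atTop]
  intro ε hε
  have huc := isCompact_Icc.uniformContinuousOn_of_continuous (hφ.continuousOn (s := Icc s t))
  obtain ⟨δ, hδ, hd⟩ := Metric.uniformContinuousOn_iff.1 huc (ε / (2 * (t - s + 1)))
    (by have : 0 ≤ t - s := by linarith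
        positivity)
  obtain ⟨n₀, hn₀⟩ := exists_nat_gt ((t - s) / δ)
  refine ⟨n₀ + 1, fun n hn => ?_⟩
  have hn0 : (0 : ℝ) < n := by exact_mod_cast (by omega : 0 < n)
  set h := (t - s) / n with hh
  have h0 : 0 ≤ h := div_nonneg (by linarith) hn0.le
  have hδh : h < δ := by
    have : (n₀ : ℝ) ≤ n := by exact_mod_cast (by omega : n₀ ≤ n)
    rw [hh, div_lt_iff₀ hn0, mul_comm, ← div_lt_iff₀ hδ]
    linarith
  have hnh : n * h = t - s := by rw [hh]; field_simp
  let a : ℕ → ℝ := fun j => s + j * h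
  have ha : ∀ j, a (j + 1) = a j + h := fun j => by simp only [a]; push_cast; ring
  have ha0 : a 0 = s := by simp [a]
  have han : a n = t := by simp only [a]; linarith
  have hint : ∫ r in s..t, φ r = ∑ j ∈ Finset.range n, ∫ r in a j..a (j + 1), φ r := by
    rw [intervalIntegral.sum_integral_adjacent_intervals
      (fun k _ => hφ.intervalIntegrable _ _), ha0, han]
  rw [hint, Real.dist_eq, ← Finset.sum_sub_distrib]
  refine lt_of_le_of_lt (Finset.abs_sum_le_sum_abs _ _) ?_
  have hterm : ∀ j ∈ Finset.range n,
      |h * φ (s + j * h) - ∫ r in a j..a (j + 1), φ r| ≤ ε / (2 * (t - s + 1)) * h := by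
    intro j hj
    have hj' : (j : ℝ) + 1 ≤ n := by exact_mod_cast Finset.mem_range.1 hj
    have e : h * φ (s + j * h) = ∫ r in a j..a (j + 1), φ (a j) := by
      rw [intervalIntegral.integral_const, ha]
      simp [a]
    rw [e, ← intervalIntegral.integral_sub (by simp) (hφ.intervalIntegrable _ _)]
    have := intervalIntegral.norm_integral_le_of_norm_le_const (a := a j) (b := a (j + 1))
      (f := fun r => φ (a j) - φ r) (C := ε / (2 * (t - s + 1))) (fun r hr => by
        rw [uIoc_of_le (by rw [ha]; linarith)] at hr
        have hj0 : (0 : ℝ) ≤ j * h := by positivity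
        have m0 : (j + 1) * h ≤ t - s := by rw [← hnh]; exact mul_le_mul_of_nonneg_right hj' h0
        have m1 : a j ∈ Icc s t := ⟨by simp only [a]; linarith, by simp only [a]; linarith⟩
        have hr2 : r ≤ a j + h := by rw [← ha]; exact hr.2
        have m2 : r ∈ Icc s t := ⟨by linarith [m1.1, hr.1], by
          simp only [a] at hr2; linarith⟩
        have := hd _ m1 _ m2 (by
          rw [Real.dist_eq, abs_sub_comm, abs_of_nonneg (by linarith [hr.1])]
          linarith)
        rw [Real.dist_eq] at this
        exact this.le)
    rw [Real.norm_eq_abs, ha, add_sub_cancel_left, abs_of_nonneg h0] at this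
    rw [ha]
    exact this
  refine lt_of_le_of_lt (Finset.sum_le_sum hterm) ?_
  rw [Finset.sum_const, Finset.card_range, nsmul_eq_mul]
  have : (n : ℝ) * (ε / (2 * (t - s + 1)) * h) = ε * ((t - s) / (2 * (t - s + 1))) := by
    rw [← hnh]; ring
  rw [this]
  have h1 : (t - s) / (2 * (t - s + 1)) < 1 := by
    rw [div_lt_one (by linarith)]; linarith
  nlinarith

end Riemann

end StochHam

namespace StochHam

/-! ### The solution of the martingale problem in a vector space -/

section Solution

variable {E : Type*} [NormedAddCommGroup E] {Ω : Type*} {mΩ : MeasurableSpace Ω}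

/-- `f(t, X(t)) - ∫_{t₀}^t g(r, X(r)) dr`. -/
noncomputable def compProc (t₀ : ℝ) (X : ℝ → Ω → E) (f g : ℝ × E → ℝ) (t : ℝ) (w : Ω) : ℝ :=
  f (t, X t w) - ∫ r in t₀..t, g (r, X r w)

theorem continuous_compProc {t₀ : ℝ} {X : ℝ → Ω → E} {f g : ℝ × E → ℝ} (hf : Continuous f)
    (hg : Continuous g) {w : Ω} (hX : Continuous fun t => X t w) :
    Continuous fun t => compProc t₀ X f g t w := by
  unfold compProc
  refine (hf.comp (continuous_id.prodMk hX)).sub ?_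
  exact intervalIntegral.continuous_primitive
    (fun a b => (hg.comp (continuous_id.prodMk hX)).intervalIntegrable a b) t₀

theorem exists_bound_compProc [ProperSpace E] (t₀ : ℝ) {f g : ℝ × E → ℝ} (hf : Continuous f)
    (hg : Continuous g) (ρ : ℝ) : ∃ B, ∀ X : ℝ → Ω → E, (∀ t w, ‖X t w‖ ≤ ρ) →
      ∀ t ∈ Icc t₀ (t₀ + 1), ∀ w, |compProc t₀ X f g t w| ≤ B := by
  have hK : IsCompact (Icc t₀ (t₀ + 1) ×ˢ Metric.closedBall (0 : E) ρ) :=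
    isCompact_Icc.prod (isCompact_closedBall _ _)
  obtain ⟨Bf, hBf⟩ := hK.exists_bound_of_continuousOn hf.continuousOn
  obtain ⟨Bg, hBg⟩ := hK.exists_bound_of_continuousOn hg.continuousOn
  refine ⟨Bf + Bg, fun X hX t ht w => ?_⟩
  have hm : ∀ r ∈ Icc t₀ (t₀ + 1), (r, X r w) ∈
      Icc t₀ (t₀ + 1) ×ˢ Metric.closedBall (0 : E) ρ := fun r hr => ⟨hr, by simpa using hX r w⟩
  have hBg0 : 0 ≤ Bg := (norm_nonneg _).trans (hBg _ (hm t ht))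
  have h1 : ‖∫ r in t₀..t, g (r, X r w)‖ ≤ Bg * |t - t₀| :=
    intervalIntegral.norm_integral_le_of_norm_le_const fun r hr => by
      rw [uIoc_of_le ht.1] at hr
      exact hBg _ (hm r ⟨hr.1.le, hr.2.trans ht.2⟩)
  have h2 : |t - t₀| ≤ 1 := by
    rw [abs_of_nonneg (by linarith [ht.1])]
    linarith [ht.2]
  refine (abs_sub _ _).trans (add_le_add (hBf _ (hm t ht)) (h1.trans ?_))
  nlinarith

/-- `X` is a bounded continuous adapted solution, on `[t₀, t₀ + 1]`, of the martingale problem of the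
operator `gen` started at `x₀`. -/
structure MartingaleSolution [NormedSpace ℝ E] [MeasurableSpace E] (ℱ : Filtration ℝ mΩ)
    (P : Measure Ω) (gen : (ℝ × E → ℝ) → ℝ × E → ℝ) (t₀ : ℝ) (x₀ : E) (X : ℝ → Ω → E) : Prop where
  continuous : ∀ w, Continuous fun t => X t w
  adapted : ∀ t, Measurable[ℱ t] (X t)
  start : ∀ w, X t₀ w = x₀
  bounded : ∃ ρ, ∀ t w, ‖X t w‖ ≤ ρ
  increments : ∀ f : ℝ × E → ℝ, ContDiff ℝ ∞ f → ∀ s t, t₀ ≤ s → s ≤ t → t ≤ t₀ + 1 →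
    ∀ A, MeasurableSet[ℱ s] A →
      ∫ w in A, compProc t₀ X f (gen f) t w ∂P = ∫ w in A, compProc t₀ X f (gen f) s w ∂P

theorem measurable_compProc [MeasurableSpace E] [BorelSpace E] [SecondCountableTopology E]
    {ℱ : Filtration ℝ mΩ} {t₀ : ℝ} {X : ℝ → Ω → E}
    (hc : ∀ w, Continuous fun t => X t w) (ha : ∀ t, Measurable[ℱ t] (X t)) {f g : ℝ × E → ℝ}
    (hf : Continuous f) (hg : Continuous g) {t : ℝ} (ht : t₀ ≤ t) :
    Measurable[ℱ t] (compProc t₀ X f g t) := by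
  have hm : ∀ φ : ℝ × E → ℝ, Continuous φ → ∀ r ≤ t, Measurable[ℱ t] fun w => φ (r, X r w) := by
    intro φ hφ r hr
    have h1 : Measurable[ℱ t] (X r) := (ha r).mono (ℱ.mono hr) le_rfl
    have h2 : Continuous fun x => φ (r, x) := by fun_prop
    exact h2.measurable.comp h1
  refine Measurable.sub (hm f hf t le_rfl) ?_
  refine @measurable_of_tendsto_metrizable Ω ℝ (ℱ t) _ _ _ _ (fun (n : ℕ) w =>
    ∑ j ∈ Finset.range n, (t - t₀) / n * g (t₀ + j * ((t - t₀) / n),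
      X (t₀ + j * ((t - t₀) / n)) w) ) _ (fun n => ?_) ?_
  · refine Finset.measurable_fun_sum _ fun j hj => Measurable.const_mul (hm g hg _ ?_) _
    have hj' : (j : ℝ) ≤ n := by exact_mod_cast (Finset.mem_range.1 hj).le
    have hn : (0 : ℝ) < n := by
      exact_mod_cast lt_of_le_of_lt (Nat.zero_le j) (Finset.mem_range.1 hj)
    have : j * ((t - t₀) / n) ≤ t - t₀ := by
      rw [mul_div_assoc', div_le_iff₀ hn]
      nlinarith
    linarith
  · rw [tendsto_pi_nhds]
    intro w
    exact tendsto_riemann_sum (φ := fun r => g (r, X r w))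
      (hg.comp (continuous_id.prodMk (hc w))) ht

end Solution

section Filtration

variable {E : Type*} [MeasurableSpace E] {Ω : Type*}

/-- The events that are determined by the values `Y q` with `q ≤ u`. -/
abbrev pastSigma (Y : ℚ → Ω → E) (u : ℝ) : MeasurableSpace Ω :=
  ⨆ q : {q : ℚ // (q : ℝ) ≤ u}, MeasurableSpace.comap (Y q) inferInstance

theorem pastSigma_le [mΩ : MeasurableSpace Ω] {Y : ℚ → Ω → E} (hY : ∀ q, Measurable (Y q)) (u : ℝ) :
    pastSigma Y u ≤ mΩ :=
  iSup_le fun q => (hY q).comap_le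

theorem measurable_pastSigma (Y : ℚ → Ω → E) {u : ℝ} {q : ℚ} (h : (q : ℝ) ≤ u) :
    Measurable[pastSigma Y u] (Y q) :=
  measurable_iff_comap_le.2
    (le_iSup_of_le (⟨q, h⟩ : {q : ℚ // (q : ℝ) ≤ u}) le_rfl)

variable [mΩ : MeasurableSpace Ω]

/-- The right-continuous completed filtration generated by `Y`, with time shifted by `t₀`. -/
def augmentedFiltration (P : Measure Ω) [P.IsComplete] (Y : ℚ → Ω → E)
    (hY : ∀ q, Measurable (Y q)) (t₀ : ℝ) : Filtration ℝ mΩ where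
  seq t := ⨅ u : {u : ℝ // t < u}, eventuallyMeasurableSpace (pastSigma Y (u - t₀)) (ae P)
  mono' s t hst := le_iInf fun u => iInf_le_of_le ⟨u.1, hst.trans_lt u.2⟩ le_rfl
  le' t := by
    refine iInf_le_of_le ⟨t + 1, by linarith⟩ ?_
    rintro s ⟨s', hs', hss⟩
    have h1 : NullMeasurableSet s P := ⟨s', pastSigma_le hY _ _ hs', hss⟩
    exact h1.measurable_of_complete

variable {P : Measure Ω} [P.IsComplete] {Y : ℚ → Ω → E} {hY : ∀ q, Measurable (Y q)} {t₀ : ℝ}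

theorem measurableSet_augmentedFiltration {t : ℝ} {A : Set Ω} :
    MeasurableSet[augmentedFiltration P Y hY t₀ t] A ↔
      ∀ u, t < u → MeasurableSet[eventuallyMeasurableSpace (pastSigma Y (u - t₀)) (ae P)] A := by
  change MeasurableSet[⨅ u : {u : ℝ // t < u}, _] A ↔ _
  rw [MeasurableSpace.measurableSet_iInf]
  exact ⟨fun h u hu => h ⟨u, hu⟩, fun h u => h u.1 u.2⟩

theorem usualConditions_augmentedFiltration :
    UsualConditions (augmentedFiltration P Y hY t₀) P := by
  constructor
  · intro t A hA
    rw [Filtration.rightCont_eq] at hA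
    rw [measurableSet_augmentedFiltration]
    intro u hu
    obtain ⟨v, hv1, hv2⟩ := exists_between hu
    have h1 : MeasurableSet[augmentedFiltration P Y hY t₀ v] A := by
      have := hA
      simp only [MeasurableSpace.measurableSet_iInf] at this
      exact this v hv1
    exact measurableSet_augmentedFiltration.1 h1 u hv2
  · intro t s hs
    rw [measurableSet_augmentedFiltration]
    intro u _
    exact ⟨∅, @MeasurableSet.empty Ω (pastSigma Y (u - t₀)), by
      rw [eventuallyEq_set]
      filter_upwards [measure_eq_zero_iff_ae_notMem.1 hs] with w hw
      simp [hw]⟩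

end Filtration

section Construction

variable {E : Type*} [NormedAddCommGroup E] [NormedSpace ℝ E] [FiniteDimensional ℝ E]
  [MeasurableSpace E] [BorelSpace E] {Ω : Type*} [mΩ : MeasurableSpace Ω] {P : Measure Ω}
  [IsProbabilityMeasure P] {κ : Type*} [Fintype κ] {b : ℝ × E → E} {σ : κ → ℝ × E → E} {t₀ : ℝ}
  {x₀ : E} {Y : ℚ → Ω → E}

/-- The continuous process in real time. -/
noncomputable def contProc (t₀ : ℝ) (x₀ : E) (Y : ℚ → Ω → E) (t : ℝ) (w : Ω) : E :=
  pathLim x₀ (fun q => Y q w) (t - t₀)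

theorem RationalSolution.exists_bound (h : RationalSolution P b σ t₀ x₀ Y) :
    ∃ ρ, (∀ q w, ‖Y q w‖ ≤ ρ) ∧ ∀ t w, ‖contProc t₀ x₀ Y t w‖ ≤ ρ := by
  obtain ⟨ρ, hρ⟩ := h.bounded
  exact ⟨max ρ ‖x₀‖, fun q w => (hρ q w).trans (le_max_left _ _),
    fun t w => norm_pathLim_le (le_max_right _ _) (fun q => (hρ q w).trans (le_max_left _ _)) _⟩

theorem RationalSolution.ae_isTame (h : RationalSolution P b σ t₀ x₀ Y) :
    ∀ᵐ w ∂P, IsTame x₀ fun q => Y q w := by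
  obtain ⟨ρ, hρ⟩ := h.bounded
  obtain ⟨K, hK0, hK⟩ := h.moment
  exact StochHam.ae_isTame h.measurable hρ (h.start 0 le_rfl) hK0 hK

theorem RationalSolution.contProc_adapted [P.IsComplete] (h : RationalSolution P b σ t₀ x₀ Y)
    (t : ℝ) : Measurable[augmentedFiltration P Y h.measurable t₀ t] (contProc t₀ x₀ Y t) := by
  intro B hB
  rw [measurableSet_augmentedFiltration]
  intro u hu
  rcases lt_or_ge t t₀ with ht | ht
  · have : contProc t₀ x₀ Y t = fun _ => x₀ := by
      funext w
      exact pathLim_of_nonpos _ _ (by linarith)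
    rw [this]
    exact @measurable_const _ _ _ (eventuallyMeasurableSpace _ _) _ _ hB
  · set c := max 0 (min (t - t₀) 1) with hc
    have hcu : c ≤ u - t₀ := max_le (by linarith) ((min_le_left _ _).trans (by linarith))
    have h1 : Measurable[pastSigma Y (u - t₀)] fun w =>
        limUnder atTop fun m => Y (dyadicFloor m c) w := by
      let _ := pastSigma Y (u - t₀)
      have : StronglyMeasurable fun w => limUnder atTop fun m => Y (dyadicFloor m c) w :=
        StronglyMeasurable.limUnder fun m => (measurable_pastSigma Y
          ((dyadicFloor_le m (clamp_mem _).1).trans hcu)).stronglyMeasurable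
      exact this.measurable
    have h2 : contProc t₀ x₀ Y t =ᵐ[P] fun w => limUnder atTop fun m => Y (dyadicFloor m c) w := by
      filter_upwards [h.ae_isTame] with w hw
      rw [contProc, pathLim, if_pos hw]
    exact h1.eventuallyMeasurable_of_eventuallyEq h2 hB

theorem RationalSolution.contProc_rat [P.IsComplete] (h : RationalSolution P b σ t₀ x₀ Y) {q : ℚ}
    (h0 : 0 ≤ q) (h1 : q ≤ 1) : ∀ᵐ w ∂P, contProc t₀ x₀ Y (t₀ + q) w = Y q w := by
  obtain ⟨ρ, hρ, hρ'⟩ := h.exists_bound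
  obtain ⟨K, hK0, hK⟩ := h.moment
  have h0' : (0 : ℝ) ≤ q := by exact_mod_cast h0
  have h1' : (q : ℝ) ≤ 1 := by exact_mod_cast h1
  have hX : Measurable (contProc t₀ x₀ Y (t₀ + q)) :=
    (h.contProc_adapted _).mono ((augmentedFiltration P Y h.measurable t₀).le _) le_rfl
  have hb : ∀ a c : E, ‖a‖ ≤ ρ → ‖c‖ ≤ ρ → ‖(‖a - c‖ ^ 4 : ℝ)‖ ≤ (2 * ρ) ^ 4 := by
    intro a c ha hc
    rw [Real.norm_eq_abs, abs_of_nonneg (by positivity)]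
    have := norm_sub_le a c
    gcongr
    linarith
  have hlim1 : Tendsto (fun m => ∫ w, ‖Y q w - Y (dyadicFloor m q) w‖ ^ 4 ∂P) atTop
      (𝓝 (∫ w, ‖Y q w - contProc t₀ x₀ Y (t₀ + q) w‖ ^ 4 ∂P)) := by
    refine tendsto_integral_of_dominated_convergence (fun _ => (2 * ρ) ^ 4) (fun m => ?_)
      (integrable_const _) (fun m => Eventually.of_forall fun w => hb _ _ (hρ _ _) (hρ _ _)) ?_
    · exact (((h.measurable _).sub (h.measurable _)).norm.pow_const 4).aestronglyMeasurable
    · filter_upwards [h.ae_isTame] with w hw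
      have := hw.tendsto_pathLim q
      rw [min_eq_left h1', max_eq_right h0'] at this
      have e : contProc t₀ x₀ Y (t₀ + q) w = pathLim x₀ (fun q => Y q w) q := by
        simp [contProc]
      rw [e]
      exact ((tendsto_const_nhds.sub this).norm.pow 4)
  have hlim2 : Tendsto (fun m => ∫ w, ‖Y q w - Y (dyadicFloor m q) w‖ ^ 4 ∂P) atTop (𝓝 0) := by
    have hz : Tendsto (fun m : ℕ => K * (((1 : ℝ) / 2) ^ m) ^ 2) atTop (𝓝 0) := by
      simpa using ((tendsto_pow_atTop_nhds_zero_of_lt_one (r := (1 / 2 : ℝ)) (by norm_num)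
        (by norm_num)).pow 2).const_mul K
    refine squeeze_zero (fun m => integral_nonneg fun w => by positivity) (fun m => ?_) hz
    have hle : (dyadicFloor m q : ℝ) ≤ q := dyadicFloor_le m h0'
    refine (hK _ _ (dyadicFloor_nonneg _ _) (by exact_mod_cast hle) h1).trans ?_
    have := lt_dyadicFloor_add m (q : ℝ)
    rw [one_div_pow]
    refine mul_le_mul_of_nonneg_left ?_ hK0
    exact pow_le_pow_left₀ (by linarith) (by linarith) 2
  have h4 := tendsto_nhds_unique hlim1 hlim2
  rw [integral_eq_zero_iff_of_nonneg (fun w => by positivity)] at h4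
  · filter_upwards [h4] with w hw
    have : ‖Y q w - contProc t₀ x₀ Y (t₀ + q) w‖ = 0 := by simpa using hw
    exact (sub_eq_zero.1 (norm_eq_zero.1 this)).symm
  · refine Integrable.of_bound
      (((h.measurable _).sub hX).norm.pow_const 4).aestronglyMeasurable ((2 * ρ) ^ 4)
      (Eventually.of_forall fun w => hb _ _ (hρ _ _) (hρ' _ _))

theorem RationalSolution.integral_compProc_eq [P.IsComplete]
    (h : RationalSolution P b σ t₀ x₀ Y) {f : ℝ × E → ℝ} (hf : ContDiff ℝ ∞ f)
    (hg : Continuous (eulerGen b σ f)) {s t : ℚ} (hs : 0 ≤ s) (hst : s ≤ t) (ht : t ≤ 1)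
    {G : (ℚ → E) → ℝ} (hG : Continuous G) (hG1 : ∀ y, |G y| ≤ 1) (hGs : DependsUpTo s G) :
    ∫ w, G (fun q => Y q w) *
      (compProc t₀ (contProc t₀ x₀ Y) f (eulerGen b σ f) (t₀ + t) w -
        compProc t₀ (contProc t₀ x₀ Y) f (eulerGen b σ f) (t₀ + s) w) ∂P = 0 := by
  obtain ⟨ρ, hρ, hρ'⟩ := h.exists_bound
  obtain ⟨K, hK0, hK⟩ := h.martingale f hf
  set X := contProc t₀ x₀ Y with hX
  set g := eulerGen b σ f with hgd
  have hfc := hf.continuous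
  have hs' : (0 : ℝ) ≤ s := by exact_mod_cast hs
  have hst' : (s : ℝ) ≤ t := by exact_mod_cast hst
  have ht' : (t : ℝ) ≤ 1 := by exact_mod_cast ht
  have hXc : ∀ w, Continuous fun t => X t w := fun w =>
    (continuous_pathLim x₀ _).comp (continuous_id.sub continuous_const)
  have hXm : ∀ t, Measurable (X t) := fun t =>
    (h.contProc_adapted _).mono ((augmentedFiltration P Y h.measurable t₀).le _) le_rfl
  have hGm : Measurable fun w => G fun q => Y q w :=
    hG.measurable.comp (measurable_pi_lambda _ h.measurable)
  have hcompact : IsCompact (Icc t₀ (t₀ + 1) ×ˢ Metric.closedBall (0 : E) ρ) :=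
    isCompact_Icc.prod (isCompact_closedBall _ _)
  obtain ⟨Bf, hBf⟩ := hcompact.exists_bound_of_continuousOn hfc.continuousOn
  obtain ⟨Bg, hBg⟩ := hcompact.exists_bound_of_continuousOn hg.continuousOn
  have hBg0 : 0 ≤ Bg := (norm_nonneg _).trans (hBg (t₀, 0) ⟨⟨le_rfl, by linarith⟩, by
    simpa using (norm_nonneg _).trans (hρ 0 (Classical.choice P.nonempty_of_neZero))⟩)
  have hsub : ∀ r : ℝ, s ≤ r → r ≤ t → t₀ + r ∈ Icc t₀ (t₀ + 1) :=
    fun r h1 h2 => ⟨by linarith, by linarith⟩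
  have hfm : ∀ (φ : ℝ × E → ℝ), Continuous φ → ∀ r, Measurable fun w => φ (r, X r w) :=
    fun φ hφ r => (by fun_prop : Continuous fun x => φ (r, x)).measurable.comp (hXm r)
  -- the approximation of the increment by a Riemann sum along `n` equal steps
  let D : ℕ → Ω → ℝ := fun n w => f (t₀ + t, X (t₀ + t) w) - f (t₀ + s, X (t₀ + s) w) -
    ∑ j ∈ Finset.range n, ((t : ℝ) - s) / n * g (t₀ + s + j * (((t : ℝ) - s) / n),
      X (t₀ + s + j * (((t : ℝ) - s) / n)) w)
  have hint : ∀ n : ℕ, 0 < n → |∫ w, G (fun q => Y q w) * D n w ∂P| ≤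
      K * ((t - s) * √((t - s) / n)) := by
    intro n hn
    have hn' : (0 : ℚ) < n := by exact_mod_cast hn
    let hq : ℚ := (t - s) / n
    have hq0 : 0 ≤ hq := div_nonneg (by linarith) hn'.le
    let u : ℕ → ℚ := fun j => s + j * hq
    have hnq : (n : ℚ) * hq = t - s := by simp only [hq]; field_simp
    have hu : ∀ j, u (j + 1) = u j + hq := fun j => by simp only [u]; push_cast; ring
    have hu0 : u 0 = s := by simp [u]
    have hun : u n = t := by simp only [u]; linarith
    have hsu : ∀ j, s ≤ u j := fun j => by
      have : 0 ≤ (j : ℚ) * hq := by positivity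
      simp only [u]; linarith
    have hut : ∀ j, j ≤ n → u j ≤ t := fun j hj => by
      have h1 : (j : ℚ) ≤ n := by exact_mod_cast hj
      have h2 : (j : ℚ) * hq ≤ n * hq := mul_le_mul_of_nonneg_right h1 hq0
      simp only [u]; linarith
    have hcast : ((hq : ℚ) : ℝ) = ((t : ℝ) - s) / n := by simp [hq]
    let T : ℕ → Ω → ℝ := fun j w => G (fun q => Y q w) *
      (f (t₀ + u (j + 1), Y (u (j + 1)) w) - f (t₀ + u j, Y (u j) w) -
        ((u (j + 1) : ℝ) - u j) * g (t₀ + u j, Y (u j) w))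
    have hT : ∀ j ∈ Finset.range n, |∫ w, T j w ∂P| ≤ K * (hq * √hq) := by
      intro j hj
      have hj' := Finset.mem_range.1 hj
      have := hK (u j) (u (j + 1)) (hs.trans (hsu j)) (by rw [hu]; linarith)
        ((hut _ hj').trans ht) G hG hG1
        (fun y y' hy => hGs y y' fun q hq' => hy q (hq'.trans (hsu j)))
      have e : (u (j + 1) : ℝ) - u j = hq := by rw [hu]; push_cast; ring
      rw [e] at this
      simp only [T, e]
      exact this
    have hTi : ∀ j ∈ Finset.range n, Integrable (T j) P := by
      intro j hj
      have hj' := Finset.mem_range.1 hj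
      have m1 : ∀ i ≤ n, (t₀ + (u i : ℝ)) ∈ Icc t₀ (t₀ + 1) := fun i hi =>
        hsub _ (by exact_mod_cast hsu i) (by exact_mod_cast hut i hi)
      have hYm : ∀ (φ : ℝ × E → ℝ), Continuous φ → ∀ (r : ℝ) q,
          Measurable fun w => φ (r, Y q w) :=
        fun φ hφ r q => (by fun_prop : Continuous fun x => φ (r, x)).measurable.comp
          (h.measurable q)
      refine Integrable.of_bound (hGm.mul (((hYm f hfc _ _).sub (hYm f hfc _ _)).sub
        ((hYm g hg _ _).const_mul _))).aestronglyMeasurable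
        (1 * (Bf + Bf + |(u (j + 1) : ℝ) - u j| * Bg)) (Eventually.of_forall fun w => ?_)
      rw [Real.norm_eq_abs, abs_mul]
      refine mul_le_mul (hG1 _) ?_ (abs_nonneg _) zero_le_one
      refine (abs_sub _ _).trans (add_le_add ((abs_sub _ _).trans (add_le_add ?_ ?_)) ?_)
      · exact hBf _ ⟨m1 _ hj', by simpa using hρ _ _⟩
      · exact hBf _ ⟨m1 _ hj'.le, by simpa using hρ _ _⟩
      · rw [abs_mul]
        exact mul_le_mul_of_nonneg_left (hBg _ ⟨m1 _ hj'.le, by simpa using hρ _ _⟩)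
          (abs_nonneg _)
    have hae : ∀ᵐ w ∂P, ∀ j ≤ n, X (t₀ + u j) w = Y (u j) w := by
      rw [ae_all_iff]
      intro j
      by_cases hj : j ≤ n
      · filter_upwards [h.contProc_rat (hs.trans (hsu j)) ((hut j hj).trans ht)] with w hw _
        exact hw
      · exact Eventually.of_forall fun w h => absurd h hj
    have heq : ∫ w, G (fun q => Y q w) * D n w ∂P = ∑ j ∈ Finset.range n, ∫ w, T j w ∂P := by
      rw [← integral_finsetSum _ hTi]
      refine integral_congr_ae ?_
      filter_upwards [hae] with w hw
      simp only [T]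
      rw [← Finset.mul_sum]
      congr 1
      rw [Finset.sum_sub_distrib,
        Finset.sum_range_sub (fun j => f (t₀ + (u j : ℝ), Y (u j) w)) n]
      simp only [D]
      rw [hun, hu0]
      congr 1
      · have e1 := hw n le_rfl
        have e2 := hw 0 (Nat.zero_le _)
        rw [hun] at e1
        rw [hu0] at e2
        rw [e1, e2]
      · refine Finset.sum_congr rfl fun j hj => ?_
        have e2 : t₀ + s + j * (((t : ℝ) - s) / n) = t₀ + u j := by
          simp only [u]; push_cast; rw [hcast]; ring
        have e : (u (j + 1) : ℝ) - u j = ((t : ℝ) - s) / n := by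
          rw [hu, ← hcast]; push_cast; ring
        rw [e2, e, hw j (Finset.mem_range.1 hj).le]
    rw [heq]
    refine (Finset.abs_sum_le_sum_abs _ _).trans ((Finset.sum_le_sum hT).trans (le_of_eq ?_))
    rw [Finset.sum_const, Finset.card_range, nsmul_eq_mul, hcast]
    field_simp
  have hDlim : Tendsto (fun n => ∫ w, G (fun q => Y q w) * D n w ∂P) atTop
      (𝓝 (∫ w, G (fun q => Y q w) * (compProc t₀ X f g (t₀ + t) w -
        compProc t₀ X f g (t₀ + s) w) ∂P)) := by
    refine tendsto_integral_of_dominated_convergence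
      (fun _ => 1 * (Bf + Bf + Bg)) (fun n => ?_) (integrable_const _)
      (fun n => Eventually.of_forall fun w => ?_) (Eventually.of_forall fun w => ?_)
    · exact (hGm.mul (((hfm f hfc _).sub (hfm f hfc _)).sub
        (Finset.measurable_fun_sum _ fun j _ => (hfm g hg _).const_mul _))).aestronglyMeasurable
    · rw [Real.norm_eq_abs, abs_mul]
      refine mul_le_mul (hG1 _) ?_ (abs_nonneg _) zero_le_one
      refine (abs_sub _ _).trans (add_le_add ((abs_sub _ _).trans (add_le_add ?_ ?_)) ?_)
      · exact hBf _ ⟨hsub _ hst' le_rfl, by simpa using hρ' _ _⟩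
      · exact hBf _ ⟨hsub _ le_rfl hst', by simpa using hρ' _ _⟩
      · refine (Finset.abs_sum_le_sum_abs _ _).trans ?_
        have hterm : ∀ j ∈ Finset.range n, |((t : ℝ) - s) / n * g (t₀ + s + j * (((t : ℝ) - s) / n),
            X (t₀ + s + j * (((t : ℝ) - s) / n)) w)| ≤ 1 / n * Bg := by
          intro j hj
          have hn : (0 : ℝ) < n := by
            exact_mod_cast lt_of_le_of_lt (Nat.zero_le j) (Finset.mem_range.1 hj)
          have hj' : (j : ℝ) ≤ n := by exact_mod_cast (Finset.mem_range.1 hj).le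
          have h0 : 0 ≤ ((t : ℝ) - s) / n := div_nonneg (by linarith) hn.le
          have h1 : j * (((t : ℝ) - s) / n) ≤ t - s := by
            rw [mul_div_assoc', div_le_iff₀ hn]
            nlinarith
          rw [abs_mul, abs_of_nonneg h0]
          refine mul_le_mul ?_ (hBg _ ⟨?_, by simpa using hρ' _ _⟩) (abs_nonneg _) (by positivity)
          · gcongr; linarith
          · rw [add_assoc]
            exact hsub _ (by have := mul_nonneg (Nat.cast_nonneg (α := ℝ) j) h0
                             linarith) (by linarith)
        refine (Finset.sum_le_sum hterm).trans ?_
        rw [Finset.sum_const, Finset.card_range, nsmul_eq_mul]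
        rcases Nat.eq_zero_or_pos n with rfl | hn
        · simpa using hBg0
        · have hn : (0 : ℝ) < n := by exact_mod_cast hn
          rw [← mul_assoc, mul_one_div_cancel hn.ne', one_mul]
    · refine Tendsto.const_mul _ ?_
      have hc : Continuous fun r => g (r, X r w) := hg.comp (continuous_id.prodMk (hXc w))
      have := (tendsto_riemann_sum hc (by linarith : t₀ + (s : ℝ) ≤ t₀ + t)).const_sub
        (f (t₀ + t, X (t₀ + t) w) - f (t₀ + s, X (t₀ + s) w))
      rw [add_sub_add_left_eq_sub] at this
      refine this.trans (le_of_eq ?_)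
      congr 1
      have e := intervalIntegral.integral_add_adjacent_intervals (μ := volume)
        (hc.intervalIntegrable t₀ (t₀ + s)) (hc.intervalIntegrable (t₀ + s) (t₀ + t))
      simp only [compProc]
      linarith
  have hz : Tendsto (fun n : ℕ => K * ((t - s) * √(((t : ℝ) - s) / n))) atTop (𝓝 0) := by
    have h1 : Tendsto (fun n : ℕ => ((t : ℝ) - s) / n) atTop (𝓝 0) :=
      tendsto_const_div_atTop_nhds_zero_nat _
    have h2 := (((Real.continuous_sqrt.tendsto 0).comp h1).const_mul ((t : ℝ) - s)).const_mul K
    simpa using h2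
  have := le_of_tendsto_of_tendsto hDlim.abs hz (by
    filter_upwards [eventually_gt_atTop 0] with n hn
    exact hint n hn)
  exact abs_eq_zero.1 (le_antisymm this (abs_nonneg _))

end Construction

end StochHam

namespace StochHam

section Conditioning

/-- Bounded continuous test functions of `Z` suffice to see that `D` has zero mean on all events
that are determined by `Z`. -/
theorem setIntegral_preimage_eq_zero {Ω S : Type*} [MeasurableSpace Ω] {P : Measure Ω}
    [IsProbabilityMeasure P] [TopologicalSpace S] [MeasurableSpace S] [BorelSpace S]
    [HasOuterApproxClosed S] {D : Ω → ℝ} (hD : Measurable D) {c : ℝ} (hc : ∀ w, |D w| ≤ c)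
    {Z : Ω → S} (hZ : Measurable Z)
    (h : ∀ φ : BoundedContinuousFunction S ℝ, ∫ w, φ (Z w) * D w ∂P = 0) {B : Set S}
    (hB : MeasurableSet B) : ∫ w in Z ⁻¹' B, D w ∂P = 0 := by
  have hDc : ∀ w, 0 ≤ D w + c := fun w => by linarith [(abs_le.1 (hc w)).1]
  have hc0 : 0 ≤ c := (abs_nonneg _).trans (hc (Classical.choice P.nonempty_of_neZero))
  have hDi : Integrable D P := Integrable.of_bound hD.aestronglyMeasurable c
    (Eventually.of_forall hc)
  have hDci : Integrable (fun w => D w + c) P := hDi.add (integrable_const _)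
  have hm : Measurable fun w => ENNReal.ofReal (D w + c) := (hD.add_const c).ennreal_ofReal
  let ν₁ : Measure S := (P.withDensity fun w => ENNReal.ofReal (D w + c)).map Z
  let ν₂ : Measure S := (ENNReal.ofReal c • P).map Z
  have hf1 : IsFiniteMeasure (P.withDensity fun w => ENNReal.ofReal (D w + c)) :=
    isFiniteMeasure_withDensity_ofReal hDci.2
  have hf1' : IsFiniteMeasure ν₁ := Measure.isFiniteMeasure_map _ _
  have hf2 : IsFiniteMeasure (ENNReal.ofReal c • P) := Measure.smul_finite _ ENNReal.ofReal_ne_top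
  have hf2' : IsFiniteMeasure ν₂ := Measure.isFiniteMeasure_map _ _
  have hν : ν₁ = ν₂ := by
    refine ext_of_forall_integral_eq_of_IsFiniteMeasure fun φ => ?_
    have hφ : Measurable φ := φ.continuous.measurable
    have hφZ : Integrable (fun w => φ (Z w)) P :=
      Integrable.of_bound (hφ.comp hZ).aestronglyMeasurable ‖φ‖
        (Eventually.of_forall fun w => φ.norm_coe_le_norm _)
    have hφD : Integrable (fun w => φ (Z w) * D w) P := by
      exact hφZ.mul_bdd hD.aestronglyMeasurable (Eventually.of_forall hc)
    rw [integral_map hZ.aemeasurable hφ.aestronglyMeasurable,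
      integral_map hZ.aemeasurable hφ.aestronglyMeasurable, integral_smul_measure,
      integral_withDensity_eq_integral_toReal_smul hm
        (Eventually.of_forall fun _ => ENNReal.ofReal_lt_top), ENNReal.toReal_ofReal hc0]
    have e : ∀ w, (ENNReal.ofReal (D w + c)).toReal • φ (Z w) =
        φ (Z w) * D w + c * φ (Z w) := by
      intro w
      rw [ENNReal.toReal_ofReal (hDc w), smul_eq_mul]
      ring
    simp only [e]
    rw [integral_add hφD (hφZ.const_mul c), h φ, zero_add, integral_const_mul, smul_eq_mul]
  have hBe : ν₁ B = ν₂ B := by rw [hν]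
  simp only [ν₁, ν₂] at hBe
  rw [Measure.map_apply hZ hB, Measure.map_apply hZ hB, withDensity_apply _ (hZ hB),
    Measure.smul_apply, smul_eq_mul,
    ← ofReal_integral_eq_lintegral_ofReal hDci.integrableOn
      (Eventually.of_forall fun w => hDc w)] at hBe
  have h1 := congrArg ENNReal.toReal hBe
  rw [ENNReal.toReal_ofReal (integral_nonneg fun w => hDc w), ENNReal.toReal_mul,
    ENNReal.toReal_ofReal hc0, integral_add hDi.integrableOn (integrable_const _).integrableOn,
    setIntegral_const, smul_eq_mul, measureReal_def] at h1
  linarith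

end Conditioning

section Construction

universe u

variable {E : Type*} [NormedAddCommGroup E] [NormedSpace ℝ E] [FiniteDimensional ℝ E]
  [MeasurableSpace E] [BorelSpace E] {Ω : Type*} [mΩ : MeasurableSpace Ω] {P : Measure Ω}
  [IsProbabilityMeasure P] {κ : Type*} [Fintype κ] {b : ℝ × E → E} {σ : κ → ℝ × E → E} {t₀ : ℝ}
  {x₀ : E} {Y : ℚ → Ω → E}

theorem RationalSolution.setIntegral_compProc_eq [P.IsComplete]
    (h : RationalSolution P b σ t₀ x₀ Y) {f : ℝ × E → ℝ} (hf : ContDiff ℝ ∞ f)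
    (hg : Continuous (eulerGen b σ f)) {s t : ℚ} (hs : 0 ≤ s) (hst : s ≤ t) (ht : t ≤ 1)
    {A : Set Ω} (hA : MeasurableSet[eventuallyMeasurableSpace (pastSigma Y s) (ae P)] A) :
    ∫ w in A, compProc t₀ (contProc t₀ x₀ Y) f (eulerGen b σ f) (t₀ + t) w ∂P =
      ∫ w in A, compProc t₀ (contProc t₀ x₀ Y) f (eulerGen b σ f) (t₀ + s) w ∂P := by
  obtain ⟨A', hA', hAA⟩ := hA
  obtain ⟨ρ, hρ, hρ'⟩ := h.exists_bound
  obtain ⟨B, hB⟩ := exists_bound_compProc (Ω := Ω) t₀ hf.continuous hg ρ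
  have hXc : ∀ w, Continuous fun t => contProc t₀ x₀ Y t w := fun w =>
    (continuous_pathLim x₀ _).comp (continuous_id.sub continuous_const)
  have hs' : (0 : ℝ) ≤ s := by exact_mod_cast hs
  have hst' : (s : ℝ) ≤ t := by exact_mod_cast hst
  have ht' : (t : ℝ) ≤ 1 := by exact_mod_cast ht
  have hNm : ∀ r : ℝ, 0 ≤ r →
      Measurable (compProc t₀ (contProc t₀ x₀ Y) f (eulerGen b σ f) (t₀ + r)) := fun r hr =>
    (measurable_compProc hXc h.contProc_adapted hf.continuous hg (by linarith)).mono
      ((augmentedFiltration P Y h.measurable t₀).le _) le_rfl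
  have hNb : ∀ r : ℝ, 0 ≤ r → r ≤ 1 → ∀ w,
      |compProc t₀ (contProc t₀ x₀ Y) f (eulerGen b σ f) (t₀ + r) w| ≤ B :=
    fun r h0 h1 w => hB _ hρ' _ ⟨by linarith, by linarith⟩ w
  have hNi : ∀ r : ℝ, 0 ≤ r → r ≤ 1 →
      Integrable (compProc t₀ (contProc t₀ x₀ Y) f (eulerGen b σ f) (t₀ + r)) P :=
    fun r h0 h1 => Integrable.of_bound (hNm r h0).aestronglyMeasurable B
      (Eventually.of_forall (hNb r h0 h1))
  rw [setIntegral_congr_set hAA, setIntegral_congr_set hAA, ← sub_eq_zero,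
    ← integral_sub (hNi t (by linarith) ht').integrableOn (hNi s hs' (by linarith)).integrableOn]
  -- `A'` is determined by the values up to time `s`
  let S := {q : ℚ // (q : ℝ) ≤ s} → E
  let Z : Ω → S := fun w q => Y q.1 w
  have hZ : Measurable Z := measurable_pi_lambda _ fun q => h.measurable _
  have hle : pastSigma Y s ≤ MeasurableSpace.comap Z inferInstance := by
    refine iSup_le fun q => ?_
    have : Y q.1 = (fun y : S => y q) ∘ Z := rfl
    rw [this, ← MeasurableSpace.comap_comp]
    exact MeasurableSpace.comap_mono (measurable_pi_apply q).comap_le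
  obtain ⟨B', hB', rfl⟩ := hle _ hA'
  let _ : PseudoMetricSpace S := TopologicalSpace.pseudoMetrizableSpacePseudoMetric S
  refine setIntegral_preimage_eq_zero ((hNm t (by linarith)).sub (hNm s hs')) (c := B + B)
    (fun w => (abs_sub _ _).trans (add_le_add (hNb t (by linarith) ht' w)
      (hNb s hs' (by linarith) w))) hZ (fun φ => ?_) hB'
  set m := ‖φ‖ + 1 with hm
  have hm0 : 0 < m := by positivity
  have key := h.integral_compProc_eq hf hg hs hst ht
    (G := fun y => m⁻¹ * φ fun q => y q.1) (by fun_prop) (fun y => by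
      rw [abs_mul, abs_of_pos (inv_pos.2 hm0), inv_mul_le_iff₀ hm0, mul_one]
      exact (φ.norm_coe_le_norm _).trans (by linarith))
    (fun y y' hy => by
      have e : (fun q : {q : ℚ // (q : ℝ) ≤ s} => y q.1) = fun q => y' q.1 :=
        funext fun q => hy q.1 (by exact_mod_cast q.2)
      simp only [e])
  simp only [mul_assoc] at key
  rw [integral_const_mul] at key
  exact (mul_eq_zero.1 key).resolve_left (inv_ne_zero hm0.ne')

/-- The continuous process solves the martingale problem. -/
theorem RationalSolution.martingaleSolution [P.IsComplete] (h : RationalSolution P b σ t₀ x₀ Y)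
    (hg : ∀ f : ℝ × E → ℝ, ContDiff ℝ ∞ f → Continuous (eulerGen b σ f)) :
    MartingaleSolution (augmentedFiltration P Y h.measurable t₀) P (eulerGen b σ) t₀ x₀
      (contProc t₀ x₀ Y) := by
  have hXc : ∀ w, Continuous fun t => contProc t₀ x₀ Y t w := fun w =>
    (continuous_pathLim x₀ _).comp (continuous_id.sub continuous_const)
  obtain ⟨ρ, hρ, hρ'⟩ := h.exists_bound
  refine ⟨hXc, h.contProc_adapted, fun w => pathLim_of_nonpos _ _ (by linarith), ⟨ρ, hρ'⟩, ?_⟩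
  intro f hf s t hs hst ht A hA
  rcases hst.eq_or_lt with rfl | hst'
  · rfl
  obtain ⟨B, hB⟩ := exists_bound_compProc (Ω := Ω) t₀ hf.continuous (hg f hf) ρ
  set N := compProc t₀ (contProc t₀ x₀ Y) f (eulerGen b σ f) with hN
  have hNm : ∀ r : ℝ, t₀ ≤ r → Measurable (N r) := fun r hr =>
    (measurable_compProc hXc h.contProc_adapted hf.continuous (hg f hf) hr).mono
      ((augmentedFiltration P Y h.measurable t₀).le _) le_rfl
  have hcont : ContinuousOn (fun r => ∫ w in A, N r w ∂P) (Icc s t) := by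
    refine continuousOn_of_dominated (bound := fun _ => B)
      (fun r hr => (hNm r (hs.trans hr.1)).aestronglyMeasurable)
      (fun r hr => Eventually.of_forall fun w => ?_) (integrable_const _)
      (Eventually.of_forall fun w => (continuous_compProc hf.continuous (hg f hf)
        (hXc w)).continuousOn)
    exact hB _ hρ' r ⟨hs.trans hr.1, hr.2.trans ht⟩ w
  -- at rational times after `s` the mean over `A` is constant
  have hrat : ∀ p q : ℚ, s < t₀ + p → p ≤ q → t₀ + q ≤ t →
      ∫ w in A, N (t₀ + q) w ∂P = ∫ w in A, N (t₀ + p) w ∂P := by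
    intro p q hp hpq hq
    have hpq' : (p : ℝ) ≤ q := by exact_mod_cast hpq
    refine h.setIntegral_compProc_eq hf (hg f hf) ?_ hpq ?_ ?_
    · exact_mod_cast (by linarith : (0 : ℝ) ≤ p)
    · exact_mod_cast (by linarith : (q : ℝ) ≤ 1)
    · have := measurableSet_augmentedFiltration.1 hA (t₀ + p) hp
      rwa [add_sub_cancel_left] at this
  obtain ⟨p, hp1, hp2⟩ := exists_rat_btwn (by linarith : s - t₀ < t - t₀)
  have hdense : Dense (range fun q : ℚ => t₀ + (q : ℝ)) := by
    exact ((Homeomorph.addLeft t₀).surjective.denseRange).comp (Rat.denseRange_cast (𝕜 := ℝ))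
      (Homeomorph.addLeft t₀).continuous
  have hEq : EqOn (fun r => ∫ w in A, N r w ∂P) (fun _ => ∫ w in A, N (t₀ + p) w ∂P)
      (Icc s t) := by
    refine EqOn.of_subset_closure (s := Ioo s t ∩ range fun q : ℚ => t₀ + (q : ℝ)) ?_ hcont
      continuousOn_const (inter_subset_left.trans Ioo_subset_Icc_self) ?_
    · rintro _ ⟨hr, q, rfl⟩
      rcases le_total p q with hpq | hpq
      · exact hrat p q (by linarith) hpq hr.2.le
      · exact (hrat q p hr.1 hpq (by linarith)).symm
    · rw [← closure_Ioo hst'.ne]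
      exact closure_minimal (hdense.open_subset_closure_inter isOpen_Ioo) isClosed_closure
  have e1 := hEq ⟨hst, le_rfl⟩
  have e2 := hEq ⟨le_rfl, hst⟩
  exact e1.trans e2.symm

/-- Passing to the completion of the probability space. -/
theorem RationalSolution.completion (h : RationalSolution P b σ t₀ x₀ Y)
    (hg : ∀ f : ℝ × E → ℝ, ContDiff ℝ ∞ f → Continuous (eulerGen b σ f)) :
    RationalSolution (Ω := NullMeasurableSpace Ω P) P.completion b σ t₀ x₀ Y := by
  have hid : @Measurable (NullMeasurableSpace Ω P) Ω _ mΩ id :=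
    fun s hs => hs.nullMeasurableSet
  have hmap : @Measure.map (NullMeasurableSpace Ω P) Ω _ mΩ id P.completion = P := by
    ext s hs
    rw [Measure.map_apply hid hs]
    rfl
  have hint : ∀ F : Ω → ℝ, Measurable F → ∫ w, F w ∂P.completion = ∫ w, F w ∂P := by
    intro F hF
    conv_rhs => rw [← hmap]
    rw [integral_map hid.aemeasurable hF.aestronglyMeasurable]
    rfl
  refine ⟨fun q => (h.measurable q).comp hid, h.bounded, fun q hq => h.start q hq, ?_, ?_⟩
  · obtain ⟨K, hK0, hK⟩ := h.moment
    refine ⟨K, hK0, fun s t hs hst ht => ?_⟩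
    exact (hint _ (((h.measurable t).sub (h.measurable s)).norm.pow_const 4)).trans_le
      (hK s t hs hst ht)
  · intro f hf
    obtain ⟨K, hK0, hK⟩ := h.martingale f hf
    refine ⟨K, hK0, fun s t hs hst ht G hG hG1 hGs => ?_⟩
    have hYm : ∀ (φ : ℝ × E → ℝ), Continuous φ → ∀ (r : ℝ) q,
        Measurable fun w => φ (r, Y q w) :=
      fun φ hφ r q => (by fun_prop : Continuous fun x => φ (r, x)).measurable.comp
        (h.measurable q)
    exact (congrArg abs (hint _ ((hG.measurable.comp (measurable_pi_lambda _ h.measurable)).mul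
      (((hYm f hf.continuous _ _).sub (hYm f hf.continuous _ _)).sub
        ((hYm _ (hg f hf) _ _).const_mul _))))).trans_le
      (hK s t hs hst ht G hG hG1 hGs)

end Construction

/-! ### Factorization of the diffusion matrix -/

section Factorization

open scoped MatrixOrder Matrix.Norms.L2Operator

variable {E : Type*} [NormedAddCommGroup E] [NormedSpace ℝ E]

/-- A functional on bilinear forms that is nonnegative on the squares `ℓ ⊗ ℓ` acts on symmetric
forms as half a sum of evaluations on the diagonal. -/
theorem exists_diagonal_sum {d : ℕ} {ℓ : Fin d → E →L[ℝ] ℝ} {e : Fin d → E}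
    (hx : ∀ x, x = ∑ i, ℓ i x • e i) {α : Bilin E →L[ℝ] ℝ}
    (hα : ∀ m : E →L[ℝ] ℝ, 0 ≤ α (m.smulRight m)) :
    ∃ v : Fin d → E, (∀ β : Bilin E, (∀ x y, β x y = β y x) →
      α β = (1 / 2) * ∑ k, β (v k) (v k)) ∧
      ∀ k, ‖v k‖ ≤ ∑ i, (1 + 2 * (‖α‖ * (‖ℓ i‖ * ‖ℓ i‖))) * ‖e i‖ := by
  let a : Matrix (Fin d) (Fin d) ℝ := fun i j =>
    α ((ℓ i).smulRight (ℓ j)) + α ((ℓ j).smulRight (ℓ i))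
  have ha : a.PosSemidef := by
    refine Matrix.PosSemidef.of_dotProduct_mulVec_nonneg ?_ fun x => ?_
    · ext i j
      change star (a j i) = a i j
      simp [a, add_comm]
    · have h0 := hα (∑ i, x i • ℓ i)
      have h1 : (∑ i, x i • ℓ i).smulRight (∑ i, x i • ℓ i) =
          ∑ i, ∑ j, (x i * x j) • (ℓ i).smulRight (ℓ j) := by
        ext u v
        simp only [ContinuousLinearMap.smulRight_apply, FunLike.coe_sum, Finset.sum_apply,
          smul_apply, smul_eq_mul, Finset.sum_mul_sum]
        refine Finset.sum_congr rfl fun i _ => Finset.sum_congr rfl fun j _ => ?_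
        ring
      rw [h1] at h0
      simp only [map_sum, map_smul, smul_eq_mul] at h0
      have h2 : ∑ i, ∑ j, x i * x j * α ((ℓ j).smulRight (ℓ i)) =
          ∑ i, ∑ j, x i * x j * α ((ℓ i).smulRight (ℓ j)) := by
        rw [Finset.sum_comm]
        refine Finset.sum_congr rfl fun i _ => Finset.sum_congr rfl fun j _ => ?_
        ring
      have h3 : star x ⬝ᵥ a.mulVec x = ∑ i, ∑ j, x i * x j * α ((ℓ i).smulRight (ℓ j)) +
          ∑ i, ∑ j, x i * x j * α ((ℓ j).smulRight (ℓ i)) := by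
        rw [← Finset.sum_add_distrib]
        simp only [dotProduct, Matrix.mulVec, a, Finset.mul_sum, ← Finset.sum_add_distrib]
        refine Finset.sum_congr rfl fun i _ => Finset.sum_congr rfl fun j _ => ?_
        simp
        ring
      rw [h3, h2]
      linarith
  obtain ⟨B, hB⟩ := CStarAlgebra.nonneg_iff_eq_star_mul_self.1 ha.nonneg
  have hBij : ∀ i j, a i j = ∑ k, B k i * B k j := by
    intro i j
    rw [hB]
    simp [Matrix.mul_apply]
  refine ⟨fun k => ∑ i, B k i • e i, fun β hβ => ?_, fun k => ?_⟩
  · have hβe : β = ∑ i, ∑ j, β (e i) (e j) • (ℓ i).smulRight (ℓ j) := by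
      ext u v
      conv_lhs => rw [hx u, hx v]
      simp only [map_sum, map_smul, FunLike.coe_sum, Finset.sum_apply, smul_apply, smul_eq_mul,
        ContinuousLinearMap.smulRight_apply, Finset.mul_sum]
      rw [Finset.sum_comm]
      refine Finset.sum_congr rfl fun i _ => Finset.sum_congr rfl fun j _ => ?_
      ring
    have h1 : α β = ∑ i, ∑ j, β (e i) (e j) * α ((ℓ i).smulRight (ℓ j)) := by
      conv_lhs => rw [hβe]
      simp only [map_sum, map_smul, smul_eq_mul]
    have h2 : ∑ k, β (∑ i, B k i • e i) (∑ i, B k i • e i) =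
        ∑ i, ∑ j, β (e i) (e j) * a i j := by
      have : ∀ k, β (∑ i, B k i • e i) (∑ i, B k i • e i) =
          ∑ i, ∑ j, β (e i) (e j) * (B k i * B k j) := by
        intro k
        simp only [map_sum, map_smul, FunLike.coe_sum, Finset.sum_apply, smul_apply, smul_eq_mul,
          Finset.mul_sum]
        rw [Finset.sum_comm]
        refine Finset.sum_congr rfl fun i _ => Finset.sum_congr rfl fun j _ => ?_
        ring
      simp only [this, hBij, Finset.mul_sum]
      rw [Finset.sum_comm]
      refine Finset.sum_congr rfl fun i _ => ?_
      rw [Finset.sum_comm]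
    have h3 : ∑ i, ∑ j, β (e i) (e j) * α ((ℓ j).smulRight (ℓ i)) =
        ∑ i, ∑ j, β (e i) (e j) * α ((ℓ i).smulRight (ℓ j)) := by
      rw [Finset.sum_comm]
      refine Finset.sum_congr rfl fun i _ => Finset.sum_congr rfl fun j _ => ?_
      rw [hβ]
    rw [h2, h1]
    simp only [a, mul_add, Finset.sum_add_distrib]
    rw [h3]
    ring
  · refine (norm_sum_le _ _).trans (Finset.sum_le_sum fun i _ => ?_)
    rw [norm_smul, Real.norm_eq_abs]
    refine mul_le_mul_of_nonneg_right ?_ (norm_nonneg _)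
    have h1 : B k i * B k i ≤ a i i := by
      rw [hBij]
      exact Finset.single_le_sum (f := fun k => B k i * B k i) (fun k _ => mul_self_nonneg _)
        (Finset.mem_univ k)
    have h2 : a i i ≤ 2 * (‖α‖ * (‖ℓ i‖ * ‖ℓ i‖)) := by
      have h3 := (le_abs_self _).trans (α.le_opNorm ((ℓ i).smulRight (ℓ i)))
      have h4 : ‖(ℓ i).smulRight (ℓ i)‖ = ‖ℓ i‖ * ‖ℓ i‖ :=
        ContinuousLinearMap.norm_smulRight_apply _ _
      rw [h4] at h3
      simp only [a]
      linarith
    have h5 := abs_mul_abs_self (B k i)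
    nlinarith [sq_nonneg (|B k i| - 1), abs_nonneg (B k i)]

end Factorization

section Existence

universe u

variable {E : Type*} [NormedAddCommGroup E] [NormedSpace ℝ E]

/-- The second derivative of `f` at `z` in the space directions. -/
noncomputable def spaceHess (f : ℝ × E → ℝ) (z : ℝ × E) : Bilin E :=
  (fderiv ℝ (fderiv ℝ f) z).bilinearComp (ContinuousLinearMap.inr ℝ ℝ E)
    (ContinuousLinearMap.inr ℝ ℝ E)

theorem spaceHess_apply (f : ℝ × E → ℝ) (z : ℝ × E) (u v : E) :
    spaceHess f z u v = fderiv ℝ (fderiv ℝ f) z (0, u) (0, v) := rfl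

/-- The operator `∂_t f + D_x f(b) + α(D_x² f)`. -/
noncomputable def diffGen (b : ℝ × E → E) (α : ℝ × E → Bilin E →L[ℝ] ℝ) (f : ℝ × E → ℝ)
    (z : ℝ × E) : ℝ :=
  fderiv ℝ f z (1, b z) + α z (spaceHess f z)

theorem contDiff_spaceHess {f : ℝ × E → ℝ} (hf : ContDiff ℝ ∞ f) :
    ContDiff ℝ ∞ (spaceHess f) := by
  have h2 : ContDiff ℝ ∞ (fderiv ℝ (fderiv ℝ f)) :=
    (hf.fderiv_right (m := ∞) (by norm_cast)).fderiv_right (by norm_cast)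
  have e : spaceHess f = fun z =>
      (ContinuousLinearMap.compL ℝ E (ℝ × E) ℝ).flip (ContinuousLinearMap.inr ℝ ℝ E) ∘L
        ((fderiv ℝ (fderiv ℝ f) z) ∘L (ContinuousLinearMap.inr ℝ ℝ E)) := by
    funext z
    ext u v
    rfl
  rw [e]
  exact contDiff_const.clm_comp (h2.clm_comp contDiff_const)

theorem contDiff_diffGen {b : ℝ × E → E} {α : ℝ × E → Bilin E →L[ℝ] ℝ} (hb : ContDiff ℝ ∞ b)
    (hα : ContDiff ℝ ∞ α) {f : ℝ × E → ℝ} (hf : ContDiff ℝ ∞ f) :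
    ContDiff ℝ ∞ (diffGen b α f) := by
  have h1 : ContDiff ℝ ∞ (fderiv ℝ f) := hf.fderiv_right (by norm_cast)
  exact (h1.clm_apply (contDiff_const.prodMk hb)).add (hα.clm_apply (contDiff_spaceHess hf))

/-- Existence for the martingale problem with smooth compactly supported coefficients; the diffusion
matrix may be degenerate. -/
theorem exists_martingaleSolution [FiniteDimensional ℝ E] [MeasurableSpace E] [BorelSpace E]
    {b : ℝ × E → E} {α : ℝ × E → Bilin E →L[ℝ] ℝ} (hb : ContDiff ℝ ∞ b) (hα : ContDiff ℝ ∞ α)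
    (hbc : HasCompactSupport b) (hαc : HasCompactSupport α)
    (hpos : ∀ z (m : E →L[ℝ] ℝ), 0 ≤ α z (m.smulRight m)) (t₀ : ℝ) (x₀ : E) :
    ∃ (Ω : Type u) (mΩ : MeasurableSpace Ω) (P : Measure Ω) (_ : IsProbabilityMeasure P)
      (ℱ : Filtration ℝ mΩ), UsualConditions ℱ P ∧ ∃ X : ℝ → Ω → E,
      MartingaleSolution ℱ P (diffGen b α) t₀ x₀ X := by
  classical
  obtain ⟨d, ℓ, e, hx, -⟩ := exists_functionals (E := E)
  choose v hv hvb using fun z => exists_diagonal_sum hx (hpos z)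
  let σ : Option (Fin d) → ℝ × E → E := fun k z =>
    if α z = 0 then 0 else k.elim 0 fun i => v z i
  have hσ : ∀ z β, (∀ x y, β x y = β y x) → α z β = (1 / 2) * ∑ k, β (σ k z) (σ k z) := by
    intro z β hβ
    by_cases h : α z = 0
    · simp [σ, h]
    · rw [hv z β hβ, Fintype.sum_option]
      simp [σ, h]
  have hgen : ∀ f : ℝ × E → ℝ, ContDiff ℝ ∞ f → eulerGen b σ f = diffGen b α f := by
    intro f hf
    funext z
    rw [eulerGen, diffGen, hσ z (spaceHess f z)]
    · rfl
    · intro x y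
      exact (hf.contDiffAt.isSymmSndFDerivAt (by simp; norm_cast)).eq _ _
  obtain ⟨Cb, hCb⟩ := hbc.exists_bound_of_continuous hb.continuous
  obtain ⟨Cα, hCα⟩ := hαc.exists_bound_of_continuous hα.continuous
  have hCα0 : 0 ≤ Cα := (norm_nonneg _).trans (hCα (t₀, x₀))
  obtain ⟨R₁, hR₁⟩ := hbc.isCompact.isBounded.subset_closedBall 0
  obtain ⟨R₂, hR₂⟩ := hαc.isCompact.isBounded.subset_closedBall 0
  have hzero : ∀ t x, max (max R₁ R₂) ‖x₀‖ < ‖x‖ → b (t, x) = 0 ∧ α (t, x) = 0 := by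
    intro t x hxx
    have hn : ‖x‖ ≤ ‖(t, x)‖ := le_max_right _ _
    constructor
    · by_contra hne
      have := hR₁ (subset_tsupport _ hne)
      rw [mem_closedBall_zero_iff] at this
      linarith [(le_max_left R₁ R₂).trans (le_max_left _ ‖x₀‖)]
    · by_contra hne
      have := hR₂ (subset_tsupport _ hne)
      rw [mem_closedBall_zero_iff] at this
      linarith [(le_max_right R₁ R₂).trans (le_max_left _ ‖x₀‖)]
  set Cσ : ℝ := ∑ i, (1 + 2 * (Cα * (‖ℓ i‖ * ‖ℓ i‖))) * ‖e i‖ with hCσ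
  have hCσ0 : 0 ≤ Cσ := Finset.sum_nonneg fun i _ => by positivity
  have hcoef : BoundedCoeff b σ (max (max R₁ R₂) ‖x₀‖) (max Cb Cσ) := by
    refine ⟨(norm_nonneg x₀).trans (le_max_right _ _), hCσ0.trans (le_max_right _ _),
      fun z => (hCb z).trans (le_max_left _ _), fun k z => ?_, fun t x h => (hzero t x h).1,
      fun k t x h => by simp [σ, (hzero t x h).2]⟩
    refine le_trans ?_ (le_max_right _ _)
    by_cases h : α z = 0
    · simpa [σ, h] using hCσ0
    · cases k with
      | none => simpa [σ] using hCσ0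
      | some i =>
        simp only [σ, h, if_false, Option.elim]
        refine (hvb z i).trans (Finset.sum_le_sum fun j _ => ?_)
        have := hCα z
        gcongr
  have hgen1 : ∀ f : ℝ × E → ℝ, ContDiff ℝ ∞ f → ContDiff ℝ ∞ (eulerGen b σ f) := by
    intro f hf
    rw [hgen f hf]
    exact contDiff_diffGen hb hα hf
  obtain ⟨Ω, mΩ, P, hP, Y, hY⟩ := hcoef.exists_rationalSolution.{u} (le_max_right _ _) t₀
    fun f hf => (hgen1 f hf).of_le (by simp)
  have hY' := hY.completion fun f hf => (hgen1 f hf).continuous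
  have hP' : IsProbabilityMeasure P.completion := ⟨by
    change P univ = 1
    exact hP.measure_univ⟩
  have hsol := hY'.martingaleSolution fun f hf => (hgen1 f hf).continuous
  refine ⟨NullMeasurableSpace Ω P, inferInstance, P.completion, hP', _,
    usualConditions_augmentedFiltration, _, hsol.continuous, hsol.adapted, hsol.start,
    hsol.bounded, fun f hf => ?_⟩
  rw [← hgen f hf]
  exact hsol.increments f hf

end Existence

end StochHam

namespace StochHam

/-! ### Optional stopping for bounded continuous martingales -/

section OptionalStopping

/-- The increments of `φ` over the cells of the partition `s, s + δ, …, s + m δ` whose left end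
point precedes `a` add up to an increment of `φ`, between `s` and nearly `a`. -/
theorem exists_sum_increments_eq (φ : ℝ → ℝ) (s a : ℝ) {δ : ℝ} (hδ : 0 ≤ δ) (m : ℕ) :
    ∃ x, ∑ k ∈ Finset.range m,
        (if s + k * δ < a then φ (s + (k + 1 : ℕ) * δ) - φ (s + k * δ) else 0) = φ x - φ s ∧
      s ≤ x ∧ x ≤ s + m * δ ∧ min (s + m * δ) (max s a) ≤ x ∧
      x ≤ min (s + m * δ) (max s a) + δ ∧ (s + m * δ < a → x = s + m * δ) := by
  induction m with
  | zero =>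
    refine ⟨s, by simp, le_rfl, by simp, by simp, ?_, fun _ => by simp⟩
    simp [hδ]
  | succ m ih =>
    obtain ⟨x, h1, h2, h3, h4, h5, h6⟩ := ih
    have hm : (0 : ℝ) ≤ m * δ := by positivity
    rw [Finset.sum_range_succ, h1]
    have e : s + ((m + 1 : ℕ) : ℝ) * δ = s + m * δ + δ := by push_cast; ring
    by_cases ha : s + m * δ < a
    · have hx := h6 ha
      rw [if_pos ha, hx]
      refine ⟨s + ((m + 1 : ℕ) : ℝ) * δ, by ring, ?_, le_rfl, min_le_left _ _, ?_, fun _ => rfl⟩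
      · rw [e]; linarith
      · have : s + m * δ ≤ min (s + ((m + 1 : ℕ) : ℝ) * δ) (max s a) :=
          le_min (by rw [e]; linarith) (ha.le.trans (le_max_right _ _))
        rw [e] at this ⊢
        linarith
    · have ha' := not_lt.1 ha
      have hmax : max s a ≤ s + m * δ := max_le (by linarith) ha'
      rw [min_eq_right hmax] at h4 h5
      have hmax' : max s a ≤ s + ((m + 1 : ℕ) : ℝ) * δ := by rw [e]; linarith
      rw [if_neg ha, add_zero, min_eq_right hmax']
      refine ⟨x, rfl, h2, by rw [e]; linarith, h4, h5, fun h => ?_⟩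
      rw [e] at h
      linarith

/-- For continuous `φ`, the sums of increments over the cells that start before `a` converge when
the partition of `[s, t]` is refined. -/
theorem tendsto_sum_increments {φ : ℝ → ℝ} (hφ : Continuous φ) {s t : ℝ} (hst : s ≤ t) (a : ℝ) :
    Tendsto (fun n : ℕ => ∑ k ∈ Finset.range (n + 1),
      (if s + k * ((t - s) / (n + 1 : ℕ)) < a then φ (s + (k + 1 : ℕ) * ((t - s) / (n + 1 : ℕ))) -
        φ (s + k * ((t - s) / (n + 1 : ℕ))) else 0)) atTop (𝓝 (φ (min t (max s a)) - φ s)) := by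
  have hδ : ∀ n : ℕ, 0 ≤ (t - s) / (n + 1 : ℕ) := fun n =>
    div_nonneg (by linarith) (by positivity)
  choose x hx1 hx2 hx3 hx4 hx5 hx6 using fun n : ℕ => exists_sum_increments_eq φ s a (hδ n) (n + 1)
  have hend : ∀ n : ℕ, s + ((n + 1 : ℕ) : ℝ) * ((t - s) / (n + 1 : ℕ)) = t := by
    intro n
    have : ((n + 1 : ℕ) : ℝ) ≠ 0 := by positivity
    field_simp
    ring
  simp only [hx1]
  simp only [hend] at hx4 hx5
  have hlim : Tendsto x atTop (𝓝 (min t (max s a))) := by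
    refine tendsto_of_tendsto_of_tendsto_of_le_of_le tendsto_const_nhds
      (h := fun n : ℕ => min t (max s a) + (t - s) / (n + 1 : ℕ)) ?_ hx4 hx5
    have h1 : Tendsto (fun n : ℕ => (t - s) / (n + 1 : ℕ)) atTop (𝓝 0) :=
      (tendsto_const_div_atTop_nhds_zero_nat (t - s)).comp (tendsto_add_atTop_nat 1)
    simpa using tendsto_const_nhds.add h1
  exact ((hφ.tendsto _).comp hlim).sub_const _

variable {Ω : Type*} [mΩ : MeasurableSpace Ω]

/-- A bounded martingale with continuous paths, on the time interval `[t₀, t₀ + 1]`. -/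
structure IsBoundedMartingale (ℱ : Filtration ℝ mΩ) (P : Measure Ω) (t₀ : ℝ) (N : ℝ → Ω → ℝ) :
    Prop where
  continuous : ∀ w, Continuous fun t => N t w
  adapted : ∀ t, t₀ ≤ t → Measurable[ℱ t] (N t)
  bounded : ∃ B, ∀ t ∈ Icc t₀ (t₀ + 1), ∀ w, |N t w| ≤ B
  increments : ∀ s t, t₀ ≤ s → s ≤ t → t ≤ t₀ + 1 → ∀ A, MeasurableSet[ℱ s] A →
    ∫ w in A, N t w ∂P = ∫ w in A, N s w ∂P

variable {ℱ : Filtration ℝ mΩ} {P : Measure Ω} {t₀ : ℝ} {N : ℝ → Ω → ℝ} {σ : Ω → ℝ}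

theorem measurableSet_lt_stopping (hσ : IsStoppingTime ℱ (fun w => (σ w : WithTop ℝ))) (u : ℝ) :
    MeasurableSet[ℱ u] {w | u < σ w} := by
  have h := (hσ u).compl
  convert h using 1
  ext w
  simp

theorem IsBoundedMartingale.measurable_stopped (hN : IsBoundedMartingale ℱ P t₀ N)
    (hσ : IsStoppingTime ℱ (fun w => (σ w : WithTop ℝ))) (hσ0 : ∀ w, t₀ ≤ σ w) {t : ℝ}
    (ht : t₀ ≤ t) : Measurable[ℱ t] fun w => N (min t (σ w)) w := by
  have hδ : ∀ n : ℕ, 0 ≤ (t - t₀) / (n + 1 : ℕ) := fun n =>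
    div_nonneg (by linarith) (by positivity)
  have hle : ∀ n k : ℕ, k ≤ n + 1 → t₀ + k * ((t - t₀) / (n + 1 : ℕ)) ≤ t := by
    intro n k hk
    have h1 : (k : ℝ) * ((t - t₀) / (n + 1 : ℕ)) ≤ ((n + 1 : ℕ) : ℝ) * ((t - t₀) / (n + 1 : ℕ)) :=
      mul_le_mul_of_nonneg_right (by exact_mod_cast hk) (hδ n)
    rw [mul_div_cancel₀ _ (by positivity)] at h1
    linarith
  have hge : ∀ n k : ℕ, t₀ ≤ t₀ + k * ((t - t₀) / (n + 1 : ℕ)) := fun n k => by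
    have := mul_nonneg k.cast_nonneg (hδ n)
    linarith
  have hlim := fun w => tendsto_sum_increments (hN.continuous w) ht (σ w)
  simp only [max_eq_right (hσ0 _)] at hlim
  have h1 : Measurable[ℱ t] fun w => N (min t (σ w)) w - N t₀ w := by
    refine @measurable_of_tendsto_metrizable Ω ℝ (ℱ t) _ _ _ _ _ _ (fun n => ?_)
      (tendsto_pi_nhds.2 hlim)
    refine Finset.measurable_sum _ fun k hk => ?_
    have hk' : k + 1 ≤ n + 1 := by have := Finset.mem_range.1 hk; omega
    refine Measurable.ite (ℱ.mono (hle n k (by omega)) _ (measurableSet_lt_stopping hσ _)) ?_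
      measurable_const
    exact Measurable.sub ((hN.adapted _ (hge _ _)).mono (ℱ.mono (hle _ _ hk')) le_rfl)
      ((hN.adapted _ (hge _ _)).mono (ℱ.mono (hle _ _ (by omega))) le_rfl)
  have h2 : Measurable[ℱ t] (N t₀) := (hN.adapted t₀ le_rfl).mono (ℱ.mono ht) le_rfl
  have h3 := Measurable.add h1 h2
  convert h3 using 2
  simp

theorem IsBoundedMartingale.setIntegral_stopped_eq [IsProbabilityMeasure P]
    (hN : IsBoundedMartingale ℱ P t₀ N)
    (hσ : IsStoppingTime ℱ (fun w => (σ w : WithTop ℝ))) (hσ0 : ∀ w, t₀ ≤ σ w) {s t : ℝ}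
    (hs : t₀ ≤ s) (hst : s ≤ t) (ht : t ≤ t₀ + 1) {A : Set Ω} (hA : MeasurableSet[ℱ s] A) :
    ∫ w in A, N (min t (σ w)) w ∂P = ∫ w in A, N (min s (σ w)) w ∂P := by
  obtain ⟨B, hB⟩ := hN.bounded
  have hδ : ∀ n : ℕ, 0 ≤ (t - s) / (n + 1 : ℕ) := fun n =>
    div_nonneg (by linarith) (by positivity)
  have hle : ∀ n k : ℕ, k ≤ n + 1 → s + k * ((t - s) / (n + 1 : ℕ)) ≤ t := by
    intro n k hk
    have h1 : (k : ℝ) * ((t - s) / (n + 1 : ℕ)) ≤ ((n + 1 : ℕ) : ℝ) * ((t - s) / (n + 1 : ℕ)) :=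
      mul_le_mul_of_nonneg_right (by exact_mod_cast hk) (hδ n)
    rw [mul_div_cancel₀ _ (by positivity)] at h1
    linarith
  have hge : ∀ n k : ℕ, s ≤ s + k * ((t - s) / (n + 1 : ℕ)) := fun n k => by
    have := mul_nonneg k.cast_nonneg (hδ n)
    linarith
  have hNm : ∀ u, t₀ ≤ u → Measurable (N u) := fun u hu =>
    (hN.adapted u hu).mono (ℱ.le _) le_rfl
  have hNi : ∀ u, t₀ ≤ u → u ≤ t₀ + 1 → Integrable (N u) P := fun u h0 h1 =>
    Integrable.of_bound (hNm u h0).aestronglyMeasurable B (Eventually.of_forall (hB u ⟨h0, h1⟩))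
  have hVi : ∀ u, t₀ ≤ u → u ≤ t₀ + 1 → Integrable (fun w => N (min u (σ w)) w) P := by
    intro u h0 h1
    exact Integrable.of_bound ((hN.measurable_stopped hσ hσ0 h0).mono (ℱ.le _)
      le_rfl).aestronglyMeasurable B (Eventually.of_forall fun w =>
        hB _ ⟨le_min h0 (hσ0 w), (min_le_left _ _).trans h1⟩ w)
  -- on each cell that starts before `σ`, the increment has zero mean
  have hcell : ∀ n k : ℕ, k < n + 1 → ∫ w in A, (if s + k * ((t - s) / (n + 1 : ℕ)) < σ w then
      N (s + (k + 1 : ℕ) * ((t - s) / (n + 1 : ℕ))) w - N (s + k * ((t - s) / (n + 1 : ℕ))) w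
        else 0) ∂P = 0 := by
    intro n k hk
    set u := s + k * ((t - s) / (n + 1 : ℕ)) with hu
    set v := s + (k + 1 : ℕ) * ((t - s) / (n + 1 : ℕ)) with hv
    have huv : u ≤ v := by
      have := hδ n
      rw [hu, hv]; push_cast at this ⊢
      nlinarith
    have hu0 : t₀ ≤ u := hs.trans (hge n k)
    have hv1 : v ≤ t₀ + 1 := (hle n (k + 1) (by omega)).trans ht
    have hm : MeasurableSet[ℱ u] {w | u < σ w} := measurableSet_lt_stopping hσ u
    have e : (fun w => if u < σ w then N v w - N u w else 0) =
        {w | u < σ w}.indicator fun w => N v w - N u w := by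
      funext w
      simp [indicator_apply]
    rw [e, setIntegral_indicator (ℱ.le u _ hm),
      integral_sub (hNi v (hu0.trans huv) hv1).integrableOn
        (hNi u hu0 (huv.trans hv1)).integrableOn,
      hN.increments u v hu0 huv hv1 _ ((ℱ.mono (hge n k) _ hA).inter hm), sub_self]
  have hlim : Tendsto (fun n : ℕ => ∫ w in A, ∑ k ∈ Finset.range (n + 1),
      (if s + k * ((t - s) / (n + 1 : ℕ)) < σ w then
        N (s + (k + 1 : ℕ) * ((t - s) / (n + 1 : ℕ))) w - N (s + k * ((t - s) / (n + 1 : ℕ))) w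
          else 0) ∂P) atTop (𝓝 (∫ w in A, (N (min t (max s (σ w))) w - N s w) ∂P)) := by
    refine tendsto_integral_of_dominated_convergence (fun _ => B + B) (fun n => ?_)
      (integrable_const _) (fun n => Eventually.of_forall fun w => ?_)
      (Eventually.of_forall fun w => tendsto_sum_increments (hN.continuous w) hst (σ w))
    · refine (Finset.measurable_sum _ fun k hk => ?_).aestronglyMeasurable
      exact Measurable.ite (ℱ.le _ _ (measurableSet_lt_stopping hσ _))
        ((hNm _ (hs.trans (hge _ _))).sub (hNm _ (hs.trans (hge _ _)))) measurable_const
    · obtain ⟨x, hx, hx1, hx2, -⟩ :=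
        exists_sum_increments_eq (fun t => N t w) s (σ w) (hδ n) (n + 1)
      rw [hx]
      exact (abs_sub _ _).trans (add_le_add
        (hB x ⟨hs.trans hx1, (hx2.trans (hle n _ le_rfl)).trans ht⟩ w)
        (hB s ⟨hs, hst.trans ht⟩ w))
  have hzero : ∀ n : ℕ, ∫ w in A, ∑ k ∈ Finset.range (n + 1),
      (if s + k * ((t - s) / (n + 1 : ℕ)) < σ w then
        N (s + (k + 1 : ℕ) * ((t - s) / (n + 1 : ℕ))) w - N (s + k * ((t - s) / (n + 1 : ℕ))) w
          else 0) ∂P = 0 := by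
    intro n
    rw [integral_finsetSum]
    · exact Finset.sum_eq_zero fun k hk => hcell n k (Finset.mem_range.1 hk)
    · intro k hk
      have hk' : k + 1 ≤ n + 1 := by have := Finset.mem_range.1 hk; omega
      refine Integrable.integrableOn ?_
      have e := (((hNi _ (hs.trans (hge n (k + 1))) ((hle n (k + 1) hk').trans ht)).sub
        (hNi _ (hs.trans (hge n k)) ((hle n k (by omega)).trans ht))).indicator
          (ℱ.le _ _ (measurableSet_lt_stopping hσ (s + k * ((t - s) / (n + 1 : ℕ))))))
      refine e.congr (Eventually.of_forall fun w => ?_)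
      simp [indicator_apply]
  simp only [hzero] at hlim
  have h0 := tendsto_nhds_unique hlim tendsto_const_nhds
  rw [← sub_eq_zero, ← integral_sub (hVi t (hs.trans hst) ht).integrableOn
    (hVi s hs (hst.trans ht)).integrableOn, ← h0]
  congr 1
  funext w
  rcases le_total s (σ w) with h | h
  · rw [max_eq_right h, min_eq_left h]
  · rw [max_eq_left h, min_eq_right (h.trans hst), min_eq_right h, min_eq_right hst]
    ring

/-- Optional stopping. -/
theorem IsBoundedMartingale.martingale_stopped [IsProbabilityMeasure P]
    (hN : IsBoundedMartingale ℱ P t₀ N) (hN0 : ∃ c, ∀ w, N t₀ w = c)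
    (hσ : IsStoppingTime ℱ (fun w => (σ w : WithTop ℝ))) (hσ0 : ∀ w, t₀ ≤ σ w)
    (hσ1 : ∀ w, σ w ≤ t₀ + 1) :
    Martingale (fun t w => N (min (max t t₀) (σ w)) w) ℱ P := by
  obtain ⟨c, hc⟩ := hN0
  have hmin : ∀ t w, t ≤ t₀ → N (min (max t t₀) (σ w)) w = c := by
    intro t w ht
    rw [max_eq_right ht, min_eq_left (hσ0 w), hc]
  have hmeas : ∀ t, Measurable[ℱ t] fun w => N (min (max t t₀) (σ w)) w := by
    intro t
    rcases le_total t t₀ with h | h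
    · simp only [hmin t _ h]
      exact measurable_const
    · simp only [max_eq_left h]
      exact hN.measurable_stopped hσ hσ0 h
  obtain ⟨B, hB⟩ := hN.bounded
  have hint : ∀ t, Integrable (fun w => N (min (max t t₀) (σ w)) w) P := fun t =>
    Integrable.of_bound ((hmeas t).mono (ℱ.le t) le_rfl).aestronglyMeasurable B
      (Eventually.of_forall fun w => hB _ ⟨le_min (le_max_right _ _) (hσ0 w),
        (min_le_right _ _).trans (hσ1 w)⟩ w)
  refine ⟨fun t => (hmeas t).stronglyMeasurable, fun s t hst => ?_⟩
  refine (ae_eq_condExp_of_forall_setIntegral_eq (ℱ.le s) (hint t)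
    (fun A _ _ => (hint s).integrableOn) (fun A hA _ => ?_)
    (hmeas s).stronglyMeasurable.aestronglyMeasurable).symm
  -- times outside `[t₀, t₀ + 1]` are brought back to this interval
  have hclamp : ∀ u w, N (min (max u t₀) (σ w)) w = N (min (min (max u t₀) (t₀ + 1)) (σ w)) w := by
    intro u w
    congr 1
    rw [min_assoc, min_eq_right (hσ1 w)]
  simp only [hclamp s, hclamp t]
  rcases le_total s (t₀ + 1) with h | h
  · refine (hN.setIntegral_stopped_eq hσ hσ0 (le_min (le_max_right _ _) (by linarith))
      (min_le_min_right _ (max_le_max_right _ hst)) (min_le_right _ _) ?_).symm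
    exact ℱ.mono (le_min (le_max_left _ _) h) _ hA
  · rw [min_eq_right (h.trans (le_max_left _ _)),
      min_eq_right ((h.trans hst).trans (le_max_left _ _))]

end OptionalStopping

/-! ### Exit times -/

section ExitTimes

variable {Ω : Type*} {t₀ t₁ : ℝ} {φ : ℝ → Ω → ℝ}

/-- The first time after `t₀` at which `φ` reaches the level `c`. -/
noncomputable def reachTime (t₀ : ℝ) (φ : ℝ → Ω → ℝ) (c : ℝ) (w : Ω) : ℝ :=
  sInf {t | t₀ ≤ t ∧ c ≤ φ t w}

theorem bddBelow_reach (c : ℝ) (w : Ω) : BddBelow {t | t₀ ≤ t ∧ c ≤ φ t w} :=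
  ⟨t₀, fun _ h => h.1⟩

theorem lt_of_lt_reachTime {c t : ℝ} {w : Ω} (h0 : t₀ ≤ t) (h : t < reachTime t₀ φ c w) :
    φ t w < c := by
  by_contra hc
  exact (csInf_le (bddBelow_reach c w) ⟨h0, not_lt.1 hc⟩).not_gt h

theorem reachTime_le {c t : ℝ} {w : Ω} (h0 : t₀ ≤ t) (h : c ≤ φ t w) : reachTime t₀ φ c w ≤ t :=
  csInf_le (bddBelow_reach c w) ⟨h0, h⟩

/-- The level is reached: `φ` is continuous and exceeds it at the time `t₁`. -/
theorem reachTime_mem (hφ : ∀ w, Continuous fun t => φ t w) (h1 : t₀ ≤ t₁) {c : ℝ} {w : Ω}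
    (hc : c ≤ φ t₁ w) : t₀ ≤ reachTime t₀ φ c w ∧ c ≤ φ (reachTime t₀ φ c w) w := by
  have hcl : IsClosed {t | t₀ ≤ t ∧ c ≤ φ t w} :=
    (isClosed_le continuous_const continuous_id).inter (isClosed_le continuous_const (hφ w))
  exact hcl.csInf_mem ⟨t₁, h1, hc⟩ (bddBelow_reach c w)

theorem isStoppingTime_reachTime [mΩ : MeasurableSpace Ω] {ℱ : Filtration ℝ mΩ} (hφ : ∀ w, Continuous fun t => φ t w)
    (ha : ∀ t, Measurable[ℱ t] (φ t)) (h1 : t₀ ≤ t₁) {c : ℝ} (hc : ∀ w, c ≤ φ t₁ w) :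
    IsStoppingTime ℱ fun w => (reachTime t₀ φ c w : WithTop ℝ) := by
  intro t
  simp only [WithTop.coe_le_coe]
  rcases lt_or_ge t t₀ with h | h
  · convert @MeasurableSet.empty Ω (ℱ t)
    refine eq_empty_iff_forall_notMem.2 fun w hw => ?_
    have := (reachTime_mem hφ h1 (hc w)).1
    exact absurd (this.trans hw) (not_le.2 h)
  have : Nonempty (Icc t₀ t) := ⟨⟨t₀, le_rfl, h⟩⟩
  -- the level has not been reached if `φ` stays below a smaller level on a dense set of times
  have e : {w | reachTime t₀ φ c w ≤ t}ᶜ = ⋃ m : ℕ, ⋂ j : ℕ,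
      {w | φ (TopologicalSpace.denseSeq (Icc t₀ t) j) w ≤ c - 1 / ((m : ℝ) + 1)} := by
    ext w
    simp only [mem_compl_iff, mem_ofPred_eq, not_le, mem_iUnion, mem_iInter]
    constructor
    · intro hw
      obtain ⟨u, hu, hmax⟩ := isCompact_Icc.exists_isMaxOn (nonempty_Icc.2 h)
        ((hφ w).continuousOn (s := Icc t₀ t))
      have hlt : φ u w < c := lt_of_lt_reachTime hu.1 (hu.2.trans_lt hw)
      obtain ⟨m, hm⟩ := exists_nat_one_div_lt (sub_pos.2 hlt)
      refine ⟨m, fun j => ?_⟩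
      have := hmax (TopologicalSpace.denseSeq (Icc t₀ t) j).2
      simp only [mem_ofPred_eq] at this
      linarith
    · rintro ⟨m, hm⟩
      by_contra hle
      have hle := not_lt.1 hle
      obtain ⟨hr0, hrc⟩ := reachTime_mem hφ h1 (hc w)
      have hcl : IsClosed {u : Icc t₀ t | φ u w ≤ c - 1 / ((m : ℝ) + 1)} :=
        isClosed_le ((hφ w).comp continuous_subtype_val) continuous_const
      have huniv := (TopologicalSpace.denseRange_denseSeq (Icc t₀ t)).closure_range
      have hsub := closure_minimal (range_subset_iff.2 hm) hcl
      rw [huniv] at hsub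
      have := hsub (mem_univ ⟨_, hr0, hle⟩)
      simp only [mem_ofPred_eq] at this
      have hp : 0 < 1 / ((m : ℝ) + 1) := by positivity
      linarith
  rw [← MeasurableSet.compl_iff, e]
  refine MeasurableSet.iUnion fun m => MeasurableSet.iInter fun j => ?_
  exact measurableSet_le ((ha _).mono (ℱ.mono (TopologicalSpace.denseSeq (Icc t₀ t) j).2.2) le_rfl)
    measurable_const

theorem reachTime_lt_reachTime (hφ : ∀ w, Continuous fun t => φ t w) (h1 : t₀ ≤ t₁) {c c' : ℝ}
    {w : Ω} (hcc : c < c') (hc : φ t₀ w < c) (hc' : c' ≤ φ t₁ w) :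
    reachTime t₀ φ c w < reachTime t₀ φ c' w := by
  obtain ⟨h2, h3⟩ := reachTime_mem hφ h1 (hcc.le.trans hc')
  obtain ⟨h4, h5⟩ := reachTime_mem hφ h1 hc'
  refine lt_of_le_of_ne (reachTime_le h4 (hcc.le.trans h5)) fun heq => ?_
  rw [← heq] at h5
  set r := reachTime t₀ φ c w with hr
  have hr0 : t₀ < r := lt_of_le_of_ne h2 fun h => by rw [← h] at h3; linarith
  have : φ r w ≤ c := by
    refine le_of_tendsto (((hφ w).tendsto r).mono_left nhdsWithin_le_nhds : Tendsto _ (𝓝[<] r) _) ?_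
    filter_upwards [Ioo_mem_nhdsLT hr0] with u hu
    exact (lt_of_lt_reachTime hu.1.le hu.2).le
  linarith

theorem exists_lt_reachTime (hφ : ∀ w, Continuous fun t => φ t w) (h1 : t₀ ≤ t₁) {t : ℝ} {w : Ω}
    (ht : t₀ ≤ t) (hc : 1 ≤ φ t₁ w) (h : t < reachTime t₀ φ 1 w) :
    ∃ n : ℕ, t < reachTime t₀ φ (1 - 1 / ((n : ℝ) + 2)) w := by
  obtain ⟨u, hu, hmax⟩ := isCompact_Icc.exists_isMaxOn (nonempty_Icc.2 ht)
    ((hφ w).continuousOn (s := Icc t₀ t))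
  have hlt : φ u w < 1 := lt_of_lt_reachTime hu.1 (hu.2.trans_lt h)
  obtain ⟨n, hn⟩ := exists_nat_one_div_lt (sub_pos.2 hlt)
  refine ⟨n, ?_⟩
  by_contra hle
  have hn2 : 1 / ((n : ℝ) + 2) ≤ 1 / ((n : ℝ) + 1) :=
    one_div_le_one_div_of_le (by positivity) (by linarith)
  have hc' : 1 - 1 / ((n : ℝ) + 2) ≤ φ t₁ w := by
    have : 0 < 1 / ((n : ℝ) + 2) := by positivity
    linarith
  obtain ⟨h2, h3⟩ := reachTime_mem hφ h1 hc'
  have := hmax ⟨h2, not_lt.1 hle⟩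
  simp only [mem_ofPred_eq] at this
  linarith

end ExitTimes

section LocalSolution

variable {E : Type*} [NormedAddCommGroup E] [NormedSpace ℝ E] [FiniteDimensional ℝ E]
  [MeasurableSpace E] [BorelSpace E] {Ω : Type*} [mΩ : MeasurableSpace Ω] {P : Measure Ω}
  [IsProbabilityMeasure P] {ℱ : Filtration ℝ mΩ} {gen : (ℝ × E → ℝ) → ℝ × E → ℝ} {t₀ : ℝ} {x₀ : E}
  {X : ℝ → Ω → E}

theorem MartingaleSolution.isBoundedMartingale (h : MartingaleSolution ℱ P gen t₀ x₀ X)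
    {f : ℝ × E → ℝ} (hf : ContDiff ℝ ∞ f) (hg : Continuous (gen f)) :
    IsBoundedMartingale ℱ P t₀ (compProc t₀ X f (gen f)) := by
  obtain ⟨ρ, hρ⟩ := h.bounded
  obtain ⟨B, hB⟩ := exists_bound_compProc (Ω := Ω) t₀ hf.continuous hg ρ
  exact ⟨fun w => continuous_compProc hf.continuous hg (h.continuous w),
    fun t ht => measurable_compProc h.continuous h.adapted hf.continuous hg ht,
    ⟨B, hB X hρ⟩, h.increments f hf⟩

/-- Optional stopping for the solution of the martingale problem. -/
theorem MartingaleSolution.martingale_stopped (h : MartingaleSolution ℱ P gen t₀ x₀ X)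
    {f : ℝ × E → ℝ} (hf : ContDiff ℝ ∞ f) (hg : Continuous (gen f)) {σ : Ω → ℝ}
    (hσ : IsStoppingTime ℱ (fun w => (σ w : WithTop ℝ))) (hσ0 : ∀ w, t₀ ≤ σ w)
    (hσ1 : ∀ w, σ w ≤ t₀ + 1) :
    Martingale (fun t w => compProc t₀ X f (gen f) (min (max t t₀) (σ w)) w) ℱ P :=
  (h.isBoundedMartingale hf hg).martingale_stopped
    ⟨f (t₀, x₀), fun w => by simp [compProc, h.start w]⟩ hσ hσ0 hσ1

/-- The lifetime of the solution up to its exit from the space-time cylinder with radius `r` and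
height `ε`, together with an announcing sequence of stopping times. -/
theorem MartingaleSolution.exists_exit (h : MartingaleSolution ℱ P gen t₀ x₀ X) {r ε : ℝ}
    (hr : 0 < r) (hε : 0 < ε) : ∃ (τ : Ω → ℝ) (σ : ℕ → Ω → ℝ),
      IsStoppingTime ℱ (fun w => (τ w : WithTop ℝ)) ∧ (∀ w, t₀ < τ w) ∧ (∀ w, τ w ≤ t₀ + ε) ∧
      (∀ w t, t₀ ≤ t → t < τ w → ‖X t w - x₀‖ < r) ∧
      (∀ n, IsStoppingTime ℱ (fun w => (σ n w : WithTop ℝ))) ∧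
      (∀ w, Monotone fun n => σ n w) ∧ (∀ n w, t₀ ≤ σ n w ∧ σ n w < τ w) ∧
      ∀ w t, t < τ w → ∃ n, t < σ n w := by
  let φ : ℝ → Ω → ℝ := fun t w => max (‖X t w - x₀‖ / r) ((t - t₀) / ε)
  have hφ : ∀ w, Continuous fun t => φ t w := fun w => by
    have := h.continuous w
    fun_prop
  have ha : ∀ t, Measurable[ℱ t] (φ t) := by
    intro t
    have h1 : Continuous fun x : E => max (‖x - x₀‖ / r) ((t - t₀) / ε) := by fun_prop
    exact h1.measurable.comp (h.adapted t)
  have h1 : t₀ ≤ t₀ + ε := by linarith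
  have hφ0 : ∀ w, φ t₀ w = 0 := fun w => by simp [φ, h.start w]
  have hφ1 : ∀ w, 1 ≤ φ (t₀ + ε) w := fun w => by
    simp only [φ, add_sub_cancel_left, div_self hε.ne']
    exact le_max_right _ _
  let c : ℕ → ℝ := fun n => 1 - 1 / ((n : ℝ) + 2)
  have hc1 : ∀ n, c n < 1 := fun n => by
    have : 0 < 1 / ((n : ℝ) + 2) := by positivity
    simp only [c]; linarith
  have hc0 : ∀ n, 0 < c n := fun n => by
    have : 1 / ((n : ℝ) + 2) < 1 := by
      rw [div_lt_one (by positivity)]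
      have := n.cast_nonneg (α := ℝ)
      linarith
    simp only [c]; linarith
  have hcm : ∀ m n, m ≤ n → c m ≤ c n := fun m n hmn => by
    have : 1 / ((n : ℝ) + 2) ≤ 1 / ((m : ℝ) + 2) :=
      one_div_le_one_div_of_le (by positivity) (by
        have : (m : ℝ) ≤ n := by exact_mod_cast hmn
        linarith)
    simp only [c]; linarith
  refine ⟨reachTime t₀ φ 1, fun n => reachTime t₀ φ (c n),
    isStoppingTime_reachTime hφ ha h1 hφ1, fun w => ?_, fun w => reachTime_le h1 (hφ1 w),
    fun w t ht0 ht => ?_, fun n => isStoppingTime_reachTime hφ ha h1 fun w => (hc1 n).le.trans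
      (hφ1 w), fun w m n hmn => ?_, fun n w => ?_, fun w t ht => ?_⟩
  · exact (reachTime_mem hφ h1 ((hc1 0).le.trans (hφ1 w))).1.trans_lt
      (reachTime_lt_reachTime hφ h1 (hc1 0) (by rw [hφ0]; exact hc0 0) (hφ1 w))
  · have h2 : φ t w < 1 := lt_of_lt_reachTime ht0 ht
    exact (div_lt_one hr).1 ((le_max_left _ _).trans_lt h2)
  · obtain ⟨h2, h3⟩ := reachTime_mem hφ h1 ((hc1 n).le.trans (hφ1 w))
    exact reachTime_le h2 ((hcm m n hmn).trans h3)
  · exact ⟨(reachTime_mem hφ h1 ((hc1 n).le.trans (hφ1 w))).1,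
      reachTime_lt_reachTime hφ h1 (hc1 n) (by rw [hφ0]; exact hc0 n) (hφ1 w)⟩
  · rcases lt_or_ge t t₀ with h0 | h0
    · exact ⟨0, h0.trans_le (reachTime_mem hφ h1 ((hc1 0).le.trans (hφ1 w))).1⟩
    · exact exists_lt_reachTime hφ h1 h0 (hφ1 w) ht

end LocalSolution

end StochHam

namespace StochHam

/-! ### Second-order jets of functions of time and space -/

section Jets

variable {E : Type*} [NormedAddCommGroup E] [NormedSpace ℝ E]

/-- The space derivatives `(D_x F, D_x² F)` of `F` at `z`. -/
noncomputable def jet (F : ℝ × E → ℝ) (z : ℝ × E) : CotFiber E :=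
  ((fderiv ℝ F z).comp (ContinuousLinearMap.inr ℝ ℝ E), symm E (spaceHess F z))

/-- The operator `∂_t F + K(0, D_x F, D_x² F)`, for a functional `K` on the model space of
`𝒯^{S*}M`. -/
noncomputable def jetGen (K : E × CotFiber E →L[ℝ] ℝ) (F : ℝ × E → ℝ) (z : ℝ × E) : ℝ :=
  fderiv ℝ F z (1, 0) + K (0, jet F z)

theorem contDiffAt_fderiv {V W : Type*} [NormedAddCommGroup V] [NormedSpace ℝ V]
    [NormedAddCommGroup W] [NormedSpace ℝ W] {F : V → W} {z : V} (hF : ContDiffAt ℝ ∞ F z) :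
    ContDiffAt ℝ ∞ (fderiv ℝ F) z :=
  hF.fderiv_right (by norm_cast)

/-- The derivative in a fixed direction is smooth. -/
theorem contDiffAt_fderiv_apply {V W : Type*} [NormedAddCommGroup V] [NormedSpace ℝ V]
    [NormedAddCommGroup W] [NormedSpace ℝ W] {F : V → W} {z : V} (hF : ContDiffAt ℝ ∞ F z) (v : V) :
    ContDiffAt ℝ ∞ (fun z' => fderiv ℝ F z' v) z :=
  (contDiffAt_fderiv hF).clm_apply contDiffAt_const

/-- Restriction of bilinear forms on `ℝ × E` to `E`. -/
noncomputable def restrictSpace : ((ℝ × E) →L[ℝ] (ℝ × E) →L[ℝ] ℝ) →L[ℝ] Bilin E :=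
  (ContinuousLinearMap.compL ℝ E ((ℝ × E) →L[ℝ] ℝ) (E →L[ℝ] ℝ)
      ((ContinuousLinearMap.compL ℝ E (ℝ × E) ℝ).flip (ContinuousLinearMap.inr ℝ ℝ E))).comp
    ((ContinuousLinearMap.compL ℝ E (ℝ × E) ((ℝ × E) →L[ℝ] ℝ)).flip
      (ContinuousLinearMap.inr ℝ ℝ E))

theorem spaceHess_eq_restrictSpace (F : ℝ × E → ℝ) (z : ℝ × E) :
    spaceHess F z = restrictSpace (fderiv ℝ (fderiv ℝ F) z) := rfl

/-- The jet as a linear image of the full first and second derivatives. -/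
noncomputable def jetLin : (((ℝ × E) →L[ℝ] ℝ) × ((ℝ × E) →L[ℝ] (ℝ × E) →L[ℝ] ℝ)) →L[ℝ]
    CotFiber E :=
  ((((ContinuousLinearMap.compL ℝ E (ℝ × E) ℝ).flip (ContinuousLinearMap.inr ℝ ℝ E)).comp
    (ContinuousLinearMap.fst ℝ _ _))).prod
    (((symm E).comp restrictSpace).comp (ContinuousLinearMap.snd ℝ _ _))

theorem jet_eq_jetLin (F : ℝ × E → ℝ) (z : ℝ × E) :
    jet F z = jetLin (fderiv ℝ F z, fderiv ℝ (fderiv ℝ F) z) := rfl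

theorem contDiffAt_jet {F : ℝ × E → ℝ} {z : ℝ × E} (hF : ContDiffAt ℝ ∞ F z) :
    ContDiffAt ℝ ∞ (jet F) z :=
  (jetLin (E := E)).contDiff.contDiffAt.comp z ((contDiffAt_fderiv hF).prodMk
    (contDiffAt_fderiv (contDiffAt_fderiv hF)))

theorem jet_congr {F G : ℝ × E → ℝ} {z : ℝ × E} (h : F =ᶠ[𝓝 z] G) : jet F z = jet G z := by
  rw [jet_eq_jetLin, jet_eq_jetLin, h.fderiv_eq, h.fderiv.fderiv_eq]

theorem jetGen_congr (K : E × CotFiber E →L[ℝ] ℝ) {F G : ℝ × E → ℝ} {z : ℝ × E}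
    (h : F =ᶠ[𝓝 z] G) : jetGen K F z = jetGen K G z := by
  rw [jetGen, jetGen, jet_congr h, h.fderiv_eq]

theorem hasFDerivAt_slice {W : Type*} [NormedAddCommGroup W] [NormedSpace ℝ W] {F : ℝ × E → W}
    {t : ℝ} {y : E} (hF : DifferentiableAt ℝ F (t, y)) :
    HasFDerivAt (fun x => F (t, x)) ((fderiv ℝ F (t, y)).comp (ContinuousLinearMap.inr ℝ ℝ E)) y :=
  HasFDerivAt.comp y (f := fun x => (t, x)) hF.hasFDerivAt (hasFDerivAt_prodMk_right t y)

theorem hasDerivAt_slice {F : ℝ × E → ℝ} {t : ℝ} {y : E} (hF : DifferentiableAt ℝ F (t, y)) :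
    HasDerivAt (fun s => F (s, y)) (fderiv ℝ F (t, y) (1, 0)) t := by
  have h := HasFDerivAt.comp t (f := fun s => (s, y)) hF.hasFDerivAt (hasFDerivAt_prodMk_left t y)
  have h' : HasDerivAt (fun s => F (s, y)) _ t := h.hasDerivAt
  convert h' using 1
  simp

/-- The jet of `F` at `(t, y)` consists of the derivatives at `y` of `F(t, ·)`. -/
theorem jet_eq_slice {F : ℝ × E → ℝ} {t : ℝ} {y : E} (hF : ContDiffAt ℝ ∞ F (t, y)) :
    jet F (t, y) = (fderiv ℝ (fun x => F (t, x)) y,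
      symm E (fderiv ℝ (fderiv ℝ fun x => F (t, x)) y)) := by
  have h1 : ∀ᶠ x in 𝓝 y, fderiv ℝ (fun x => F (t, x)) x =
      (fderiv ℝ F (t, x)).comp (ContinuousLinearMap.inr ℝ ℝ E) := by
    have h : ∀ᶠ z in 𝓝 (t, y), ContDiffAt ℝ 1 F z :=
      (hF.of_le (by simp) : ContDiffAt ℝ 1 F (t, y)).eventually (by simp)
    have hc : ContinuousAt (fun x : E => (t, x)) y := by fun_prop
    filter_upwards [hc.eventually h] with x hx
    exact (hasFDerivAt_slice (hx.differentiableAt (by simp))).fderiv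
  have h2 : DifferentiableAt ℝ (fderiv ℝ F) (t, y) :=
    (contDiffAt_fderiv hF).differentiableAt (by simp)
  refine Prod.ext h1.self_of_nhds.symm ?_
  have h3 := ((hasFDerivAt_slice h2).clm_comp
    (hasFDerivAt_const (ContinuousLinearMap.inr ℝ ℝ E) y)).congr_of_eventuallyEq h1
  simp only [jet]
  rw [h3.fderiv]
  congr 1
  ext u v
  simp [spaceHess_apply]

theorem isSymmSndFDerivAt_of_smooth {V W : Type*} [NormedAddCommGroup V] [NormedSpace ℝ V]
    [NormedAddCommGroup W] [NormedSpace ℝ W] {F : V → W} {z : V} (hF : ContDiffAt ℝ ∞ F z)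
    (u v : V) : fderiv ℝ (fderiv ℝ F) z u v = fderiv ℝ (fderiv ℝ F) z v u :=
  (hF.isSymmSndFDerivAt (by simp; norm_cast)).eq _ _

/-- Derivatives commute with taking jets. -/
theorem fderiv_jet {F : ℝ × E → ℝ} {z : ℝ × E} (hF : ContDiffAt ℝ ∞ F z) (v : ℝ × E) :
    fderiv ℝ (jet F) z v = jet (fun z' => fderiv ℝ F z' v) z := by
  have h1 : DifferentiableAt ℝ (fderiv ℝ F) z :=
    (contDiffAt_fderiv hF).differentiableAt (by simp)
  have h2 : DifferentiableAt ℝ (fderiv ℝ (fderiv ℝ F)) z :=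
    (contDiffAt_fderiv (contDiffAt_fderiv hF)).differentiableAt (by simp)
  have hd : fderiv ℝ (jet F) z v =
      jetLin (fderiv ℝ (fderiv ℝ F) z v, fderiv ℝ (fderiv ℝ (fderiv ℝ F)) z v) := by
    have h := jetLin.hasFDerivAt.comp z (h1.hasFDerivAt.prodMk h2.hasFDerivAt)
    have e : jet F = jetLin ∘ fun z => (fderiv ℝ F z, fderiv ℝ (fderiv ℝ F) z) := rfl
    rw [e, h.fderiv]
    rfl
  -- near `z` the derivative of `∂_v F` is the derivative of `DF` in the direction `v`
  have h3 : (fderiv ℝ fun z' => fderiv ℝ F z' v) =ᶠ[𝓝 z] fun z' => fderiv ℝ (fderiv ℝ F) z' v := by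
    have h : ∀ᶠ z' in 𝓝 z, ContDiffAt ℝ 2 F z' :=
      (hF.of_le (by norm_cast) : ContDiffAt ℝ 2 F z).eventually (by simp)
    filter_upwards [h] with z' hz'
    have hd' : DifferentiableAt ℝ (fderiv ℝ F) z' :=
      (hz'.fderiv_right (m := 1) (by norm_num)).differentiableAt (by simp)
    refine ContinuousLinearMap.ext fun u => ?_
    rw [(hd'.hasFDerivAt.clm_apply (hasFDerivAt_const v z')).fderiv]
    simp only [add_apply, ContinuousLinearMap.comp_apply, ContinuousLinearMap.flip_apply]
    simpa using (hz'.isSymmSndFDerivAt (by simp)).eq u v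
  rw [hd, jet_eq_jetLin, h3.eq_of_nhds, h3.fderiv_eq,
    (h2.hasFDerivAt.clm_apply (hasFDerivAt_const v z)).fderiv]
  congr 2
  refine ContinuousLinearMap.ext fun u => ?_
  simp only [add_apply, ContinuousLinearMap.comp_apply, ContinuousLinearMap.flip_apply]
  simpa using isSymmSndFDerivAt_of_smooth (contDiffAt_fderiv hF) v u

/-- The space derivative of the Hamilton–Jacobi–Bellman expression `∂_t F + G(t, x, jet F)`: it is
the action of the operator `∂_t + K(0, D_x, D_x²)`, where `K` is the derivative of `G(t, ·)`, on the
space derivative of `F`, up to the derivative of `G` in the direction of `x`. -/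
theorem fderiv_hjb {F : ℝ × E → ℝ} {G : ℝ × (E × CotFiber E) → ℝ} {t : ℝ} {y : E}
    (hF : ContDiffAt ℝ ∞ F (t, y)) (hG : ContDiffAt ℝ ∞ G (t, y, jet F (t, y))) (e : E)
    {K : E × CotFiber E →L[ℝ] ℝ} (hK : K = fderiv ℝ (fun z => G (t, z)) (y, jet F (t, y))) :
    fderiv ℝ (fun z : ℝ × E => fderiv ℝ F z (1, 0) + G (z.1, z.2, jet F z)) (t, y) (0, e) =
      jetGen K (fun z => fderiv ℝ F z (0, e)) (t, y) + K (e, 0) := by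
  have h1 : DifferentiableAt ℝ (fderiv ℝ F) (t, y) :=
    (contDiffAt_fderiv hF).differentiableAt (by simp)
  have hj : DifferentiableAt ℝ (jet F) (t, y) := (contDiffAt_jet hF).differentiableAt (by simp)
  have hGd : DifferentiableAt ℝ G (t, y, jet F (t, y)) := hG.differentiableAt (by simp)
  have ha := h1.hasFDerivAt.clm_apply (hasFDerivAt_const ((1 : ℝ), (0 : E)) (t, y))
  have hb : HasFDerivAt (fun z : ℝ × E => (z.1, z.2, jet F z))
      ((ContinuousLinearMap.fst ℝ ℝ E).prod ((ContinuousLinearMap.snd ℝ ℝ E).prod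
        (fderiv ℝ (jet F) (t, y)))) (t, y) :=
    hasFDerivAt_fst.prodMk (hasFDerivAt_snd.prodMk hj.hasFDerivAt)
  have hc := HasFDerivAt.comp (t, y) (f := fun z : ℝ × E => (z.1, z.2, jet F z))
    hGd.hasFDerivAt hb
  have hd := ha.add hc
  rw [show (fun z : ℝ × E => fderiv ℝ F z (1, 0) + G (z.1, z.2, jet F z)) =
    (fun z => fderiv ℝ F z (1, 0)) + G ∘ fun z : ℝ × E => (z.1, z.2, jet F z) from rfl, hd.fderiv]
  have hK' : K = (fderiv ℝ G (t, y, jet F (t, y))).comp (ContinuousLinearMap.inr ℝ ℝ _) := by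
    rw [hK, (hasFDerivAt_slice hGd).fderiv]
  have e1 : fderiv ℝ (fun z => fderiv ℝ F z (0, e)) (t, y) (1, 0) =
      fderiv ℝ (fderiv ℝ F) (t, y) (0, e) (1, 0) := by
    rw [(h1.hasFDerivAt.clm_apply (hasFDerivAt_const _ (t, y))).fderiv]
    simpa using isSymmSndFDerivAt_of_smooth hF _ _
  rw [jetGen, e1, ← fderiv_jet hF, hK']
  have e2 : ((0 : ℝ), e, fderiv ℝ (jet F) (t, y) (0, e)) =
      (0, 0, fderiv ℝ (jet F) (t, y) (0, e)) + (0, e, 0) := by simp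
  simp only [add_apply, ContinuousLinearMap.comp_apply, ContinuousLinearMap.prod_apply,
    ContinuousLinearMap.coe_fst', ContinuousLinearMap.coe_snd', ContinuousLinearMap.inr_apply]
  rw [e2, map_add]
  simp [add_assoc]

end Jets

/-! ### Hadamard's lemma -/

section Hadamard

variable {E : Type*} [NormedAddCommGroup E] [NormedSpace ℝ E]

open scoped Convolution in
/-- Integrals over `[0, 1]` depend smoothly on parameters. -/
theorem contDiff_integral_unit [FiniteDimensional ℝ E] {h : E × ℝ → ℝ} (hh : ContDiff ℝ ∞ h) :
    ContDiff ℝ ∞ fun y => ∫ r in (0 : ℝ)..1, h (y, r) := by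
  -- the integral is the value at `0` of a convolution with the indicator of `[0, 1]`
  let χ : ContDiffBump (0 : ℝ) := ⟨2, 3, by norm_num, by norm_num⟩
  let g : E → ℝ → ℝ := fun y r => χ r * h (y, -r)
  let f : ℝ → ℝ := (Ioc (0 : ℝ) 1).indicator 1
  have hf : LocallyIntegrable f volume :=
    ((integrable_indicator_iff measurableSet_Ioc).2 (by
      simp [Pi.one_def])).locallyIntegrable
  have hg : ContDiff ℝ ∞ ↿g := by
    have : (↿g) = fun p : E × ℝ => χ p.2 * h (p.1, -p.2) := rfl
    rw [this]
    exact (χ.contDiff.comp contDiff_snd).mul (hh.comp (contDiff_fst.prodMk contDiff_snd.neg))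
  have key := contDiffOn_convolution_right_with_param (n := ⊤) (μ := volume)
    (ContinuousLinearMap.mul ℝ ℝ) (f := f) (g := g) (s := univ) (k := Metric.closedBall 0 3)
    isOpen_univ (isCompact_closedBall _ _)
    (fun p x _ hx => by
      have : χ x = 0 := χ.zero_of_le_dist (by
        rw [Metric.mem_closedBall, not_le] at hx
        exact hx.le)
      simp [g, this]) hf (by rw [univ_prod_univ]; exact hg.contDiffOn)
  rw [univ_prod_univ, contDiffOn_univ] at key
  have h2 := key.comp (contDiff_id.prodMk (contDiff_const (c := (0 : ℝ))) :
    ContDiff ℝ ∞ fun y : E => (y, (0 : ℝ)))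
  convert h2 using 1
  funext y
  simp only [Function.comp_apply, id, convolution, ContinuousLinearMap.mul_apply', zero_sub, g, neg_neg]
  rw [intervalIntegral.integral_of_le zero_le_one, ← integral_indicator measurableSet_Ioc]
  congr 1
  funext r
  by_cases hr : r ∈ Ioc (0 : ℝ) 1
  · have : χ (-r) = 1 := χ.one_of_mem_closedBall (by
      simp only [mem_closedBall_zero_iff, norm_neg, Real.norm_eq_abs, χ]
      rw [abs_le]
      constructor <;> linarith [hr.1, hr.2])
    simp [f, hr, this]
  · simp [f, hr]

/-- Hadamard's lemma. -/
theorem exists_hadamard [FiniteDimensional ℝ E] {ι : Type*} [Fintype ι] {ℓ : ι → E →L[ℝ] ℝ}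
    {e : ι → E} (hx : ∀ x, x = ∑ i, ℓ i x • e i) {f : E → ℝ} (hf : ContDiff ℝ ∞ f) (x₀ : E) :
    ∃ g : ι → E → ℝ, (∀ i, ContDiff ℝ ∞ (g i)) ∧
      ∀ x, f x = f x₀ + ∑ i, ℓ i (x - x₀) * g i x := by
  have hf1 : ContDiff ℝ ∞ (fderiv ℝ f) := hf.fderiv_right (by norm_cast)
  have hs : ∀ i, ContDiff ℝ ∞ fun p : E × ℝ => fderiv ℝ f (x₀ + p.2 • (p.1 - x₀)) (e i) := fun i =>
    (hf1.comp (contDiff_const.add (contDiff_snd.smul (contDiff_fst.sub contDiff_const)))).clm_apply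
      contDiff_const
  refine ⟨fun i x => ∫ r in (0 : ℝ)..1, fderiv ℝ f (x₀ + r • (x - x₀)) (e i),
    fun i => contDiff_integral_unit (hs i), fun x => ?_⟩
  have hd : ∀ r : ℝ, HasDerivAt (fun r : ℝ => f (x₀ + r • (x - x₀)))
      (∑ i, ℓ i (x - x₀) * fderiv ℝ f (x₀ + r • (x - x₀)) (e i)) r := by
    intro r
    have h1 : HasDerivAt (fun r : ℝ => x₀ + r • (x - x₀)) ((1 : ℝ) • (x - x₀)) r :=
      ((hasDerivAt_id r).smul_const (x - x₀)).const_add x₀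
    have h2 := (hf.differentiable (by simp) (x₀ + r • (x - x₀))).hasFDerivAt.comp_hasDerivAt r h1
    have h4 : fderiv ℝ f (x₀ + r • (x - x₀)) (x - x₀) =
        ∑ i, ℓ i (x - x₀) * fderiv ℝ f (x₀ + r • (x - x₀)) (e i) := by
      generalize fderiv ℝ f (x₀ + r • (x - x₀)) = D
      conv_lhs => rw [hx (x - x₀)]
      simp only [map_sum, map_smul, smul_eq_mul]
    rw [one_smul, h4] at h2
    exact h2
  have hc : ∀ i, Continuous fun r : ℝ => fderiv ℝ f (x₀ + r • (x - x₀)) (e i) := fun i =>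
    (hs i).continuous.comp (by fun_prop : Continuous fun r : ℝ => (x, r))
  have h3 := intervalIntegral.integral_eq_sub_of_hasDerivAt (fun r _ => hd r)
    ((continuous_finsetSum _ fun i _ => (hc i).const_mul (ℓ i (x - x₀))).intervalIntegrable 0 1)
  rw [intervalIntegral.integral_finsetSum fun i _ =>
    ((hc i).const_mul (ℓ i (x - x₀))).intervalIntegrable 0 1] at h3
  simp only [intervalIntegral.integral_const_mul] at h3
  rw [h3]
  simp

end Hadamard

end StochHam

namespace StochHam

/-! ### Second-order tangent vectors in coordinates -/

section Germs

variable {E H : Type*} [NormedAddCommGroup E] [NormedSpace ℝ E] [TopologicalSpace H]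
  {I : ModelWithCorners ℝ E H} {N : Type*} [TopologicalSpace N] [ChartedSpace H N]

/-- The product of a cutoff function with a function that is smooth on its support. -/
noncomputable def cutoffMul (χ : C^∞⟮I, N; ℝ⟯) (g : N → ℝ)
    (hg : ∀ x ∈ tsupport χ, ContMDiffAt I 𝓘(ℝ, ℝ) ∞ g x) : C^∞⟮I, N; ℝ⟯ :=
  ⟨fun x => χ x * g x, contMDiff_of_tsupport fun x hx =>
    χ.contMDiff.contMDiffAt.mul (hg x (tsupport_mul_subset_left hx))⟩

theorem cutoffMul_eventuallyEq {χ : C^∞⟮I, N; ℝ⟯} {g : N → ℝ}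
    (hg : ∀ x ∈ tsupport χ, ContMDiffAt I 𝓘(ℝ, ℝ) ∞ g x) {q : N}
    (hχ : ∀ᶠ x in 𝓝 q, χ x = 1) : cutoffMul χ g hg =ᶠ[𝓝 q] g := by
  filter_upwards [hχ] with x hx
  change χ x * g x = g x
  rw [hx, one_mul]

theorem exists_bump [FiniteDimensional ℝ E] [T2Space N] [IsManifold I ∞ N] {q : N} {U : Set N}
    (hU : U ∈ 𝓝 q) : ∃ χ : C^∞⟮I, N; ℝ⟯, (∀ᶠ x in 𝓝 q, χ x = 1) ∧ tsupport χ ⊆ U := by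
  obtain ⟨f, hf, -⟩ := (SmoothBumpFunction.nhds_basis_support (I := I) hU).mem_iff.1 univ_mem
  exact ⟨⟨f, f.contMDiff⟩, f.eventuallyEq_one, hf⟩

/-- Germs of smooth functions extend to the manifold. -/
theorem exists_smooth_germ [FiniteDimensional ℝ E] [T2Space N] [IsManifold I ∞ N] {q : N}
    {U : Set N} (hU : U ∈ 𝓝 q) {g : N → ℝ} (hg : ∀ x ∈ U, ContMDiffAt I 𝓘(ℝ, ℝ) ∞ g x) :
    ∃ u : C^∞⟮I, N; ℝ⟯, u =ᶠ[𝓝 q] g := by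
  obtain ⟨χ, h1, h2⟩ := exists_bump (I := I) hU
  exact ⟨_, cutoffMul_eventuallyEq (fun x hx => hg x (h2 hx)) h1⟩

namespace SecondOrderVector

variable {q : N} (A : SecondOrderVector I q)

theorem toLin_one : A.toLin 1 = 0 := by
  obtain ⟨Γ, -, h⟩ := A.exists_tensor
  have h1 := h 1 1
  have h2 : (mfderiv I 𝓘(ℝ, ℝ) (1 : C^∞⟮I, N; ℝ⟯) q : TangentSpace I q →L[ℝ] ℝ) = 0 :=
    mfderiv_const
  have h3 : Γ (mfderiv I 𝓘(ℝ, ℝ) (1 : C^∞⟮I, N; ℝ⟯) q) (mfderiv I 𝓘(ℝ, ℝ) (1 : C^∞⟮I, N; ℝ⟯) q) =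
    0 := (congrArg (Γ _) h2).trans (map_zero _)
  have h4 : (1 : C^∞⟮I, N; ℝ⟯) q = 1 := rfl
  rw [h3, h4, mul_one] at h1
  linarith

/-- Second-order tangent vectors are local. -/
theorem toLin_congr [FiniteDimensional ℝ E] [T2Space N] [IsManifold I ∞ N] {u v : C^∞⟮I, N; ℝ⟯}
    (h : u =ᶠ[𝓝 q] v) : A.toLin u = A.toLin v := by
  obtain ⟨χ, h1, h2⟩ := exists_bump (I := I) h
  have e : u - v = (1 - χ) * (u - v) := by
    ext x
    change u x - v x = (1 - χ x) * (u x - v x)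
    by_cases hx : u x = v x
    · simp [hx]
    · have : x ∉ tsupport χ := fun hm => hx (h2 hm)
      rw [image_eq_zero_of_notMem_tsupport this]
      ring
  obtain ⟨Γ, -, hΓ⟩ := A.exists_tensor
  have h3 := hΓ (1 - χ) (u - v)
  have h4 : (1 - χ) q = 0 := by
    change (1 : ℝ) - χ q = 0
    rw [h1.self_of_nhds, sub_self]
  have h5 : (u - v) q = 0 := sub_eq_zero.2 h.self_of_nhds
  have h6 : (mfderiv I 𝓘(ℝ, ℝ) (u - v) q : TangentSpace I q →L[ℝ] ℝ) = 0 := by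
    have h7 : (⇑(u - v)) =ᶠ[𝓝 q] fun _ => (0 : ℝ) := by
      filter_upwards [h] with x hx
      exact sub_eq_zero.2 hx
    rw [h7.mfderiv_eq]
    exact mfderiv_const
  have h7 : Γ (mfderiv I 𝓘(ℝ, ℝ) (1 - χ : C^∞⟮I, N; ℝ⟯) q)
      (mfderiv I 𝓘(ℝ, ℝ) (u - v : C^∞⟮I, N; ℝ⟯) q) = 0 :=
    (congrArg (Γ _) h6).trans (map_zero _)
  rw [← e, h4, h5, h7, map_sub] at h3
  linarith

end SecondOrderVector

end Germs

section Coordinates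

variable {E : Type*} [NormedAddCommGroup E] [NormedSpace ℝ E]
  {M : Type*} [TopologicalSpace M] [ChartedSpace E M]

theorem contMDiffAt_comp_chart (c : Chart E M) {g : E → ℝ} {x : M} (hx : x ∈ c.1.source)
    (hg : ContDiffAt ℝ ∞ g (c.1 x)) : ContMDiffAt 𝓘(ℝ, E) 𝓘(ℝ, ℝ) ∞ (fun q => g (c.1 q)) x :=
  ContMDiffAt.comp x (f := c.1) (g := g) hg.contMDiffAt
    (contMDiffAt_of_mem_maximalAtlas c.2 hx)

theorem mfderiv_comp_chart (c : Chart E M) {q : M} (hq : q ∈ c.1.source) {u : M → ℝ} {g : E → ℝ}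
    (hg : DifferentiableAt ℝ g (c.1 q)) (hu : u =ᶠ[𝓝 q] fun x => g (c.1 x)) :
    mfderiv 𝓘(ℝ, E) 𝓘(ℝ, ℝ) u q =
      (fderiv ℝ g (c.1 q)).comp (mfderiv 𝓘(ℝ, E) 𝓘(ℝ, E) c.1 q) := by
  rw [hu.mfderiv_eq]
  have h1 : MDifferentiableAt 𝓘(ℝ, E) 𝓘(ℝ, E) c.1 q :=
    (contMDiffAt_of_mem_maximalAtlas c.2 hq).mdifferentiableAt (by simp)
  have h2 := mfderiv_comp q (g := g) hg.mdifferentiableAt h1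
  rw [mfderiv_eq_fderiv] at h2
  exact h2

theorem contDiffAt_comp_symm (c : Chart E M) (φ : C^∞⟮𝓘(ℝ, E), M; ℝ⟯) {y : E}
    (hy : y ∈ c.1.target) : ContDiffAt ℝ ∞ (φ ∘ c.1.symm) y := by
  have h := ContMDiffAt.comp y (φ.contMDiff (c.1.symm y))
    (contMDiffAt_symm_of_mem_maximalAtlas c.2 hy)
  exact h.contDiffAt

/-- A second-order tangent vector is determined in a chart by its action on the linear functions of
the coordinates and by its squared field operator on pairs of them. -/
theorem SecondOrderVector.toLin_eq_of_coord [FiniteDimensional ℝ E] [T2Space M]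
    [IsManifold 𝓘(ℝ, E) ∞ M] {q : M}
    (A : SecondOrderVector 𝓘(ℝ, E) q) (c : Chart E M) (hq : q ∈ c.1.source)
    (K : E × CotFiber E →L[ℝ] ℝ)
    (h1 : ∀ (ℓ : E →L[ℝ] ℝ) (u : C^∞⟮𝓘(ℝ, E), M; ℝ⟯), (u =ᶠ[𝓝 q] fun x => ℓ (c.1 x)) →
      A.toLin u = K (0, ℓ, 0))
    (h2 : ∀ (ℓ m : E →L[ℝ] ℝ) (u v : C^∞⟮𝓘(ℝ, E), M; ℝ⟯), (u =ᶠ[𝓝 q] fun x => ℓ (c.1 x)) →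
      (v =ᶠ[𝓝 q] fun x => m (c.1 x)) →
      A.squaredField u v = 2 * K (0, 0, symm E (ℓ.smulRight m)))
    (φ : C^∞⟮𝓘(ℝ, E), M; ℝ⟯) :
    A.toLin φ = K (0, fderiv ℝ (φ ∘ c.1.symm) (c.1 q),
      symm E (fderiv ℝ (fderiv ℝ (φ ∘ c.1.symm)) (c.1 q))) := by
  set x₀ := c.1 q with hx₀
  have hx₀t : x₀ ∈ c.1.target := c.1.map_source hq
  have hsrc : c.1.source ∈ 𝓝 q := c.1.open_source.mem_nhds hq
  -- replace the local expression of `φ` by a smooth function on `E`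
  obtain ⟨f, hf⟩ : ∃ f : C^∞⟮𝓘(ℝ, E), E; ℝ⟯, f =ᶠ[𝓝 x₀] φ ∘ c.1.symm :=
    exists_smooth_germ (c.1.open_target.mem_nhds hx₀t)
      fun y hy => (contDiffAt_comp_symm c φ hy).contMDiffAt
  have hfs : ContDiff ℝ ∞ f := f.contMDiff.contDiff
  rw [← hf.fderiv_eq, ← hf.fderiv.fderiv_eq]
  obtain ⟨d, ℓ, e, hx, -⟩ := exists_functionals (E := E)
  obtain ⟨g, hg, hfg⟩ := exists_hadamard hx hfs x₀
  have hgd : ∀ i x, DifferentiableAt ℝ (g i) x := fun i x => (hg i).differentiable (by simp) x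
  have hgd1 : ∀ i x, DifferentiableAt ℝ (fderiv ℝ (g i)) x := fun i x =>
    ((hg i).fderiv_right (m := ∞) (by norm_cast)).differentiable (by simp) x
  -- the derivatives of `f`
  have hℓd : ∀ i x, HasFDerivAt (fun x => ℓ i (x - x₀)) (ℓ i) x := fun i x => by
    exact (ℓ i).hasFDerivAt.comp x ((hasFDerivAt_id x).sub_const x₀)
  have hD : fderiv ℝ f = fun x => ∑ i, (ℓ i (x - x₀) • fderiv ℝ (g i) x + g i x • ℓ i) := by
    funext x
    have h : HasFDerivAt (fun x => f x₀ + ∑ i, ℓ i (x - x₀) * g i x)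
        (∑ i, (ℓ i (x - x₀) • fderiv ℝ (g i) x + g i x • ℓ i)) x :=
      (HasFDerivAt.fun_sum fun i _ => (hℓd i x).mul (hgd i x).hasFDerivAt).const_add _
    rw [← h.fderiv]
    exact congrArg (fun F => fderiv ℝ F x) (funext hfg)
  have hD0 : fderiv ℝ f x₀ = ∑ i, g i x₀ • ℓ i := by
    rw [hD]
    simp
  have hDD : fderiv ℝ (fderiv ℝ f) x₀ =
      ∑ i, ((ℓ i).smulRight (fderiv ℝ (g i) x₀) + (fderiv ℝ (g i) x₀).smulRight (ℓ i)) := by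
    have h : HasFDerivAt (fun x => ∑ i, (ℓ i (x - x₀) • fderiv ℝ (g i) x + g i x • ℓ i))
        (∑ i, ((ℓ i (x₀ - x₀) • fderiv ℝ (fderiv ℝ (g i)) x₀ +
          (ℓ i).smulRight (fderiv ℝ (g i) x₀)) + (fderiv ℝ (g i) x₀).smulRight (ℓ i))) x₀ :=
      HasFDerivAt.fun_sum fun i _ => ((hℓd i x₀).smul (hgd1 i x₀).hasFDerivAt).add
        ((hgd i x₀).hasFDerivAt.smul_const (ℓ i))
    rw [hD, h.fderiv]
    simp
  -- functions on `M` with the germs of the factors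
  have hgerm : ∀ k : E → ℝ, ContDiff ℝ ∞ k →
      ∃ u : C^∞⟮𝓘(ℝ, E), M; ℝ⟯, u =ᶠ[𝓝 q] fun x => k (c.1 x) := fun k hk =>
    exists_smooth_germ hsrc fun x hx => contMDiffAt_comp_chart c hx hk.contDiffAt
  choose u hu using fun i => hgerm (fun x => ℓ i (x - x₀))
    ((ℓ i).contDiff.comp (contDiff_id.sub contDiff_const))
  choose G hG using fun i => hgerm (g i) (hg i)
  obtain ⟨Γ, -, hΓ⟩ := A.exists_tensor
  have hsq : ∀ F F' : C^∞⟮𝓘(ℝ, E), M; ℝ⟯, A.squaredField F F' =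
      Γ (mfderiv 𝓘(ℝ, E) 𝓘(ℝ, ℝ) F q) (mfderiv 𝓘(ℝ, E) 𝓘(ℝ, ℝ) F' q) := by
    intro F F'
    rw [SecondOrderVector.squaredField, hΓ]
    ring
  have hφ : φ =ᶠ[𝓝 q] (f x₀ • (1 : C^∞⟮𝓘(ℝ, E), M; ℝ⟯) + ∑ i, u i * G i :
      C^∞⟮𝓘(ℝ, E), M; ℝ⟯) := by
    have hc : ContinuousAt c.1 q := c.1.continuousAt hq
    filter_upwards [hsrc, hc.eventually hf, eventually_all.2 hu, eventually_all.2 hG]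
      with x h3 h4 h5 h6
    have e1 : (f x₀ • (1 : C^∞⟮𝓘(ℝ, E), M; ℝ⟯) + ∑ i, u i * G i : C^∞⟮𝓘(ℝ, E), M; ℝ⟯) x =
        f x₀ + ∑ i, u i x * G i x := by
      have : (∑ i, u i * G i : C^∞⟮𝓘(ℝ, E), M; ℝ⟯) x = ∑ i, u i x * G i x := by
        have h := map_sum (ContMDiffMap.evalRingHom x : C^∞⟮𝓘(ℝ, E), M; ℝ⟯ →+* ℝ)
          (fun i => u i * G i) Finset.univ
        exact h
      change f x₀ * 1 + (∑ i, u i * G i : C^∞⟮𝓘(ℝ, E), M; ℝ⟯) x = _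
      rw [this, mul_one]
    rw [e1]
    simp only [h5, h6]
    rw [← hfg, h4, Function.comp_apply, c.1.left_inv h3]
  have hterm : ∀ i, A.toLin (u i * G i) = g i x₀ * K (0, ℓ i, 0) +
      2 * K (0, 0, symm E ((ℓ i).smulRight (fderiv ℝ (g i) x₀))) := by
    intro i
    obtain ⟨u', hu'⟩ := hgerm (ℓ i) (ℓ i).contDiff
    obtain ⟨v', hv'⟩ := hgerm (fderiv ℝ (g i) x₀) (fderiv ℝ (g i) x₀).contDiff
    have h3 : A.toLin (u i) = K (0, ℓ i, 0) := by
      rw [← h1 (ℓ i) u' hu', ← sub_eq_zero, ← map_sub]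
      have : (⇑(u i - u')) =ᶠ[𝓝 q] (((-ℓ i x₀) • 1 : C^∞⟮𝓘(ℝ, E), M; ℝ⟯)) := by
        filter_upwards [hu i, hu'] with x h3 h4
        change u i x - u' x = -ℓ i x₀ * 1
        rw [h3, h4, map_sub]
        ring
      rw [A.toLin_congr this, map_smul, A.toLin_one, smul_zero]
    have h4 : Γ (mfderiv 𝓘(ℝ, E) 𝓘(ℝ, ℝ) (u i) q) (mfderiv 𝓘(ℝ, E) 𝓘(ℝ, ℝ) (G i) q) =
        2 * K (0, 0, symm E ((ℓ i).smulRight (fderiv ℝ (g i) x₀))) := by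
      rw [← h2 _ _ u' v' hu' hv', hsq,
        mfderiv_comp_chart c hq (hℓd i _).differentiableAt (hu i),
        mfderiv_comp_chart c hq (hgd i _) (hG i),
        mfderiv_comp_chart c hq (ℓ i).differentiableAt hu',
        mfderiv_comp_chart c hq (fderiv ℝ (g i) x₀).differentiableAt hv',
        ContinuousLinearMap.fderiv, ContinuousLinearMap.fderiv, (hℓd i _).fderiv]
    have h5 : u i q = 0 := by
      have h6 : u i q = ℓ i (c.1 q - x₀) := (hu i).self_of_nhds
      rw [h6, ← hx₀, sub_self, map_zero]
    have h6 : G i q = g i x₀ := (hG i).self_of_nhds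
    rw [hΓ, h4, h3, h5, h6]
    ring
  rw [A.toLin_congr hφ, map_add, map_smul, A.toLin_one, smul_zero, zero_add, map_sum, hD0, hDD]
  simp only [hterm]
  have e1 : ((0 : E), (∑ i, g i x₀ • ℓ i), symm E (∑ i, ((ℓ i).smulRight (fderiv ℝ (g i) x₀) +
      (fderiv ℝ (g i) x₀).smulRight (ℓ i)))) =
      ∑ i, (g i x₀ • ((0 : E), (ℓ i, (0 : symBilin E))) + (2 : ℝ) • ((0 : E),
        ((0 : E →L[ℝ] ℝ), symm E ((ℓ i).smulRight (fderiv ℝ (g i) x₀))))) := by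
    have e2 : ∀ i, symm E ((fderiv ℝ (g i) x₀).smulRight (ℓ i)) =
        symm E ((ℓ i).smulRight (fderiv ℝ (g i) x₀)) := by
      intro i
      refine Subtype.ext ?_
      ext a b
      rw [symm_apply, symm_apply]
      simp
      ring
    refine Prod.ext ?_ (Prod.ext ?_ ?_)
    · simp [Prod.fst_sum]
    · simp [Prod.fst_sum, Prod.snd_sum]
    · simp [Prod.snd_sum, map_sum, e2, two_smul]
  rw [e1, map_sum]
  refine Finset.sum_congr rfl fun i _ => ?_
  rw [map_add, map_smul, map_smul, smul_eq_mul, smul_eq_mul]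

end Coordinates

end StochHam

namespace StochHam

section Instances

variable (E : Type*) [NormedAddCommGroup E] [NormedSpace ℝ E]

-- direct access to the structures on the model space, whose synthesis is expensive

/-- The norm of the typical fibre. -/
noncomputable abbrev cotFiberGroup : NormedAddCommGroup (CotFiber E) := inferInstance

/-- The normed space structure of the typical fibre. -/
noncomputable abbrev cotFiberSpace : NormedSpace ℝ (CotFiber E) := inferInstance

/-- The norm of the model space. -/
noncomputable abbrev cotModelGroup : NormedAddCommGroup (E × CotFiber E) := inferInstance

/-- The normed space structure of the model space. -/
noncomputable abbrev cotModelSpace : NormedSpace ℝ (E × CotFiber E) := inferInstance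

end Instances

attribute [local instance] cotFiberGroup cotFiberSpace cotModelGroup cotModelSpace

/-! ### Canonical coordinates and second-order differentials -/

section CanonicalCoordinates

variable {E : Type*} [NormedAddCommGroup E] [NormedSpace ℝ E]
  {M : Type*} [TopologicalSpace M] [ChartedSpace E M] [IsManifold 𝓘(ℝ, E) ∞ M]

theorem mem_source_indexAt (q : M) : q ∈ ((cotCore E M).indexAt q).1.source :=
  (cotCore E M).mem_baseSet_at q

theorem canonicalCoord_ofCanonicalCoord (c : Chart E M) {y : E × CotFiber E}
    (hy : y.1 ∈ c.1.target) : canonicalCoord c (ofCanonicalCoord c y) = y := by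
  have hs : c.1.symm y.1 ∈ c.1.source := c.1.map_target hy
  refine Prod.ext (c.1.right_inv hy) ?_
  exact (cotChange_comp c _ c _ hs (mem_source_indexAt _) hs _).trans (cotChange_self c _ hs _)

theorem ofCanonicalCoord_canonicalCoord (c : Chart E M) {z : SOCotangent E M}
    (hz : z.proj ∈ c.1.source) : ofCanonicalCoord c (canonicalCoord c z) = z := by
  obtain ⟨q, a⟩ := z
  have hq : c.1.symm (c.1 q) = q := c.1.left_inv hz
  have key : ∀ r : M, r = q → (⟨r, cotChange c ((cotCore E M).indexAt r) r
      (cotChange ((cotCore E M).indexAt q) c q a)⟩ : SOCotangent E M) = ⟨q, a⟩ := by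
    rintro r rfl
    exact congrArg (Bundle.TotalSpace.mk r) ((cotChange_comp _ c _ _ (mem_source_indexAt _) hz
      (mem_source_indexAt _) _).trans (cotChange_self _ _ (mem_source_indexAt _) _))
  exact key _ hq

instance (c : Chart E M) : MemTrivializationAtlas ((cotCore E M).localTriv c) :=
  ⟨⟨c, rfl⟩⟩

theorem contMDiffAt_canonicalCoord (c : Chart E M) {z : SOCotangent E M}
    (hz : z.proj ∈ c.1.source) :
    ContMDiffAt (cotModel E) 𝓘(ℝ, E × CotFiber E) ∞ (canonicalCoord c) z := by
  have hz' : z ∈ ((cotCore E M).localTriv c).source :=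
    ((cotCore E M).localTriv c).mem_source.2 hz
  have h := (((cotCore E M).localTriv c).contMDiffAt_iff (IB := 𝓘(ℝ, E)) (n := ∞)
    (f := id) hz').1 contMDiffAt_id
  have h1 := (contMDiffAt_of_mem_maximalAtlas c.2 hz).comp z h.1
  exact h1.prodMk_space h.2

theorem contMDiffAt_ofCanonicalCoord (c : Chart E M) {y : E × CotFiber E} (hy : y.1 ∈ c.1.target) :
    ContMDiffAt 𝓘(ℝ, E × CotFiber E) (cotModel E) ∞ (ofCanonicalCoord c) y := by
  have hs : (ofCanonicalCoord c y).proj ∈ c.1.source := c.1.map_target hy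
  have hz' : ofCanonicalCoord c y ∈ ((cotCore E M).localTriv c).source :=
    ((cotCore E M).localTriv c).mem_source.2 hs
  refine (((cotCore E M).localTriv c).contMDiffAt_iff (IB := 𝓘(ℝ, E)) (n := ∞)
    (f := ofCanonicalCoord c) hz').2 ⟨?_, ?_⟩
  · exact ContMDiffAt.comp y (g := c.1.symm) (f := Prod.fst)
      (contMDiffAt_symm_of_mem_maximalAtlas c.2 hy) contDiff_fst.contMDiff.contMDiffAt
  · have h2 : ContMDiffAt 𝓘(ℝ, E × CotFiber E) 𝓘(ℝ, CotFiber E) ∞ Prod.snd y :=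
      contDiff_snd.contMDiff.contMDiffAt
    refine h2.congr_of_eventuallyEq ?_
    have ho : IsOpen {y : E × CotFiber E | y.1 ∈ c.1.target} :=
      c.1.open_target.preimage continuous_fst
    filter_upwards [ho.mem_nhds hy] with y' hy'
    exact congrArg Prod.snd (canonicalCoord_ofCanonicalCoord c hy')

/-- The local expression of a time-dependent function in a chart. -/
def loc {N : Type*} (c : Chart E M) (f : ℝ × M → N) (z : ℝ × E) : N := f (z.1, c.1.symm z.2)

theorem loc_apply {N : Type*} (c : Chart E M) (f : ℝ × M → N) {t : ℝ} {q : M}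
    (hq : q ∈ c.1.source) : loc c f (t, c.1 q) = f (t, q) := by
  simp [loc, c.1.left_inv hq]

theorem contMDiffAt_loc {E' H' : Type*} [NormedAddCommGroup E'] [NormedSpace ℝ E']
    [TopologicalSpace H'] {I' : ModelWithCorners ℝ E' H'} {N : Type*} [TopologicalSpace N]
    [ChartedSpace H' N] (c : Chart E M) {f : ℝ × M → N} {z : ℝ × E} (hz : z.2 ∈ c.1.target)
    (hf : ContMDiffAt (𝓘(ℝ, ℝ).prod 𝓘(ℝ, E)) I' ∞ f (z.1, c.1.symm z.2)) :
    ContMDiffAt 𝓘(ℝ, ℝ × E) I' ∞ (loc c f) z := by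
  have h1 : ContMDiffAt 𝓘(ℝ, ℝ × E) 𝓘(ℝ, ℝ) ∞ (Prod.fst : ℝ × E → ℝ) z :=
    contDiff_fst.contMDiff.contMDiffAt
  have h2 : ContMDiffAt 𝓘(ℝ, ℝ × E) 𝓘(ℝ, E) ∞ (fun z : ℝ × E => c.1.symm z.2) z :=
    ContMDiffAt.comp z (contMDiffAt_symm_of_mem_maximalAtlas c.2 hz)
      contDiff_snd.contMDiff.contMDiffAt
  exact ContMDiffAt.comp z (f := fun z : ℝ × E => (z.1, c.1.symm z.2)) hf (h1.prodMk h2)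

theorem contDiffAt_loc (c : Chart E M) (f : C^∞⟮𝓘(ℝ, ℝ).prod 𝓘(ℝ, E), ℝ × M; ℝ⟯) {z : ℝ × E}
    (hz : z.2 ∈ c.1.target) : ContDiffAt ℝ ∞ (loc c f) z :=
  (contMDiffAt_loc c hz f.contMDiff.contMDiffAt).contDiffAt

/-- The chain rule for the pair of the first and the symmetrized second derivative. -/
theorem jet_comp {f g' : E → ℝ} {g : E → E} {y : E} (hf : ContDiffAt ℝ ∞ f (g y))
    (hg : ContDiffAt ℝ ∞ g y) (h : g' =ᶠ[𝓝 y] f ∘ g) :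
    ((fderiv ℝ g' y, symm E (fderiv ℝ (fderiv ℝ g') y)) : CotFiber E) =
      itoAct (fderiv ℝ g y) (fderiv ℝ (fderiv ℝ g) y)
        (fderiv ℝ f (g y), symm E (fderiv ℝ (fderiv ℝ f) (g y))) := by
  have hD : fderiv ℝ g' =ᶠ[𝓝 y] fun z => (fderiv ℝ f (g z)).comp (fderiv ℝ g z) := by
    have hf' : ∀ᶠ w in 𝓝 (g y), ContDiffAt ℝ 1 f w :=
      (hf.of_le (by simp) : ContDiffAt ℝ 1 f (g y)).eventually (by simp)
    have hg' : ∀ᶠ z in 𝓝 y, ContDiffAt ℝ 1 g z :=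
      (hg.of_le (by simp) : ContDiffAt ℝ 1 g y).eventually (by simp)
    filter_upwards [h.fderiv (𝕜 := ℝ), hg', hg.continuousAt.eventually hf'] with z h1 h2 h3
    rw [h1, fderiv_comp z (h3.differentiableAt (by simp)) (h2.differentiableAt (by simp))]
  have hf1 : DifferentiableAt ℝ (fderiv ℝ f) (g y) :=
    (contDiffAt_fderiv hf).differentiableAt (by simp)
  have hg1 : DifferentiableAt ℝ (fderiv ℝ g) y := (contDiffAt_fderiv hg).differentiableAt (by simp)
  have hg0 : DifferentiableAt ℝ g y := hg.differentiableAt (by simp)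
  have hD2 : ∀ u v, fderiv ℝ (fderiv ℝ g') y u v =
      fderiv ℝ f (g y) (fderiv ℝ (fderiv ℝ g) y u v) +
        fderiv ℝ (fderiv ℝ f) (g y) (fderiv ℝ g y u) (fderiv ℝ g y v) := by
    intro u v
    have h1 : HasFDerivAt (fun z => fderiv ℝ f (g z))
        ((fderiv ℝ (fderiv ℝ f) (g y)).comp (fderiv ℝ g y)) y :=
      hf1.hasFDerivAt.comp y hg0.hasFDerivAt
    have h2 := h1.clm_comp hg1.hasFDerivAt
    rw [hD.fderiv_eq, h2.fderiv]
    simp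
  refine Prod.ext ?_ (Subtype.ext ?_)
  · ext u
    rw [itoAct_fst, hD.eq_of_nhds]
    rfl
  · ext u v
    rw [itoAct_snd, symm_apply, symm_apply, hD2, hD2]
    ring

/-- In every chart, the coordinates of the second-order differential of `S` are the derivatives of
the local expression of `S`. -/
theorem canonicalCoord_d2 (S : C^∞⟮𝓘(ℝ, ℝ).prod 𝓘(ℝ, E), ℝ × M; ℝ⟯) (c : Chart E M) (t : ℝ)
    {q : M} (hq : q ∈ c.1.source) :
    canonicalCoord c (d2 S t q) = (c.1 q, jet (loc c S) (t, c.1 q)) := by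
  set i : Chart E M := ⟨chartAt E q, IsManifold.chart_mem_maximalAtlas q⟩ with hi
  have hqi : q ∈ i.1.source := mem_chart_source E q
  refine Prod.ext rfl ?_
  rw [jet_eq_slice (F := loc c S) (t := t) (y := c.1 q) (contDiffAt_loc c S (c.1.map_source hq))]
  have hg : transition i c (c.1 q) = i.1 q := by simp [transition, c.1.left_inv hq]
  have hf : ContDiffAt ℝ ∞ ((fun r => S (t, r)) ∘ i.1.symm) (transition i c (c.1 q)) := by
    rw [hg]
    exact contDiffAt_comp_symm i (slice S t) (i.1.map_source hqi)
  have h := jet_comp (g' := fun x => loc c S (t, x)) hf (contDiffAt_transition i c hqi hq) ?_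
  · rw [h, hg]
    rfl
  · have hc : ContinuousAt c.1.symm (c.1 q) := c.1.continuousAt_symm (c.1.map_source hq)
    have hm : i.1.source ∈ 𝓝 (c.1.symm (c.1 q)) := by
      rw [c.1.left_inv hq]
      exact i.1.open_source.mem_nhds hqi
    filter_upwards [hc hm] with y hy
    simp only [Function.comp_apply, transition, loc]
    rw [i.1.left_inv hy]

theorem d2_eq_ofCanonicalCoord (S : C^∞⟮𝓘(ℝ, ℝ).prod 𝓘(ℝ, E), ℝ × M; ℝ⟯) (c : Chart E M) (t : ℝ)
    {q : M} (hq : q ∈ c.1.source) :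
    d2 S t q = ofCanonicalCoord c (c.1 q, jet (loc c S) (t, c.1 q)) := by
  rw [← canonicalCoord_d2 S c t hq]
  exact (ofCanonicalCoord_canonicalCoord c (z := d2 S t q) hq).symm

theorem loc_d2 (S : C^∞⟮𝓘(ℝ, ℝ).prod 𝓘(ℝ, E), ℝ × M; ℝ⟯) (c : Chart E M) {z : ℝ × E}
    (hz : z.2 ∈ c.1.target) :
    d2 S z.1 (c.1.symm z.2) = ofCanonicalCoord c (z.2, jet (loc c S) z) := by
  rw [d2_eq_ofCanonicalCoord S c z.1 (c.1.map_target hz), c.1.right_inv hz]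

theorem contMDiff_d2 (S : C^∞⟮𝓘(ℝ, ℝ).prod 𝓘(ℝ, E), ℝ × M; ℝ⟯) :
    ContMDiff (𝓘(ℝ, ℝ).prod 𝓘(ℝ, E)) (cotModel E) ∞ (fun z : ℝ × M => d2 S z.1 z.2) := by
  rintro ⟨t, q⟩
  set c : Chart E M := ⟨chartAt E q, IsManifold.chart_mem_maximalAtlas q⟩ with hc
  have hq : q ∈ c.1.source := mem_chart_source E q
  have h1 : ContMDiffAt (𝓘(ℝ, ℝ).prod 𝓘(ℝ, E)) 𝓘(ℝ, E) ∞ (fun z : ℝ × M => c.1 z.2) (t, q) :=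
    ContMDiffAt.comp (t, q) (g := c.1) (f := Prod.snd) (contMDiffAt_of_mem_maximalAtlas c.2 hq)
      contMDiffAt_snd
  have h2 : ContMDiffAt (𝓘(ℝ, ℝ).prod 𝓘(ℝ, E)) 𝓘(ℝ, ℝ × E) ∞
      (fun z : ℝ × M => (z.1, c.1 z.2)) (t, q) := contMDiffAt_fst.prodMk_space h1
  have h3 : ContMDiffAt (𝓘(ℝ, ℝ).prod 𝓘(ℝ, E)) 𝓘(ℝ, CotFiber E) ∞
      (fun z : ℝ × M => jet (loc c S) (z.1, c.1 z.2)) (t, q) :=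
    ContMDiffAt.comp (t, q) (g := jet (loc c S)) (f := fun z : ℝ × M => (z.1, c.1 z.2))
      (contDiffAt_jet (contDiffAt_loc c S (c.1.map_source hq))).contMDiffAt h2
  have h4 := ContMDiffAt.comp (t, q) (g := ofCanonicalCoord c)
    (f := fun z : ℝ × M => (c.1 z.2, jet (loc c S) (z.1, c.1 z.2)))
    (contMDiffAt_ofCanonicalCoord c (c.1.map_source hq)) (h1.prodMk_space h3)
  refine h4.congr_of_eventuallyEq ?_
  have ho : IsOpen {z : ℝ × M | z.2 ∈ c.1.source} := c.1.open_source.preimage continuous_snd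
  filter_upwards [ho.mem_nhds hq] with z hz
  exact d2_eq_ofCanonicalCoord S c z.1 hz

theorem contMDiff_graph_d2 (S : C^∞⟮𝓘(ℝ, ℝ).prod 𝓘(ℝ, E), ℝ × M; ℝ⟯) :
    ContMDiff (𝓘(ℝ, ℝ).prod 𝓘(ℝ, E)) (𝓘(ℝ, ℝ).prod (cotModel E)) ∞
      (fun z : ℝ × M => (z.1, d2 S z.1 z.2)) :=
  contMDiff_fst.prodMk (contMDiff_d2 S)

/-- The smooth function `g(t, d²S(t, q))`. -/
noncomputable def pullD2 (S : C^∞⟮𝓘(ℝ, ℝ).prod 𝓘(ℝ, E), ℝ × M; ℝ⟯)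
    (g : C^∞⟮𝓘(ℝ, ℝ).prod (cotModel E), ℝ × SOCotangent E M; ℝ⟯) :
    C^∞⟮𝓘(ℝ, ℝ).prod 𝓘(ℝ, E), ℝ × M; ℝ⟯ :=
  ⟨fun z => g (z.1, d2 S z.1 z.2), g.contMDiff.comp (contMDiff_graph_d2 S)⟩

variable (A : SecondOrderField (cotModel E) (SOCotangent E M))
  (S : C^∞⟮𝓘(ℝ, ℝ).prod 𝓘(ℝ, E), ℝ × M; ℝ⟯)

/-- The projections of the second-order vector field `A` along `d²S`, as a second-order vector
field on `M`. -/
noncomputable def projField : SecondOrderField 𝓘(ℝ, E) M where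
  val := projection A S
  smooth f := (A.smooth (f.comp (cotProj E M))).comp (contMDiff_graph_d2 S)

end CanonicalCoordinates

/-! ### The projected generator in coordinates -/

section ProjectedGenerator

variable {E : Type*} [NormedAddCommGroup E] [NormedSpace ℝ E]
  {M : Type*} [TopologicalSpace M] [ChartedSpace E M] [IsManifold 𝓘(ℝ, E) ∞ M]
  {H : C^∞⟮𝓘(ℝ, ℝ).prod (cotModel E), ℝ × SOCotangent E M; ℝ⟯}
  {A : SecondOrderField (cotModel E) (SOCotangent E M)}
  {S : C^∞⟮𝓘(ℝ, ℝ).prod 𝓘(ℝ, E), ℝ × M; ℝ⟯}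

/-- The local expression `H(t, x, p, o)` of `H`. -/
noncomputable def locH (H : C^∞⟮𝓘(ℝ, ℝ).prod (cotModel E), ℝ × SOCotangent E M; ℝ⟯) (c : Chart E M)
    (z : ℝ × (E × CotFiber E)) : ℝ := H (z.1, ofCanonicalCoord c z.2)

theorem contDiffAt_locH (c : Chart E M) {z : ℝ × (E × CotFiber E)} (hz : z.2.1 ∈ c.1.target) :
    ContDiffAt ℝ ∞ (locH H c) z := by
  have h1 : ContMDiffAt 𝓘(ℝ, ℝ × (E × CotFiber E)) 𝓘(ℝ, ℝ) ∞
      (Prod.fst : ℝ × (E × CotFiber E) → ℝ) z := contDiff_fst.contMDiff.contMDiffAt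
  have h2 : ContMDiffAt 𝓘(ℝ, ℝ × (E × CotFiber E)) (cotModel E) ∞
      (fun z : ℝ × (E × CotFiber E) => ofCanonicalCoord c z.2) z :=
    ContMDiffAt.comp z (contMDiffAt_ofCanonicalCoord c hz) contDiff_snd.contMDiff.contMDiffAt
  exact (ContMDiffAt.comp z (f := fun z : ℝ × (E × CotFiber E) => (z.1, ofCanonicalCoord c z.2))
    H.contMDiff.contMDiffAt (h1.prodMk h2)).contDiffAt

/-- The derivative of `H(t, ·)` in canonical coordinates, along `d²S`. -/
noncomputable def coordDiff (H : C^∞⟮𝓘(ℝ, ℝ).prod (cotModel E), ℝ × SOCotangent E M; ℝ⟯)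
    (S : C^∞⟮𝓘(ℝ, ℝ).prod 𝓘(ℝ, E), ℝ × M; ℝ⟯) (c : Chart E M) (z : ℝ × E) :
    E × CotFiber E →L[ℝ] ℝ :=
  fderiv ℝ (fun y => locH H c (z.1, y)) (z.2, jet (loc c S) z)

theorem coordDeriv_d2 (c : Chart E M) (t : ℝ) {q : M} (hq : q ∈ c.1.source) (y : E × CotFiber E) :
    coordDeriv (slice H t) c (d2 S t q) y = coordDiff H S c (t, c.1 q) y := by
  rw [coordDeriv, canonicalCoord_d2 S c t hq]
  rfl

theorem contDiffAt_coordDiff (c : Chart E M) {z : ℝ × E} (hz : z.2 ∈ c.1.target) :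
    ContDiffAt ℝ ∞ (coordDiff H S c) z := by
  have h1 : ContDiffAt ℝ ∞ (fun z : ℝ × E => (z.2, jet (loc c S) z)) z :=
    contDiffAt_snd.prodMk (contDiffAt_jet (contDiffAt_loc c S hz))
  have h2 : ContDiffAt ℝ ∞ (Function.uncurry fun (z : ℝ × E) y => locH H c (z.1, y))
      (z, (z.2, jet (loc c S) z)) :=
    ContDiffAt.comp (z, (z.2, jet (loc c S) z))
      (f := fun p : (ℝ × E) × (E × CotFiber E) => (p.1.1, p.2)) (contDiffAt_locH c hz)
      (contDiff_fst.fst.prodMk contDiff_snd).contDiffAt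
  exact ContDiffAt.fderiv (n := ∞) (m := ∞) h2 h1 (by norm_cast)

theorem eventuallyEq_canonicalCoord_fst (c : Chart E M) (z : SOCotangent E M) {u : M → ℝ}
    {k : E → ℝ} (hu : u =ᶠ[𝓝 z.proj] fun x => k (c.1 x)) :
    (fun w : SOCotangent E M => u w.proj) =ᶠ[𝓝 z] fun w => k (canonicalCoord c w).1 := by
  have hc : ContinuousAt (fun w : SOCotangent E M => w.proj) z :=
    (FiberBundle.continuous_proj (CotFiber E) (cotCore E M).Fiber).continuousAt
  exact hc.eventually hu

/-- The projected generator is the second-order operator with the coefficients `∂H/∂p`, `∂H/∂o`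
along `d²S`; in particular it depends on `H` and `S` only. -/
theorem projection_toLin [FiniteDimensional ℝ E] [T2Space M] (hA : IsHamiltonianField H A)
    (c : Chart E M) (t : ℝ) {q : M} (hq : q ∈ c.1.source) (φ : C^∞⟮𝓘(ℝ, E), M; ℝ⟯) :
    (projection A S t q).toLin φ = coordDiff H S c (t, c.1 q)
      (0, fderiv ℝ (φ ∘ c.1.symm) (c.1 q), symm E (fderiv ℝ (fderiv ℝ (φ ∘ c.1.symm)) (c.1 q))) := by
  have hz := hA t (d2 S t q)
  refine (projection A S t q).toLin_eq_of_coord c hq _ (fun ℓ u hu => ?_)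
    (fun ℓ m u v hu hv => ?_) φ
  · rw [← coordDeriv_d2 c t hq]
    exact hz.apply_x c hq ℓ (u.comp (cotProj E M)) (eventuallyEq_canonicalCoord_fst c (d2 S t q) hu)
  · rw [← coordDeriv_d2 c t hq]
    exact hz.squaredField_x c hq ℓ m (u.comp (cotProj E M)) (v.comp (cotProj E M))
      (eventuallyEq_canonicalCoord_fst c (d2 S t q) hu)
      (eventuallyEq_canonicalCoord_fst c (d2 S t q) hv)

/-- The space-time generator `∂_t + d²τ A` in coordinates. -/
theorem deriv_add_projection [FiniteDimensional ℝ E] [T2Space M] (hA : IsHamiltonianField H A)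
    (c : Chart E M) (t : ℝ) {q : M} (hq : q ∈ c.1.source) (f : C^∞⟮𝓘(ℝ, ℝ).prod 𝓘(ℝ, E), ℝ × M; ℝ⟯) :
    deriv (fun r => f (r, q)) t + (projection A S t q).toLin (slice f t) =
      jetGen (coordDiff H S c (t, c.1 q)) (loc c f) (t, c.1 q) := by
  have hs := contDiffAt_loc c f (z := (t, c.1 q)) (c.1.map_source hq)
  have h1 : (fun r => f (r, q)) = fun r => loc c f (r, c.1 q) := by
    funext r
    rw [loc_apply c f hq]
  rw [jetGen, projection_toLin hA c t hq, h1,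
    (hasDerivAt_slice (hs.differentiableAt (by simp))).deriv, jet_eq_slice hs]
  rfl

end ProjectedGenerator

end StochHam

namespace StochHam

attribute [local instance] cotFiberGroup cotFiberSpace cotModelGroup cotModelSpace

/-! ### Construction of second-order tangent vectors -/

section Construction

variable {V : Type*} [NormedAddCommGroup V] [NormedSpace ℝ V]

theorem jet_mul {F G : ℝ × V → ℝ} {z : ℝ × V} (hF : ContDiffAt ℝ ∞ F z)
    (hG : ContDiffAt ℝ ∞ G z) :
    jet (fun z => F z * G z) z = F z • jet G z + G z • jet F z +
      (2 : ℝ) • ((0 : V →L[ℝ] ℝ), symm V ((jet F z).1.smulRight (jet G z).1)) := by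
  have hF1 : DifferentiableAt ℝ F z := hF.differentiableAt (by simp)
  have hG1 : DifferentiableAt ℝ G z := hG.differentiableAt (by simp)
  have hF2 : DifferentiableAt ℝ (fderiv ℝ F) z := (contDiffAt_fderiv hF).differentiableAt (by simp)
  have hG2 : DifferentiableAt ℝ (fderiv ℝ G) z := (contDiffAt_fderiv hG).differentiableAt (by simp)
  have h1 : (fderiv ℝ fun z => F z * G z) =ᶠ[𝓝 z]
      fun z => F z • fderiv ℝ G z + G z • fderiv ℝ F z := by
    have hF' : ∀ᶠ w in 𝓝 z, ContDiffAt ℝ 1 F w :=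
      (hF.of_le (by simp) : ContDiffAt ℝ 1 F z).eventually (by simp)
    have hG' : ∀ᶠ w in 𝓝 z, ContDiffAt ℝ 1 G w :=
      (hG.of_le (by simp) : ContDiffAt ℝ 1 G z).eventually (by simp)
    filter_upwards [hF', hG'] with w h1 h2
    exact fderiv_fun_mul (h1.differentiableAt (by simp)) (h2.differentiableAt (by simp))
  have h2 := ((hF1.hasFDerivAt.smul hG2.hasFDerivAt).add
    (hG1.hasFDerivAt.smul hF2.hasFDerivAt)).congr_of_eventuallyEq h1
  refine Prod.ext ?_ (Subtype.ext ?_)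
  · ext u
    simp [jet, h1.eq_of_nhds]
  · ext u v
    have h3 : ∀ a b, spaceHess (fun z => F z * G z) z a b = F z * spaceHess G z a b +
        fderiv ℝ F z (0, a) * fderiv ℝ G z (0, b) + (G z * spaceHess F z a b +
        fderiv ℝ G z (0, a) * fderiv ℝ F z (0, b)) := by
      intro a b
      rw [spaceHess_apply, h2.fderiv]
      simp [spaceHess_apply]
    simp only [jet, Prod.snd_add, Prod.smul_snd, Submodule.coe_add, Submodule.coe_smul, add_apply,
      smul_apply, smul_eq_mul]
    rw [symm_apply, symm_apply, symm_apply, symm_apply, h3, h3]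
    simp
    ring

theorem jet_add {F G : ℝ × V → ℝ} {z : ℝ × V} (hF : ContDiffAt ℝ ∞ F z)
    (hG : ContDiffAt ℝ ∞ G z) : jet (fun z => F z + G z) z = jet F z + jet G z := by
  have h1 : (fderiv ℝ fun z => F z + G z) =ᶠ[𝓝 z] fun z => fderiv ℝ F z + fderiv ℝ G z := by
    have hF' : ∀ᶠ w in 𝓝 z, ContDiffAt ℝ 1 F w :=
      (hF.of_le (by simp) : ContDiffAt ℝ 1 F z).eventually (by simp)
    have hG' : ∀ᶠ w in 𝓝 z, ContDiffAt ℝ 1 G w :=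
      (hG.of_le (by simp) : ContDiffAt ℝ 1 G z).eventually (by simp)
    filter_upwards [hF', hG'] with w h1 h2
    exact fderiv_fun_add (h1.differentiableAt (by simp)) (h2.differentiableAt (by simp))
  rw [jet_eq_jetLin, jet_eq_jetLin, jet_eq_jetLin, h1.fderiv_eq, h1.eq_of_nhds,
    fderiv_fun_add ((contDiffAt_fderiv hF).differentiableAt (by simp))
      ((contDiffAt_fderiv hG).differentiableAt (by simp)), ← map_add]
  rfl

theorem jetGen_mul (K : V × CotFiber V →L[ℝ] ℝ) {F G : ℝ × V → ℝ} {z : ℝ × V}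
    (hF : ContDiffAt ℝ ∞ F z) (hG : ContDiffAt ℝ ∞ G z) :
    jetGen K (fun z => F z * G z) z = F z * jetGen K G z + G z * jetGen K F z +
      2 * K (0, 0, symm V ((jet F z).1.smulRight (jet G z).1)) := by
  have e : ((0 : V), jet (fun z => F z * G z) z) = F z • ((0 : V), jet G z) +
      G z • ((0 : V), jet F z) +
      (2 : ℝ) • ((0 : V), (0 : V →L[ℝ] ℝ), symm V ((jet F z).1.smulRight (jet G z).1)) := by
    refine Prod.ext ?_ (jet_mul hF hG)
    simp
  simp only [jetGen]
  rw [e, map_add, map_add, map_smul, map_smul, map_smul, fderiv_fun_mul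
    (hF.differentiableAt (by simp)) (hG.differentiableAt (by simp))]
  simp only [add_apply, smul_apply, smul_eq_mul]
  ring

theorem jetGen_add (K : V × CotFiber V →L[ℝ] ℝ) {F G : ℝ × V → ℝ} {z : ℝ × V}
    (hF : ContDiffAt ℝ ∞ F z) (hG : ContDiffAt ℝ ∞ G z) :
    jetGen K (fun z => F z + G z) z = jetGen K F z + jetGen K G z := by
  have e : ((0 : V), jet (fun z => F z + G z) z) = ((0 : V), jet F z) + ((0 : V), jet G z) := by
    refine Prod.ext ?_ (jet_add hF hG)
    simp
  simp only [jetGen]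
  rw [e, map_add, fderiv_fun_add (hF.differentiableAt (by simp)) (hG.differentiableAt (by simp)),
    add_apply]
  ring

theorem jet_const (a : ℝ) (z : ℝ × V) : jet (fun _ => a) z = 0 := by
  have h : fderiv ℝ (fun _ : ℝ × V => a) = fun _ => 0 := by
    funext
    simp
  rw [jet_eq_jetLin, h, fderiv_fun_const]
  exact map_zero _

theorem jetGen_const (K : V × CotFiber V →L[ℝ] ℝ) (a : ℝ) (z : ℝ × V) :
    jetGen K (fun _ => a) z = 0 := by
  have h : K (0, 0) = 0 := map_zero K
  rw [jetGen, jet_const, h]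
  simp

theorem jetGen_const_mul (K : V × CotFiber V →L[ℝ] ℝ) (a : ℝ) {F : ℝ × V → ℝ} {z : ℝ × V}
    (hF : ContDiffAt ℝ ∞ F z) : jetGen K (fun z => a * F z) z = a * jetGen K F z := by
  rw [jetGen_mul K contDiffAt_const hF, jetGen_const, jet_const]
  have h0 : ((0 : CotFiber V).1.smulRight (jet F z).1 : Bilin V) = 0 := by
    ext
    simp
  have h1 : K (0, (0 : V →L[ℝ] ℝ), (0 : symBilin V)) = 0 := map_zero K
  rw [h0, map_zero, h1]
  ring

variable {E H : Type*} [NormedAddCommGroup E] [NormedSpace ℝ E] [TopologicalSpace H]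
  {I : ModelWithCorners ℝ E H} {N : Type*} [TopologicalSpace N] [ChartedSpace H N]

theorem contDiffAt_comp_map {ψ : ℝ × V → N} {w : ℝ × V}
    (hψ : ContMDiffAt 𝓘(ℝ, ℝ × V) I ∞ ψ w) (g : C^∞⟮I, N; ℝ⟯) :
    ContDiffAt ℝ ∞ (fun x => g (ψ x)) w :=
  (ContMDiffAt.comp w (g := g) g.contMDiff.contMDiffAt hψ).contDiffAt

/-- The second-order tangent vector `g ↦ (∂_t + K(0, D_x, D_x²)) (g ∘ ψ) (w)` at `ψ(w)`. -/
noncomputable def jetVector (K : V × CotFiber V →L[ℝ] ℝ) (ψ : ℝ × V → N) (w : ℝ × V)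
    (hψ : ContMDiffAt 𝓘(ℝ, ℝ × V) I ∞ ψ w) : SecondOrderVector I (ψ w) where
  toLin :=
    { toFun := fun g => jetGen K (fun x => g (ψ x)) w
      map_add' := fun f g => jetGen_add K (contDiffAt_comp_map hψ f) (contDiffAt_comp_map hψ g)
      map_smul' := fun a g => jetGen_const_mul K a (contDiffAt_comp_map hψ g) }
  exists_tensor := by
    -- pull a covector back to the space `V`
    let p : (TangentSpace I (ψ w) →L[ℝ] ℝ) →ₗ[ℝ] (V →L[ℝ] ℝ) :=
      { toFun := fun a => (a.comp (mfderiv 𝓘(ℝ, ℝ × V) I ψ w)).comp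
          (ContinuousLinearMap.inr ℝ ℝ V)
        map_add' := fun _ _ => rfl
        map_smul' := fun _ _ => rfl }
    have hp : ∀ g : C^∞⟮I, N; ℝ⟯, p (mfderiv I 𝓘(ℝ, ℝ) g (ψ w)) =
        (jet (fun x => g (ψ x)) w).1 := by
      intro g
      have h := mfderiv_comp w (g.contMDiff.mdifferentiable (by simp) (ψ w))
        (hψ.mdifferentiableAt (by simp))
      rw [mfderiv_eq_fderiv] at h
      exact (congrArg (fun a : (ℝ × V) →L[ℝ] ℝ => a.comp (ContinuousLinearMap.inr ℝ ℝ V)) h).symm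
    let Γ₀ : (V →L[ℝ] ℝ) →ₗ[ℝ] (V →L[ℝ] ℝ) →ₗ[ℝ] ℝ :=
      LinearMap.mk₂ ℝ (fun a b => 2 * K (0, 0, symm V (a.smulRight b)))
        (fun a a' b => by
          have e : ((a + a').smulRight b : Bilin V) = a.smulRight b + a'.smulRight b := by
            ext; simp [add_mul]
          have e' : ((0 : V), (0 : V →L[ℝ] ℝ), symm V (a.smulRight b + a'.smulRight b)) =
            (0, 0, symm V (a.smulRight b)) + (0, 0, symm V (a'.smulRight b)) := by simp
          rw [e, e', map_add, mul_add])
        (fun r a b => by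
          have e : ((r • a).smulRight b : Bilin V) = r • a.smulRight b := by
            ext; simp [mul_assoc]
          have e' : ((0 : V), (0 : V →L[ℝ] ℝ), symm V (r • a.smulRight b)) =
            r • (0, 0, symm V (a.smulRight b)) := by simp
          rw [e, e', map_smul, smul_eq_mul, smul_eq_mul]
          ring)
        (fun a b b' => by
          have e : (a.smulRight (b + b') : Bilin V) = a.smulRight b + a.smulRight b' := by
            ext; simp
          have e' : ((0 : V), (0 : V →L[ℝ] ℝ), symm V (a.smulRight b + a.smulRight b')) =
            (0, 0, symm V (a.smulRight b)) + (0, 0, symm V (a.smulRight b')) := by simp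
          rw [e, e', map_add, mul_add])
        (fun r a b => by
          have e : (a.smulRight (r • b) : Bilin V) = r • a.smulRight b := by
            ext; simp; ring
          have e' : ((0 : V), (0 : V →L[ℝ] ℝ), symm V (r • a.smulRight b)) =
            r • (0, 0, symm V (a.smulRight b)) := by simp
          rw [e, e', map_smul, smul_eq_mul, smul_eq_mul]
          ring)
    refine ⟨Γ₀.compl₁₂ p p, fun α β => ?_, fun f g => ?_⟩
    · change 2 * K (0, 0, symm V ((p α).smulRight (p β))) =
        2 * K (0, 0, symm V ((p β).smulRight (p α)))
      congr 4
      refine Subtype.ext ?_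
      ext u v
      rw [symm_apply, symm_apply]
      simp
      ring
    · have h := jetGen_mul K (contDiffAt_comp_map hψ f) (contDiffAt_comp_map hψ g)
      rw [← hp f, ← hp g] at h
      exact h

theorem jetVector_toLin (K : V × CotFiber V →L[ℝ] ℝ) {ψ : ℝ × V → N} {w : ℝ × V}
    (hψ : ContMDiffAt 𝓘(ℝ, ℝ × V) I ∞ ψ w) (g : C^∞⟮I, N; ℝ⟯) :
    (jetVector K ψ w hψ).toLin g = jetGen K (fun x => g (ψ x)) w := rfl

theorem isElliptic_jetVector {K : V × CotFiber V →L[ℝ] ℝ}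
    (hK : ∀ m : V →L[ℝ] ℝ, 0 ≤ K (0, 0, symm V (m.smulRight m))) {ψ : ℝ × V → N} {w : ℝ × V}
    (hψ : ContMDiffAt 𝓘(ℝ, ℝ × V) I ∞ ψ w) : (jetVector K ψ w hψ).IsElliptic := by
  intro f
  have h := jetGen_mul K (contDiffAt_comp_map hψ f) (contDiffAt_comp_map hψ f)
  have e : (jetVector K ψ w hψ).squaredField f f =
      2 * K (0, 0, symm V ((jet (fun x => f (ψ x)) w).1.smulRight
        (jet (fun x => f (ψ x)) w).1)) := by
    rw [SecondOrderVector.squaredField, jetVector_toLin, jetVector_toLin]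
    have h' : (fun x => (f * f) (ψ x)) = fun x => f (ψ x) * f (ψ x) := rfl
    rw [h', h]
    ring
  rw [e]
  exact mul_nonneg zero_le_two (hK _)

/-- A linear combination of second-order tangent vectors at the same point. -/
noncomputable def sumVector {q : N} {ι : Type*} (s : Finset ι) (a : ι → ℝ)
    (A : ι → SecondOrderVector I q) : SecondOrderVector I q where
  toLin := ∑ i ∈ s, a i • (A i).toLin
  exists_tensor := by
    choose Γ hs hΓ using fun i => (A i).exists_tensor
    have hsum : ∀ α β, (∑ i ∈ s, a i • Γ i) α β = ∑ i ∈ s, a i * Γ i α β := fun α β => by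
      simp only [LinearMap.sum_apply, LinearMap.smul_apply, smul_eq_mul]
    refine ⟨∑ i ∈ s, a i • Γ i, fun α β => ?_, fun f g => ?_⟩
    · rw [hsum, hsum]
      exact Finset.sum_congr rfl fun i _ => by rw [hs]
    · refine Eq.trans ?_ (congrArg₂ (· + ·) rfl (hsum _ _).symm)
      simp only [LinearMap.sum_apply, LinearMap.smul_apply, hΓ, smul_eq_mul, Finset.mul_sum,
        mul_add, Finset.sum_add_distrib]
      refine congrArg₂ (· + ·) (congrArg₂ (· + ·) ?_ ?_) rfl
      · exact Finset.sum_congr rfl fun i _ => by ring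
      · exact Finset.sum_congr rfl fun i _ => by ring

theorem sumVector_toLin {q : N} {ι : Type*} (s : Finset ι) (a : ι → ℝ)
    (A : ι → SecondOrderVector I q) (g : C^∞⟮I, N; ℝ⟯) :
    (sumVector s a A).toLin g = ∑ i ∈ s, a i * (A i).toLin g := by
  simp [sumVector]

theorem isElliptic_sumVector {q : N} {ι : Type*} {s : Finset ι} {a : ι → ℝ}
    {A : ι → SecondOrderVector I q} (ha : ∀ i ∈ s, 0 ≤ a i) (hA : ∀ i ∈ s, (A i).IsElliptic) :
    (sumVector s a A).IsElliptic := by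
  intro f
  have e : (sumVector s a A).squaredField f f = ∑ i ∈ s, a i * (A i).squaredField f f := by
    simp only [SecondOrderVector.squaredField, sumVector_toLin, Finset.mul_sum,
      ← Finset.sum_sub_distrib]
    exact Finset.sum_congr rfl fun i _ => by ring
  rw [e]
  exact Finset.sum_nonneg fun i hi => mul_nonneg (ha i hi) (hA i hi f)

/-- Jets depend smoothly on parameters. -/
theorem contDiffAt_jet_param {P : Type*} [NormedAddCommGroup P] [NormedSpace ℝ P]
    {F : P → ℝ × V → ℝ} {w : P → ℝ × V} {p : P}
    (hF : ContDiffAt ℝ ∞ (Function.uncurry F) (p, w p)) (hw : ContDiffAt ℝ ∞ w p) :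
    ContDiffAt ℝ ∞ (fun p => fderiv ℝ (F p) (w p)) p ∧
      ContDiffAt ℝ ∞ (fun p => jet (F p) (w p)) p := by
  have h1 : ContDiffAt ℝ ∞ (fun p => fderiv ℝ (F p) (w p)) p :=
    ContDiffAt.fderiv (n := ∞) hF hw (by norm_cast)
  have h2 : ContDiffAt ℝ ∞ (Function.uncurry fun p x => fderiv ℝ (F p) x) (p, w p) := by
    refine ContDiffAt.fderiv (n := ∞) (f := fun (y : P × (ℝ × V)) => F y.1) (g := Prod.snd)
      (x₀ := (p, w p)) ?_ contDiffAt_snd (by norm_cast)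
    exact ContDiffAt.comp ((p, w p), w p) (g := Function.uncurry F)
      (f := fun y : (P × (ℝ × V)) × (ℝ × V) => (y.1.1, y.2)) hF
      (contDiff_fst.fst.prodMk contDiff_snd).contDiffAt
  have h3 : ContDiffAt ℝ ∞ (fun p => fderiv ℝ (fderiv ℝ (F p)) (w p)) p :=
    ContDiffAt.fderiv (n := ∞) h2 hw (by norm_cast)
  exact ⟨h1, (jetLin (E := V)).contDiff.contDiffAt.comp p (h1.prodMk h3)⟩

end Construction

end StochHam

namespace StochHam

attribute [local instance] cotFiberGroup cotFiberSpace cotModelGroup cotModelSpace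

/-! ### The generator on `𝒯^{S*}M` of the lifted diffusion -/

section Lift

variable {E : Type*} [NormedAddCommGroup E] [NormedSpace ℝ E]
  {M : Type*} [TopologicalSpace M] [ChartedSpace E M] [IsManifold 𝓘(ℝ, E) ∞ M]
  (H : C^∞⟮𝓘(ℝ, ℝ).prod (cotModel E), ℝ × SOCotangent E M; ℝ⟯)
  (S : C^∞⟮𝓘(ℝ, ℝ).prod 𝓘(ℝ, E), ℝ × M; ℝ⟯) (c : Chart E M)

/-- The function `g(d²S(t, q))`. -/
noncomputable def pullSpace (g : C^∞⟮cotModel E, SOCotangent E M; ℝ⟯) :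
    C^∞⟮𝓘(ℝ, ℝ).prod 𝓘(ℝ, E), ℝ × M; ℝ⟯ :=
  ⟨fun z => g (d2 S z.1 z.2), g.contMDiff.comp (contMDiff_d2 S)⟩

/-- The translate by a vector of the typical fibre of the graph of `d²S` in canonical coordinates,
through the point with the coordinates `a` at time `t`. -/
noncomputable def shiftedGraph (t : ℝ) (a : E × CotFiber E) (w : ℝ × E) : SOCotangent E M :=
  ofCanonicalCoord c (w.2, a.2 + (jet (loc c S) w - jet (loc c S) (t, a.1)))

variable {H S c}

theorem shiftedGraph_self (t : ℝ) {z : SOCotangent E M} (hz : z.proj ∈ c.1.source) :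
    shiftedGraph S c t (canonicalCoord c z) (t, c.1 z.proj) = z := by
  have e : shiftedGraph S c t (canonicalCoord c z) (t, c.1 z.proj) =
      ofCanonicalCoord c (canonicalCoord c z) := by
    change ofCanonicalCoord c (c.1 z.proj, (canonicalCoord c z).2 +
      (jet (loc c S) (t, c.1 z.proj) - jet (loc c S) (t, c.1 z.proj))) = _
    rw [sub_self, add_zero]
    rfl
  rw [e, ofCanonicalCoord_canonicalCoord c hz]

theorem contMDiffAt_shiftedGraph (t : ℝ) (a : E × CotFiber E) {w : ℝ × E}
    (hw : w.2 ∈ c.1.target) :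
    ContMDiffAt 𝓘(ℝ, ℝ × E) (cotModel E) ∞ (shiftedGraph S c t a) w := by
  have h1 : ContDiffAt ℝ ∞
      (fun w : ℝ × E => (w.2, a.2 + (jet (loc c S) w - jet (loc c S) (t, a.1)))) w :=
    contDiffAt_snd.prodMk (contDiffAt_const.add
      ((contDiffAt_jet (contDiffAt_loc c S hw)).sub contDiffAt_const))
  exact ContMDiffAt.comp w (g := ofCanonicalCoord c)
    (contMDiffAt_ofCanonicalCoord c hw) h1.contMDiffAt

/-- The function whose value is the action on `g` of the generator along the translated graphs. -/
noncomputable def liftGen (H : C^∞⟮𝓘(ℝ, ℝ).prod (cotModel E), ℝ × SOCotangent E M; ℝ⟯)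
    (S : C^∞⟮𝓘(ℝ, ℝ).prod 𝓘(ℝ, E), ℝ × M; ℝ⟯) (c : Chart E M)
    (g : C^∞⟮cotModel E, SOCotangent E M; ℝ⟯) (t : ℝ) (a : E × CotFiber E) : ℝ :=
  jetGen (coordDiff H S c (t, a.1)) (fun w => g (shiftedGraph S c t a w)) (t, a.1)

theorem contDiffAt_liftGen (g : C^∞⟮cotModel E, SOCotangent E M; ℝ⟯)
    {p : ℝ × (E × CotFiber E)} (hp : p.2.1 ∈ c.1.target) :
    ContDiffAt ℝ ∞ (fun p : ℝ × (E × CotFiber E) => liftGen H S c g p.1 p.2) p := by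
  have hw : ContDiffAt ℝ ∞ (fun p : ℝ × (E × CotFiber E) => (p.1, p.2.1)) p :=
    (contDiff_fst.prodMk contDiff_snd.fst).contDiffAt
  have hJ : ∀ z : ℝ × E, z.2 ∈ c.1.target → ContDiffAt ℝ ∞ (jet (loc c S)) z := fun z hz =>
    contDiffAt_jet (contDiffAt_loc c S hz)
  have hF : ContDiffAt ℝ ∞ (Function.uncurry fun (p : ℝ × (E × CotFiber E)) (w : ℝ × E) =>
      g (shiftedGraph S c p.1 p.2 w)) (p, (p.1, p.2.1)) := by
    have h1 : ContDiffAt ℝ ∞ (fun y : (ℝ × (E × CotFiber E)) × (ℝ × E) =>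
        (y.2.2, y.1.2.2 + (jet (loc c S) y.2 - jet (loc c S) (y.1.1, y.1.2.1))))
        (p, (p.1, p.2.1)) := by
      have h2 : ContDiffAt ℝ ∞ (fun y : (ℝ × (E × CotFiber E)) × (ℝ × E) => jet (loc c S) y.2)
          (p, (p.1, p.2.1)) :=
        ContDiffAt.comp (p, (p.1, p.2.1)) (g := jet (loc c S))
          (f := fun y : (ℝ × (E × CotFiber E)) × (ℝ × E) => y.2) (hJ (p.1, p.2.1) hp)
          contDiffAt_snd
      have h3 : ContDiffAt ℝ ∞ (fun y : (ℝ × (E × CotFiber E)) × (ℝ × E) =>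
          jet (loc c S) (y.1.1, y.1.2.1)) (p, (p.1, p.2.1)) :=
        ContDiffAt.comp (p, (p.1, p.2.1)) (g := jet (loc c S))
          (f := fun y : (ℝ × (E × CotFiber E)) × (ℝ × E) => (y.1.1, y.1.2.1))
          (hJ (p.1, p.2.1) hp) (contDiff_fst.fst.prodMk contDiff_fst.snd.fst).contDiffAt
      exact contDiff_snd.snd.contDiffAt.prodMk (contDiff_fst.snd.snd.contDiffAt.add (h2.sub h3))
    have h4 := ContMDiffAt.comp (p, (p.1, p.2.1)) (g := ofCanonicalCoord c)
      (f := fun y : (ℝ × (E × CotFiber E)) × (ℝ × E) =>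
        (y.2.2, y.1.2.2 + (jet (loc c S) y.2 - jet (loc c S) (y.1.1, y.1.2.1))))
      (contMDiffAt_ofCanonicalCoord c hp) h1.contMDiffAt
    exact (ContMDiffAt.comp (p, (p.1, p.2.1)) (g := g) g.contMDiff.contMDiffAt h4).contDiffAt
  obtain ⟨h5, h6⟩ := contDiffAt_jet_param hF hw
  have h7 : ContDiffAt ℝ ∞ (fun p : ℝ × (E × CotFiber E) => coordDiff H S c (p.1, p.2.1)) p :=
    ContDiffAt.comp p (g := coordDiff H S c)
      (f := fun p : ℝ × (E × CotFiber E) => (p.1, p.2.1)) (contDiffAt_coordDiff c hp) hw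
  exact (h5.clm_apply contDiffAt_const).add (h7.clm_apply (contDiffAt_const.prodMk h6))

variable (H S c)

open scoped Classical in
/-- The second-order tangent vector at `z` that is obtained from the generator of the diffusion on
`M` along the translate of the graph of `d²S` in the chart `c`. -/
noncomputable def liftVector (t : ℝ) (z : SOCotangent E M) : SecondOrderVector (cotModel E) z :=
  if hz : z.proj ∈ c.1.source then
    (shiftedGraph_self t hz : shiftedGraph S c t (canonicalCoord c z) (t, c.1 z.proj) = z) ▸
      jetVector (coordDiff H S c (t, c.1 z.proj)) (shiftedGraph S c t (canonicalCoord c z))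
        (t, c.1 z.proj) (contMDiffAt_shiftedGraph t _ (c.1.map_source hz))
  else sumVector ∅ (fun _ : Empty => 0) fun i => i.elim

variable {H S c}

theorem toLin_cast {E' H' N : Type*} [NormedAddCommGroup E'] [NormedSpace ℝ E']
    [TopologicalSpace H'] {I' : ModelWithCorners ℝ E' H'} [TopologicalSpace N] [ChartedSpace H' N]
    {x y : N} (h : x = y) (A : SecondOrderVector I' x) :
    (h ▸ A : SecondOrderVector I' y).toLin = A.toLin := by
  subst h
  rfl

theorem isElliptic_cast {E' H' N : Type*} [NormedAddCommGroup E'] [NormedSpace ℝ E']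
    [TopologicalSpace H'] {I' : ModelWithCorners ℝ E' H'} [TopologicalSpace N] [ChartedSpace H' N]
    {x y : N} (h : x = y) {A : SecondOrderVector I' x} (hA : A.IsElliptic) :
    (h ▸ A : SecondOrderVector I' y).IsElliptic := by
  subst h
  exact hA

theorem liftVector_toLin (t : ℝ) {z : SOCotangent E M} (hz : z.proj ∈ c.1.source)
    (g : C^∞⟮cotModel E, SOCotangent E M; ℝ⟯) :
    (liftVector H S c t z).toLin g = liftGen H S c g t (canonicalCoord c z) := by
  rw [liftVector, dif_pos hz, toLin_cast]
  rfl

/-- On the graph of `d²S`, the lifted vector does not depend on the chart. -/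
theorem liftVector_toLin_d2 (t : ℝ) {q : M} (hq : q ∈ c.1.source)
    (g : C^∞⟮cotModel E, SOCotangent E M; ℝ⟯) :
    (liftVector H S c t (d2 S t q)).toLin g =
      jetGen (coordDiff H S c (t, c.1 q)) (loc c (pullSpace S g)) (t, c.1 q) := by
  rw [liftVector_toLin t (z := d2 S t q) hq, canonicalCoord_d2 S c t hq, liftGen]
  refine jetGen_congr _ ?_
  have ho : IsOpen {w : ℝ × E | w.2 ∈ c.1.target} := c.1.open_target.preimage continuous_snd
  filter_upwards [ho.mem_nhds (c.1.map_source hq)] with w hw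
  change g (ofCanonicalCoord c (w.2, jet (loc c S) (t, c.1 q) + (jet (loc c S) w -
    jet (loc c S) (t, c.1 q)))) = g (d2 S w.1 (c.1.symm w.2))
  rw [add_sub_cancel, loc_d2 S c hw]

theorem isElliptic_liftVector (t : ℝ) (z : SOCotangent E M)
    (hK : z.proj ∈ c.1.source → ∀ m : E →L[ℝ] ℝ,
      0 ≤ coordDiff H S c (t, c.1 z.proj) (0, 0, symm E (m.smulRight m))) :
    (liftVector H S c t z).IsElliptic := by
  rw [liftVector]
  split_ifs with hz
  · exact isElliptic_cast _ (isElliptic_jetVector (hK hz) _)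
  · exact isElliptic_sumVector (by simp) (by simp)

theorem coordDiff_nonneg [FiniteDimensional ℝ E] [T2Space M]
    {A : SecondOrderField (cotModel E) (SOCotangent E M)} (hA : IsHamiltonianField H A)
    (hell : ∀ t q, (projection A S t q).IsElliptic) (t : ℝ) {q : M} (hq : q ∈ c.1.source)
    (m : E →L[ℝ] ℝ) : 0 ≤ coordDiff H S c (t, c.1 q) (0, 0, symm E (m.smulRight m)) := by
  obtain ⟨u, hu⟩ := exists_smooth_germ (I := 𝓘(ℝ, E)) (c.1.open_source.mem_nhds hq)
    fun x hx => contMDiffAt_comp_chart c hx m.contDiff.contDiffAt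
  have h1 := hell t q u
  have h2 := (hA t (d2 S t q)).squaredField_x c hq m m (u.comp (cotProj E M))
    (u.comp (cotProj E M)) (eventuallyEq_canonicalCoord_fst c (d2 S t q) hu)
    (eventuallyEq_canonicalCoord_fst c (d2 S t q) hu)
  rw [coordDeriv_d2 c t hq] at h2
  have h3 : (projection A S t q).squaredField u u = (A.val t (d2 S t q)).squaredField
    (u.comp (cotProj E M)) (u.comp (cotProj E M)) := rfl
  rw [h3, h2] at h1
  linarith

/-- There is a smooth elliptic second-order vector field on `𝒯^{S*}M` that generates the process
`d²S(t, X(t))` for every diffusion `X` generated by the projection of `A`. It is glued from the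
lifts in charts by a partition of unity. -/
theorem exists_liftField [FiniteDimensional ℝ E] [T2Space M] [SecondCountableTopology M]
    {A : SecondOrderField (cotModel E) (SOCotangent E M)} (hA : IsHamiltonianField H A)
    (hell : ∀ t q, (projection A S t q).IsElliptic) :
    ∃ L : SecondOrderField (cotModel E) (SOCotangent E M),
      (∀ t z, (L.val t z).IsElliptic) ∧ ∀ (c : Chart E M) (t : ℝ) (q : M), q ∈ c.1.source → ∀ g,
        (L.val t (d2 S t q)).toLin g =
          jetGen (coordDiff H S c (t, c.1 q)) (loc c (pullSpace S g)) (t, c.1 q) := by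
  have : LocallyCompactSpace M := Manifold.locallyCompact_of_finiteDimensional 𝓘(ℝ, E)
  obtain ⟨ρ, hρ⟩ := SmoothPartitionOfUnity.exists_isSubordinate_chartAt_source 𝓘(ℝ, E) M
  let C : M → Chart E M := fun i => ⟨chartAt E i, IsManifold.chart_mem_maximalAtlas i⟩
  have hsupp : ∀ i q, q ∈ tsupport (ρ i) → q ∈ (C i).1.source := fun i q hq => hρ i hq
  have hmem : ∀ i q, i ∈ ρ.finsupport q → q ∈ (C i).1.source := fun i q hi =>
    hsupp i q (subset_tsupport _ ((ρ.mem_finsupport q).1 hi))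
  have hproj : Continuous fun w : SOCotangent E M => w.proj :=
    FiberBundle.continuous_proj (CotFiber E) (cotCore E M).Fiber
  let L : ℝ → ∀ z : SOCotangent E M, SecondOrderVector (cotModel E) z := fun t z =>
    sumVector (ρ.finsupport z.proj) (fun i => ρ i z.proj) fun i => liftVector H S (C i) t z
  have hL : ∀ t z g, (L t z).toLin g =
      ∑ᶠ i, ρ i z.proj * (liftVector H S (C i) t z).toLin g := by
    intro t z g
    rw [sumVector_toLin]
    exact ρ.sum_finsupport_smul_eq_finsum z.proj
      fun i _ => (liftVector H S (C i) t z).toLin g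
  refine ⟨⟨L, fun g => ?_⟩, fun t z => ?_, fun c t q hq g => ?_⟩
  · simp only [hL]
    refine contMDiff_finsum (fun i => ?_) ?_
    · refine contMDiff_of_tsupport fun z hz => ?_
      have hz1 : z.2.proj ∈ tsupport (ρ i) := by
        have h1 : z ∈ tsupport fun z : ℝ × SOCotangent E M => ρ i z.2.proj :=
          tsupport_mul_subset_left hz
        have hcont : Continuous fun z : ℝ × SOCotangent E M => z.2.proj :=
          hproj.comp continuous_snd
        have h2 : IsClosed {z : ℝ × SOCotangent E M | z.2.proj ∈ tsupport (ρ i)} :=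
          (isClosed_tsupport (ρ i)).preimage hcont
        have h3 : (tsupport fun z : ℝ × SOCotangent E M => ρ i z.2.proj) ⊆
            {z | z.2.proj ∈ tsupport (ρ i)} :=
          closure_minimal (fun y hy => subset_tsupport (ρ i) hy) h2
        exact h3 h1
      have hz2 := hsupp i _ hz1
      have h1 : ContMDiffAt (𝓘(ℝ, ℝ).prod (cotModel E)) 𝓘(ℝ, ℝ) ∞
          (fun z : ℝ × SOCotangent E M => ρ i z.2.proj) z :=
        ((ρ i).contMDiff.comp ((cotProj E M).contMDiff.comp contMDiff_snd)).contMDiffAt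
      have h2 : ContMDiffAt (𝓘(ℝ, ℝ).prod (cotModel E)) 𝓘(ℝ, ℝ × (E × CotFiber E)) ∞
          (fun z : ℝ × SOCotangent E M => (z.1, canonicalCoord (C i) z.2)) z :=
        contMDiffAt_fst.prodMk_space (ContMDiffAt.comp z (g := canonicalCoord (C i))
          (f := Prod.snd) (contMDiffAt_canonicalCoord (C i) hz2) contMDiffAt_snd)
      have h3 := ContMDiffAt.comp z
        (g := fun p : ℝ × (E × CotFiber E) => liftGen H S (C i) g p.1 p.2)
        (f := fun z : ℝ × SOCotangent E M => (z.1, canonicalCoord (C i) z.2))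
        (contDiffAt_liftGen g ((C i).1.map_source hz2)).contMDiffAt h2
      refine h1.mul (h3.congr_of_eventuallyEq ?_)
      have ho : IsOpen {z : ℝ × SOCotangent E M | z.2.proj ∈ (C i).1.source} :=
        (C i).1.open_source.preimage (hproj.comp continuous_snd)
      filter_upwards [ho.mem_nhds hz2] with y hy
      exact liftVector_toLin y.1 hy g
    · refine (ρ.locallyFinite.preimage_continuous (hproj.comp continuous_snd)).subset fun i => ?_
      intro z hz
      exact left_ne_zero_of_mul hz
  · exact isElliptic_sumVector (fun i _ => ρ.nonneg i _) fun i _ =>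
      isElliptic_liftVector t z fun hz m => coordDiff_nonneg hA hell t hz m
  · have h1 : ∀ i ∈ ρ.finsupport q, (liftVector H S (C i) t (d2 S t q)).toLin g =
        jetGen (coordDiff H S c (t, c.1 q)) (loc c (pullSpace S g)) (t, c.1 q) := by
      intro i hi
      rw [liftVector_toLin_d2 t (hmem i q hi), ← deriv_add_projection hA (C i) t (hmem i q hi),
        deriv_add_projection hA c t hq]
    change (sumVector (ρ.finsupport q) (fun i => ρ i q) _).toLin g = _
    rw [sumVector_toLin, Finset.sum_congr rfl fun i hi => by rw [h1 i hi], ← Finset.sum_mul,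
      ρ.sum_finsupport q (mem_univ q), one_mul]

end Lift

end StochHam

namespace StochHam

attribute [local instance] cotFiberGroup cotFiberSpace cotModelGroup cotModelSpace

/-! ### Consequences of the Hamilton–Jacobi–Bellman equation in coordinates -/

section FlatEquation

variable {V : Type*} [NormedAddCommGroup V] [NormedSpace ℝ V]

theorem fderiv_slice_apply {F : ℝ × V → ℝ} {t : ℝ} {y : V} (hF : DifferentiableAt ℝ F (t, y))
    (v : V) : fderiv ℝ F (t, y) (0, v) = fderiv ℝ (fun x => F (t, x)) y v := by
  rw [(hasFDerivAt_slice hF).fderiv]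
  simp

theorem jet_congr_slice {F G : ℝ × V → ℝ} {t : ℝ} {y : V} (hF : ContDiffAt ℝ ∞ F (t, y))
    (hG : ContDiffAt ℝ ∞ G (t, y)) (h : (fun x => F (t, x)) =ᶠ[𝓝 y] fun x => G (t, x)) :
    jet F (t, y) = jet G (t, y) := by
  rw [jet_eq_slice hF, jet_eq_slice hG, h.fderiv_eq, h.fderiv.fderiv_eq]

theorem jet_linear (ℓ : V →L[ℝ] ℝ) (z : ℝ × V) : jet (fun z => ℓ z.2) z = (ℓ, 0) := by
  have h : ∀ z, fderiv ℝ (fun z : ℝ × V => ℓ z.2) z = ℓ.comp (ContinuousLinearMap.snd ℝ ℝ V) :=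
    fun z => (ℓ.comp (ContinuousLinearMap.snd ℝ ℝ V)).fderiv
  have h1 : spaceHess (fun z : ℝ × V => ℓ z.2) z = 0 := by
    rw [spaceHess_eq_restrictSpace, funext h, fderiv_fun_const]
    exact map_zero _
  refine Prod.ext ?_ ?_
  · ext v
    simp [jet, h]
  · simp [jet, h1]

theorem jetGen_linear (K : V × CotFiber V →L[ℝ] ℝ) (ℓ : V →L[ℝ] ℝ) (z : ℝ × V) :
    jetGen K (fun z => ℓ z.2) z = K (0, ℓ, 0) := by
  have h : fderiv ℝ (fun z : ℝ × V => ℓ z.2) z = ℓ.comp (ContinuousLinearMap.snd ℝ ℝ V) :=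
    (ℓ.comp (ContinuousLinearMap.snd ℝ ℝ V)).fderiv
  rw [jetGen, jet_linear, h]
  simp

variable {F : ℝ × V → ℝ} {G : ℝ × (V × CotFiber V) → ℝ} {t a : ℝ} {y : V}
  {K : V × CotFiber V →L[ℝ] ℝ}

/-- Differentiation of the Hamilton–Jacobi–Bellman equation in space: the equation for `p`. -/
theorem jetGen_space_of_hjb (hF : ContDiffAt ℝ ∞ F (t, y))
    (hG : ContDiffAt ℝ ∞ G (t, y, jet F (t, y)))
    (hK : K = fderiv ℝ (fun z => G (t, z)) (y, jet F (t, y)))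
    (h : ∀ᶠ x in 𝓝 y, fderiv ℝ F (t, x) (1, 0) + G (t, x, jet F (t, x)) = a) (e : V) :
    jetGen K (fun z => fderiv ℝ F z (0, e)) (t, y) = - K (e, 0) := by
  have h1 := fderiv_hjb hF hG e hK
  have h2 : ContDiffAt ℝ ∞ (fun z : ℝ × V => fderiv ℝ F z (1, 0) + G (z.1, z.2, jet F z)) (t, y) :=
    (contDiffAt_fderiv_apply hF _).add (ContDiffAt.comp (t, y)
      (f := fun z : ℝ × V => (z.1, z.2, jet F z)) hG
      (contDiffAt_fst.prodMk (contDiffAt_snd.prodMk (contDiffAt_jet hF))))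
  have h3 : (fun x => fderiv ℝ F (t, x) (1, 0) + G (t, x, jet F (t, x))) =ᶠ[𝓝 y] fun _ => a := h
  rw [fderiv_slice_apply (h2.differentiableAt (by simp)), h3.fderiv_eq] at h1
  simp only [fderiv_fun_const, Pi.zero_apply, zero_apply] at h1
  linarith

/-- Along the solutions of the Hamilton–Jacobi–Bellman equation, the lifted generator annihilates
the Hamiltonian `H(t, ·)`, because derivatives in time and in space commute. -/
theorem jetGen_hamiltonian_of_hjb (hF : ContDiffAt ℝ ∞ F (t, y))
    (hG : ContDiffAt ℝ ∞ G (t, y, jet F (t, y)))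
    (hK : K = fderiv ℝ (fun z => G (t, z)) (y, jet F (t, y)))
    (h : ∀ᶠ x in 𝓝 y, fderiv ℝ F (t, x) (1, 0) + G (t, x, jet F (t, x)) = a) :
    jetGen K (fun z => G (t, z.2, jet F z)) (t, y) = 0 := by
  have hj := contDiffAt_jet hF
  have hW : ContDiffAt ℝ ∞ (fun z : ℝ × V => G (t, z.2, jet F z)) (t, y) :=
    ContDiffAt.comp (t, y) (f := fun z : ℝ × V => (t, z.2, jet F z)) hG
      (contDiffAt_const.prodMk (contDiffAt_snd.prodMk hj))
  have hT : ContDiffAt ℝ ∞ (fun z => fderiv ℝ F z (1, 0)) (t, y) := contDiffAt_fderiv_apply hF _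
  have h1 : jet (fun z : ℝ × V => G (t, z.2, jet F z)) (t, y) +
      jet (fun z => fderiv ℝ F z (1, 0)) (t, y) = 0 := by
    rw [← jet_add hW hT, ← jet_const a (t, y)]
    refine jet_congr_slice (hW.add hT) contDiffAt_const ?_
    filter_upwards [h] with x hx
    rw [← hx, add_comm]
  have h2 : fderiv ℝ (fun z : ℝ × V => G (t, z.2, jet F z)) (t, y) (1, 0) =
      K (0, fderiv ℝ (jet F) (t, y) (1, 0)) := by
    have hGt : DifferentiableAt ℝ (fun z => G (t, z)) (y, jet F (t, y)) :=
      (hasFDerivAt_slice (hG.differentiableAt (by simp))).differentiableAt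
    have hb : HasFDerivAt (fun z : ℝ × V => (z.2, jet F z))
        ((ContinuousLinearMap.snd ℝ ℝ V).prod (fderiv ℝ (jet F) (t, y))) (t, y) :=
      hasFDerivAt_snd.prodMk (hj.differentiableAt (by simp)).hasFDerivAt
    have hc := HasFDerivAt.comp (t, y) (g := fun z => G (t, z))
      (f := fun z : ℝ × V => (z.2, jet F z)) hGt.hasFDerivAt hb
    have hc' : HasFDerivAt (fun z : ℝ × V => G (t, z.2, jet F z)) _ (t, y) := hc
    rw [hc'.fderiv, hK]
    rfl
  rw [jetGen, h2, fderiv_jet hF, ← map_add]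
  have e : ((0 : V), jet (fun z => fderiv ℝ F z (1, 0)) (t, y)) +
      (0, jet (fun z : ℝ × V => G (t, z.2, jet F z)) (t, y)) = 0 := by
    refine Prod.ext (add_zero 0) ?_
    rw [add_comm] at h1
    exact h1
  rw [e, map_zero]

/-- The chain rule on the diagonal. -/
theorem deriv_diagonal {k : ℝ × ℝ → ℝ} {t : ℝ} (hk : DifferentiableAt ℝ k (t, t)) :
    deriv (fun r => k (r, r)) t = deriv (fun r => k (r, t)) t + deriv (fun r => k (t, r)) t := by
  have h0 : HasFDerivAt k (fderiv ℝ k (t, t)) (t, t) := hk.hasFDerivAt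
  have h1 := h0.comp_hasDerivAt (f := fun r : ℝ => (r, r)) t
    ((hasDerivAt_id t).prodMk (hasDerivAt_id t))
  have h2 := h0.comp_hasDerivAt (f := fun r : ℝ => (r, t)) t
    ((hasDerivAt_id t).prodMk (hasDerivAt_const t t))
  have h3 := h0.comp_hasDerivAt (f := fun r : ℝ => (t, r)) t
    ((hasDerivAt_const t t).prodMk (hasDerivAt_id t))
  have e1 : deriv (fun r => k (r, r)) t = fderiv ℝ k (t, t) (1, 1) := h1.deriv
  have e2 : deriv (fun r => k (r, t)) t = fderiv ℝ k (t, t) (1, 0) := h2.deriv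
  have e3 : deriv (fun r => k (t, r)) t = fderiv ℝ k (t, t) (0, 1) := h3.deriv
  rw [e1, e2, e3, ← map_add]
  simp

end FlatEquation

/-! ### Processes with a given generator -/

section Adapted

variable {Ω : Type*} [mΩ : MeasurableSpace Ω] {E H : Type*} [NormedAddCommGroup E]
  [NormedSpace ℝ E] [TopologicalSpace H] {I : ModelWithCorners ℝ E H} {N : Type*}
  [TopologicalSpace N] [ChartedSpace H N] {ℱ : Filtration ℝ mΩ} {P : Measure Ω} {t₀ : ℝ}
  {τ : Ω → WithTop ℝ} {X : ℝ → Ω → N}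

theorem measurableSet_lifetime_comp {t : ℝ}
    (h : ∀ U : Set N, IsOpen U → MeasurableSet[ℱ t] {w | (t : WithTop ℝ) < τ w ∧ X t w ∈ U})
    {k : N → ℝ} (hk : Continuous k) {B : Set ℝ} (hB : MeasurableSet B) :
    MeasurableSet[ℱ t] {w | (t : WithTop ℝ) < τ w ∧ k (X t w) ∈ B} := by
  rw [BorelSpace.measurable_eq (α := ℝ)] at hB
  induction B, hB using MeasurableSpace.generateFrom_induction with
  | hC U hU _ => exact h (k ⁻¹' U) ((show IsOpen U from hU).preimage hk)
  | empty => simp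
  | compl s _ hs =>
    have e : {w | (t : WithTop ℝ) < τ w ∧ k (X t w) ∈ sᶜ} =
        {w | (t : WithTop ℝ) < τ w ∧ X t w ∈ univ} \
          {w | (t : WithTop ℝ) < τ w ∧ k (X t w) ∈ s} := by
      ext w
      simp only [mem_ofPred_eq, mem_compl_iff, mem_univ, and_true, Set.mem_sdiff]
      tauto
    rw [e]
    exact (h univ isOpen_univ).diff hs
  | iUnion s _ hs =>
    have e : {w | (t : WithTop ℝ) < τ w ∧ k (X t w) ∈ ⋃ n, s n} =
        ⋃ n, {w | (t : WithTop ℝ) < τ w ∧ k (X t w) ∈ s n} := by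
      ext w
      simp
    rw [e]
    exact MeasurableSet.iUnion hs

/-- For a generator that is given by an elliptic second-order vector field, the regularity
requirements in the definition of mean derivatives are automatic. -/
theorem HasMeanDerivatives.of_field (A : SecondOrderField I N)
    (hA : ∀ t q, (A.val t q).IsElliptic) (lifetime : IsStoppingTime ℱ τ)
    (start_lt : ∀ᵐ w ∂P, (t₀ : WithTop ℝ) < τ w)
    (continuous : ∀ᵐ w ∂P, ContinuousOn (fun t => X t w) (lifeInterval t₀ τ w))
    (adapted : ∀ t, t₀ ≤ t → ∀ U : Set N, IsOpen U →
      MeasurableSet[ℱ t] {w | (t : WithTop ℝ) < τ w ∧ X t w ∈ U})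
    (martingale : ∀ f : C^∞⟮𝓘(ℝ, ℝ).prod I, ℝ × N; ℝ⟯,
      IsLocalMartingaleUpTo ℱ P t₀ τ (compensated t₀ X (fun t w => A.val t (X t w)) f)) :
    HasMeanDerivatives ℱ P t₀ τ X (fun t w => A.val t (X t w)) where
  lifetime := lifetime
  start_lt := start_lt
  continuous := continuous
  adapted := adapted
  gen_elliptic := Eventually.of_forall fun w t _ => hA t _
  gen_continuous := by
    filter_upwards [continuous] with w hw f
    exact (A.smooth f).continuous.comp_continuousOn (continuousOn_id.prodMk hw)
  gen_adapted f t ht B hB := by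
    have hk : Continuous fun q => (A.val t q).toLin f :=
      (A.smooth f).continuous.comp (continuous_const.prodMk continuous_id)
    exact measurableSet_lifetime_comp (adapted t ht) hk hB
  martingale := martingale

end Adapted

/-! ### From the Hamilton–Jacobi–Bellman equation to Hamilton's equations -/

section Sufficiency

variable {E : Type*} [NormedAddCommGroup E] [NormedSpace ℝ E]
  {M : Type*} [TopologicalSpace M] [ChartedSpace E M] [IsManifold 𝓘(ℝ, E) ∞ M]
  {H : C^∞⟮𝓘(ℝ, ℝ).prod (cotModel E), ℝ × SOCotangent E M; ℝ⟯}
  {A : SecondOrderField (cotModel E) (SOCotangent E M)}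
  {S : C^∞⟮𝓘(ℝ, ℝ).prod 𝓘(ℝ, E), ℝ × M; ℝ⟯}

/-- The time derivative of `S` together with `H(t, d²S)` in a chart. -/
theorem hjb_eq_loc (c : Chart E M) {z : ℝ × E} (hz : z.2 ∈ c.1.target) :
    deriv (fun s => S (s, c.1.symm z.2)) z.1 + H (z.1, d2 S z.1 (c.1.symm z.2)) =
      fderiv ℝ (loc c S) z (1, 0) + locH H c (z.1, z.2, jet (loc c S) z) := by
  have h1 : HasDerivAt (fun s => S (s, c.1.symm z.2)) (fderiv ℝ (loc c S) z (1, 0)) z.1 :=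
    hasDerivAt_slice (F := loc c S) (t := z.1) (y := z.2)
      ((contDiffAt_loc c S hz).differentiableAt (by simp))
  rw [h1.deriv, loc_d2 S c hz]
  rfl

theorem loc_pullSpace_eventuallyEq (c : Chart E M) (t : ℝ) {q : M} (hq : q ∈ c.1.source)
    {g : C^∞⟮cotModel E, SOCotangent E M; ℝ⟯} {k : E × CotFiber E → ℝ}
    (hg : g =ᶠ[𝓝 (d2 S t q)] fun z => k (canonicalCoord c z)) :
    loc c (pullSpace S g) =ᶠ[𝓝 (t, c.1 q)] fun z => k (z.2, jet (loc c S) z) := by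
  have h1 : ContMDiffAt 𝓘(ℝ, ℝ × E) (cotModel E) ∞ (loc c fun z : ℝ × M => d2 S z.1 z.2)
      (t, c.1 q) := contMDiffAt_loc c (c.1.map_source hq) (contMDiff_d2 S).contMDiffAt
  have h2 : loc c (fun z : ℝ × M => d2 S z.1 z.2) (t, c.1 q) = d2 S t q := loc_apply c _ hq
  have h3 := h1.continuousAt
  rw [ContinuousAt, h2] at h3
  have ho : IsOpen {w : ℝ × E | w.2 ∈ c.1.target} := c.1.open_target.preimage continuous_snd
  filter_upwards [h3.eventually hg, ho.mem_nhds (c.1.map_source hq)] with z hz1 hz2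
  refine hz1.trans ?_
  change k (canonicalCoord c (d2 S z.1 (c.1.symm z.2))) = _
  rw [canonicalCoord_d2 S c z.1 (c.1.map_target hz2), c.1.right_inv hz2]

/-- If `S` solves the Hamilton–Jacobi–Bellman equation, the lifted generator satisfies the
stochastic Hamilton's equations. -/
theorem isHamiltonianVector_of_hjb {f : ℝ → ℝ}
    (hS : ∀ t q, deriv (fun s => S (s, q)) t + H (t, d2 S t q) = f t) (t : ℝ) (q : M)
    (B : SecondOrderVector (cotModel E) (d2 S t q))
    (hB : ∀ c : Chart E M, q ∈ c.1.source → ∀ g,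
      B.toLin g = jetGen (coordDiff H S c (t, c.1 q)) (loc c (pullSpace S g)) (t, c.1 q)) :
    IsHamiltonianVector (slice H t) (d2 S t q) B := by
  have hjb : ∀ c : Chart E M, q ∈ c.1.source → ∀ᶠ x in 𝓝 (c.1 q),
      fderiv ℝ (loc c S) (t, x) (1, 0) + locH H c (t, x, jet (loc c S) (t, x)) = f t := by
    intro c hq
    filter_upwards [c.1.open_target.mem_nhds (c.1.map_source hq)] with x hx
    rw [← hjb_eq_loc c (z := (t, x)) hx]
    exact hS t _
  have hloc : ∀ c : Chart E M, q ∈ c.1.source → ContDiffAt ℝ ∞ (loc c S) (t, c.1 q) :=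
    fun c hq => contDiffAt_loc c S (c.1.map_source hq)
  have hlocH : ∀ c : Chart E M, q ∈ c.1.source →
      ContDiffAt ℝ ∞ (locH H c) (t, c.1 q, jet (loc c S) (t, c.1 q)) :=
    fun c hq => contDiffAt_locH c (c.1.map_source hq)
  refine ⟨fun c hq ℓ u hu => ?_, fun c hq ℓ m u v hu hv => ?_, fun c hq e u hu => ?_, ?_⟩
  · have hq : q ∈ c.1.source := hq
    rw [hB c hq, coordDeriv_d2 c t hq, jetGen_congr _ (loc_pullSpace_eventuallyEq c t hq
      (k := fun z => ℓ z.1) hu), jetGen_linear]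
  · have hq : q ∈ c.1.source := hq
    have hu' := loc_pullSpace_eventuallyEq c t hq (k := fun z => ℓ z.1) hu
    have hv' := loc_pullSpace_eventuallyEq c t hq (k := fun z => m z.1) hv
    have huv : loc c (pullSpace S (u * v)) =
        fun z => loc c (pullSpace S u) z * loc c (pullSpace S v) z := rfl
    have eu : u (d2 S t q) = loc c (pullSpace S u) (t, c.1 q) :=
      (loc_apply c (pullSpace S u) hq).symm
    have ev : v (d2 S t q) = loc c (pullSpace S v) (t, c.1 q) :=
      (loc_apply c (pullSpace S v) hq).symm
    rw [SecondOrderVector.squaredField, hB c hq, hB c hq, hB c hq, huv,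
      jetGen_mul _ (contDiffAt_loc c _ (c.1.map_source hq)) (contDiffAt_loc c _ (c.1.map_source hq)),
      eu, ev, coordDeriv_d2 c t hq, jet_congr hu', jet_congr hv', jet_linear, jet_linear]
    ring
  · have hq : q ∈ c.1.source := hq
    rw [hB c hq, coordDeriv_d2 c t hq, jetGen_congr _ (loc_pullSpace_eventuallyEq c t hq
      (k := fun z => z.2.1 e) hu)]
    exact jetGen_space_of_hjb (hloc c hq) (hlocH c hq) rfl (hjb c hq) e
  · set c : Chart E M := ⟨chartAt E q, IsManifold.chart_mem_maximalAtlas q⟩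
    have hq : q ∈ c.1.source := mem_chart_source E q
    have hH : slice H t =ᶠ[𝓝 (d2 S t q)] fun z => locH H c (t, canonicalCoord c z) := by
      have hproj : Continuous fun w : SOCotangent E M => w.proj :=
        FiberBundle.continuous_proj (CotFiber E) (cotCore E M).Fiber
      filter_upwards [(c.1.open_source.preimage hproj).mem_nhds hq] with z hz
      exact congrArg (fun z => H (t, z)) (ofCanonicalCoord_canonicalCoord c hz).symm
    rw [hB c hq, jetGen_congr _ (loc_pullSpace_eventuallyEq c t hq
      (k := fun z => locH H c (t, z)) hH)]
    exact jetGen_hamiltonian_of_hjb (hloc c hq) (hlocH c hq) rfl (hjb c hq)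

/-- The space-time generator of `d²S(t, X(t))` acts on `g` as the one of `X` does on the composition
of `g` with `d²S`. -/
theorem lift_generator_eq [FiniteDimensional ℝ E] [T2Space M] (hA : IsHamiltonianField H A)
    {t : ℝ} {q : M} {B : SecondOrderVector (cotModel E) (d2 S t q)}
    (hB : ∀ c : Chart E M, q ∈ c.1.source → ∀ g,
      B.toLin g = jetGen (coordDiff H S c (t, c.1 q)) (loc c (pullSpace S g)) (t, c.1 q))
    (g : C^∞⟮𝓘(ℝ, ℝ).prod (cotModel E), ℝ × SOCotangent E M; ℝ⟯) :
    deriv (fun r => g (r, d2 S t q)) t + B.toLin (slice g t) =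
      deriv (fun r => pullD2 S g (r, q)) t + (projection A S t q).toLin (slice (pullD2 S g) t) := by
  have hq := mem_chart_source E q
  rw [hB ⟨chartAt E q, IsManifold.chart_mem_maximalAtlas q⟩ hq,
    ← deriv_add_projection hA ⟨chartAt E q, IsManifold.chart_mem_maximalAtlas q⟩ t hq]
  have h1 : ContMDiff 𝓘(ℝ, ℝ × ℝ) 𝓘(ℝ, ℝ) ∞ fun r : ℝ × ℝ => g (r.1, d2 S r.2 q) := by
    refine g.contMDiff.comp (ContMDiff.prodMk contDiff_fst.contMDiff ?_)
    exact (contMDiff_d2 S).comp (f := fun r : ℝ × ℝ => (r.2, q))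
      (contDiff_snd.contMDiff.prodMk contMDiff_const)
  have h2 := deriv_diagonal (k := fun r : ℝ × ℝ => g (r.1, d2 S r.2 q)) (t := t)
    (h1.contDiff.differentiable (by simp) _)
  have h3 : deriv (fun r => pullD2 S g (r, q)) t = deriv (fun r => g (r, d2 S t q)) t +
      deriv (fun r => pullSpace S (slice g t) (r, q)) t := h2
  have h4 : slice (pullSpace S (slice g t)) t = slice (pullD2 S g) t := rfl
  rw [h3, h4]
  ring

/-- If `S` solves the Hamilton–Jacobi–Bellman equation and the mean derivatives of `X` are given by
the projected generator, then `d²S(t, X(t))` is a horizontal integral process. -/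
theorem isHorizontalIntegralProcess_of_hjb [FiniteDimensional ℝ E] [T2Space M]
    [SecondCountableTopology M] (hA : IsHamiltonianField H A)
    (hell : ∀ t q, (projection A S t q).IsElliptic) {f : ℝ → ℝ}
    (hS : ∀ t q, deriv (fun s => S (s, q)) t + H (t, d2 S t q) = f t)
    {Ω : Type*} [mΩ : MeasurableSpace Ω] {P : Measure Ω} {ℱ : Filtration ℝ mΩ} {t₀ : ℝ}
    {τ : Ω → WithTop ℝ} {X : ℝ → Ω → M} (hX : IsDiffusion 𝓘(ℝ, E) ℱ P t₀ τ X)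
    (hX' : HasMeanDerivatives ℱ P t₀ τ X (fun t w => projection A S t (X t w))) :
    IsHorizontalIntegralProcess H ℱ P t₀ τ (fun t w => d2 S t (X t w)) := by
  obtain ⟨L, hL, hL'⟩ := exists_liftField hA hell
  have hZ : HasMeanDerivatives ℱ P t₀ τ (fun t w => d2 S t (X t w))
      (fun t w => L.val t (d2 S t (X t w))) := by
    refine HasMeanDerivatives.of_field L hL hX'.lifetime hX'.start_lt ?_ (fun t ht U hU => ?_)
      fun g => ?_
    · filter_upwards [hX'.continuous] with w hw
      exact (contMDiff_d2 S).continuous.comp_continuousOn (continuousOn_id.prodMk hw)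
    · exact hX'.adapted t ht _ (hU.preimage
        ((contMDiff_d2 S).continuous.comp (continuous_const.prodMk continuous_id)))
    · have e : compensated t₀ (fun t w => d2 S t (X t w))
          (fun t w => L.val t (d2 S t (X t w))) g =
          compensated t₀ X (fun t w => projection A S t (X t w)) (pullD2 S g) := by
        funext t w
        refine congrArg (fun r => g (t, d2 S t (X t w)) - g (t₀, d2 S t₀ (X t₀ w)) - r) ?_
        refine intervalIntegral.integral_congr fun s _ => ?_
        exact lift_generator_eq hA (fun c hq => hL' c s _ hq) g
      rw [e]
      exact hX'.martingale (pullD2 S g)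
  refine ⟨⟨⟨L, hL, hZ⟩, X, fun z => d2 S z.1 z.2, hX, contMDiff_d2 S, fun t q => rfl,
    Eventually.of_forall fun w t _ => rfl⟩, _, hZ, Eventually.of_forall fun w t _ => ?_⟩
  exact isHamiltonianVector_of_hjb hS t _ _ fun c hq => hL' c t _ hq

end Sufficiency

end StochHam

namespace StochHam

attribute [local instance] cotFiberGroup cotFiberSpace cotModelGroup cotModelSpace

/-! ### Local diffusions with prescribed coefficients -/

section LocalDiffusion

universe u

variable {E : Type*} [NormedAddCommGroup E] [NormedSpace ℝ E]

/-- `X` is, up to the time `τ` when it leaves the set `W`, a diffusion started at `(t₀, x₀)` whose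
space-time generator is `∂_t + K(0, D_x, D_x²)`. Functions that are smooth only on a larger open
set `V` can be tested after they have been modified outside `W`. -/
structure LocalDiffusion {Ω : Type*} [mΩ : MeasurableSpace Ω] (ℱ : Filtration ℝ mΩ) (P : Measure Ω)
    (K : ℝ × E → (E × CotFiber E →L[ℝ] ℝ)) (W V : Set (ℝ × E)) (t₀ : ℝ) (x₀ : E) (τ : Ω → ℝ)
    (X : ℝ → Ω → E) : Prop where
  continuous : ∀ w, Continuous fun t => X t w
  adapted : ∀ t, ∀ U : Set E, IsOpen U → MeasurableSet[ℱ t] (X t ⁻¹' U)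
  start : ∀ w, X t₀ w = x₀
  lifetime : IsStoppingTime ℱ (fun w => (τ w : WithTop ℝ))
  start_lt : ∀ w, t₀ < τ w
  lifetime_le : ∀ w, τ w ≤ t₀ + 1
  mem : ∀ w t, t₀ ≤ t → t < τ w → (t, X t w) ∈ W
  exhaustion : ∃ σ : ℕ → Ω → ℝ, (∀ n, IsStoppingTime ℱ (fun w => (σ n w : WithTop ℝ))) ∧
    (∀ w, Monotone fun n => σ n w) ∧ (∀ n w, t₀ ≤ σ n w ∧ σ n w < τ w) ∧
    ∀ w t, t < τ w → ∃ n, t < σ n w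
  martingale : ∀ F : ℝ × E → ℝ, (∀ z ∈ V, ContDiffAt ℝ ∞ F z) → ∃ F' g : ℝ × E → ℝ,
    Continuous g ∧ (∀ z ∈ W, F' z = F z) ∧ (∀ z ∈ W, g z = jetGen (K z) F z) ∧
    ∀ σ : Ω → ℝ, IsStoppingTime ℱ (fun w => (σ w : WithTop ℝ)) → (∀ w, t₀ ≤ σ w) →
      (∀ w, σ w ≤ t₀ + 1) →
      Martingale (fun t w => compProc t₀ X F' g (min (max t t₀) (σ w)) w) ℱ P

/-- A function that is smooth on the support of a smooth factor. -/
theorem contDiff_cutoff_smul {V W : Type*} [NormedAddCommGroup V] [NormedSpace ℝ V]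
    [NormedAddCommGroup W] [NormedSpace ℝ W] {χ : V → ℝ} (hχ : ContDiff ℝ ∞ χ) {f : V → W}
    (hf : ∀ z ∈ tsupport χ, ContDiffAt ℝ ∞ f z) : ContDiff ℝ ∞ fun z => χ z • f z := by
  have h : ContMDiff 𝓘(ℝ, V) 𝓘(ℝ, W) ∞ fun z => χ z • f z :=
    contMDiff_of_tsupport fun z hz => (hχ.contDiffAt.smul
      (hf z (tsupport_smul_subset_left χ f hz))).contMDiffAt
  exact h.contDiff

/-- The vector that represents the first-order part `p ↦ K(0, p, 0)` of the functional `K`. -/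
theorem exists_drift [FiniteDimensional ℝ E] {K : ℝ × E → (E × CotFiber E →L[ℝ] ℝ)} :
    ∃ b : ℝ × E → E, (∀ z, ContDiffAt ℝ ∞ K z → ContDiffAt ℝ ∞ b z) ∧
      ∀ z (p : E →L[ℝ] ℝ), p (b z) = K z (0, p, 0) := by
  obtain ⟨d, ℓ, e, hx, -⟩ := exists_functionals (E := E)
  refine ⟨fun z => ∑ i, K z (0, ℓ i, 0) • e i, fun z hz => ?_, fun z p => ?_⟩
  · exact ContDiffAt.sum fun i _ => (hz.clm_apply contDiffAt_const).smul contDiffAt_const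
  · let J : (E →L[ℝ] ℝ) →L[ℝ] E × CotFiber E :=
      (ContinuousLinearMap.inr ℝ E (CotFiber E)).comp (ContinuousLinearMap.inl ℝ _ _)
    have hJ : ∀ q, J q = (0, q, 0) := fun q => rfl
    have hp : p = ∑ i, p (e i) • ℓ i := by
      ext x
      conv_lhs => rw [hx x]
      simp [mul_comm]
    have h1 : ∀ q, K z (0, q, 0) = (K z).comp J q := fun q => rfl
    conv_rhs => rw [hp]
    simp only [h1, map_sum, map_smul, smul_eq_mul]
    exact Finset.sum_congr rfl fun i _ => mul_comm _ _

/-- The second-order part of the functional `K`. -/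
noncomputable def secondPart (E : Type*) [NormedAddCommGroup E] [NormedSpace ℝ E] :
    (E × CotFiber E →L[ℝ] ℝ) →L[ℝ] (Bilin E →L[ℝ] ℝ) :=
  (ContinuousLinearMap.compL ℝ (Bilin E) (E × CotFiber E) ℝ).flip
    ((ContinuousLinearMap.inr ℝ E (CotFiber E)).comp
      ((ContinuousLinearMap.inr ℝ (E →L[ℝ] ℝ) (symBilin E)).comp (symm E)))

/-- The coefficients are cut off, so that the martingale problem can be solved globally, and the
solution is stopped when it leaves the region where the cutoff function is `1`. -/
theorem exists_localDiffusion [FiniteDimensional ℝ E] {K : ℝ × E → (E × CotFiber E →L[ℝ] ℝ)}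
    {V U : Set (ℝ × E)} (hK : ∀ z ∈ V, ContDiffAt ℝ ∞ K z)
    (hpos : ∀ z ∈ V, ∀ m : E →L[ℝ] ℝ, 0 ≤ K z (0, 0, symm E (m.smulRight m))) {t₀ : ℝ} {x₀ : E}
    (hV : V ∈ 𝓝 (t₀, x₀)) (hU : U ∈ 𝓝 (t₀, x₀)) :
    ∃ W ⊆ U ∩ V, ∃ (Ω : Type u) (mΩ : MeasurableSpace Ω) (P : Measure Ω)
      (_ : IsProbabilityMeasure P) (ℱ : Filtration ℝ mΩ), UsualConditions ℱ P ∧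
      ∃ (τ : Ω → ℝ) (X : ℝ → Ω → E), LocalDiffusion ℱ P K W V t₀ x₀ τ X := by
  borelize E
  obtain ⟨R, hR, hRUV⟩ := Metric.nhds_basis_closedBall.mem_iff.1 (inter_mem hU hV)
  let χ : ContDiffBump ((t₀, x₀) : ℝ × E) := ⟨R / 2, R, by positivity, by linarith⟩
  have hχ : ContDiff ℝ ∞ χ := χ.contDiff
  have hsupp : tsupport χ ⊆ V := by
    rw [χ.tsupport_eq]
    exact fun z hz => (hRUV hz).2
  have hχ1 : ∀ z ∈ Metric.ball ((t₀, x₀) : ℝ × E) (R / 2), χ z = 1 := fun z hz =>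
    χ.one_of_mem_closedBall (Metric.ball_subset_closedBall hz)
  obtain ⟨β, hβ, hβK⟩ := exists_drift (K := K)
  let b : ℝ × E → E := fun z => χ z • β z
  let α : ℝ × E → Bilin E →L[ℝ] ℝ := fun z => χ z • secondPart E (K z)
  have hb : ContDiff ℝ ∞ b := contDiff_cutoff_smul hχ fun z hz => hβ z (hK z (hsupp hz))
  have hα : ContDiff ℝ ∞ α := contDiff_cutoff_smul hχ fun z hz =>
    (secondPart E).contDiff.contDiffAt.comp z (hK z (hsupp hz))
  have hbc : HasCompactSupport b := χ.hasCompactSupport.smul_right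
  have hαc : HasCompactSupport α := χ.hasCompactSupport.smul_right
  have hα0 : ∀ z (m : E →L[ℝ] ℝ), 0 ≤ α z (m.smulRight m) := by
    intro z m
    change 0 ≤ χ z * K z (0, 0, symm E (m.smulRight m))
    by_cases hz : z ∈ tsupport χ
    · exact mul_nonneg χ.nonneg (hpos z (hsupp hz) m)
    · rw [image_eq_zero_of_notMem_tsupport hz, zero_mul]
  have hgen : ∀ z ∈ Metric.ball ((t₀, x₀) : ℝ × E) (R / 2), ∀ F, diffGen b α F z =
      jetGen (K z) F z := by
    intro z hz F
    have h1 : fderiv ℝ F z (1, β z) = fderiv ℝ F z (1, 0) + K z (0, (jet F z).1, 0) := by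
      rw [← hβK]
      change _ = _ + fderiv ℝ F z (0, β z)
      rw [← map_add]
      simp
    have h2 : K z (0, jet F z) = K z (0, (jet F z).1, 0) + K z (0, 0, symm E (spaceHess F z)) := by
      rw [← map_add]
      refine congrArg (K z) ?_
      refine Prod.ext (by simp) (Prod.ext (by simp) ?_)
      exact (zero_add _).symm
    have h3 : diffGen b α F z = fderiv ℝ F z (1, χ z • β z) +
      χ z * K z (0, 0, symm E (spaceHess F z)) := rfl
    rw [h3, hχ1 z hz, one_smul, one_mul, h1, jetGen, h2, add_assoc]
  obtain ⟨Ω, mΩ, P, hP, ℱ, hℱ, X, hX⟩ :=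
    exists_martingaleSolution.{u} hb hα hbc hαc hα0 t₀ x₀
  obtain ⟨τ, σ, h1, h2, h3, h4, h5, h6, h7, h8⟩ :=
    hX.exists_exit (r := R / 2) (ε := min (R / 2) 1) (by positivity) (by positivity)
  refine ⟨Metric.ball (t₀, x₀) (R / 2), fun z hz => hRUV (Metric.ball_subset_closedBall
    (Metric.ball_subset_ball (by linarith) hz)), Ω, mΩ, P, hP, ℱ, hℱ, τ, X, ?_⟩
  refine ⟨hX.continuous, fun t A hA => hX.adapted t hA.measurableSet, hX.start, h1, h2,
    fun w => (h3 w).trans (by gcongr; exact min_le_right _ _), fun w t ht0 ht => ?_,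
    ⟨σ, h5, h6, h7, h8⟩, fun F hF => ?_⟩
  · rw [← ball_prod_same]
    refine ⟨?_, ?_⟩
    · rw [Metric.mem_ball, Real.dist_eq, abs_of_nonneg (sub_nonneg.2 ht0)]
      have := min_le_left (R / 2) 1
      have := h3 w
      change t - t₀ < R / 2
      linarith
    · rw [Metric.mem_ball, dist_eq_norm]
      exact h4 w t ht0 ht
  · have hF' : ContDiff ℝ ∞ fun z => χ z • F z :=
      contDiff_cutoff_smul hχ fun z hz => hF z (hsupp hz)
    have hg : Continuous (diffGen b α fun z => χ z • F z) := (contDiff_diffGen hb hα hF').continuous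
    refine ⟨fun z => χ z • F z, _, hg, fun z hz => ?_, fun z hz => ?_,
      fun ρ hρ hρ0 hρ1 => hX.martingale_stopped hF' hg hρ hρ0 hρ1⟩
    · simp only [hχ1 z hz, one_smul]
    · rw [hgen z hz]
      refine jetGen_congr _ ?_
      filter_upwards [Metric.isOpen_ball.mem_nhds hz] with y hy
      simp only [hχ1 y hy, one_smul]

end LocalDiffusion

end StochHam

namespace StochHam

attribute [local instance] cotFiberGroup cotFiberSpace cotModelGroup cotModelSpace

/-! ### From Hamilton's equations to the Hamilton–Jacobi–Bellman equation -/

section Necessity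

variable {E : Type*} [NormedAddCommGroup E] [NormedSpace ℝ E] [FiniteDimensional ℝ E]
  {M : Type*} [TopologicalSpace M] [ChartedSpace E M] [IsManifold 𝓘(ℝ, E) ∞ M] [T2Space M]
  {H : C^∞⟮𝓘(ℝ, ℝ).prod (cotModel E), ℝ × SOCotangent E M; ℝ⟯}
  {A : SecondOrderField (cotModel E) (SOCotangent E M)}
  {S : C^∞⟮𝓘(ℝ, ℝ).prod 𝓘(ℝ, E), ℝ × M; ℝ⟯} {c : Chart E M}
  {Ω : Type*} [mΩ : MeasurableSpace Ω] {P : Measure Ω} [IsProbabilityMeasure P]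
  {ℱ : Filtration ℝ mΩ} {t₀ : ℝ} {x₀ : E} {τ : Ω → ℝ} {X : ℝ → Ω → E} {W : Set (ℝ × E)}

/-- A local diffusion in the chart `c` becomes a diffusion on `M`. -/
theorem LocalDiffusion.hasMeanDerivatives
    (h : LocalDiffusion ℱ P (coordDiff H S c) W {z | z.2 ∈ c.1.target} t₀ x₀ τ X)
    (hW : ∀ z ∈ W, z.2 ∈ c.1.target) (hA : IsHamiltonianField H A)
    (hell : ∀ t q, (projection A S t q).IsElliptic) :
    HasMeanDerivatives ℱ P t₀ (fun w => (τ w : WithTop ℝ)) (fun t w => c.1.symm (X t w))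
      (fun t w => (projField A S).val t (c.1.symm (X t w))) := by
  have hmem : ∀ w t, t₀ ≤ t → t < τ w → X t w ∈ c.1.target := fun w t h0 h1 =>
    hW _ (h.mem w t h0 h1)
  refine HasMeanDerivatives.of_field (projField A S) hell h.lifetime
    (Eventually.of_forall fun w => WithTop.coe_lt_coe.2 (h.start_lt w))
    (Eventually.of_forall fun w => ?_) (fun t ht U hU => ?_) fun f => ?_
  · exact c.1.continuousOn_symm.comp (h.continuous w).continuousOn fun t ht =>
      hmem w t ht.1 (WithTop.coe_lt_coe.1 ht.2)
  · have e : {w | (t : WithTop ℝ) < τ w ∧ c.1.symm (X t w) ∈ U} =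
        {w | t < τ w} ∩ X t ⁻¹' (c.1.target ∩ c.1.symm ⁻¹' U) := by
      ext w
      simp only [mem_ofPred_eq, WithTop.coe_lt_coe, mem_inter_iff, mem_preimage]
      exact ⟨fun hw => ⟨hw.1, hmem w t ht hw.1, hw.2⟩, fun hw => ⟨hw.1, hw.2.2⟩⟩
    rw [e]
    exact (measurableSet_lt_stopping h.lifetime t).inter
      (h.adapted t _ (c.1.isOpen_inter_preimage_symm hU))
  · obtain ⟨σ, h1, h2, h3, h4⟩ := h.exhaustion
    obtain ⟨F, g, hg, hF, hgF, hmart⟩ := h.martingale (loc c f) fun z hz => contDiffAt_loc c f hz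
    refine ⟨σ, h1, Eventually.of_forall fun w => ⟨h2 w, fun n => ⟨(h3 n w).1,
      WithTop.coe_lt_coe.2 (h3 n w).2⟩, fun t ht => h4 w t (WithTop.coe_lt_coe.1 ht)⟩, fun n => ?_⟩
    have hM := (hmart (σ n) (h1 n) (fun w => (h3 n w).1)
      fun w => (h3 n w).2.le.trans (h.lifetime_le w)).sub (martingale_const ℱ P (F (t₀, x₀)))
    convert hM using 1
    funext t w
    set s := min (max t t₀) (σ n w) with hs
    have hs0 : t₀ ≤ s := le_min (le_max_right _ _) (h3 n w).1
    have hs1 : s < τ w := (min_le_right _ _).trans_lt (h3 n w).2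
    have hloc : ∀ r, t₀ ≤ r → r < τ w → f (r, c.1.symm (X r w)) = F (r, X r w) := fun r hr0 hr1 =>
      (hF _ (h.mem w r hr0 hr1)).symm
    have hint : ∫ r in t₀..s, (deriv (fun r' => f (r', c.1.symm (X r w))) r +
        (projection A S r (c.1.symm (X r w))).toLin (slice f r)) = ∫ r in t₀..s, g (r, X r w) := by
      refine intervalIntegral.integral_congr fun r hr => ?_
      rw [uIcc_of_le hs0] at hr
      have hr1 := hr.2.trans_lt hs1
      have hX := hmem w r hr.1 hr1
      refine (deriv_add_projection hA c r (c.1.map_target hX) f).trans ?_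
      rw [c.1.right_inv hX]
      exact (hgF _ (h.mem w r hr.1 hr1)).symm
    change f (s, c.1.symm (X s w)) - f (t₀, c.1.symm (X t₀ w)) - (∫ r in t₀..s,
      (deriv (fun r' => f (r', c.1.symm (X r w))) r +
        (projection A S r (c.1.symm (X r w))).toLin (slice f r))) =
      F (s, X s w) - (∫ r in t₀..s, g (r, X r w)) - F (t₀, x₀)
    rw [hint, hloc s hs0 hs1, hloc t₀ le_rfl (h.start_lt w), h.start w]
    ring

/-- The coordinate `p(e)` of the process `d²S(t, X(t))` has the mean derivative that is prescribed
by Itô's formula and the one that is prescribed by Hamilton's equations. Hence the space derivative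
of the Hamilton–Jacobi–Bellman expression, which is their difference, cannot be positive along the
paths. -/
theorem LocalDiffusion.false_of_pos
    (h : LocalDiffusion ℱ P (coordDiff H S c) W {z | z.2 ∈ c.1.target} t₀ x₀ τ X)
    (hW : ∀ z ∈ W, z.2 ∈ c.1.target)
    (hZ : IsHorizontalIntegralProcess H ℱ P t₀ (fun w => (τ w : WithTop ℝ))
      (fun t w => d2 S t (c.1.symm (X t w)))) {χ : C^∞⟮𝓘(ℝ, E), M; ℝ⟯}
    (hχ : tsupport χ ⊆ c.1.source) (hχW : ∀ z ∈ W, ∀ᶠ q in 𝓝 (c.1.symm z.2), χ q = 1) {e : E}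
    (hpos : ∀ z ∈ W, 0 < jetGen (coordDiff H S c z) (fun z => fderiv ℝ (loc c S) z (0, e)) z +
      coordDiff H S c z (e, 0)) : False := by
  obtain ⟨-, 𝒜, hZ', hham⟩ := hZ
  have hproj : Continuous fun w : SOCotangent E M => w.proj :=
    FiberBundle.continuous_proj (CotFiber E) (cotCore E M).Fiber
  -- the coordinate `p(e)`, extended to a smooth function on `𝒯^{S*}M`
  let χ' : C^∞⟮cotModel E, SOCotangent E M; ℝ⟯ := χ.comp (cotProj E M)
  have hχ' : ∀ z ∈ tsupport χ', z.proj ∈ c.1.source := by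
    have h1 : tsupport χ' ⊆ {z | z.proj ∈ tsupport χ} :=
      closure_minimal (fun z hz => subset_tsupport χ hz) ((isClosed_tsupport χ).preimage hproj)
    exact fun z hz => hχ (h1 hz)
  let u : C^∞⟮cotModel E, SOCotangent E M; ℝ⟯ :=
    cutoffMul χ' (fun z => (canonicalCoord c z).2.1 e) fun z hz => by
      let J : E × CotFiber E →L[ℝ] ℝ := (ContinuousLinearMap.apply ℝ ℝ e).comp
        ((ContinuousLinearMap.fst ℝ _ _).comp (ContinuousLinearMap.snd ℝ _ _))
      exact ContMDiffAt.comp z (g := J) J.contDiff.contMDiff.contMDiffAt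
        (contMDiffAt_canonicalCoord c (hχ' z hz))
  let v : ℝ × E → ℝ := fun z => fderiv ℝ (loc c S) z (0, e)
  have hu : ∀ z ∈ W, u =ᶠ[𝓝 (d2 S z.1 (c.1.symm z.2))] fun z => (canonicalCoord c z).2.1 e := by
    intro z hz
    refine cutoffMul_eventuallyEq _ ?_
    have h1 : Tendsto (fun w : SOCotangent E M => w.proj) (𝓝 (d2 S z.1 (c.1.symm z.2)))
      (𝓝 (c.1.symm z.2)) := hproj.tendsto _
    exact h1.eventually (hχW z hz)
  have huv : ∀ z ∈ W, u (d2 S z.1 (c.1.symm z.2)) = v z := by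
    intro z hz
    refine (hu z hz).eq_of_nhds.trans ?_
    rw [canonicalCoord_d2 S c z.1 (c.1.map_target (hW z hz)), c.1.right_inv (hW z hz)]
    rfl
  let ut : C^∞⟮𝓘(ℝ, ℝ).prod (cotModel E), ℝ × SOCotangent E M; ℝ⟯ :=
    ⟨fun z => u z.2, u.contMDiff.comp contMDiff_snd⟩
  obtain ⟨ρ, hρ, hρ', hρM⟩ := hZ'.martingale ut
  obtain ⟨F, g, hg, hF, hgF, hmart⟩ := h.martingale v fun z hz =>
    contDiffAt_fderiv_apply (contDiffAt_loc c S hz) _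
  -- the compensator of `p(e)`, by Hamilton's equations
  have hZint : ∀ᵐ w ∂P, ∀ s, t₀ ≤ s → s < τ w →
      compensated t₀ (fun t w => d2 S t (c.1.symm (X t w))) 𝒜 ut s w =
        F (s, X s w) - F (t₀, x₀) + ∫ r in t₀..s, coordDiff H S c (r, X r w) (e, 0) := by
    filter_upwards [hham] with w hw s hs0 hs1
    have hint : ∫ r in t₀..s, (deriv (fun r' => ut (r', d2 S r (c.1.symm (X r w)))) r +
        (𝒜 r w).toLin (slice ut r)) = ∫ r in t₀..s, - coordDiff H S c (r, X r w) (e, 0) := by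
      refine intervalIntegral.integral_congr fun r hr => ?_
      rw [uIcc_of_le hs0] at hr
      have hr1 := hr.2.trans_lt hs1
      have hm := h.mem w r hr.1 hr1
      have hX := hW _ hm
      have h1 : deriv (fun r' => ut (r', d2 S r (c.1.symm (X r w)))) r = 0 :=
        deriv_const r (u (d2 S r (c.1.symm (X r w))))
      have h2 := (hw r ⟨hr.1, WithTop.coe_lt_coe.2 hr1⟩).apply_p c (c.1.map_target hX) e
        (slice ut r) (hu _ hm)
      rw [coordDeriv_d2 c r (c.1.map_target hX), c.1.right_inv hX] at h2
      beta_reduce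
      rw [h1, h2, zero_add]
    have e1 : ∀ r, t₀ ≤ r → r < τ w → ut (r, d2 S r (c.1.symm (X r w))) = F (r, X r w) :=
      fun r hr0 hr1 => (huv _ (h.mem w r hr0 hr1)).trans (hF _ (h.mem w r hr0 hr1)).symm
    rw [compensated, hint, intervalIntegral.integral_neg, e1 s hs0 hs1,
      e1 t₀ le_rfl (h.start_lt w), h.start w, sub_neg_eq_add]
  -- the stopping times of the local martingale, modified on a null set
  let σ : ℕ → Ω → ℝ := fun n w => max (min (ρ n w) (t₀ + 1)) t₀
  have hσ : ∀ n, IsStoppingTime ℱ (fun w => (σ n w : WithTop ℝ)) := by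
    intro n
    have h1 := ((hρ n).min_const (t₀ + 1)).max_const t₀
    have e1 : (fun w => (σ n w : WithTop ℝ)) =
        fun w => max (min (ρ n w : WithTop ℝ) ((t₀ + 1 : ℝ) : WithTop ℝ)) (t₀ : WithTop ℝ) :=
      funext fun w => by simp only [σ, WithTop.coe_max, WithTop.coe_min]
    rw [e1]
    exact h1
  have hσρ : ∀ᵐ w ∂P, ∀ n, σ n w = ρ n w := by
    filter_upwards [hρ'] with w hw n
    have h1 := (hw.2.1 n).1
    have h2 := (WithTop.coe_lt_coe.1 (hw.2.1 n).2).le.trans (h.lifetime_le w)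
    change max (min (ρ n w) (t₀ + 1)) t₀ = ρ n w
    rw [min_eq_left h2, max_eq_left h1]
  let D : ℝ × E → ℝ := fun z => g z + coordDiff H S c z (e, 0)
  have hDpos : ∀ z ∈ W, 0 < D z := by
    intro z hz
    change 0 < g z + _
    rw [hgF z hz]
    exact hpos z hz
  have hint : ∀ w s, t₀ ≤ s → s < τ w →
      IntervalIntegrable (fun r => coordDiff H S c (r, X r w) (e, 0)) volume t₀ s := by
    intro w s hs0 hs1
    refine ContinuousOn.intervalIntegrable fun r hr => ?_
    rw [uIcc_of_le hs0] at hr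
    have hX := hW _ (h.mem w r hr.1 (hr.2.trans_lt hs1))
    have h1 : ContinuousAt (fun z => coordDiff H S c z (e, 0)) (r, X r w) :=
      ((contDiffAt_coordDiff c hX).clm_apply contDiffAt_const).continuousAt
    have h2 : ContinuousAt (fun r => (r, X r w)) r :=
      continuousAt_id.prodMk (h.continuous w).continuousAt
    exact (ContinuousAt.comp (f := fun r => (r, X r w)) h1 h2).continuousWithinAt
  have hgint : ∀ w s, IntervalIntegrable (fun r => g (r, X r w)) volume t₀ s := fun w s =>
    (hg.comp (continuous_id.prodMk (h.continuous w))).intervalIntegrable _ _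
  have hDint : ∀ w s, t₀ ≤ s → s < τ w →
      IntervalIntegrable (fun r => D (r, X r w)) volume t₀ s := fun w s hs0 hs1 =>
    (hgint w s).add (hint w s hs0 hs1)
  have hzero : ∀ n, ∀ᵐ w ∂P, ρ n w = t₀ := by
    intro n
    have hM := hmart (σ n) (hσ n) (fun w => le_max_right _ _)
      fun w => max_le (min_le_right _ _) (by linarith)
    have hN := hρM n
    -- the difference of the two martingales at the time `t₀ + 1`
    have hdiff : ∀ᵐ w ∂P, compensated t₀ (fun t w => d2 S t (c.1.symm (X t w))) 𝒜 ut
        (min (max (t₀ + 1) t₀) (ρ n w)) w - compProc t₀ X F g (min (max (t₀ + 1) t₀) (σ n w)) w =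
          (∫ r in t₀..ρ n w, D (r, X r w)) - F (t₀, x₀) := by
      filter_upwards [hZint, hρ', hσρ] with w h1 h2 h3
      have h4 := (h2.2.1 n).1
      have h5 := WithTop.coe_lt_coe.1 (h2.2.1 n).2
      have h6 : min (max (t₀ + 1) t₀) (ρ n w) = ρ n w :=
        min_eq_right ((h5.le.trans (h.lifetime_le w)).trans (le_max_left _ _))
      rw [h3 n, h6, h1 _ h4 h5, compProc]
      change _ = (∫ r in t₀..ρ n w, (g (r, X r w) + coordDiff H S c (r, X r w) (e, 0))) - _
      rw [intervalIntegral.integral_add (hgint w _) (hint w _ h4 h5)]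
      ring
    have hE : ∫ w, ((∫ r in t₀..ρ n w, D (r, X r w)) - F (t₀, x₀)) ∂P = - F (t₀, x₀) := by
      rw [← integral_congr_ae hdiff, integral_sub (hN.integrable _) (hM.integrable _)]
      have h1 := hN.setIntegral_eq (show t₀ ≤ t₀ + 1 by linarith) MeasurableSet.univ
      have h2 := hM.setIntegral_eq (show t₀ ≤ t₀ + 1 by linarith) MeasurableSet.univ
      rw [setIntegral_univ, setIntegral_univ] at h1 h2
      rw [← h1, ← h2]
      have h3 : ∀ᵐ w ∂P, compensated t₀ (fun t w => d2 S t (c.1.symm (X t w))) 𝒜 ut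
          (min (max t₀ t₀) (ρ n w)) w = 0 := by
        filter_upwards [hρ'] with w hw
        rw [max_self, min_eq_left (hw.2.1 n).1]
        simp [compensated]
      have h4 : ∀ w, compProc t₀ X F g (min (max t₀ t₀) (σ n w)) w = F (t₀, x₀) := by
        intro w
        rw [max_self, min_eq_left (le_max_right _ _)]
        simp [compProc, h.start w]
      rw [integral_congr_ae h3, integral_congr_ae (Eventually.of_forall h4)]
      simp
    have hI : Integrable (fun w => (∫ r in t₀..ρ n w, D (r, X r w)) - F (t₀, x₀)) P :=
      ((hN.integrable _).sub (hM.integrable _)).congr hdiff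
    have hI' : Integrable (fun w => ∫ r in t₀..ρ n w, D (r, X r w)) P := by
      refine (hI.add (integrable_const (F (t₀, x₀)))).congr (Eventually.of_forall fun w => ?_)
      simp only [Pi.add_apply, sub_add_cancel]
    have hnn : 0 ≤ᵐ[P] fun w => ∫ r in t₀..ρ n w, D (r, X r w) := by
      filter_upwards [hρ'] with w hw
      refine intervalIntegral.integral_nonneg (hw.2.1 n).1 fun r hr => (hDpos _ ?_).le
      exact h.mem w r hr.1 (hr.2.trans_lt (WithTop.coe_lt_coe.1 (hw.2.1 n).2))
    have hE' : ∫ w, (∫ r in t₀..ρ n w, D (r, X r w)) ∂P = 0 := by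
      rw [integral_sub hI' (integrable_const _)] at hE
      simpa using hE
    filter_upwards [(integral_eq_zero_iff_of_nonneg_ae hnn hI').1 hE', hρ'] with w h1 h2
    by_contra hne
    have h3 : t₀ < ρ n w := lt_of_le_of_ne (h2.2.1 n).1 (Ne.symm hne)
    have h4 := WithTop.coe_lt_coe.1 (h2.2.1 n).2
    have h5 := intervalIntegral.intervalIntegral_pos_of_pos_on (hDint w _ h3.le h4)
      (fun r hr => hDpos _ (h.mem w r hr.1.le (hr.2.trans h4))) h3
    exact h5.ne' h1
  obtain ⟨w, hw1, hw2⟩ := ((ae_all_iff.2 hzero).and hρ').exists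
  obtain ⟨n, hn⟩ := hw2.2.2 t₀ (WithTop.coe_lt_coe.2 (h.start_lt w))
  exact hn.ne' (hw1 n)

end Necessity

end StochHam

namespace StochHam

attribute [local instance] cotFiberGroup cotFiberSpace cotModelGroup cotModelSpace

/-! ### The space derivative of the Hamilton–Jacobi–Bellman expression -/

section Conclusion

universe u

variable {E : Type*} [NormedAddCommGroup E] [NormedSpace ℝ E] [FiniteDimensional ℝ E]
  {M : Type*} [TopologicalSpace M] [ChartedSpace E M] [IsManifold 𝓘(ℝ, E) ∞ M] [T2Space M]
  {H : C^∞⟮𝓘(ℝ, ℝ).prod (cotModel E), ℝ × SOCotangent E M; ℝ⟯}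
  {A : SecondOrderField (cotModel E) (SOCotangent E M)}
  {S : C^∞⟮𝓘(ℝ, ℝ).prod 𝓘(ℝ, E), ℝ × M; ℝ⟯}

/-- The expression `∂_t S + H(t, d²S)` in the chart `c`. -/
noncomputable def locHJB (H : C^∞⟮𝓘(ℝ, ℝ).prod (cotModel E), ℝ × SOCotangent E M; ℝ⟯)
    (S : C^∞⟮𝓘(ℝ, ℝ).prod 𝓘(ℝ, E), ℝ × M; ℝ⟯) (c : Chart E M) (z : ℝ × E) : ℝ :=
  fderiv ℝ (loc c S) z (1, 0) + locH H c (z.1, z.2, jet (loc c S) z)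

theorem contDiffAt_locHJB (c : Chart E M) {z : ℝ × E} (hz : z.2 ∈ c.1.target) :
    ContDiffAt ℝ ∞ (locHJB H S c) z :=
  (contDiffAt_fderiv_apply (contDiffAt_loc c S hz) _).add (ContDiffAt.comp z
    (f := fun z : ℝ × E => (z.1, z.2, jet (loc c S) z)) (contDiffAt_locH c hz)
    (contDiffAt_fst.prodMk (contDiffAt_snd.prodMk (contDiffAt_jet (contDiffAt_loc c S hz)))))

/-- If the processes `d²S(t, X(t))` are integral processes, the space derivative of
`∂_t S + H(t, d²S)` is nowhere positive: otherwise a diffusion started at such a point would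
contradict Hamilton's equation for `p`. -/
theorem not_fderiv_locHJB_pos (hA : IsHamiltonianField H A)
    (hell : ∀ t q, (projection A S t q).IsElliptic)
    (hi : ∀ (Ω : Type u) [mΩ : MeasurableSpace Ω] (P : Measure Ω) [IsProbabilityMeasure P]
      (ℱ : Filtration ℝ mΩ), UsualConditions ℱ P →
      ∀ (t₀ : ℝ) (τ : Ω → WithTop ℝ) (X : ℝ → Ω → M), IsDiffusion 𝓘(ℝ, E) ℱ P t₀ τ X →
        HasMeanDerivatives ℱ P t₀ τ X (fun t w => projection A S t (X t w)) →
        IsHorizontalIntegralProcess H ℱ P t₀ τ (fun t w => d2 S t (X t w)))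
    (c : Chart E M) {t₀ : ℝ} {x₀ : E} (hx₀ : x₀ ∈ c.1.target) (e : E) :
    ¬ 0 < fderiv ℝ (locHJB H S c) (t₀, x₀) (0, e) := by
  intro hpos
  have hopen : IsOpen {z : ℝ × E | z.2 ∈ c.1.target} := c.1.open_target.preimage continuous_snd
  have hV : {z : ℝ × E | z.2 ∈ c.1.target} ∈ 𝓝 (t₀, x₀) := hopen.mem_nhds hx₀
  obtain ⟨χ, hχ1, hχ⟩ := exists_bump (I := 𝓘(ℝ, E))
    (c.1.open_source.mem_nhds (c.1.map_target hx₀))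
  have hU : {z : ℝ × E | (∀ᶠ q in 𝓝 (c.1.symm z.2), χ q = 1) ∧
      0 < fderiv ℝ (locHJB H S c) z (0, e)} ∈ 𝓝 (t₀, x₀) := by
    have h1 : ContinuousAt (fun z : ℝ × E => c.1.symm z.2) (t₀, x₀) :=
      ContinuousAt.comp (g := c.1.symm) (f := Prod.snd) (c.1.continuousAt_symm hx₀)
        continuousAt_snd
    have h2 : ContinuousAt (fun z => fderiv ℝ (locHJB H S c) z (0, e)) (t₀, x₀) :=
      (contDiffAt_fderiv_apply (contDiffAt_locHJB c hx₀) _).continuousAt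
    exact (h1.eventually (eventually_eventually_nhds.2 hχ1)).and
      (h2.eventually (lt_mem_nhds hpos))
  have hK : ∀ z ∈ {z : ℝ × E | z.2 ∈ c.1.target}, ∀ m : E →L[ℝ] ℝ,
      0 ≤ coordDiff H S c z (0, 0, symm E (m.smulRight m)) := by
    intro z hz m
    have h1 := coordDiff_nonneg hA hell z.1 (c.1.map_target hz) m
    rwa [c.1.right_inv hz] at h1
  obtain ⟨W, hW, Ω, mΩ, P, hP, ℱ, hℱ, τ, X, hX⟩ := exists_localDiffusion.{u}
    (fun z hz => contDiffAt_coordDiff c hz) hK hV hU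
  have hmean := hX.hasMeanDerivatives (fun z hz => (hW hz).2) hA hell
  refine hX.false_of_pos (fun z hz => (hW hz).2)
    (hi Ω P ℱ hℱ t₀ _ _ ⟨projField A S, hell, hmean⟩ hmean) hχ (fun z hz => (hW hz).1.1) (e := e)
    fun z hz => ?_
  have hz2 : z.2 ∈ c.1.target := (hW hz).2
  exact (hW hz).1.2.trans_eq (fderiv_hjb (t := z.1) (y := z.2) (contDiffAt_loc c S hz2)
    (contDiffAt_locH c hz2) e rfl)

/-- A function of the Hamilton–Jacobi–Bellman expression with vanishing space derivatives depends
on time only. -/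
theorem exists_hjb_of_fderiv_eq_zero [ConnectedSpace M]
    (h : ∀ (c : Chart E M) (t : ℝ) (x : E), x ∈ c.1.target → ∀ e,
      fderiv ℝ (locHJB H S c) (t, x) (0, e) = 0) :
    ∃ f : ℝ → ℝ, ∀ t q, deriv (fun s => S (s, q)) t + H (t, d2 S t q) = f t := by
  obtain ⟨q₀⟩ : Nonempty M := inferInstance
  refine ⟨fun t => deriv (fun s => S (s, q₀)) t + H (t, d2 S t q₀), fun t q => ?_⟩
  refine IsLocallyConstant.apply_eq_of_preconnectedSpace
    (f := fun q => deriv (fun s => S (s, q)) t + H (t, d2 S t q))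
    ((IsLocallyConstant.iff_eventually_eq _).2 fun q => ?_) q q₀
  let c : Chart E M := ⟨chartAt E q, IsManifold.chart_mem_maximalAtlas q⟩
  have hq : q ∈ c.1.source := mem_chart_source E q
  have hloc : ∀ r ∈ c.1.source, deriv (fun s => S (s, r)) t + H (t, d2 S t r) =
      locHJB H S c (t, c.1 r) := by
    intro r hr
    have h1 := hjb_eq_loc (H := H) (S := S) c (z := (t, c.1 r)) (c.1.map_source hr)
    rwa [c.1.left_inv hr] at h1
  obtain ⟨ε, hε, hball⟩ := Metric.isOpen_iff.1 c.1.open_target _ (c.1.map_source hq)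
  have hd : ∀ x ∈ Metric.ball (c.1 q) ε,
      DifferentiableAt ℝ (locHJB H S c) (t, x) := fun x hx =>
    (contDiffAt_locHJB c (z := (t, x)) (hball hx)).differentiableAt (by simp)
  filter_upwards [c.1.open_source.mem_nhds hq, (c.1.continuousAt hq).preimage_mem_nhds
    (Metric.ball_mem_nhds _ hε)] with r hr1 hr2
  rw [hloc r hr1, hloc q hq]
  refine Metric.isOpen_ball.is_const_of_fderiv_eq_zero (𝕜 := ℝ)
    (f := fun x => locHJB H S c (t, x)) (convex_ball (c.1 q) ε).isPreconnected
    (fun x hx => (hasFDerivAt_slice (hd x hx)).differentiableAt.differentiableWithinAt)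
    (fun x hx => ?_) hr2 (Metric.mem_ball_self hε)
  refine ContinuousLinearMap.ext fun e => ?_
  rw [← fderiv_slice_apply (hd x hx), h c t x (hball hx)]
  rfl

end Conclusion

end StochHam

theorem mainTheorem5 {E : Type*} [NormedAddCommGroup E] [NormedSpace ℝ E]
    [FiniteDimensional ℝ E] {M : Type*} [TopologicalSpace M] [ChartedSpace E M]
    [IsManifold 𝓘(ℝ, E) ∞ M] [T2Space M] [SecondCountableTopology M] [ConnectedSpace M]
    (H : C^∞⟮𝓘(ℝ, ℝ).prod (StochHam.cotModel E), ℝ × StochHam.SOCotangent E M; ℝ⟯)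
    (A : StochHam.SecondOrderField (StochHam.cotModel E) (StochHam.SOCotangent E M))
    (hA : StochHam.IsHamiltonianField H A)
    (S : C^∞⟮𝓘(ℝ, ℝ).prod 𝓘(ℝ, E), ℝ × M; ℝ⟯)
    (hell : ∀ t q, (StochHam.projection A S t q).IsElliptic) :
    (∀ (Ω : Type*) [mΩ : MeasurableSpace Ω] (P : Measure Ω) [IsProbabilityMeasure P]
        (ℱ : Filtration ℝ mΩ), StochHam.UsualConditions ℱ P →
        ∀ (t₀ : ℝ) (τ : Ω → WithTop ℝ) (X : ℝ → Ω → M),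
          StochHam.IsDiffusion 𝓘(ℝ, E) ℱ P t₀ τ X →
          StochHam.HasMeanDerivatives ℱ P t₀ τ X
            (fun t w => StochHam.projection A S t (X t w)) →
          StochHam.IsHorizontalIntegralProcess H ℱ P t₀ τ
            (fun t w => StochHam.d2 S t (X t w))) ↔
      ∃ f : ℝ → ℝ, ∀ t q,
        deriv (fun s => S (s, q)) t + H (t, StochHam.d2 S t q) = f t := by
  constructor
  · intro hi
    refine StochHam.exists_hjb_of_fderiv_eq_zero fun c t x hx e => le_antisymm
      (not_lt.1 (StochHam.not_fderiv_locHJB_pos hA hell hi c hx e)) ?_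
    have h := not_lt.1 (StochHam.not_fderiv_locHJB_pos hA hell hi c (t₀ := t) hx (-e))
    have he : ((0 : ℝ), -e) = -(0, e) := by simp
    rw [he, map_neg] at h
    exact neg_nonpos.1 h
  · rintro ⟨f, hf⟩ Ω mΩ P hP ℱ - t₀ τ X hX hX'
    exact StochHam.isHorizontalIntegralProcess_of_hjb hA hell hf hX hX'
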